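/- **Setting.** Let $M$ be a compact (connected, boundaryless) smooth Riemannian manifold with distance $d$, and let $f\colon M\to M$ be a Borel map (for instance a piecewise $C^1$ diffeomorphism). A *continuous family of $C^1$ disks* is a family $\Gamma=\{\Phi(\{x\}\times D)\colon x\in K\}$, where $K$ is a compact metric space, $D$ is the closed unit ball of some $\mathbb R^k$, $\Phi\colon K\times D\to M$ is continuous and injective, and $x\mapsto\Phi|_{\{x\}\times D}$ is continuous into the space of $C^1$ embeddings of $D$ in $M$ with the $C^1$ topology. Let $\Gamma^s,\Gamma^u$ be continuous families of $C^1$ disks with $\dim\Gamma^s+\dim\Gamma^u=\dim M$, such that each $\gamma\in\Gamma^s$ meets each $\gamma'\in\Gamma^u$ in exactly one point, and put $\Lambda=\bigcup\Gamma^s\cap\bigcup\Gamma^u$. An *s-subset* of $\Lambda$ is a set $\bigcup\Gamma^s_0\cap\bigcup\Gamma^u$ with $\Gamma^s_0\subset\Gamma^s$ a continuous subfamily; *u-subsets* are defined in the same way. For $x\in\Lambda$ let $\gamma^*(x)$ be the disk of $\Gamma^*$ through $x$ ($*=s,u$), and let $\mathrm{Leb}_\gamma$ be the Riemannian volume on $\gamma$.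 The set $\Lambda$ has a *Young structure* for $f$ if $\mathrm{Leb}_\gamma(\Lambda\cap\gamma)>0$ for all $\gamma\in\Gamma^u$, and there are countably many pairwise disjoint s-subsets $\Lambda_i$, integers $R_i\ge1$ and constants $C_0>0$, $0<\beta<1$ with the following properties. * (Markov) $\mathrm{Leb}_\gamma((\Lambda\setminus\bigcup_i\Lambda_i)\cap\gamma)=0$ for $\gamma\in\Gamma^u$; each $f^{R_i}(\Lambda_i)$ is a u-subset; and for every $i$ there is an open set $V_i\supset\Lambda_i$ on which $f^{R_i}$ is a $C^1$ diffeomorphism onto its image, such that $f^{R_i}(\gamma^s(x))\subset\gamma^s(f^{R_i}(x))$ and $f^{R_i}(\gamma^u(x)\cap V_i)\supset\gamma^u(f^{R_i}(x))$ for all $x\in\Lambda_i$. Put $R=R_i$ and $f^R=f^{R_i}$ on $\Lambda_i$. Let $\Lambda'$ be the set of the points of $\Lambda$ all of whose iterates under $f^R$ are defined. For $x,y\in\Lambda'$ let $s(x,y)\in\mathbb N\cup\{\infty\}$ be the least $n\ge0$ such that $(f^R)^n(x)$ and $(f^R)^n(y)$ lie in distinct $\Lambda_i$'s ($\infty$ if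 there is none), and let $s(x,y)=0$ for all other pairs; $\beta^\infty=0$. * (Contraction) For $\gamma\in\Gamma^s$ and $x,y\in\gamma\cap\Lambda_i$: $d((f^R)^n(x),(f^R)^n(y))\le C_0\beta^n$ for $n\ge0$, if $x,y\in\Lambda'$; and $d(f^j(x),f^j(y))\le C_0\,d(x,y)$ for $1\le j\le R_i$. * (Expansion) For $\gamma\in\Gamma^u$ and $x,y\in\gamma\cap\Lambda_i$: $d((f^R)^n(x),(f^R)^n(y))\le C_0\beta^{s(x,y)-n}$ for $n\ge0$, if $x,y\in\Lambda'$; and $d(f^j(x),f^j(y))\le C_0\,d(f^R(x),f^R(y))$ for $1\le j\le R_i$. * (Gibbs) For $\gamma\in\Gamma^u$ and $x,y\in\gamma\cap\Lambda_i$: $\log\dfrac{|\det Df^R|_{T_x\gamma}|}{|\det Df^R|_{T_y\gamma}|}\le C_0\beta^{s(f^R(x),f^R(y))}$. * (Holonomy) For $\gamma,\gamma'\in\Gamma^u$ the push-forward of $\mathrm{Leb}_\gamma|_\Lambda$ under $\Theta\colon\gamma\cap\Lambda\to\gamma'\cap\Lambda$, $\Theta(x)=\gamma^s(x)\cap\gamma'$,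 has a positive density $\rho$ with respect to $\mathrm{Leb}_{\gamma'}|_\Lambda$, with $1/C_0\le\int_{\gamma'\cap\Lambda}\rho\,d\mathrm{Leb}_{\gamma'}\le C_0$ and $\log\frac{\rho(x)}{\rho(y)}\le C_0\beta^{s(x,y)}$ for $x,y\in\gamma'\cap\Lambda$. The associated *Young tower* is $\Delta=\{(x,\ell)\colon x\in\Lambda',\ 0\le\ell<R(x)\}$ with the map $T(x,\ell)=(x,\ell+1)$ if $\ell<R(x)-1$ and $T(x,\ell)=(f^R(x),0)$ if $\ell=R(x)-1$; put $\pi(x,\ell)=f^\ell(x)$. An *SRB measure* of $T$ is a $T$-invariant probability measure whose conditional measures on the sets $(\gamma\cap\Lambda'\cap\{R>\ell\})\times\{\ell\}$, $\gamma\in\Gamma^u$, $\ell\ge0$, are (almost all) absolutely continuous with respect to $\mathrm{Leb}_\gamma$. Put $s((x,\ell),(x',\ell'))=s(x,x')$ if $\ell=\ell'$ and $0$ otherwise. For $0<b<1$ let $\mathcal F_b(\Delta)$ be the space of the functions $\psi\colon\Delta\to\mathbb R$ with $|\psi|_b:=\sup_{y\ne z}|\psi(y)-\psi(z)|/b^{s(y,z)}<\infty$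 (in particular $\psi(y)=\psi(z)$ if $s(y,z)=\infty$), with the norm $\|\psi\|_b=|\psi|_b+\|\psi\|_\infty$. For $0<\eta<1$ let $\mathcal H_\eta(M)$ be the space of the $\eta$-Hölder functions on $M$, with $\|\varphi\|_{\mathcal H_\eta}=\|\varphi\|_\infty+\sup_{x\ne y}|\varphi(x)-\varphi(y)|/d(x,y)^\eta$. Write $$\mathrm{Cor}_\nu(\psi,\xi\circ T^n)=\Big|\int\psi\,(\xi\circ T^n)\,d\nu-\int\psi\,d\nu\int\xi\,d\nu\Big|,\qquad \mathrm{mld}_\mu(\varphi,\epsilon,n)=\mu\Big(\sup_{j\ge n}\Big|\frac1j\sum_{i=0}^{j-1}\varphi\circ f^i-\int\varphi\,d\mu\Big|>\epsilon\Big).$$ **Theorem.** Let $T\colon\Delta\to\Delta$ be a Young tower for $f$, $\nu$ an SRB measure of $T$, $\mu=\pi_*\nu$, $0<\eta<1$ and $\beta'=\beta^{\eta/2}$. The constants below may depend on these fixed data, and otherwise only on what is indicated. (a) Let $\alpha>1$ and suppose that for some $C>0$, $\mathrm{Cor}_\nu(\psi,\xi\circ T^n)\le C\|\psi\|_{\beta'}\|\xi\|_{\beta'}n^{-\alpha}$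 for all $\psi,\xi\in\mathcal F_{\beta'}(\Delta)$ and $n\ge1$. Then for every $q>\max\{1,\alpha\}$ there is $C_{\alpha,q}>0$, depending only on $\alpha$ and $q$, such that for all $\varphi\in\mathcal H_\eta(M)$, $\epsilon>0$ and $n\ge1$ $$\mathrm{mld}_\mu(\varphi,\epsilon,n)\le C_{\alpha,q}\,\|\varphi\|_{\mathcal H_\eta}\|\varphi\|_\infty^{2q-1}\epsilon^{-2q}n^{-\alpha}.$$ (b) Let $\tau,\theta>0$ and suppose that for some $C>0$, $\mathrm{Cor}_\nu(\psi,\xi\circ T^n)\le C\|\psi\|_{\beta'}\|\xi\|_{\beta'}e^{-\tau n^\theta}$ for all $\psi,\xi\in\mathcal F_{\beta'}(\Delta)$ and $n\ge1$. Put $\theta'=\theta/(\theta+1)$. Then there is $C_{\tau,\theta}>0$, depending only on $\tau,\theta$, and for every $\varphi\in\mathcal H_\eta(M)$ there is $C_{\tau,\theta,\varphi}>0$, depending only on $\tau,\theta,\varphi$, such that for all $\epsilon>0$ and $n\ge1$ $$\mathrm{mld}_\mu(\varphi,\epsilon,n)\le C_{\tau,\theta,\varphi}\,e^{-\tau' n^{\theta'}\epsilon^{2\theta'}},\qquad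 \tau'=C_{\tau,\theta}\|\varphi\|_{\mathcal H_\eta}^{-2\theta'}$$ (for $\varphi=0$ the left side is $0$). -/

import Mathlib

open MeasureTheory Set Bundle
open scoped Manifold ContDiff Bundle ENNReal

noncomputable section

namespace YoungTower

/-! ### Observables, norms, correlations and maximal large deviations -/

/-- `β ^ s` for an extended natural number `s`, with `β ^ ∞ = 0` (here `0 < β < 1`). -/
def epow (β : ℝ) (s : ℕ∞) : ℝ := if s = ⊤ then 0 else β ^ s.toNat

/-- The supremum norm of a (bounded) function. -/
def supNorm {X : Type*} (φ : X → ℝ) : ℝ := ⨆ x, |φ x|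

/-- `φ` is `η`-Hölder continuous. -/
def IsHolder {M : Type*} [MetricSpace M] (η : ℝ) (φ : M → ℝ) : Prop :=
  ∃ C : ℝ, ∀ x y, |φ x - φ y| ≤ C * dist x y ^ η

/-- The Hölder norm: supremum norm plus the supremum of the Hölder quotients
(the pairs with `x = y` contribute `0 / 0 = 0`). -/
def holderNorm {M : Type*} [MetricSpace M] (η : ℝ) (φ : M → ℝ) : ℝ :=
  supNorm φ + ⨆ p : M × M, |φ p.1 - φ p.2| / dist p.1 p.2 ^ η

/-- Correlation of `ψ` and `ξ ∘ T ^ n`. -/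
def corr {X : Type*} [MeasurableSpace X] (ν : Measure X) (T : X → X)
    (ψ ξ : X → ℝ) (n : ℕ) : ℝ :=
  |∫ y, ψ y * ξ (T^[n] y) ∂ν - (∫ y, ψ y ∂ν) * ∫ y, ξ y ∂ν|

/-- Maximal large deviation at time `n`: the measure of the set of points at which the supremum
over `j ≥ n` of the deviations of the Birkhoff averages exceeds `ε`. The supremum is taken in
`[0, ∞]`. -/
def mld {X : Type*} [MeasurableSpace X] (μ : Measure X) (f : X → X)
    (φ : X → ℝ) (ε : ℝ) (n : ℕ) : ℝ :=
  μ.real {x | ENNReal.ofReal ε < ⨆ (j : ℕ) (_ : n ≤ j),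
    ENNReal.ofReal |(∑ i ∈ Finset.range j, φ (f^[i] x)) / (j : ℝ) - ∫ z, φ z ∂μ|}

/-! ### Disks in a Riemannian manifold -/

/-- The closed unit ball of `ℝ ^ k`. -/
abbrev unitDisk (k : ℕ) : Set (EuclideanSpace ℝ (Fin k)) := Metric.closedBall 0 1

section Disks

variable {d : ℕ} {M : Type*} [MetricSpace M] [ChartedSpace (EuclideanSpace ℝ (Fin d)) M]

/-- The `k`-dimensional volume of the parallelepiped spanned by `k` tangent vectors. -/
def gramVol [RiemannianBundle (fun x : M => TangentSpace (𝓡 d) x)] {k : ℕ} {x : M}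
    (v : Fin k → TangentSpace (𝓡 d) x) : ℝ :=
  Real.sqrt (Matrix.gram ℝ v).det

/-- `g` restricted to the open set `V` is a `C^1` diffeomorphism onto its image. -/
def IsC1DiffeoOn (d : ℕ) {M : Type*} [MetricSpace M]
    [ChartedSpace (EuclideanSpace ℝ (Fin d)) M] (g : M → M) (V : Set M) : Prop :=
  IsOpen V ∧ InjOn g V ∧ ContMDiffOn (𝓡 d) (𝓡 d) 1 g V ∧
    ∀ x ∈ V, Function.Bijective (mfderiv (𝓡 d) (𝓡 d) g x)

/-- A continuous family of `C^1` disks of dimension `k` in `M`, indexed by a compact metrizable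
space `K`. Only the values of the parametrisations on the closed unit ball matter. As
`K × unitDisk k` is compact, an injective continuous map on it is a homeomorphism onto its image.
Joint continuity of the tangent maps is continuity of `x ↦ toFun x` for the `C^1` topology. -/
structure DiskFamily (d : ℕ) (M : Type*) [MetricSpace M]
    [ChartedSpace (EuclideanSpace ℝ (Fin d)) M] [IsManifold (𝓡 d) ∞ M]
    (k : ℕ) (K : Type*) [TopologicalSpace K] where
  /-- the parametrisation of each disk -/
  toFun : K → EuclideanSpace ℝ (Fin k) → M
  injOn : InjOn (fun p : K × EuclideanSpace ℝ (Fin k) => toFun p.1 p.2) (univ ×ˢ unitDisk k)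
  continuousOn :
    ContinuousOn (fun p : K × EuclideanSpace ℝ (Fin k) => toFun p.1 p.2) (univ ×ˢ unitDisk k)
  contMDiffOn : ∀ x, ContMDiffOn (𝓡 k) (𝓡 d) 1 (toFun x) (unitDisk k)
  immersion : ∀ x, ∀ z ∈ unitDisk k,
    Function.Injective (mfderivWithin (𝓡 k) (𝓡 d) (toFun x) (unitDisk k) z)
  continuousOn_tangent :
    ContinuousOn (fun p : K × EuclideanSpace ℝ (Fin k) × EuclideanSpace ℝ (Fin k) =>
      (⟨toFun p.1 p.2.1, mfderivWithin (𝓡 k) (𝓡 d) (toFun p.1) (unitDisk k) p.2.1 p.2.2⟩ :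
        TangentBundle (𝓡 d) M)) (univ ×ˢ unitDisk k ×ˢ univ)

variable [IsManifold (𝓡 d) ∞ M] {k : ℕ} {K : Type*} [TopologicalSpace K]

namespace DiskFamily

/-- The disk with index `x`, as a subset of `M`. -/
def disk (Γ : DiskFamily d M k K) (x : K) : Set M := Γ.toFun x '' unitDisk k

/-- The union of the disks with index in `A`. -/
def union (Γ : DiskFamily d M k K) (A : Set K) : Set M := ⋃ x ∈ A, Γ.disk x

/-- The image of the standard basis under the derivative of the parametrisation: a basis of the
tangent space of the disk `x` at the point with parameter `z`. -/
def frame (Γ : DiskFamily d M k K) (x : K) (z : EuclideanSpace ℝ (Fin k)) :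
    Fin k → TangentSpace (𝓡 d) (Γ.toFun x z) :=
  fun a => mfderivWithin (𝓡 k) (𝓡 d) (Γ.toFun x) (unitDisk k) z
    (EuclideanSpace.single a (1 : ℝ) : EuclideanSpace ℝ (Fin k))

variable [RiemannianBundle (fun x : M => TangentSpace (𝓡 d) x)]

/-- The Lebesgue measure on the disk `x` induced by the Riemannian metric, as a measure on `M`. -/
def leb [MeasurableSpace M] (Γ : DiskFamily d M k K) (x : K) : Measure M :=
  ((volume.restrict (unitDisk k)).withDensity
    fun z => ENNReal.ofReal (gramVol (Γ.frame x z))).map (Γ.toFun x)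

/-- The absolute value of the determinant of the restriction of `Dg` to the tangent space of the
disk `x` at the point with parameter `z`, a linear map onto its image. -/
def tangentDet (Γ : DiskFamily d M k K) (g : M → M) (x : K)
    (z : EuclideanSpace ℝ (Fin k)) : ℝ :=
  gramVol (fun a => mfderiv (𝓡 d) (𝓡 d) g (Γ.toFun x z) (Γ.frame x z a)) /
    gramVol (Γ.frame x z)

end DiskFamily

end Disks

/-! ### Product structures -/

section Product

/-- Two transverse continuous families of disks, stable and unstable, of complementary dimensions,
such that each stable disk meets each unstable disk in exactly one point. -/
structure ProductStructure (d : ℕ) (M : Type*) [MetricSpace M]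
    [ChartedSpace (EuclideanSpace ℝ (Fin d)) M] [IsManifold (𝓡 d) ∞ M]
    (Ks Ku : Type*) [TopologicalSpace Ks] [TopologicalSpace Ku] where
  /-- dimension of the stable disks -/
  ds : ℕ
  /-- dimension of the unstable disks -/
  du : ℕ
  dim_add : ds + du = d
  /-- the family of stable disks -/
  stable : DiskFamily d M ds Ks
  /-- the family of unstable disks -/
  unstable : DiskFamily d M du Ku
  meet : ∀ (j : Ks) (k : Ku), ∃! x, x ∈ stable.disk j ∧ x ∈ unstable.disk k

variable {d : ℕ} {M : Type*} [MetricSpace M] [ChartedSpace (EuclideanSpace ℝ (Fin d)) M]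
  [IsManifold (𝓡 d) ∞ M] {Ks Ku : Type*} [TopologicalSpace Ks] [TopologicalSpace Ku]

namespace ProductStructure

/-- The compact set `Λ` with the product structure. -/
def Lam (P : ProductStructure d M Ks Ku) : Set M := P.stable.union univ ∩ P.unstable.union univ

/-- `s`-subsets: same unstable disks, and a continuous subfamily of the stable disks. The
continuous subfamilies are those that are indexed by a closed subset of the compact index space. -/
def IsSSubset (P : ProductStructure d M Ks Ku) (S : Set M) : Prop :=
  ∃ A : Set Ks, IsClosed A ∧ S = P.stable.union A ∩ P.unstable.union univ

/-- `u`-subsets: same stable disks, and a continuous subfamily of the unstable disks. -/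
def IsUSubset (P : ProductStructure d M Ks Ku) (S : Set M) : Prop :=
  ∃ B : Set Ku, IsClosed B ∧ S = P.stable.union univ ∩ P.unstable.union B

/-- The point of intersection of a stable and an unstable disk. -/
def inter (P : ProductStructure d M Ks Ku) (j : Ks) (k : Ku) : M := (P.meet j k).choose

open Classical in
/-- The holonomy onto the unstable disk `k`: the point of that disk which lies on the stable disk
through `x`. (It does not depend on the unstable disk on which `x` lies.) -/
def holonomy (P : ProductStructure d M Ks Ku) (k : Ku) (x : M) : M :=
  if h : ∃ j, x ∈ P.stable.disk j then P.inter h.choose k else x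

lemma exists_unstable (P : ProductStructure d M Ks Ku) {x : M} (hx : x ∈ P.Lam) :
    ∃ k, x ∈ P.unstable.disk k := by
  have h := hx.2
  simp only [DiskFamily.union, mem_iUnion] at h
  obtain ⟨k, _, hk⟩ := h
  exact ⟨k, hk⟩

end ProductStructure

/-! ### Recurrence times, return map and separation time -/

/-- A product structure together with a countable family of `s`-subsets and a positive integer
for each of them. -/
structure Scheme (d : ℕ) (M : Type*) [MetricSpace M]
    [ChartedSpace (EuclideanSpace ℝ (Fin d)) M] [IsManifold (𝓡 d) ∞ M]
    (Ks Ku : Type*) [TopologicalSpace Ks] [TopologicalSpace Ku] (ι : Type*)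
    extends ProductStructure d M Ks Ku where
  /-- the elements `Λ_i` of the partition of `Λ` -/
  cell : ι → Set M
  cell_sSubset : ∀ i, toProductStructure.IsSSubset (cell i)
  cell_disjoint : ∀ i i', i ≠ i' → Disjoint (cell i) (cell i')
  /-- the recurrence times `R_i` -/
  time : ι → ℕ
  time_pos : ∀ i, 0 < time i

variable {ι : Type*}

namespace Scheme

open Classical in
/-- The recurrence time `R`, equal to `R_i` on `Λ_i`. -/
def R (S : Scheme d M Ks Ku ι) (x : M) : ℕ :=
  if h : ∃ i, x ∈ S.cell i then S.time h.choose else 0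

/-- The return map, equal to `f ^ R_i` on `Λ_i` (and, by convention, to the identity off
the union of the `Λ_i`, where it is never used). -/
def ret (S : Scheme d M Ks Ku ι) (f : M → M) (x : M) : M := f^[S.R x] x

/-- The set `Λ'` of the points of `Λ` at which all iterates of the return map are defined. -/
def core (S : Scheme d M Ks Ku ι) (f : M → M) : Set M :=
  {x | x ∈ S.Lam ∧ ∀ n : ℕ, ∃ i, (S.ret f)^[n] x ∈ S.cell i}

open Classical in
/-- The separation time; it is `∞` for points of `Λ'` that never separate and `0` if one of the
points is not in `Λ'`. -/
def sep (S : Scheme d M Ks Ku ι) (f : M → M) (x y : M) : ℕ∞ :=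
  if x ∈ S.core f ∧ y ∈ S.core f then
    ⨅ (n : ℕ) (_ : ¬ ∃ i, (S.ret f)^[n] x ∈ S.cell i ∧ (S.ret f)^[n] y ∈ S.cell i), (n : ℕ∞)
  else 0

lemma cell_subset_Lam (S : Scheme d M Ks Ku ι) (i : ι) : S.cell i ⊆ S.Lam := by
  obtain ⟨A, _, hA⟩ := S.cell_sSubset i
  rw [hA]
  rintro x ⟨h1, h2⟩
  refine ⟨?_, h2⟩
  simp only [DiskFamily.union, mem_iUnion] at h1 ⊢
  obtain ⟨j, _, hj⟩ := h1
  exact ⟨j, mem_univ j, hj⟩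

lemma R_pos (S : Scheme d M Ks Ku ι) {x : M} (h : ∃ i, x ∈ S.cell i) : 0 < S.R x := by
  unfold R
  rw [dif_pos h]
  exact S.time_pos _

lemma R_pos_of_core (S : Scheme d M Ks Ku ι) {f : M → M} {x : M} (h : x ∈ S.core f) :
    0 < S.R x := S.R_pos (h.2 0)

lemma ret_mem_core (S : Scheme d M Ks Ku ι) {f : M → M} {x : M} (h : x ∈ S.core f) :
    S.ret f x ∈ S.core f := by
  refine ⟨?_, fun n => ?_⟩
  · obtain ⟨i, hi⟩ := h.2 1
    exact S.cell_subset_Lam i hi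
  · obtain ⟨i, hi⟩ := h.2 (n + 1)
    exact ⟨i, by simpa [Function.iterate_succ_apply] using hi⟩

/-! ### The tower -/

/-- The tower over the points at which the return map can be iterated for ever. -/
abbrev Tower (S : Scheme d M Ks Ku ι) (f : M → M) : Type _ :=
  {p : M × ℕ // p.1 ∈ S.core f ∧ p.2 < S.R p.1}

/-- The tower map. -/
def towerMap (S : Scheme d M Ks Ku ι) (f : M → M) (y : S.Tower f) : S.Tower f :=
  if h : y.1.2 + 1 < S.R y.1.1 then ⟨(y.1.1, y.1.2 + 1), y.2.1, h⟩
  else ⟨(S.ret f y.1.1, 0), S.ret_mem_core y.2.1, S.R_pos_of_core (S.ret_mem_core y.2.1)⟩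

/-- The projection `(x, ℓ) ↦ f ^ ℓ x` of the tower to `M`. -/
def proj (S : Scheme d M Ks Ku ι) (f : M → M) (y : S.Tower f) : M := f^[y.1.2] y.1.1

/-- The separation time on the tower. -/
def towerSep (S : Scheme d M Ks Ku ι) (f : M → M) (y z : S.Tower f) : ℕ∞ :=
  if y.1.2 = z.1.2 then S.sep f y.1.1 z.1.1 else 0

/-- The space of the functions on the tower that are Lipschitz for `b ^ s`. -/
def IsLip (S : Scheme d M Ks Ku ι) (f : M → M) (b : ℝ) (ψ : S.Tower f → ℝ) : Prop :=
  ∃ C : ℝ, 0 < C ∧ ∀ y z, |ψ y - ψ z| ≤ C * epow b (S.towerSep f y z)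

/-- The norm of this space: the Lipschitz seminorm plus the supremum norm (pairs that never
separate contribute `0 / 0 = 0` to the supremum). -/
def lipNorm (S : Scheme d M Ks Ku ι) (f : M → M) (b : ℝ) (ψ : S.Tower f → ℝ) : ℝ :=
  (⨆ p : S.Tower f × S.Tower f, |ψ p.1 - ψ p.2| / epow b (S.towerSep f p.1 p.2)) + supNorm ψ

/-- The index of the unstable disk through the base point, together with the level. -/
def leaf (S : Scheme d M Ks Ku ι) (f : M → M) (y : S.Tower f) : Ku × ℕ :=
  ((S.exists_unstable y.2.1.1).choose, y.1.2)

/-- SRB measures of the tower map: invariant probability measures whose conditional measures on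
the unstable disks of the levels of the tower (that is, in a disintegration along the partition
into the fibres of `leaf`) are almost all absolutely continuous with respect to the Lebesgue
measures on the disks. -/
def IsSRB [MeasurableSpace M] [MeasurableSpace Ku]
    [RiemannianBundle (fun x : M => TangentSpace (𝓡 d) x)]
    (S : Scheme d M Ks Ku ι) (f : M → M) (ν : Measure (S.Tower f)) : Prop :=
  IsProbabilityMeasure ν ∧ MeasurePreserving (S.towerMap f) ν ν ∧
    ∃ κ : ProbabilityTheory.Kernel (Ku × ℕ) (S.Tower f),
      ProbabilityTheory.IsMarkovKernel κ ∧
      ν = (ν.map (S.leaf f)).bind κ ∧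
      ∀ᵐ a ∂(ν.map (S.leaf f)),
        κ a (S.leaf f ⁻¹' {a})ᶜ = 0 ∧
        (κ a).map (fun y => y.1.1) ≪ S.unstable.leb a.1

end Scheme

/-! ### Young structures -/

/-- The scheme `S` is a Young structure for `f`, with constants `C > 0` and `0 < β < 1`.
Conditions on the iterates of the return map are stated at the points of `Λ'`, where all these
iterates are defined. -/
structure IsYoung [MeasurableSpace M]
    [RiemannianBundle (fun x : M => TangentSpace (𝓡 d) x)]
    (S : Scheme d M Ks Ku ι) (f : M → M) (C β : ℝ) : Prop where
  C_pos : 0 < C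
  β_pos : 0 < β
  β_lt_one : β < 1
  leb_pos : ∀ k, 0 < S.unstable.leb k (S.Lam ∩ S.unstable.disk k)
  /-- Markov: the `Λ_i` cover `Λ` up to null sets. -/
  cover : ∀ k, S.unstable.leb k ((S.Lam \ ⋃ i, S.cell i) ∩ S.unstable.disk k) = 0
  /-- Markov: the images are `u`-subsets. -/
  image_uSubset : ∀ i, S.IsUSubset (f^[S.time i] '' S.cell i)
  /-- Markov: images of stable disks are contained in stable disks, and images of unstable
  disks contain unstable disks. Since `f` need not be a diffeomorphism of `M`, this refers to a
  branch of `f ^ R_i`, defined on an open neighbourhood `V` of `Λ_i`, that is a `C^1`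
  diffeomorphism onto its image. -/
  markov : ∀ i, ∃ V : Set M, S.cell i ⊆ V ∧ IsC1DiffeoOn d (f^[S.time i]) V ∧
    ∀ x ∈ S.cell i, ∀ j k, x ∈ S.stable.disk j → x ∈ S.unstable.disk k →
      ∃ j' k', f^[S.time i] x ∈ S.stable.disk j' ∧ f^[S.time i] x ∈ S.unstable.disk k' ∧
        f^[S.time i] '' S.stable.disk j ⊆ S.stable.disk j' ∧
        S.unstable.disk k' ⊆ f^[S.time i] '' (S.unstable.disk k ∩ V)
  /-- Contraction on stable disks, at returns. -/
  contraction : ∀ i j, ∀ x ∈ S.stable.disk j ∩ S.cell i, ∀ y ∈ S.stable.disk j ∩ S.cell i,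
    x ∈ S.core f → y ∈ S.core f → ∀ n : ℕ,
      dist ((S.ret f)^[n] x) ((S.ret f)^[n] y) ≤ C * β ^ n
  /-- Contraction on stable disks, between returns. -/
  contraction' : ∀ i j, ∀ x ∈ S.stable.disk j ∩ S.cell i, ∀ y ∈ S.stable.disk j ∩ S.cell i,
    ∀ l : ℕ, 1 ≤ l → l ≤ S.time i → dist (f^[l] x) (f^[l] y) ≤ C * dist x y
  /-- Expansion on unstable disks, at returns: the bound is `C * β ^ (s(x, y) - n)`. -/
  expansion : ∀ i k, ∀ x ∈ S.unstable.disk k ∩ S.cell i, ∀ y ∈ S.unstable.disk k ∩ S.cell i,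
    x ∈ S.core f → y ∈ S.core f → ∀ n : ℕ,
      dist ((S.ret f)^[n] x) ((S.ret f)^[n] y) ≤ C * (epow β (S.sep f x y) / β ^ n)
  /-- Expansion on unstable disks, between returns. -/
  expansion' : ∀ i k, ∀ x ∈ S.unstable.disk k ∩ S.cell i, ∀ y ∈ S.unstable.disk k ∩ S.cell i,
    ∀ l : ℕ, 1 ≤ l → l ≤ S.time i →
      dist (f^[l] x) (f^[l] y) ≤ C * dist (f^[S.time i] x) (f^[S.time i] y)
  /-- Gibbs. The points `x`, `y` of the disk `k` are given by their parameters `z`, `w`. -/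
  gibbs : ∀ i k, ∀ z ∈ unitDisk S.du, ∀ w ∈ unitDisk S.du,
    S.unstable.toFun k z ∈ S.cell i → S.unstable.toFun k w ∈ S.cell i →
      Real.log (S.unstable.tangentDet (f^[S.time i]) k z /
          S.unstable.tangentDet (f^[S.time i]) k w) ≤
        C * epow β (S.sep f (f^[S.time i] (S.unstable.toFun k z))
          (f^[S.time i] (S.unstable.toFun k w)))
  /-- Regularity of the stable holonomy. -/
  holonomy_regular : ∀ k k', ∃ ρ : M → ℝ, Measurable ρ ∧
    (∀ x ∈ S.unstable.disk k' ∩ S.Lam, 0 < ρ x) ∧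
    ((S.unstable.leb k).restrict S.Lam).map (S.holonomy k') =
      ((S.unstable.leb k').restrict S.Lam).withDensity (fun x => ENNReal.ofReal (ρ x)) ∧
    1 / C ≤ ∫ x in S.Lam, ρ x ∂(S.unstable.leb k') ∧
    ∫ x in S.Lam, ρ x ∂(S.unstable.leb k') ≤ C ∧
    ∀ x ∈ S.unstable.disk k' ∩ S.Lam, ∀ y ∈ S.unstable.disk k' ∩ S.Lam,
      Real.log (ρ x / ρ y) ≤ C * epow β (S.sep f x y)

end Product

end YoungTower

end

noncomputable section

namespace YoungTower

/-! ### Volumes of parallelepipeds in tangent spaces, and right factors of immersions. -/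

section Gram
variable {d : ℕ} {M : Type*} [MetricSpace M] [ChartedSpace (EuclideanSpace ℝ (Fin d)) M]
  [RiemannianBundle (fun x : M => TangentSpace (𝓡 d) x)]

/-! The observable is lifted to the tower, and the tower is read through symbols: a point is sent to
its level and to the sequence of cells visited by its returns (`Scheme.sym`, below called q). In
these coordinates the tower map becomes F = `symStep`, a suspension of the shift, and Φ = φ ∘ π is
almost a function of the symbols once many returns have been made. Write m for the mean of Φ.

Bounded distortion. Along one return the Gibbs condition controls the Jacobian, and the holonomy
brings the image disk back to the original one; along a word the errors add up geometrically. So the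
itineraries of the Lebesgue measure of an unstable disk form a Gibbs measure
(`IsYoung.isGibbs_itinMeasure`). A shift invariant measure that is absolutely continuous with
respect to a Gibbs measure is again Gibbs (`IsGibbsOn.of_absolutelyContinuous`), and this applies to
the measure that ν induces on the base.

Tails. A point of the base cannot be at level n + 1 after n steps, so decay of correlations bounds
the tail of the height (`DecayCor.exists_tail_le`). Bounded distortion makes the return times almost
independent, and few returns up to time k become unlikely.

Approximation. Let G be the conditional expectation of Φ given the symbols after time k, that is,
given F^k ∘ q. Its averages over two parts of a cylinder are compared from far in the past: on each
history the distortion compares the measures and contraction and expansion compare the values of Φ.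
Hence, up to the points with few returns, G is Lipschitz uniformly in k
(`SymOsc.exists_lipschitz_isCond`). Its variance is then a correlation at time k of two Lipschitz
functions, so G is close to m in L² (`SymOsc.exists_isCond_sub_sq_le`). Therefore Φ ∘ T^k - m is
close to v ∘ q, where v is the conditional expectation of Φ ∘ T^k given q, minus G ∘ F^(2k); and v
is exactly orthogonal to the functions of F^(2k) (`SymOsc.exists_isOrth`).

Sums. Functions orthogonal to F^Q behave like reverse martingale differences along each residue
class modulo Q: Burkholder and Azuma type bounds hold. With k = 2^r for all r, a Birkhoff sum of
length 2^l splits into the contributions of the differences between consecutive scales. In the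
polynomial case these are summed geometrically up to the scale l, with p-th moments, p = 2q; in the
stretched exponential case one scale is treated by Azuma's inequality and the finer ones by second
moments. Cutting [0, j) into dyadic blocks then passes from the times 2^l to all times j ≥ n, since
the deviations allowed to the blocks can be chosen so that the union bound still sums geometrically.

The linear dependence on the Hölder norm H in the polynomial case comes from discarding the points
with fewer than K₀ returns, with b^K₀ of order A / H, A being the supremum norm and b = β^(η/2): the
two functions in the correlation then have norms of order H and A. When θ > 1 the hypothesis is so
strong that the symbolic tower is trivial and Φ is almost surely constant
(`SymOsc.ae_eq_integral_of_decayCor`). -/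

lemma gramVol_pos {k : ℕ} {x : M} {v : Fin k → TangentSpace (𝓡 d) x}
    (hv : LinearIndependent ℝ v) : 0 < gramVol v := by
  unfold gramVol
  exact Real.sqrt_pos.2 (Matrix.posDef_gram_of_linearIndependent hv).det_pos

/-- The Gram matrix becomes AᵀGA. This turns the derivative of an inverse branch into a ratio of
volumes of frames. -/
lemma gramVol_sum_smul {k : ℕ} {x : M} (v : Fin k → TangentSpace (𝓡 d) x)
    (A : Matrix (Fin k) (Fin k) ℝ) :
    gramVol (fun a => ∑ b, A b a • v b) = |A.det| * gramVol v := by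
  have h : Matrix.gram ℝ (fun a => ∑ b, A b a • v b) = A.transpose * Matrix.gram ℝ v * A := by
    ext i j
    simp only [Matrix.gram_apply, sum_inner, inner_sum, Matrix.mul_apply, Matrix.transpose_apply,
      real_inner_smul_left, real_inner_smul_right, Finset.sum_mul]
    refine Finset.sum_congr rfl fun a _ => Finset.sum_congr rfl fun b _ => ?_
    rw [real_inner_comm]; ring
  unfold gramVol
  rw [h, Matrix.det_mul, Matrix.det_mul, Matrix.det_transpose,
    show A.det * (Matrix.gram ℝ v).det * A.det = A.det ^ 2 * (Matrix.gram ℝ v).det by ring,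
    Real.sqrt_mul (sq_nonneg _), Real.sqrt_sq_eq_abs]

/-- The inner product depends on the base point although all tangent spaces are the same type; this
transports a volume along a propositional equality of base points. -/
lemma gramVol_congr {k : ℕ} {x y : M} (h : x = y) (v : Fin k → EuclideanSpace ℝ (Fin d)) :
    gramVol (x := x) (fun a => (v a : TangentSpace (𝓡 d) x)) =
      gramVol (x := y) (fun a => (v a : TangentSpace (𝓡 d) y)) := by
  subst h; rfl
end Gram

/-- A continuous right factor of a map with injective derivative is differentiable. -/
lemma hasFDerivWithinAt_of_comp_eq {E F : Type*} [NormedAddCommGroup E] [NormedSpace ℝ E]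
    [FiniteDimensional ℝ E] [NormedAddCommGroup F] [NormedSpace ℝ F] [FiniteDimensional ℝ F]
    {G H : E → F} {σ : E → E} {s t : Set E} {a : E} {L N : E →L[ℝ] F}
    (hG : HasFDerivWithinAt G L s (σ a)) (hL : Function.Injective L)
    (hH : HasFDerivWithinAt H N t a) (hσ : ContinuousWithinAt σ t a) (hst : MapsTo σ t s)
    (ha : a ∈ t)
    (h : ∀ z ∈ t, G (σ z) = H z) (ht : UniqueDiffWithinAt ℝ t a) :
    ∃ A : E →L[ℝ] E, HasFDerivWithinAt σ A t a ∧ N = L.comp A := by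
  obtain ⟨P, hP⟩ := LinearMap.exists_leftInverse_of_injective (L : E →ₗ[ℝ] F)
    (LinearMap.ker_eq_bot.2 hL)
  have hPL : ∀ x, P (L x) = x := fun x => LinearMap.congr_fun hP x
  obtain ⟨c, hc, hcL⟩ : ∃ c > 0, ∀ x, ‖x‖ ≤ c * ‖L x‖ := by
    obtain ⟨c, hc, h'⟩ := (L : E →ₗ[ℝ] F).exists_antilipschitzWith (LinearMap.ker_eq_bot.2 hL)
    exact ⟨c, hc, fun x => by simpa using h'.le_mul_dist x 0⟩
  have hGo : (fun z => G (σ z) - G (σ a) - L (σ z - σ a)) =o[nhdsWithin a t]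
      fun z => σ z - σ a := by
    have := hG.isLittleO
    exact this.comp_tendsto (tendsto_nhdsWithin_iff.2 ⟨hσ, by
      filter_upwards [self_mem_nhdsWithin] with z hz using hst hz⟩)
  have hHo := hH.isLittleO
  have hHO : (fun z => H z - H a) =O[nhdsWithin a t] fun z => z - a := hH.isBigO_sub
  -- The remainder of G is taken with constant 1 / (2c), so that after multiplication by c it is
  -- half of the left side and can be absorbed there.
  have hσO : (fun z => σ z - σ a) =O[nhdsWithin a t] fun z => z - a := by
    have h1 := hGo.def (c := 1 / (2 * c)) (by positivity)
    refine Asymptotics.IsBigO.trans (Asymptotics.IsBigO.of_bound (2 * c) ?_) hHO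
    filter_upwards [h1, self_mem_nhdsWithin] with z hz hzt
    have h2 := hcL (σ z - σ a)
    have h3 : ‖L (σ z - σ a)‖ ≤ ‖H z - H a‖ + 1 / (2 * c) * ‖σ z - σ a‖ := by
      have : L (σ z - σ a) = (H z - H a) - (G (σ z) - G (σ a) - L (σ z - σ a)) := by
        rw [h z hzt, h a ha]; abel
      rw [this]
      exact (norm_sub_le _ _).trans (by gcongr)
    have h4 : c * ‖L (σ z - σ a)‖ ≤ c * (‖H z - H a‖ + 1 / (2 * c) * ‖σ z - σ a‖) := by gcongr
    have h5 : c * (‖H z - H a‖ + 1 / (2 * c) * ‖σ z - σ a‖)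
        = c * ‖H z - H a‖ + ‖σ z - σ a‖ / 2 := by field_simp
    linarith
  -- The derivative of σ has to be P ∘ N with P a left inverse of L: apply P to the two expansions
  -- of G ∘ σ = H.
  let P' : F →L[ℝ] E := LinearMap.toContinuousLinearMap P
  have hA : HasFDerivWithinAt σ (P'.comp N) t a := by
    refine .of_isLittleO ?_
    have h1 : (fun z => P' (H z - H a - N (z - a))) =o[nhdsWithin a t] fun z => z - a :=
      (P'.isBigO_comp _ _).trans_isLittleO hHo
    have h2 : (fun z => P' (G (σ z) - G (σ a) - L (σ z - σ a))) =o[nhdsWithin a t]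
        fun z => z - a := (P'.isBigO_comp _ _).trans_isLittleO (hGo.trans_isBigO hσO)
    refine (h1.sub h2).congr' ?_ Filter.EventuallyEq.rfl
    filter_upwards [self_mem_nhdsWithin] with z hz
    have h3 : P' (L (σ z - σ a)) = σ z - σ a := hPL _
    rw [map_sub, map_sub P' (G (σ z) - G (σ a)), h3, h z hz, h a ha]
    simp only [ContinuousLinearMap.comp_apply]
    abel
  refine ⟨_, hA, ?_⟩
  have h1 : HasFDerivWithinAt (G ∘ σ) (L.comp (P'.comp N)) t a := hG.comp a hA hst
  exact ht.eq hH (h1.congr (fun z hz => (h z hz).symm) (h a ha).symm)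

/-! ### Disks: compactness, frames, and openness of local diffeomorphisms. -/

section Disk

variable {d : ℕ} {M : Type*} [MetricSpace M] [ChartedSpace (EuclideanSpace ℝ (Fin d)) M]
  [IsManifold (𝓡 d) ∞ M] {k : ℕ} {K : Type*} [TopologicalSpace K]

namespace DiskFamily

lemma injOn_toFun (Γ : DiskFamily d M k K) (x : K) : InjOn (Γ.toFun x) (unitDisk k) := by
  intro z hz w hw h
  have hz' : (x, z) ∈ (univ : Set K) ×ˢ unitDisk k := mk_mem_prod (mem_univ _) hz
  have hw' : (x, w) ∈ (univ : Set K) ×ˢ unitDisk k := mk_mem_prod (mem_univ _) hw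
  exact congrArg Prod.snd (Γ.injOn hz' hw' h)

lemma eq_of_mem_disk (Γ : DiskFamily d M k K) {x y : K} {p : M} (hx : p ∈ Γ.disk x)
    (hy : p ∈ Γ.disk y) : x = y := by
  obtain ⟨z, hz, rfl⟩ := hx
  obtain ⟨w, hw, h⟩ := hy
  have hz' : (x, z) ∈ (univ : Set K) ×ˢ unitDisk k := mk_mem_prod (mem_univ _) hz
  have hw' : (y, w) ∈ (univ : Set K) ×ˢ unitDisk k := mk_mem_prod (mem_univ _) hw
  exact congrArg Prod.fst (Γ.injOn hz' hw' h.symm)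

lemma continuousOn_toFun (Γ : DiskFamily d M k K) (x : K) :
    ContinuousOn (Γ.toFun x) (unitDisk k) :=
  Γ.continuousOn.comp (f := fun z => (x, z)) (by fun_prop) fun z hz => ⟨mem_univ _, hz⟩

lemma isCompact_disk (Γ : DiskFamily d M k K) (x : K) : IsCompact (Γ.disk x) :=
  (isCompact_closedBall _ _).image_of_continuousOn (Γ.continuousOn_toFun x)

lemma isCompact_union [CompactSpace K] (Γ : DiskFamily d M k K) {A : Set K} (hA : IsClosed A) :
    IsCompact (Γ.union A) := by
  have : Γ.union A = (fun p : K × EuclideanSpace ℝ (Fin k) => Γ.toFun p.1 p.2) ''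
      (A ×ˢ unitDisk k) := by
    ext p
    simp [union, disk]
  rw [this]
  exact (hA.isCompact.prod (isCompact_closedBall _ _)).image_of_continuousOn
    (Γ.continuousOn.mono (prod_mono_left (subset_univ _)))

/-- By compactness of the ball and injectivity of the parametrisation, z is the only possible
cluster point. This is how inverse branches, obtained by mere choice, are seen to be continuous. -/
lemma tendsto_of_tendsto_toFun (Γ : DiskFamily d M k K) (x : K) {α : Type*} {l : Filter α}
    {u : α → EuclideanSpace ℝ (Fin k)} (hu : ∀ᶠ a in l, u a ∈ unitDisk k)
    {z : EuclideanSpace ℝ (Fin k)} (hz : z ∈ unitDisk k)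
    (h : Filter.Tendsto (fun a => Γ.toFun x (u a)) l (nhds (Γ.toFun x z))) :
    Filter.Tendsto u l (nhds z) := by
  refine (isCompact_closedBall _ _).tendsto_nhds_of_unique_mapClusterPt hu fun w hw hwc => ?_
  refine Γ.injOn_toFun x hw hz ?_
  rw [mapClusterPt_iff_ultrafilter] at hwc
  obtain ⟨U, hU, hUw⟩ := hwc
  have h1 : Filter.Tendsto u U (nhdsWithin w (unitDisk k)) :=
    tendsto_nhdsWithin_iff.2 ⟨hUw, hU hu⟩
  exact tendsto_nhds_unique ((Γ.continuousOn_toFun x w hw).tendsto.comp h1) (h.mono_left hU)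

lemma hasMFDerivWithinAt_toFun (Γ : DiskFamily d M k K) (x : K)
    {z : EuclideanSpace ℝ (Fin k)} (hz : z ∈ unitDisk k) :
    HasMFDerivWithinAt (𝓡 k) (𝓡 d) (Γ.toFun x) (unitDisk k) z
      (mfderivWithin (𝓡 k) (𝓡 d) (Γ.toFun x) (unitDisk k) z) :=
  ((Γ.contMDiffOn x z hz).mdifferentiableWithinAt one_ne_zero).hasMFDerivWithinAt

lemma linearIndependent_frame (Γ : DiskFamily d M k K) (x : K)
    {z : EuclideanSpace ℝ (Fin k)} (hz : z ∈ unitDisk k) :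
    LinearIndependent ℝ (Γ.frame x z) := by
  have h : LinearIndependent ℝ
      (fun a : Fin k => (EuclideanSpace.single a (1 : ℝ) : EuclideanSpace ℝ (Fin k))) := by
    have h1 := (EuclideanSpace.basisFun (Fin k) ℝ).toBasis.linearIndependent
    have h2 : ⇑(EuclideanSpace.basisFun (Fin k) ℝ).toBasis = fun a : Fin k =>
        (EuclideanSpace.single a (1 : ℝ) : EuclideanSpace ℝ (Fin k)) := by
      ext1 a
      simp
    rwa [h2] at h1
  let D : EuclideanSpace ℝ (Fin k) →L[ℝ] EuclideanSpace ℝ (Fin d) :=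
    mfderivWithin (𝓡 k) (𝓡 d) (Γ.toFun x) (unitDisk k) z
  have hD : Function.Injective D := Γ.immersion x z hz
  exact h.map' (D : EuclideanSpace ℝ (Fin k) →ₗ[ℝ] EuclideanSpace ℝ (Fin d))
    (LinearMap.ker_eq_bot.2 hD)

variable [RiemannianBundle (fun x : M => TangentSpace (𝓡 d) x)]

lemma gramVol_frame_pos (Γ : DiskFamily d M k K) (x : K)
    {z : EuclideanSpace ℝ (Fin k)} (hz : z ∈ unitDisk k) : 0 < gramVol (Γ.frame x z) :=
  gramVol_pos (Γ.linearIndependent_frame x hz)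

lemma continuousOn_gramVol_frame [IsContMDiffRiemannianBundle (𝓡 d) ∞ (EuclideanSpace ℝ (Fin d))
      (fun x : M => TangentSpace (𝓡 d) x)] (Γ : DiskFamily d M k K) (x : K) :
    ContinuousOn (fun z => gramVol (Γ.frame x z)) (unitDisk k) := by
  have h1 : ∀ a, ContinuousOn (fun z => (⟨Γ.toFun x z, Γ.frame x z a⟩ : TangentBundle (𝓡 d) M))
      (unitDisk k) := fun a =>
    Γ.continuousOn_tangent.comp (f := fun z => (x, z, EuclideanSpace.single a (1 : ℝ)))
      (by fun_prop) fun z hz => ⟨mem_univ _, hz, mem_univ _⟩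
  have : IsContinuousRiemannianBundle (EuclideanSpace ℝ (Fin d))
      (fun x : M => TangentSpace (𝓡 d) x) := by
    have h0 : IsContMDiffRiemannianBundle (𝓡 d) 0 (EuclideanSpace ℝ (Fin d))
      (fun x : M => TangentSpace (𝓡 d) x) := .of_le (n' := 0) (n := ∞) (by simp)
    obtain ⟨g, hg, hg'⟩ := h0.exists_contMDiff
    exact ⟨g, hg.continuous, hg'⟩
  unfold gramVol
  refine Real.continuous_sqrt.comp_continuousOn ?_
  have h2 : ContinuousOn (fun z => Matrix.gram ℝ (Γ.frame x z)) (unitDisk k) := by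
    refine continuousOn_pi.2 fun i => continuousOn_pi.2 fun j => ?_
    exact ContinuousOn.inner_bundle (h1 i) (h1 j)
  exact (continuous_id.matrix_det).comp_continuousOn h2

end DiskFamily

/-- The inverse function theorem read in charts. -/
lemma map_nhds_eq_of_isC1DiffeoOn {g : M → M} {V : Set M} (h : IsC1DiffeoOn d g V) {x : M}
    (hx : x ∈ V) : Filter.map g (nhds x) = nhds (g x) := by
  have h1 : ContMDiffAt (𝓡 d) (𝓡 d) 1 g x := (h.2.2.1 x hx).contMDiffAt (h.1.mem_nhds hx)
  have hm := (h1.mdifferentiableAt one_ne_zero).hasMFDerivAt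
  have h2 := (contMDiffAt_iff.1 h1).2
  set F := extChartAt (𝓡 d) (g x) ∘ g ∘ (extChartAt (𝓡 d) x).symm with hF
  have h3 : ContDiffAt ℝ 1 F (extChartAt (𝓡 d) x x) := by
    rw [modelWithCornersSelf_coe, range_id] at h2
    exact contDiffWithinAt_univ.1 h2
  let D : EuclideanSpace ℝ (Fin d) →L[ℝ] EuclideanSpace ℝ (Fin d) := mfderiv (𝓡 d) (𝓡 d) g x
  have h4 : HasFDerivAt F D (extChartAt (𝓡 d) x x) := by
    have h := hm.2
    rw [modelWithCornersSelf_coe, range_id] at h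
    exact hasFDerivWithinAt_univ.1 (show HasFDerivWithinAt F D univ _ from h)
  have h5 := h3.hasStrictFDerivAt' h4 one_ne_zero
  let e : EuclideanSpace ℝ (Fin d) ≃L[ℝ] EuclideanSpace ℝ (Fin d) :=
    (LinearEquiv.ofBijective (D : EuclideanSpace ℝ (Fin d) →ₗ[ℝ] EuclideanSpace ℝ (Fin d))
      (h.2.2.2 x hx)).toContinuousLinearEquiv
  have h6 : HasStrictFDerivAt F (e : EuclideanSpace ℝ (Fin d) →L[ℝ] EuclideanSpace ℝ (Fin d))
      (extChartAt (𝓡 d) x x) := by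
    have : (e : EuclideanSpace ℝ (Fin d) →L[ℝ] EuclideanSpace ℝ (Fin d)) = D := by
      ext1 v; rfl
    rw [this]
    exact h5
  have h7 := h6.map_nhds_eq_of_equiv
  have h8 : Filter.map (extChartAt (𝓡 d) x) (nhds x) = nhds (extChartAt (𝓡 d) x x) :=
    map_extChartAt_nhds_of_boundaryless x
  have h9 : F (extChartAt (𝓡 d) x x) = extChartAt (𝓡 d) (g x) (g x) := by
    simp [hF]
  have h10 : Filter.map g (nhds x) =
      Filter.map (extChartAt (𝓡 d) (g x)).symm (nhds (extChartAt (𝓡 d) (g x) (g x))) := by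
    rw [← h9, ← h7, ← h8, Filter.map_map, Filter.map_map]
    refine Filter.map_congr ?_
    filter_upwards [extChartAt_source_mem_nhds (I := 𝓡 d) x,
      h1.continuousAt.preimage_mem_nhds (extChartAt_source_mem_nhds (I := 𝓡 d) (g x))] with y hy hy'
    simp only [hF, Function.comp_apply]
    rw [(extChartAt (𝓡 d) x).left_inv hy, (extChartAt (𝓡 d) (g x)).left_inv hy']
  rw [h10]
  have h11 := map_extChartAt_nhds_of_boundaryless (I := 𝓡 d) (g x)
  rw [← h11, Filter.map_map]
  conv_rhs => rw [← Filter.map_id (f := nhds (g x))]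
  refine Filter.map_congr ?_
  filter_upwards [extChartAt_source_mem_nhds (I := 𝓡 d) (g x)] with y hy
  exact (extChartAt (𝓡 d) (g x)).left_inv hy

end Disk

/-- A comparison of averages of u with weight G, in cross-multiplied form: no division, so null sets
need no separate treatment. All distortion bounds below are kept in this form. -/
lemma lintegral_mul_lintegral_le_of_le {α : Type*} [MeasurableSpace α] {μ : Measure α}
    {W W' : Set α} (hW : MeasurableSet W) (hW' : MeasurableSet W') {G u : α → ℝ≥0∞} {c : ℝ≥0∞}
    (hc : c ≠ ⊤) (hGW : ∫⁻ z in W, G z ∂μ ≠ ⊤) (huW : ∫⁻ z in W, G z * u z ∂μ ≠ ⊤)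
    (hu : ∀ w ∈ W', u w ≠ ⊤)
    (h : ∀ z ∈ W, ∀ w ∈ W', u z ≤ c * u w) :
    (∫⁻ z in W, G z * u z ∂μ) * ∫⁻ w in W', G w ∂μ ≤
      c * (∫⁻ w in W', G w * u w ∂μ) * ∫⁻ z in W, G z ∂μ := by
  have h1 : ∀ w ∈ W', ∫⁻ z in W, G z * u z ∂μ ≤ c * u w * ∫⁻ z in W, G z ∂μ := fun w hw => by
    rw [← lintegral_const_mul' _ _ (ENNReal.mul_ne_top hc (hu w hw))]
    refine setLIntegral_mono' hW fun z hz => ?_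
    rw [mul_comm]
    gcongr
    exact h z hz w hw
  rw [← lintegral_const_mul' _ _ huW]
  calc ∫⁻ w in W', (∫⁻ z in W, G z * u z ∂μ) * G w ∂μ
      ≤ ∫⁻ w in W', (c * ∫⁻ z in W, G z ∂μ) * (G w * u w) ∂μ := by
        refine setLIntegral_mono' hW' fun w hw => ?_
        calc (∫⁻ z in W, G z * u z ∂μ) * G w ≤ (c * u w * ∫⁻ z in W, G z ∂μ) * G w := by
              gcongr; exact h1 w hw
          _ = _ := by ring
    _ = _ := by
        rw [lintegral_const_mul' _ _ (ENNReal.mul_ne_top hc hGW)]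
        ring

/-! ### Volume of disks and its distortion under inverse branches. -/

section Disk

variable {d : ℕ} {M : Type*} [MetricSpace M] [ChartedSpace (EuclideanSpace ℝ (Fin d)) M]
  [IsManifold (𝓡 d) ∞ M] {k : ℕ} {K : Type*} [TopologicalSpace K]
  [RiemannianBundle (fun x : M => TangentSpace (𝓡 d) x)]

lemma gramVol_nonneg {k : ℕ} {x : M} (v : Fin k → TangentSpace (𝓡 d) x) : 0 ≤ gramVol v :=
  Real.sqrt_nonneg _

namespace DiskFamily

/-- The inverse branch of `g` on a disk, read in the parametrisations of the disks. -/
lemma exists_inverse_branch (Γ : DiskFamily d M k K) {x x' : K} {g : M → M} {V : Set M}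
    (hg : IsC1DiffeoOn d g V) (h : Γ.disk x' ⊆ g '' (Γ.disk x ∩ V)) :
    ∃ σ : EuclideanSpace ℝ (Fin k) → EuclideanSpace ℝ (Fin k),
      MapsTo σ (unitDisk k) (unitDisk k) ∧ InjOn σ (unitDisk k) ∧
      (∀ z ∈ unitDisk k, Γ.toFun x (σ z) ∈ V ∧ g (Γ.toFun x (σ z)) = Γ.toFun x' z) ∧
      ∀ z ∈ unitDisk k, ∃ A : EuclideanSpace ℝ (Fin k) →L[ℝ] EuclideanSpace ℝ (Fin k),
        HasFDerivWithinAt σ A (unitDisk k) z ∧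
        gramVol (Γ.frame x' z) = |A.det| * gramVol (fun a =>
          mfderiv (𝓡 d) (𝓡 d) g (Γ.toFun x (σ z)) (Γ.frame x (σ z) a)) := by
  have h1 : ∀ z, ∃ w, z ∈ unitDisk k → w ∈ unitDisk k ∧ Γ.toFun x w ∈ V ∧
      g (Γ.toFun x w) = Γ.toFun x' z := fun z => by
    by_cases hz : z ∈ unitDisk k
    · obtain ⟨p, ⟨⟨w, hw, rfl⟩, hpV⟩, hp⟩ := h ⟨z, hz, rfl⟩
      exact ⟨w, fun _ => ⟨hw, hpV, hp⟩⟩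
    · exact ⟨0, fun hz' => absurd hz' hz⟩
  choose σ hσ using h1
  have hmaps : MapsTo σ (unitDisk k) (unitDisk k) := fun z hz => (hσ z hz).1
  refine ⟨σ, hmaps, ?_, fun z hz => (hσ z hz).2, fun z hz => ?_⟩
  · intro z hz w hw hzw
    refine Γ.injOn_toFun x' hz hw ?_
    rw [← (hσ z hz).2.2, ← (hσ w hw).2.2, hzw]
  -- The map g is open at the chosen preimage, so images of small neighbourhoods catch all nearby
  -- points of the disk `x'`; injectivity on V identifies the preimage found there with the chosen
  -- one.
  have hcont : ContinuousWithinAt σ (unitDisk k) z := by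
    refine Γ.tendsto_of_tendsto_toFun x ?_ (hmaps hz) ?_
    · filter_upwards [self_mem_nhdsWithin] with w hw using hmaps hw
    rw [Filter.tendsto_def]
    intro U hU
    have h2 : g '' (U ∩ V) ∈ nhds (Γ.toFun x' z) := by
      rw [← (hσ z hz).2.2, ← map_nhds_eq_of_isC1DiffeoOn hg (hσ z hz).2.1]
      exact Filter.image_mem_map (Filter.inter_mem hU (hg.1.mem_nhds (hσ z hz).2.1))
    filter_upwards [(Γ.continuousOn_toFun x' z hz).preimage_mem_nhdsWithin h2,
      self_mem_nhdsWithin] with w hw hwd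
    obtain ⟨u, ⟨huU, huV⟩, hu⟩ := hw
    rw [← (hσ w hwd).2.2] at hu
    have := hg.2.1 huV (hσ w hwd).2.1 hu
    simpa [this] using huU
  set p := Γ.toFun x' z with hp
  have hV := (hσ z hz).2.1
  have hgm : HasMFDerivAt (𝓡 d) (𝓡 d) g (Γ.toFun x (σ z))
      (mfderiv (𝓡 d) (𝓡 d) g (Γ.toFun x (σ z))) :=
    (((hg.2.2.1 _ hV).contMDiffAt (hg.1.mem_nhds hV)).mdifferentiableAt one_ne_zero).hasMFDerivAt
  have hcomp := hgm.comp_hasMFDerivWithinAt (σ z) (Γ.hasMFDerivWithinAt_toFun x (hmaps hz))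
  let L₁ : EuclideanSpace ℝ (Fin k) →L[ℝ] EuclideanSpace ℝ (Fin d) :=
    mfderivWithin (𝓡 k) (𝓡 d) (Γ.toFun x) (unitDisk k) (σ z)
  let L₂ : EuclideanSpace ℝ (Fin d) →L[ℝ] EuclideanSpace ℝ (Fin d) :=
    mfderiv (𝓡 d) (𝓡 d) g (Γ.toFun x (σ z))
  let N : EuclideanSpace ℝ (Fin k) →L[ℝ] EuclideanSpace ℝ (Fin d) :=
    mfderivWithin (𝓡 k) (𝓡 d) (Γ.toFun x') (unitDisk k) z
  have hL₁ : Function.Injective L₁ := Γ.immersion x _ (hmaps hz)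
  have hL₂ : Function.Injective L₂ := (hg.2.2.2 _ hV).1
  have hG : HasFDerivWithinAt (extChartAt (𝓡 d) p ∘ g ∘ Γ.toFun x) (L₂.comp L₁) (unitDisk k)
      (σ z) := by
    have h3 := hcomp.2
    have h4 : (g ∘ Γ.toFun x) (σ z) = p := (hσ z hz).2.2
    simp only [writtenInExtChartAt, h4, extChartAt_model_space_eq_id, modelWithCornersSelf_coe,
      range_id, inter_univ] at h3
    exact h3
  have hH : HasFDerivWithinAt (extChartAt (𝓡 d) p ∘ Γ.toFun x') N (unitDisk k) z := by
    have h3 := (Γ.hasMFDerivWithinAt_toFun x' hz).2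
    simp only [writtenInExtChartAt, ← hp, extChartAt_model_space_eq_id, modelWithCornersSelf_coe,
      range_id, inter_univ] at h3
    exact h3
  have huniq : UniqueDiffWithinAt ℝ (unitDisk k) z :=
    uniqueDiffOn_convex (convex_closedBall _ _)
      ⟨0, by rw [interior_closedBall _ one_ne_zero]; simp⟩ z hz
  -- In a chart at p, the disk `x'` is the composition of σ with the immersion g ∘ `Γ.toFun x`.
  obtain ⟨A, hA, hNA⟩ := hasFDerivWithinAt_of_comp_eq hG (hL₂.comp hL₁) hH hcont hmaps hz
    (fun w hw => by simp only [Function.comp_apply, (hσ w hw).2.2]) huniq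
  refine ⟨A, hA, ?_⟩
  let e : Fin k → EuclideanSpace ℝ (Fin k) := fun a => EuclideanSpace.single a (1 : ℝ)
  let m : Matrix (Fin k) (Fin k) ℝ := Matrix.of fun b a => A (e a) b
  have hdet : A.det = m.det := by
    rw [ContinuousLinearMap.det, ← LinearMap.det_toMatrix (EuclideanSpace.basisFun (Fin k) ℝ).toBasis]
    congr 1
  have hframe : ∀ a, N (e a) = ∑ b, m b a • L₂ (L₁ (e b)) := fun a => by
    have h5 : A (e a) = ∑ b, m b a • e b := by
      ext i
      simp [m, e, Finset.sum_apply, Pi.single_apply]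
    rw [hNA, ContinuousLinearMap.comp_apply, h5]
    simp [map_sum]
  have h6 := gramVol_sum_smul (x := g (Γ.toFun x (σ z))) (fun a =>
          mfderiv (𝓡 d) (𝓡 d) g (Γ.toFun x (σ z)) (Γ.frame x (σ z) a)) m
  rw [hdet, ← h6]
  have h7 := gramVol_congr (hσ z hz).2.2 (fun a => N (e a))
  have h8 : (fun a => N (e a)) = fun a => ∑ b, m b a • L₂ (L₁ (e b)) := funext hframe
  rw [h8] at h7
  have h9 : Γ.frame x' z = fun a => N (e a) := rfl
  rw [h9, h8]
  exact h7.symm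

section Leb

variable [MeasurableSpace M] [BorelSpace M]
  [IsContMDiffRiemannianBundle (𝓡 d) ∞ (EuclideanSpace ℝ (Fin d))
    (fun x : M => TangentSpace (𝓡 d) x)]

lemma measurableSet_disk (Γ : DiskFamily d M k K) (x : K) : MeasurableSet (Γ.disk x) :=
  (Γ.isCompact_disk x).measurableSet

/-- The parametrisation is controlled on the closed ball only, so it is replaced by a constant
outside. -/
lemma measurableSet_param (Γ : DiskFamily d M k K) (x : K) {B : Set M} (hB : MeasurableSet B) :
    MeasurableSet (unitDisk k ∩ Γ.toFun x ⁻¹' B) := by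
  classical
  have h := (Γ.continuousOn_toFun x).measurable_piecewise
    (continuousOn_const (c := Γ.toFun x 0)) (Metric.isClosed_closedBall.measurableSet)
  have h2 : unitDisk k ∩ Γ.toFun x ⁻¹' B = unitDisk k ∩
      ((unitDisk k).piecewise (Γ.toFun x) (fun _ => Γ.toFun x 0)) ⁻¹' B := by
    ext z
    constructor
    · rintro ⟨h1, h2⟩
      exact ⟨h1, by simpa [piecewise, h1] using h2⟩
    · rintro ⟨h1, h2⟩
      refine ⟨h1, ?_⟩
      have : (unitDisk k).piecewise (Γ.toFun x) (fun _ => Γ.toFun x 0) z = Γ.toFun x z :=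
        piecewise_eq_of_mem _ _ _ h1
      rwa [mem_preimage, this] at h2
  rw [h2]
  exact Metric.isClosed_closedBall.measurableSet.inter (h hB)

lemma leb_apply (Γ : DiskFamily d M k K) (x : K) {B : Set M} (hB : MeasurableSet B) :
    Γ.leb x B = ∫⁻ z in unitDisk k ∩ Γ.toFun x ⁻¹' B,
      ENNReal.ofReal (gramVol (Γ.frame x z)) := by
  have hm : MeasurableSet (unitDisk k) := Metric.isClosed_closedBall.measurableSet
  have h1 : AEMeasurable (Γ.toFun x) (volume.restrict (unitDisk k)) :=
    (Γ.continuousOn_toFun x).aemeasurable hm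
  have h0 : AEMeasurable (fun z => ENNReal.ofReal (gramVol (Γ.frame x z)))
      (volume.restrict (unitDisk k)) :=
    ((Γ.continuousOn_gramVol_frame x).aemeasurable hm).ennreal_ofReal
  have h2 : AEMeasurable (Γ.toFun x) ((volume.restrict (unitDisk k)).withDensity
      fun z => ENNReal.ofReal (gramVol (Γ.frame x z))) :=
    h1.mono_ac (withDensity_absolutelyContinuous _ _)
  rw [leb, Measure.map_apply_of_aemeasurable h2 hB, withDensity_apply' _ ,
    Measure.restrict_restrict₀' hm.nullMeasurableSet, inter_comm]

lemma leb_compl_disk (Γ : DiskFamily d M k K) (x : K) : Γ.leb x (Γ.disk x)ᶜ = 0 := by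
  rw [Γ.leb_apply x (Γ.measurableSet_disk x).compl]
  have : unitDisk k ∩ Γ.toFun x ⁻¹' (Γ.disk x)ᶜ = ∅ := by
    ext z
    simp only [mem_inter_iff, mem_preimage, mem_compl_iff, mem_empty_iff_false, iff_false, not_and,
      not_not]
    exact fun hz => ⟨z, hz, rfl⟩
  rw [this]
  simp

lemma lintegral_gramVol_ne_top (Γ : DiskFamily d M k K) (x : K)
    (W : Set (EuclideanSpace ℝ (Fin k))) (hW : W ⊆ unitDisk k) :
    ∫⁻ z in W, ENNReal.ofReal (gramVol (Γ.frame x z)) ≠ ⊤ := by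
  obtain ⟨C, hC⟩ := (isCompact_closedBall (0 : EuclideanSpace ℝ (Fin k)) 1).bddAbove_image
    (Γ.continuousOn_gramVol_frame x)
  refine ne_top_of_le_ne_top ?_ (lintegral_mono_set hW)
  refine ne_top_of_le_ne_top ?_ (setLIntegral_mono' Metric.isClosed_closedBall.measurableSet
    (g := fun _ => ENNReal.ofReal C) fun z hz => ENNReal.ofReal_le_ofReal (hC ⟨z, hz, rfl⟩))
  rw [setLIntegral_const]
  exact ENNReal.mul_ne_top ENNReal.ofReal_ne_top (measure_closedBall_lt_top).ne

lemma isFiniteMeasure_leb (Γ : DiskFamily d M k K) (x : K) : IsFiniteMeasure (Γ.leb x) := by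
  refine ⟨?_⟩
  rw [Γ.leb_apply x MeasurableSet.univ]
  exact (Γ.lintegral_gramVol_ne_top x _ inter_subset_left).lt_top

/-- Bounded distortion of the volumes of disks under a diffeomorphism with bounded distortion. -/
lemma leb_mul_leb_le (Γ : DiskFamily d M k K) {x x' : K} {g : M → M} {V : Set M}
    (hg : IsC1DiffeoOn d g V) (h : Γ.disk x' ⊆ g '' (Γ.disk x ∩ V))
    {P B P' B' : Set M} (hP : MeasurableSet P) (hB : MeasurableSet B) (hP' : MeasurableSet P')
    (hB' : MeasurableSet B') (hPB : ∀ p ∈ Γ.disk x, p ∈ V → g p ∈ Γ.disk x' → (p ∈ P ↔ g p ∈ B))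
    (hPB' : ∀ p ∈ Γ.disk x, p ∈ V → g p ∈ Γ.disk x' → (p ∈ P' ↔ g p ∈ B'))
    (hPV : ∀ p ∈ Γ.disk x, p ∈ P → p ∈ V ∧ g p ∈ Γ.disk x')
    (hPV' : ∀ p ∈ Γ.disk x, p ∈ P' → p ∈ V ∧ g p ∈ Γ.disk x')
    {c : ℝ} (hc : 0 ≤ c)
    (hJ : ∀ z ∈ unitDisk k, ∀ w ∈ unitDisk k, Γ.toFun x z ∈ P → Γ.toFun x w ∈ P' →
      Γ.tangentDet g x w ≤ c * Γ.tangentDet g x z) :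
    Γ.leb x P * Γ.leb x' B' ≤ ENNReal.ofReal c * Γ.leb x P' * Γ.leb x' B := by
  obtain ⟨σ, hσ, hinj, hσg, hder⟩ := Γ.exists_inverse_branch hg h
  choose! A hA hdet using hder
  have hm : MeasurableSet (unitDisk k) := Metric.isClosed_closedBall.measurableSet
  let G : EuclideanSpace ℝ (Fin k) → ℝ≥0∞ := fun z => ENNReal.ofReal (gramVol (Γ.frame x' z))
  let u : EuclideanSpace ℝ (Fin k) → ℝ≥0∞ := fun z =>
    ENNReal.ofReal (Γ.tangentDet g x (σ z))⁻¹
  have hJpos : ∀ z ∈ unitDisk k, 0 < Γ.tangentDet g x (σ z) := fun z hz => by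
    refine div_pos ?_ (Γ.gramVol_frame_pos x (hσ hz))
    have h1 := Γ.gramVol_frame_pos x' hz
    rw [hdet z hz] at h1
    exact (pos_iff_pos_of_mul_pos h1).1 (pos_of_mul_pos_left h1 (gramVol_nonneg _))
  -- Change of variables by σ: the volume of a piece of the disk x becomes an integral over the
  -- parameters of its image in the disk `x'`, with the inverse Jacobian as density relative to the
  -- volume there.
  have key : ∀ Q D : Set M, MeasurableSet Q → MeasurableSet D →
      (∀ p ∈ Γ.disk x, p ∈ V → g p ∈ Γ.disk x' → (p ∈ Q ↔ g p ∈ D)) →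
      (∀ p ∈ Γ.disk x, p ∈ Q → p ∈ V ∧ g p ∈ Γ.disk x') →
      Γ.leb x Q = ∫⁻ z in unitDisk k ∩ Γ.toFun x' ⁻¹' D, G z * u z := by
    intro Q D hQ hD hQD hQV
    have h1 : unitDisk k ∩ Γ.toFun x ⁻¹' Q = σ '' (unitDisk k ∩ Γ.toFun x' ⁻¹' D) := by
      ext w
      constructor
      · rintro ⟨hw, hwQ⟩
        have hd : Γ.toFun x w ∈ Γ.disk x := ⟨w, hw, rfl⟩
        obtain ⟨hwV, z, hz, hzw⟩ := hQV _ hd hwQ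
        have h2 : Γ.toFun x (σ z) = Γ.toFun x w :=
          hg.2.1 (hσg z hz).1 hwV (by rw [(hσg z hz).2, hzw])
        refine ⟨z, ⟨hz, ?_⟩, Γ.injOn_toFun x (hσ hz) hw h2⟩
        rw [mem_preimage, hzw]
        exact (hQD _ hd hwV ⟨z, hz, hzw⟩).1 hwQ
      · rintro ⟨z, ⟨hz, hzD⟩, rfl⟩
        refine ⟨hσ hz, ?_⟩
        refine (hQD _ ⟨_, hσ hz, rfl⟩ (hσg z hz).1 ?_).2 ?_
        · rw [(hσg z hz).2]; exact ⟨z, hz, rfl⟩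
        · rw [(hσg z hz).2]; exact hzD
    rw [Γ.leb_apply x hQ, h1, lintegral_image_eq_lintegral_abs_det_fderiv_mul volume
      (Γ.measurableSet_param x' hD) (fun z hz => (hA z hz.1).mono inter_subset_left)
      (hinj.mono inter_subset_left)]
    refine setLIntegral_congr_fun (Γ.measurableSet_param x' hD) fun z hz => ?_
    simp only [G, u]
    rw [← ENNReal.ofReal_mul (abs_nonneg _), ← ENNReal.ofReal_mul (gramVol_nonneg _)]
    congr 1
    have h2 := hJpos z hz.1
    have h3 := Γ.gramVol_frame_pos x (hσ hz.1)
    rw [hdet z hz.1, tangentDet, inv_div, mul_assoc]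
    congr 1
    rw [tangentDet] at h2
    have h4 := (div_pos_iff_of_pos_right h3).1 h2
    field_simp
  have hWB := Γ.measurableSet_param x' hB
  have hWB' := Γ.measurableSet_param x' hB'
  have hle := lintegral_mul_lintegral_le_of_le (μ := volume) hWB hWB' (G := G) (u := u)
    (c := ENNReal.ofReal c) ENNReal.ofReal_ne_top
    (Γ.lintegral_gramVol_ne_top x' _ inter_subset_left)
    (by rw [← key P B hP hB hPB hPV]
        have := Γ.isFiniteMeasure_leb x
        exact measure_ne_top _ _)
    (fun _ _ => ENNReal.ofReal_ne_top)
    (fun z hz w hw => by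
      simp only [u]
      rw [← ENNReal.ofReal_mul hc]
      refine ENNReal.ofReal_le_ofReal ?_
      have hz' : Γ.toFun x (σ z) ∈ P := (hPB _ ⟨_, hσ hz.1, rfl⟩ (hσg z hz.1).1
        (by rw [(hσg z hz.1).2]; exact ⟨z, hz.1, rfl⟩)).2 (by rw [(hσg z hz.1).2]; exact hz.2)
      have hw' : Γ.toFun x (σ w) ∈ P' := (hPB' _ ⟨_, hσ hw.1, rfl⟩ (hσg w hw.1).1
        (by rw [(hσg w hw.1).2]; exact ⟨w, hw.1, rfl⟩)).2 (by rw [(hσg w hw.1).2]; exact hw.2)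
      have h5 := hJ _ (hσ hz.1) _ (hσ hw.1) hz' hw'
      have h6 := hJpos z hz.1
      have h7 := hJpos w hw.1
      rw [← div_eq_mul_inv, inv_eq_one_div, div_le_div_iff₀ h6 h7]
      linarith)
  rw [key P B hP hB hPB hPV, key P' B' hP' hB' hPB' hPV', Γ.leb_apply x' hB, Γ.leb_apply x' hB']
  exact hle

end Leb

end DiskFamily
end Disk

/-! ### Itineraries, and the action of returns on stable and unstable disks. -/

section Dynamics

variable {d : ℕ} {M : Type*} [MetricSpace M] [ChartedSpace (EuclideanSpace ℝ (Fin d)) M]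
  [IsManifold (𝓡 d) ∞ M] {Ks Ku : Type*} [TopologicalSpace Ks] [TopologicalSpace Ku] {ι : Type*}

namespace ProductStructure

lemma mem_Lam (P : ProductStructure d M Ks Ku) {x : M} :
    x ∈ P.Lam ↔ ∃ j k, x ∈ P.stable.disk j ∧ x ∈ P.unstable.disk k := by
  simp [Lam, DiskFamily.union]

lemma inter_mem (P : ProductStructure d M Ks Ku) (j : Ks) (k : Ku) :
    P.inter j k ∈ P.stable.disk j ∧ P.inter j k ∈ P.unstable.disk k :=
  (P.meet j k).choose_spec.1

lemma inter_mem_Lam (P : ProductStructure d M Ks Ku) (j : Ks) (k : Ku) : P.inter j k ∈ P.Lam :=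
  P.mem_Lam.2 ⟨j, k, P.inter_mem j k⟩

lemma holonomy_eq (P : ProductStructure d M Ks Ku) {j : Ks} (k : Ku) {x : M}
    (h : x ∈ P.stable.disk j) : P.holonomy k x = P.inter j k := by
  have h' : ∃ j, x ∈ P.stable.disk j := ⟨j, h⟩
  rw [holonomy, dif_pos h', P.stable.eq_of_mem_disk h'.choose_spec h]

end ProductStructure

namespace Scheme

variable (S : Scheme d M Ks Ku ι) (f : M → M)

lemma cell_unique {x : M} {i i' : ι} (h : x ∈ S.cell i) (h' : x ∈ S.cell i') : i = i' := by
  by_contra hne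
  exact Set.disjoint_left.1 (S.cell_disjoint i i' hne) h h'

lemma R_eq {x : M} {i : ι} (h : x ∈ S.cell i) : S.R x = S.time i := by
  have h' : ∃ i, x ∈ S.cell i := ⟨i, h⟩
  rw [R, dif_pos h', S.cell_unique h'.choose_spec h]

lemma ret_eq {x : M} {i : ι} (h : x ∈ S.cell i) : S.ret f x = f^[S.time i] x := by
  rw [ret, S.R_eq h]

/-- Cells are s-subsets, so they contain, with a point, all points of Λ on its stable disk. -/
lemma mem_cell_iff_of_stable {x y : M} {j : Ks} (hx : x ∈ S.stable.disk j)
    (hy : y ∈ S.stable.disk j) (hyL : y ∈ S.Lam) {i : ι} (h : x ∈ S.cell i) : y ∈ S.cell i := by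
  obtain ⟨A, _, hA⟩ := S.cell_sSubset i
  rw [hA] at h ⊢
  refine ⟨?_, hyL.2⟩
  have h1 := h.1
  simp only [DiskFamily.union, mem_iUnion] at h1 ⊢
  obtain ⟨j', hj', hxj'⟩ := h1
  exact ⟨j', hj', by rwa [← S.stable.eq_of_mem_disk hx hxj']⟩

variable [Nonempty ι]

/-- The index of the cell of a point. -/
def cellIndex (x : M) : ι := Classical.epsilon fun i => x ∈ S.cell i

/-- The sequence of the indices of the cells visited by the iterates of the return map. -/
def itin (x : M) (n : ℕ) : ι := S.cellIndex ((S.ret f)^[n] x)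

variable {S f}

lemma mem_cell_cellIndex {x : M} (h : ∃ i, x ∈ S.cell i) : x ∈ S.cell (S.cellIndex x) :=
  Classical.epsilon_spec h

lemma cellIndex_eq {x : M} {i : ι} (h : x ∈ S.cell i) : S.cellIndex x = i :=
  S.cell_unique (mem_cell_cellIndex ⟨i, h⟩) h

lemma mem_cell_itin {x : M} (h : x ∈ S.core f) (n : ℕ) :
    (S.ret f)^[n] x ∈ S.cell (S.itin f x n) := mem_cell_cellIndex (h.2 n)

lemma itin_ret (x : M) (n : ℕ) : S.itin f (S.ret f x) n = S.itin f x (n + 1) := by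
  rw [itin, itin, Function.iterate_succ_apply]

lemma iterate_ret_mem_core {x : M} (h : x ∈ S.core f) (n : ℕ) : (S.ret f)^[n] x ∈ S.core f := by
  induction n with
  | zero => exact h
  | succ n ih => rw [Function.iterate_succ_apply']; exact S.ret_mem_core ih

lemma mem_core_iff_ret {x : M} {i : ι} (h : x ∈ S.cell i) :
    x ∈ S.core f ↔ S.ret f x ∈ S.core f := by
  refine ⟨S.ret_mem_core, fun h1 => ⟨S.cell_subset_Lam i h, fun n => ?_⟩⟩
  cases n with
  | zero => exact ⟨i, h⟩
  | succ n => rw [Function.iterate_succ_apply]; exact h1.2 n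

lemma exists_same_cell_iff {x y : M} (hx : x ∈ S.core f) (hy : y ∈ S.core f) (n : ℕ) :
    (∃ i, (S.ret f)^[n] x ∈ S.cell i ∧ (S.ret f)^[n] y ∈ S.cell i) ↔
      S.itin f x n = S.itin f y n := by
  constructor
  · rintro ⟨i, h1, h2⟩
    rw [itin, itin, cellIndex_eq h1, cellIndex_eq h2]
  · intro h
    refine ⟨S.itin f x n, mem_cell_itin hx n, ?_⟩
    rw [h]
    exact mem_cell_itin hy n

lemma sep_eq_top {x y : M} (hx : x ∈ S.core f) (hy : y ∈ S.core f)
    (h : ∀ n, S.itin f x n = S.itin f y n) : S.sep f x y = ⊤ := by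
  rw [sep, if_pos ⟨hx, hy⟩]
  simp only [iInf_eq_top]
  exact fun n hn => absurd ((exists_same_cell_iff hx hy n).2 (h n)) hn

lemma sep_eq {x y : M} (hx : x ∈ S.core f) (hy : y ∈ S.core f) {n : ℕ}
    (h : ∀ m < n, S.itin f x m = S.itin f y m) (hn : S.itin f x n ≠ S.itin f y n) :
    S.sep f x y = n := by
  rw [sep, if_pos ⟨hx, hy⟩]
  refine le_antisymm (iInf₂_le n fun h' => hn ((exists_same_cell_iff hx hy n).1 h')) ?_
  refine le_iInf₂ fun m hm => ?_
  by_contra hlt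
  exact hm ((exists_same_cell_iff hx hy m).2 (h m (by exact_mod_cast not_le.1 hlt)))

lemma epow_sep_le {x y : M} (hx : x ∈ S.core f) (hy : y ∈ S.core f) {β : ℝ} (hβ : 0 < β)
    (hβ1 : β < 1) {n : ℕ} (h : ∀ m < n, S.itin f x m = S.itin f y m) :
    epow β (S.sep f x y) ≤ β ^ n := by
  by_cases hall : ∀ m, S.itin f x m = S.itin f y m
  · rw [sep_eq_top hx hy hall, epow, if_pos rfl]
    positivity
  · push Not at hall
    classical
    have hN := Nat.find_spec hall
    have hlt : ∀ m < Nat.find hall, S.itin f x m = S.itin f y m := fun m hm => by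
      simpa using Nat.find_min hall hm
    rw [sep_eq hx hy hlt hN, epow, if_neg (ENat.natCast_ne_top _), ENat.toNat_natCast]
    refine pow_le_pow_of_le_one hβ.le hβ1.le ?_
    by_contra hc
    exact hN (h _ (not_le.1 hc))

variable [MeasurableSpace M] [RiemannianBundle (fun x : M => TangentSpace (𝓡 d) x)]
  {C β : ℝ}

end Scheme

namespace IsYoung

variable [MeasurableSpace M] [RiemannianBundle (fun x : M => TangentSpace (𝓡 d) x)]
  {S : Scheme d M Ks Ku ι} {f : M → M} {C β : ℝ} (hS : IsYoung S f C β)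
include hS

lemma ret_mem_Lam {x : M} {i : ι} (h : x ∈ S.cell i) : S.ret f x ∈ S.Lam := by
  obtain ⟨B, _, hB⟩ := hS.image_uSubset i
  have h1 : S.ret f x ∈ f^[S.time i] '' S.cell i := ⟨x, h, (S.ret_eq f h).symm⟩
  rw [hB] at h1
  refine ⟨h1.1, ?_⟩
  have h2 := h1.2
  simp only [DiskFamily.union, mem_iUnion] at h2 ⊢
  obtain ⟨k, _, hk⟩ := h2
  exact ⟨k, mem_univ _, hk⟩

lemma exists_stable_ret {x y : M} {i : ι} {j : Ks} (hx : x ∈ S.cell i) (hxj : x ∈ S.stable.disk j)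
    (hyj : y ∈ S.stable.disk j) (hy : y ∈ S.Lam) :
    ∃ j', S.ret f x ∈ S.stable.disk j' ∧ S.ret f y ∈ S.stable.disk j' := by
  obtain ⟨V, _, _, hV⟩ := hS.markov i
  obtain ⟨k, hk⟩ := S.exists_unstable (S.cell_subset_Lam i hx)
  obtain ⟨j', k', h1, _, h3, _⟩ := hV x hx j k hxj hk
  refine ⟨j', by rwa [S.ret_eq f hx], ?_⟩
  rw [S.ret_eq f (S.mem_cell_iff_of_stable hxj hyj hy hx)]
  exact h3 ⟨y, hyj, rfl⟩

/-- Stable disks go into stable disks and cells are saturated by stable disks, so the returns of y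
follow those of x. In particular y inherits membership in Λ' and the whole itinerary. -/
lemma iterate_stable {x y : M} {j : Ks} (hx : x ∈ S.core f) (hxj : x ∈ S.stable.disk j)
    (hyj : y ∈ S.stable.disk j) (hy : y ∈ S.Lam) (n : ℕ) :
    (S.ret f)^[n] y ∈ S.Lam ∧
      ∃ j', (S.ret f)^[n] x ∈ S.stable.disk j' ∧ (S.ret f)^[n] y ∈ S.stable.disk j' := by
  induction n with
  | zero => exact ⟨hy, j, hxj, hyj⟩
  | succ n ih =>
    obtain ⟨h1, j', h2, h3⟩ := ih
    obtain ⟨i, hi⟩ := hx.2 n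
    simp only [Function.iterate_succ_apply']
    exact ⟨hS.ret_mem_Lam (S.mem_cell_iff_of_stable h2 h3 h1 hi),
      hS.exists_stable_ret hi h2 h3 h1⟩

lemma core_of_stable {x y : M} {j : Ks} (hx : x ∈ S.core f) (hxj : x ∈ S.stable.disk j)
    (hyj : y ∈ S.stable.disk j) (hy : y ∈ S.Lam) : y ∈ S.core f := by
  refine ⟨hy, fun n => ?_⟩
  obtain ⟨h1, j', h2, h3⟩ := hS.iterate_stable hx hxj hyj hy n
  obtain ⟨i, hi⟩ := hx.2 n
  exact ⟨i, S.mem_cell_iff_of_stable h2 h3 h1 hi⟩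

variable [Nonempty ι]

lemma itin_of_stable {x y : M} {j : Ks} (hx : x ∈ S.core f) (hxj : x ∈ S.stable.disk j)
    (hyj : y ∈ S.stable.disk j) (hy : y ∈ S.Lam) : S.itin f y = S.itin f x := by
  funext n
  obtain ⟨h1, j', h2, h3⟩ := hS.iterate_stable hx hxj hyj hy n
  obtain ⟨i, hi⟩ := hx.2 n
  rw [Scheme.itin, Scheme.itin, Scheme.cellIndex_eq hi,
    Scheme.cellIndex_eq (S.mem_cell_iff_of_stable h2 h3 h1 hi)]

/-- Points that never separate have separation time `⊤`, for which the expansion bound at n = 0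
vanishes. -/
lemma eq_of_itin_eq {x y : M} {k : Ku} (hx : x ∈ S.core f) (hy : y ∈ S.core f)
    (hxk : x ∈ S.unstable.disk k) (hyk : y ∈ S.unstable.disk k) (h : S.itin f x = S.itin f y) :
    x = y := by
  have h1 := hS.expansion (S.itin f x 0) k x ⟨hxk, Scheme.mem_cell_itin hx 0⟩ y
    ⟨hyk, by rw [h]; exact Scheme.mem_cell_itin hy 0⟩ hx hy 0
  rw [Scheme.sep_eq_top hx hy (fun n => congrFun h n), epow, if_pos rfl] at h1
  simpa using h1

/-- The image of an unstable disk contains, for each point of `Λ'` of the disk, the whole of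
an unstable disk, and this does not depend on the point. -/
lemma exists_unstable_ret {i : ι} {k : Ku} {x₀ : M} (hx₀i : x₀ ∈ S.cell i)
    (hx₀k : x₀ ∈ S.unstable.disk k) {V : Set M} (hcV : S.cell i ⊆ V)
    (hinj : InjOn (f^[S.time i]) V)
    (hV : ∀ x ∈ S.cell i, ∀ j k, x ∈ S.stable.disk j → x ∈ S.unstable.disk k →
      ∃ j' k', f^[S.time i] x ∈ S.stable.disk j' ∧ f^[S.time i] x ∈ S.unstable.disk k' ∧
        f^[S.time i] '' S.stable.disk j ⊆ S.stable.disk j' ∧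
        S.unstable.disk k' ⊆ f^[S.time i] '' (S.unstable.disk k ∩ V)) :
    ∃ k', S.unstable.disk k' ⊆ f^[S.time i] '' (S.unstable.disk k ∩ V) ∧
      (∀ x ∈ S.core f, x ∈ S.cell i → x ∈ S.unstable.disk k → S.ret f x ∈ S.unstable.disk k') ∧
      ∀ p ∈ S.unstable.disk k, p ∈ V → f^[S.time i] p ∈ S.unstable.disk k' →
        f^[S.time i] p ∈ S.Lam → p ∈ S.cell i := by
  have key : ∀ x ∈ S.cell i, x ∈ S.unstable.disk k → ∃ k', S.ret f x ∈ S.unstable.disk k' ∧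
      S.unstable.disk k' ⊆ f^[S.time i] '' (S.unstable.disk k ∩ V) ∧
      ∀ p ∈ S.unstable.disk k, p ∈ V → f^[S.time i] p ∈ S.unstable.disk k' →
        f^[S.time i] p ∈ S.Lam → p ∈ S.cell i := by
    intro x hx hxk
    obtain ⟨j, _, hj, _⟩ := S.mem_Lam.1 (S.cell_subset_Lam i hx)
    obtain ⟨j', k', h1, h2, h3, h4⟩ := hV x hx j k hj hxk
    refine ⟨k', by rwa [S.ret_eq f hx], h4, fun p _ hpV hpk' hpL => ?_⟩
    obtain ⟨B, _, hB⟩ := hS.image_uSubset i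
    have h5 : f^[S.time i] x ∈ f^[S.time i] '' S.cell i := ⟨x, hx, rfl⟩
    rw [hB] at h5
    have h6 := h5.2
    simp only [DiskFamily.union, mem_iUnion] at h6
    obtain ⟨k'', hk''B, hk''⟩ := h6
    have h7 : k'' = k' := S.unstable.eq_of_mem_disk hk'' h2
    subst h7
    -- The image of the cell is a u-subset, so it contains every point of Λ on the unstable disk of
    -- one of its points. Injectivity on V then forces p itself to be in the cell.
    have h8 : f^[S.time i] p ∈ f^[S.time i] '' S.cell i := by
      rw [hB]
      refine ⟨hpL.1, ?_⟩
      simp only [DiskFamily.union, mem_iUnion]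
      exact ⟨k'', hk''B, hpk'⟩
    obtain ⟨q, hq, hqp⟩ := h8
    rwa [← hinj (hcV hq) hpV hqp]
  obtain ⟨k', h1, h2, h3⟩ := key x₀ hx₀i hx₀k
  refine ⟨k', h2, fun x hx hxi hxk => ?_, h3⟩
  obtain ⟨k₁, h1x, h2x, h3x⟩ := key x hxi hxk
  have hrx := S.ret_mem_core hx
  obtain ⟨j, _, hj, _⟩ := S.mem_Lam.1 hrx.1
  -- the point of the disk `k'` on the stable disk of the image of `x`
  obtain ⟨hpj, hpk⟩ := S.inter_mem j k'
  have hpL := S.inter_mem_Lam j k'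
  set p := S.inter j k' with hp
  have hpc := hS.core_of_stable hrx hj hpj hpL
  have hpi := hS.itin_of_stable hrx hj hpj hpL
  -- The preimage q of p on the disk k starts in the same cell as x and continues with the itinerary
  -- of the return of x. Having the itinerary and the unstable disk of x, it is x, so the return of
  -- x is p and lies on `k'`.
  obtain ⟨q, ⟨hqk, hqV⟩, hqp⟩ := h2 hpk
  have hqi : q ∈ S.cell i := h3 q hqk hqV (by rwa [hqp]) (by rwa [hqp])
  have hqr : S.ret f q = p := by rw [S.ret_eq f hqi, hqp]
  have hqc : q ∈ S.core f := (Scheme.mem_core_iff_ret hqi).2 (by rwa [hqr])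
  have hqx : q = x := by
    refine hS.eq_of_itin_eq hqc hx hqk hxk ?_
    funext n
    cases n with
    | zero => rw [Scheme.itin, Scheme.itin]; exact (Scheme.cellIndex_eq hqi).trans (Scheme.cellIndex_eq hxi).symm
    | succ n => rw [← Scheme.itin_ret, ← Scheme.itin_ret, hqr, hpi]
  rw [← hqx, hqr]
  exact hpk

lemma exists_unstable_ret_pair {i : ι} {k : Ku} {x y : M} (hx : x ∈ S.core f)
    (hxi : x ∈ S.cell i) (hxk : x ∈ S.unstable.disk k) (hy : y ∈ S.core f)
    (hyi : y ∈ S.cell i) (hyk : y ∈ S.unstable.disk k) :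
    ∃ k', S.ret f x ∈ S.unstable.disk k' ∧ S.ret f y ∈ S.unstable.disk k' := by
  obtain ⟨V, hcV, hC1, hV⟩ := hS.markov i
  obtain ⟨k', _, h, _⟩ := hS.exists_unstable_ret hxi hxk hcV hC1.2.1 hV
  exact ⟨k', h x hx hxi hxk, h y hy hyi hyk⟩

lemma iterate_unstable {k : Ku} {x y : M} (hx : x ∈ S.core f) (hxk : x ∈ S.unstable.disk k)
    (hy : y ∈ S.core f) (hyk : y ∈ S.unstable.disk k) {n : ℕ}
    (h : ∀ m < n, S.itin f x m = S.itin f y m) :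
    ∃ k', (S.ret f)^[n] x ∈ S.unstable.disk k' ∧ (S.ret f)^[n] y ∈ S.unstable.disk k' := by
  induction n with
  | zero => exact ⟨k, hxk, hyk⟩
  | succ n ih =>
    obtain ⟨k', h1, h2⟩ := ih fun m hm => h m (by omega)
    simp only [Function.iterate_succ_apply']
    refine hS.exists_unstable_ret_pair (Scheme.iterate_ret_mem_core hx n)
      (Scheme.mem_cell_itin hx n) h1 (Scheme.iterate_ret_mem_core hy n) ?_ h2
    rw [h n (by omega)]
    exact Scheme.mem_cell_itin hy n

/-- Points whose returns follow the same itinerary for `n` returns in the past and `m + 1` in the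
future are close, also between returns. -/
lemma dist_le {x y : M} (hx : x ∈ S.core f) (hy : y ∈ S.core f) {n m : ℕ}
    (h : ∀ l < n + (m + 1), S.itin f x l = S.itin f y l) {l : ℕ}
    (hl : l < S.time (S.itin f x n)) :
    dist (f^[l] ((S.ret f)^[n] x)) (f^[l] ((S.ret f)^[n] y)) ≤
      (C + C ^ 2) * β ^ n + (C + C ^ 2) * β ^ m := by
  obtain ⟨j, _, hxj, _⟩ := S.mem_Lam.1 hx.1
  obtain ⟨k, hyk⟩ := S.exists_unstable hy.1
  -- The intersection z of the stable disk of x with the unstable disk of y has the full itinerary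
  -- of x; contraction compares x with z, expansion compares z with y.
  obtain ⟨hzj, hzk⟩ := S.inter_mem j k
  have hzL := S.inter_mem_Lam j k
  set z := S.inter j k
  have hz := hS.core_of_stable hx hxj hzj hzL
  have hzi := hS.itin_of_stable hx hxj hzj hzL
  have hβ := hS.β_pos
  have hC := hS.C_pos
  set i := S.itin f x n with hi
  have hxi := Scheme.mem_cell_itin hx n
  have hzin : (S.ret f)^[n] z ∈ S.cell i := by rw [hi, ← hzi]; exact Scheme.mem_cell_itin hz n
  have hyin : (S.ret f)^[n] y ∈ S.cell i := by
    rw [hi, h n (by omega)]; exact Scheme.mem_cell_itin hy n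
  -- the stable part
  have hs : dist (f^[l] ((S.ret f)^[n] x)) (f^[l] ((S.ret f)^[n] z)) ≤ (C + C ^ 2) * β ^ n := by
    have h1 := hS.contraction (S.itin f x 0) j x ⟨hxj, Scheme.mem_cell_itin hx 0⟩ z
      ⟨hzj, by rw [← hzi]; exact Scheme.mem_cell_itin hz 0⟩ hx hz n
    rcases Nat.eq_zero_or_pos l with rfl | hl0
    · simp only [Function.iterate_zero, id_eq]
      nlinarith [pow_pos hβ n, mul_pos (pow_pos hC 2) (pow_pos hβ n)]
    · obtain ⟨_, j', h2, h3⟩ := hS.iterate_stable hx hxj hzj hzL n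
      have h4 := hS.contraction' i j' _ ⟨h2, hxi⟩ _ ⟨h3, hzin⟩ l hl0 hl.le
      have h5 := mul_le_mul_of_nonneg_left h1 hC.le
      nlinarith [pow_pos hβ n, mul_pos hC (pow_pos hβ n)]
  -- the unstable part
  have hzy : ∀ l < n + (m + 1), S.itin f z l = S.itin f y l := fun l hl => by rw [hzi, h l hl]
  have hu : dist (f^[l] ((S.ret f)^[n] z)) (f^[l] ((S.ret f)^[n] y)) ≤ (C + C ^ 2) * β ^ m := by
    have h0 : z ∈ S.cell (S.itin f z 0) := Scheme.mem_cell_itin hz 0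
    have h0' : y ∈ S.cell (S.itin f z 0) := by
      rw [hzy 0 (by omega)]; exact Scheme.mem_cell_itin hy 0
    have hsep := Scheme.epow_sep_le hz hy hβ hS.β_lt_one hzy
    have h1 : ∀ r ≤ n + 1, dist ((S.ret f)^[r] z) ((S.ret f)^[r] y) ≤ C * β ^ (n + m + 1 - r) := by
      intro r hr
      refine (hS.expansion _ k z ⟨hzk, h0⟩ y ⟨hyk, h0'⟩ hz hy r).trans ?_
      gcongr
      rw [div_le_iff₀ (pow_pos hβ r), ← pow_add]
      refine hsep.trans (le_of_eq ?_)
      congr 1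
      omega
    rcases Nat.eq_zero_or_pos l with rfl | hl0
    · simp only [Function.iterate_zero, id_eq]
      refine (h1 n (by omega)).trans ?_
      have h2 : β ^ (n + m + 1 - n) ≤ β ^ m :=
        pow_le_pow_of_le_one hβ.le hS.β_lt_one.le (by omega)
      have h3 := mul_le_mul_of_nonneg_left h2 hC.le
      nlinarith [mul_pos (pow_pos hC 2) (pow_pos hβ m)]
    · obtain ⟨k', h2, h3⟩ := hS.iterate_unstable hz hzk hy hyk (n := n)
        fun l hl => hzy l (by omega)
      -- Between two returns the distance is controlled by that at the next return, number n + 1.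
      -- This is why m + 1 common symbols are required for a bound of order β^m.
      have h4 := hS.expansion' i k' _ ⟨h2, hzin⟩ _ ⟨h3, hyin⟩ l hl0 hl.le
      rw [← S.ret_eq f hzin, ← S.ret_eq f hyin, ← Function.iterate_succ_apply' (S.ret f),
        ← Function.iterate_succ_apply' (S.ret f)] at h4
      have h5 := h1 (n + 1) le_rfl
      rw [show n + m + 1 - (n + 1) = m by omega] at h5
      have h6 := mul_le_mul_of_nonneg_left h5 hC.le
      nlinarith [mul_pos hC (pow_pos hβ m)]
  exact (dist_triangle _ _ _).trans (add_le_add hs hu)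

end IsYoung

end Dynamics

/-! ### Gibbs measures on sequence spaces -/

section Gibbs

variable {ι : Type*}

/-- The shift on sequences. -/
def shift (x : ℕ → ι) : ℕ → ι := fun n => x (n + 1)

/-- The sequences that start with the word `w` and continue with an element of `E`. -/
def prepend : List ι → Set (ℕ → ι) → Set (ℕ → ι)
  | [], E => E
  | i :: w, E => {x | x 0 = i ∧ shift x ∈ prepend w E}

/-- The initial word of length `n`. -/
def initial : ℕ → (ℕ → ι) → List ι
  | 0, _ => []
  | n + 1, x => x 0 :: initial n (shift x)

lemma length_initial (n : ℕ) (x : ℕ → ι) : (initial n x).length = n := by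
  induction n generalizing x with
  | zero => rfl
  | succ n ih => simp [initial, ih]

lemma shift_iterate_apply (n m : ℕ) (x : ℕ → ι) : shift^[n] x m = x (m + n) := by
  induction n generalizing x with
  | zero => rfl
  | succ n ih => rw [Function.iterate_succ_apply, ih, shift, Nat.add_assoc]

lemma mem_prepend {w : List ι} {E : Set (ℕ → ι)} {x : ℕ → ι} :
    x ∈ prepend w E ↔ initial w.length x = w ∧ shift^[w.length] x ∈ E := by
  induction w generalizing x with
  | nil => simp [prepend, initial]
  | cons i w ih => simp [prepend, initial, ih, and_assoc]

lemma initial_eq_initial {n : ℕ} {x x' : ℕ → ι} :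
    initial n x = initial n x' ↔ ∀ m < n, x m = x' m := by
  induction n generalizing x x' with
  | zero => simp [initial]
  | succ n ih =>
    simp only [initial, List.cons.injEq, ih, shift]
    constructor
    · rintro ⟨h1, h2⟩ m hm
      cases m with
      | zero => exact h1
      | succ m => exact h2 m (by omega)
    · exact fun h => ⟨h 0 (by omega), fun m hm => h (m + 1) (by omega)⟩

lemma prepend_append (w u : List ι) (E : Set (ℕ → ι)) :
    prepend (w ++ u) E = prepend w (prepend u E) := by
  induction w with
  | nil => rfl
  | cons i w ih => simp [prepend, ih]

lemma prepend_cylinder {w : List ι} {s : ℕ} {E E' : Set (ℕ → ι)}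
    (h : ∀ x ∈ E, ∀ x' ∈ E', ∀ m < s, x m = x' m) :
    ∀ x ∈ prepend w E, ∀ x' ∈ prepend w E', ∀ m < s + w.length, x m = x' m := by
  intro x hx x' hx' m hm
  rw [mem_prepend] at hx hx'
  by_cases hmw : m < w.length
  · exact initial_eq_initial.1 (hx.1.trans hx'.1.symm) m hmw
  · have := h _ hx.2 _ hx'.2 (m - w.length) (by omega)
    rwa [shift_iterate_apply, shift_iterate_apply, Nat.sub_add_cancel (by omega)] at this

variable [MeasurableSpace ι]

lemma measurable_shift : Measurable (shift : (ℕ → ι) → ℕ → ι) :=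
  measurable_pi_lambda _ fun n => measurable_pi_apply (n + 1)

lemma measurableSet_prepend [MeasurableSingletonClass ι] (w : List ι) {E : Set (ℕ → ι)}
    (hE : MeasurableSet E) : MeasurableSet (prepend w E) := by
  induction w with
  | nil => exact hE
  | cons i w ih =>
    exact (measurable_pi_apply 0 (measurableSet_singleton i)).inter (measurable_shift ih)

/-- Bounded distortion of a measure on a sequence space, for the words `w` satisfying `p`: the
relative measures of `w E` and `E` are comparable for all subsets `E` of the same cylinder of
length `s`, up to a factor `exp (C β ^ s)`. -/
def IsGibbsOn (p : List ι → Prop) (μ : Measure (ℕ → ι)) (C β : ℝ) : Prop :=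
  ∀ w, p w → ∀ (s : ℕ) (E E' : Set (ℕ → ι)), MeasurableSet E → MeasurableSet E' →
    (∀ x ∈ E, ∀ x' ∈ E', ∀ m < s, x m = x' m) →
    μ (prepend w E) * μ E' ≤ ENNReal.ofReal (Real.exp (C * β ^ s)) * μ (prepend w E') * μ E

/-- Bounded distortion of a measure on a sequence space. -/
abbrev IsGibbs (μ : Measure (ℕ → ι)) (C β : ℝ) : Prop := IsGibbsOn (fun _ => True) μ C β

/-- Compare E with the whole space, at s = 0. -/
lemma IsGibbsOn.null {p : List ι → Prop} {μ : Measure (ℕ → ι)} {C β : ℝ} (h : IsGibbsOn p μ C β)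
    {w : List ι} (hw : p w) {E : Set (ℕ → ι)} (hE : MeasurableSet E) (h0 : μ E = 0) :
    μ (prepend w E) = 0 := by
  by_cases hu : μ univ = 0
  · exact measure_mono_null (subset_univ _) hu
  · have := h w hw 0 E univ hE MeasurableSet.univ (by simp)
    rw [h0, mul_zero] at this
    exact (mul_eq_zero.1 (le_antisymm this zero_le)).resolve_right hu

/-- Two cross-multiplied comparisons compose because the intermediate quantities y and z are
positive and finite and can be cancelled. -/
lemma ENNReal_mul_le_mul_of_chain {a b c x x' y y' : ℝ≥0∞} (hy : y ≠ 0) (hy' : y ≠ ⊤)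
    {z z' : ℝ≥0∞} (hz : z ≠ 0) (hz' : z ≠ ⊤)
    (h1 : a * z ≤ c * b * y) (h2 : y * x ≤ y' * z * x') (h : c * y' ≤ z') :
    a * x ≤ z' * b * x' := by
  have h3 : (a * x) * (y * z) ≤ (z' * b * x') * (y * z) := by
    calc (a * x) * (y * z) = (a * z) * (y * x) := by ring
      _ ≤ (c * b * y) * (y' * z * x') := by gcongr
      _ = (c * y') * b * x' * (y * z) := by ring
      _ ≤ _ := by gcongr
  exact (ENNReal.mul_le_mul_iff_left (mul_ne_zero hy hz) (ENNReal.mul_ne_top hy' hz')).1 h3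

/-- The word is built letter by letter. When a letter is added in front of w, the sets already agree
on s + |w| symbols, so the distortion exponents are bounded by the geometric series C β^s (1 + β +
β² + ⋯). -/
lemma IsGibbsOn.isGibbs [MeasurableSingletonClass ι] {μ : Measure (ℕ → ι)} [IsFiniteMeasure μ]
    {C β : ℝ} (hC : 0 ≤ C) (hβ : 0 < β) (hβ1 : β < 1)
    (h : IsGibbsOn (fun w => w.length = 1) μ C β) : IsGibbs μ (C / (1 - β)) β := by
  have h1β : 0 < 1 - β := by linarith
  have key : ∀ w : List ι, ∀ (s : ℕ) (E E' : Set (ℕ → ι)), MeasurableSet E → MeasurableSet E' →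
      (∀ x ∈ E, ∀ x' ∈ E', ∀ m < s, x m = x' m) → μ (prepend w E) * μ E' ≤
        ENNReal.ofReal (Real.exp (C * (β ^ s * ∑ j ∈ Finset.range w.length, β ^ j))) *
          μ (prepend w E') * μ E := by
    intro w s E E' hE hE' hEE'
    have hnull : ∀ w : List ι, ∀ F, MeasurableSet F → μ F = 0 → μ (prepend w F) = 0 := by
      intro w F hF h0
      induction w with
      | nil => exact h0
      | cons i w ih =>
        exact IsGibbsOn.null h (w := [i]) rfl (measurableSet_prepend w hF) ih
    induction w with
    | nil => simp [prepend, mul_comm]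
    | cons i w ih =>
      have h1 := h [i] rfl (s + w.length) (prepend w E) (prepend w E')
        (measurableSet_prepend w hE) (measurableSet_prepend w hE') (prepend_cylinder hEE')
      change μ (prepend (i :: w) E) * _ ≤ _ * μ (prepend (i :: w) E') * _ at h1
      by_cases hz : μ (prepend w E) = 0
      · have : μ (prepend (i :: w) E) = 0 :=
          IsGibbsOn.null h (w := [i]) rfl (measurableSet_prepend w hE) hz
        simp [this]
      by_cases hz' : μ (prepend w E') = 0
      · rw [hz', mul_zero, zero_mul] at ih
        have := (mul_eq_zero.1 (le_antisymm ih zero_le)).resolve_left hz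
        simp [this]
      refine ENNReal_mul_le_mul_of_chain hz (measure_ne_top _ _) hz' (measure_ne_top _ _) h1 ih ?_
      rw [← ENNReal.ofReal_mul (Real.exp_nonneg _), ← Real.exp_add, List.length_cons,
        Finset.sum_range_succ]
      refine ENNReal.ofReal_le_ofReal (Real.exp_le_exp.2 (le_of_eq ?_))
      rw [pow_add]; ring
  intro w _ s E E' hE hE' hEE'
  refine (key w s E E' hE hE' hEE').trans ?_
  have h2 : ∑ j ∈ Finset.range w.length, β ^ j ≤ 1 / (1 - β) := by
    rw [le_div_iff₀ h1β, geom_sum_mul_neg]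
    linarith [pow_pos hβ w.length]
  have h3 : C * (β ^ s * ∑ j ∈ Finset.range w.length, β ^ j) ≤ C / (1 - β) * β ^ s := by
    calc C * (β ^ s * ∑ j ∈ Finset.range w.length, β ^ j) ≤ C * (β ^ s * (1 / (1 - β))) := by
          gcongr
      _ = C / (1 - β) * β ^ s := by ring
  gcongr

lemma take_initial {n m : ℕ} (h : n ≤ m) (x : ℕ → ι) :
    (initial m x).take n = initial n x := by
  induction n generalizing m x with
  | zero => rfl
  | succ n ih =>
    obtain ⟨m, rfl⟩ : ∃ k, m = k + 1 := ⟨m - 1, by omega⟩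
    simp [initial, ih (Nat.le_of_succ_le_succ h)]

lemma measurableSet_initial_eq [MeasurableSingletonClass ι] (n : ℕ) (w : List ι) :
    MeasurableSet {x : ℕ → ι | initial n x = w} := by
  by_cases hw : w.length = n
  · subst hw
    have : {x : ℕ → ι | initial w.length x = w} = prepend w univ := by
      ext x; simp [mem_prepend]
    rw [this]
    exact measurableSet_prepend w MeasurableSet.univ
  · convert MeasurableSet.empty using 1
    ext x
    simp only [mem_ofPred_eq, mem_empty_iff_false, iff_false]
    rintro rfl
    exact hw (length_initial n x)

/-- A shift invariant measure which is absolutely continuous with respect to a Gibbs measure is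
a Gibbs measure. -/
lemma IsGibbsOn.of_absolutelyContinuous [Countable ι] [MeasurableSingletonClass ι] [Nonempty ι]
    {μ ν : Measure (ℕ → ι)} [IsFiniteMeasure μ] [IsFiniteMeasure ν] {C β : ℝ}
    (h : IsGibbs μ C β) (hν : ν ≪ μ) (hs : MeasurePreserving shift ν ν) :
    IsGibbs ν (2 * C) β := by
  -- the conditional expectations of the density
  let F : Filtration ℕ (inferInstance : MeasurableSpace (ℕ → ι)) :=
    { seq := fun n => MeasurableSpace.comap (initial n) ⊤
      mono' := by
        intro n m hnm
        have : initial (ι := ι) n = List.take n ∘ initial m :=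
          funext fun x => (take_initial hnm x).symm
        simp only [this, ← MeasurableSpace.comap_comp]
        exact MeasurableSpace.comap_mono le_top
      le' := by
        intro n
        rintro _ ⟨t, _, rfl⟩
        have : initial n ⁻¹' t = ⋃ w ∈ t, {x : ℕ → ι | initial n x = w} := by
          ext x; simp
        rw [this]
        exact MeasurableSet.biUnion (to_countable t) fun w _ => measurableSet_initial_eq n w }
  let f : (ℕ → ι) → ℝ := fun x => (ν.rnDeriv μ x).toReal
  have hf : Integrable f μ := Measure.integrable_toReal_rnDeriv
  have hF : StronglyMeasurable[⨆ n, F n] f := by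
    have hle : (inferInstance : MeasurableSpace (ℕ → ι)) ≤ ⨆ n, (F n : MeasurableSpace (ℕ → ι)) := by
      refine iSup_le fun n => le_trans ?_ (le_iSup (fun n => (F n : MeasurableSpace (ℕ → ι))) (n + 1))
      rintro _ ⟨t, _, rfl⟩
      refine ⟨{l | ∃ x : ℕ → ι, initial (n + 1) x = l ∧ x n ∈ t}, trivial, ?_⟩
      ext x
      constructor
      · rintro ⟨y, hy, hyt⟩
        have := initial_eq_initial.1 hy n (by omega)
        rwa [mem_preimage, ← this]
      · exact fun hx => ⟨x, rfl, hx⟩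
    exact ((Measure.measurable_rnDeriv ν μ).ennreal_toReal.mono hle le_rfl).stronglyMeasurable
  have hlim := hf.tendsto_eLpNorm_condExp hF
  have hfac : ∀ n, ∃ g : List ι → ℝ, μ[f | F n] = g ∘ initial n := by
    intro n
    have h1 : StronglyMeasurable[F n] (μ[f | F n]) := stronglyMeasurable_condExp
    let _ : MeasurableSpace (List ι) := ⊤
    obtain ⟨g, _, hg⟩ := StronglyMeasurable.exists_eq_measurable_comp h1
    exact ⟨g, hg⟩
  choose g hg using hfac
  -- the measures of sets, approximated by means of the conditional expectations
  let A : ℕ → Set (ℕ → ι) → ℝ≥0∞ := fun n E =>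
    ∑' w : {w : List ι // w.length = n}, ENNReal.ofReal (g n w) * μ (prepend w E)
  -- The sum A n E is the integral, over the preimage of E under the n-th iterate of the shift, of
  -- the density averaged on cylinders of length n; it tends to ν E by L¹ convergence of
  -- martingales.
  have hA : ∀ E, MeasurableSet E → Filter.Tendsto (fun n => A n E) Filter.atTop (nhds (ν E)) := by
    intro E hE
    let e : ℕ → ℝ≥0∞ := fun n => eLpNorm (μ[f | F n] - f) 1 μ
    have hS : ∀ n, MeasurableSet (shift^[n] ⁻¹' E) := fun n => (measurable_shift.iterate n) hE
    have hAn : ∀ n, A n E = ∫⁻ x in shift^[n] ⁻¹' E, ENNReal.ofReal ((μ[f | F n]) x) ∂μ := by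
      intro n
      have h1 : shift^[n] ⁻¹' E = ⋃ w : {w : List ι // w.length = n}, prepend w E := by
        ext x
        simp only [mem_preimage, mem_iUnion, mem_prepend]
        constructor
        · exact fun hx => ⟨⟨initial n x, length_initial n x⟩, by simp [length_initial, hx]⟩
        · rintro ⟨⟨w, rfl⟩, _, hx⟩
          exact hx
      rw [h1, lintegral_iUnion (fun w => measurableSet_prepend _ hE)]
      · refine tsum_congr fun w => ?_
        rw [← setLIntegral_const]
        refine setLIntegral_congr_fun (measurableSet_prepend _ hE) fun x hx => ?_
        have := (mem_prepend.1 hx).1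
        rw [w.2] at this
        simp only [hg n, Function.comp_apply, this]
      · intro w w' hww'
        refine Set.disjoint_left.2 fun x hx hx' => hww' (Subtype.ext ?_)
        rw [← (mem_prepend.1 hx).1, ← (mem_prepend.1 hx').1, w.2, w'.2]
    -- Invariance of ν lets one fixed number be computed on all these preimages.
    have hνn : ∀ n, ν E = ∫⁻ x in shift^[n] ⁻¹' E, ENNReal.ofReal (f x) ∂μ := by
      intro n
      rw [← (hs.iterate n).measure_preimage hE.nullMeasurableSet,
        ← Measure.setLIntegral_rnDeriv hν]
      refine lintegral_congr_ae (ae_restrict_of_ae ?_)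
      filter_upwards [Measure.rnDeriv_lt_top ν μ] with x hx
      exact (ENNReal.ofReal_toReal hx.ne).symm
    have hbound : ∀ (a b : (ℕ → ι) → ℝ) (S : Set (ℕ → ι)), AEStronglyMeasurable (a - b) μ →
        ∫⁻ x in S, ENNReal.ofReal (a x) ∂μ ≤
          ∫⁻ x in S, ENNReal.ofReal (b x) ∂μ + eLpNorm (a - b) 1 μ := by
      intro a b S hab
      rw [eLpNorm_one_eq_lintegral_enorm]
      refine le_trans ?_ (add_le_add_right (setLIntegral_le_lintegral S _) _)
      rw [← lintegral_add_right' _ hab.enorm.restrict]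
      refine lintegral_mono fun x => ?_
      rw [Pi.sub_apply, Real.enorm_eq_ofReal_abs]
      refine le_trans (ENNReal.ofReal_le_ofReal ?_) ENNReal.ofReal_add_le
      linarith [le_abs_self (a x - b x)]
    have hm1 : ∀ n, AEStronglyMeasurable (μ[f | F n]) μ := fun n =>
      integrable_condExp.aestronglyMeasurable
    refine tendsto_of_tendsto_of_tendsto_of_le_of_le (g := fun n => ν E - e n)
      (h := fun n => ν E + e n) ?_ ?_ (fun n => ?_) (fun n => ?_)
    · simpa using ENNReal.Tendsto.sub (tendsto_const_nhds (x := ν E)) hlim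
        (Or.inl (measure_ne_top _ _))
    · simpa using (tendsto_const_nhds (x := ν E)).add hlim
    · simp only [tsub_le_iff_right]
      rw [hAn n, hνn n]
      have := hbound f (μ[f | F n]) (shift^[n] ⁻¹' E) (hf.aestronglyMeasurable.sub (hm1 n))
      rwa [← eLpNorm_sub_comm] at this
    · simp only
      rw [hAn n, hνn n]
      exact hbound _ f _ ((hm1 n).sub hf.aestronglyMeasurable)
  intro w _ s E E' hE hE' hEE'
  have hpE := measurableSet_prepend w hE
  have hpE' := measurableSet_prepend w hE'
  have hle : ∀ n, A n (prepend w E) * A n E' ≤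
      ENNReal.ofReal (Real.exp (2 * C * β ^ s)) * A n (prepend w E') * A n E := by
    intro n
    simp only [A]
    rw [mul_assoc, ← ENNReal.tsum_mul_right, ← ENNReal.tsum_mul_right, ← ENNReal.tsum_mul_left]
    refine ENNReal.tsum_le_tsum fun u => ?_
    rw [← ENNReal.tsum_mul_left, ← ENNReal.tsum_mul_left, ← ENNReal.tsum_mul_left]
    refine ENNReal.tsum_le_tsum fun u' => ?_
    -- The distortion of μ is used twice, for the word u w and, with E and E' exchanged, for u':
    -- hence the constant 2 C.
    have key : μ (prepend u (prepend w E)) * μ (prepend u' E') ≤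
        ENNReal.ofReal (Real.exp (2 * C * β ^ s)) * μ (prepend u (prepend w E')) *
          μ (prepend u' E) := by
      rw [← prepend_append, ← prepend_append]
      by_cases h0 : μ E = 0
      · rw [h.null trivial hE h0]; simp
      by_cases h0' : μ E' = 0
      · rw [h.null (w := u') trivial hE' h0']; simp
      have h1 := h (u ++ w) trivial s E E' hE hE' hEE'
      have h2 := h u' trivial s E' E hE' hE fun x hx y hy m hm => (hEE' y hy x hx m hm).symm
      have h3 : ENNReal.ofReal (Real.exp (2 * C * β ^ s)) =
          ENNReal.ofReal (Real.exp (C * β ^ s)) * ENNReal.ofReal (Real.exp (C * β ^ s)) := by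
        rw [← ENNReal.ofReal_mul (Real.exp_nonneg _), ← Real.exp_add]
        congr 2; ring
      rw [h3]
      refine (ENNReal.mul_le_mul_iff_left (c := μ E * μ E') (mul_ne_zero h0 h0')
        (ENNReal.mul_ne_top (measure_ne_top _ _) (measure_ne_top _ _))).1 ?_
      calc _ = (μ (prepend (u ++ w) E) * μ E') * (μ (prepend u' E') * μ E) := by ring
        _ ≤ _ := by
          refine (mul_le_mul' h1 h2).trans (le_of_eq ?_)
          ring
    calc _ = ENNReal.ofReal (g n u) * ENNReal.ofReal (g n u') *
          (μ (prepend u (prepend w E)) * μ (prepend u' E')) := by ring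
      _ ≤ ENNReal.ofReal (g n u) * ENNReal.ofReal (g n u') *
          (ENNReal.ofReal (Real.exp (2 * C * β ^ s)) * μ (prepend u (prepend w E')) *
          μ (prepend u' E)) := mul_le_mul' le_rfl key
      _ = _ := by ring
  refine le_of_tendsto_of_tendsto' (ENNReal.Tendsto.mul (hA _ hpE) (Or.inr (measure_ne_top _ _))
    (hA _ hE') (Or.inr (measure_ne_top _ _))) (ENNReal.Tendsto.mul
      (ENNReal.Tendsto.const_mul (hA _ hpE') (Or.inr ENNReal.ofReal_ne_top))
      (Or.inr (measure_ne_top _ _)) (hA _ hE)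
      (Or.inr (ENNReal.mul_ne_top ENNReal.ofReal_ne_top (measure_ne_top _ _)))) hle

end Gibbs

/-! ### Distribution of itineraries on unstable disks. -/

section SymbolicMeasure

variable {d : ℕ} {M : Type*} [MetricSpace M] [ChartedSpace (EuclideanSpace ℝ (Fin d)) M]
  [IsManifold (𝓡 d) ∞ M] {Ks Ku : Type*} [TopologicalSpace Ks] [TopologicalSpace Ku]
  [CompactSpace Ks] [CompactSpace Ku] {ι : Type*}
  [MeasurableSpace M] [BorelSpace M]

namespace Scheme

variable (S : Scheme d M Ks Ku ι) {f : M → M}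

lemma measurableSet_Lam : MeasurableSet S.Lam :=
  ((S.stable.isCompact_union isClosed_univ).measurableSet).inter
    (S.unstable.isCompact_union isClosed_univ).measurableSet

lemma measurableSet_cell (i : ι) : MeasurableSet (S.cell i) := by
  obtain ⟨A, hA, h⟩ := S.cell_sSubset i
  rw [h]
  exact ((S.stable.isCompact_union hA).measurableSet).inter
    (S.unstable.isCompact_union isClosed_univ).measurableSet

variable [Countable ι]

lemma measurable_of_eqOn_cell {α : Type*} [MeasurableSpace α] [MeasurableSingletonClass α]
    [Countable α] {g : M → α} (c : ι → α) (c₀ : α) (h : ∀ i, ∀ x ∈ S.cell i, g x = c i)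
    (h₀ : ∀ x, (¬ ∃ i, x ∈ S.cell i) → g x = c₀) : Measurable g := by
  refine measurable_to_countable' fun a => ?_
  have h1 : g ⁻¹' {a} = (⋃ i ∈ {i | c i = a}, S.cell i) ∪
      ((⋃ i, S.cell i)ᶜ ∩ {_x | c₀ = a}) := by
    ext x
    by_cases hx : ∃ i, x ∈ S.cell i
    · obtain ⟨i, hi⟩ := hx
      simp only [mem_preimage, mem_singleton_iff, h i x hi, mem_union, mem_iUnion, mem_inter_iff,
        mem_compl_iff]
      constructor
      · exact fun hc => Or.inl ⟨i, hc, hi⟩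
      · rintro (⟨i', hc, hi'⟩ | ⟨hn, _⟩)
        · rwa [S.cell_unique hi hi']
        · exact absurd ⟨i, hi⟩ hn
    · simp only [mem_preimage, mem_singleton_iff, h₀ x hx, mem_union, mem_iUnion, mem_inter_iff,
        mem_compl_iff]
      push Not at hx
      simp [hx]
  rw [h1]
  exact (MeasurableSet.biUnion (to_countable _) fun i _ => S.measurableSet_cell i).union
    ((MeasurableSet.iUnion S.measurableSet_cell).compl.inter (MeasurableSet.const _))

lemma measurable_R : Measurable S.R :=
  S.measurable_of_eqOn_cell S.time 0 (fun _ _ hx => S.R_eq hx) fun x hx => by rw [R, dif_neg hx]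

lemma measurable_ret (hf : Measurable f) : Measurable (S.ret f) := by
  have h1 : Measurable fun p : ℕ × M => f^[p.1] p.2 :=
    measurable_from_prod_countable_right fun n => hf.iterate n
  exact h1.comp (S.measurable_R.prodMk measurable_id)

lemma measurableSet_core (hf : Measurable f) : MeasurableSet (S.core f) := by
  have h : S.core f = S.Lam ∩ ⋂ n : ℕ, ⋃ i, (S.ret f)^[n] ⁻¹' S.cell i := by
    ext x
    simp [core]
  rw [h]
  exact S.measurableSet_Lam.inter (MeasurableSet.iInter fun n => MeasurableSet.iUnion fun i =>
    ((S.measurable_ret hf).iterate n) (S.measurableSet_cell i))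

variable [Nonempty ι] [MeasurableSpace ι] [MeasurableSingletonClass ι]

lemma measurable_cellIndex : Measurable S.cellIndex := by
  refine S.measurable_of_eqOn_cell id (Classical.epsilon fun _ => False)
    (fun i x hx => cellIndex_eq hx) fun x hx => ?_
  push Not at hx
  simp [cellIndex, hx]

lemma measurable_itin (hf : Measurable f) : Measurable (S.itin f) :=
  measurable_pi_lambda _ fun n => S.measurable_cellIndex.comp ((S.measurable_ret hf).iterate n)

variable [RiemannianBundle (fun x : M => TangentSpace (𝓡 d) x)]

/-- The distribution of the itineraries of the points of a disk. -/
def itinMeasure (f : M → M) (k : Ku) : Measure (ℕ → ι) :=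
  ((S.unstable.leb k).restrict (S.core f)).map (S.itin f)

variable {S}

lemma itinMeasure_apply (hf : Measurable f) (k : Ku) {E : Set (ℕ → ι)} (hE : MeasurableSet E) :
    S.itinMeasure f k E = S.unstable.leb k (S.core f ∩ S.itin f ⁻¹' E) := by
  rw [itinMeasure, Measure.map_apply (S.measurable_itin hf) hE,
    Measure.restrict_apply' (S.measurableSet_core hf), inter_comm]

variable [IsContMDiffRiemannianBundle (𝓡 d) ∞ (EuclideanSpace ℝ (Fin d))
    (fun x : M => TangentSpace (𝓡 d) x)]

instance isFiniteMeasure_itinMeasure (k : Ku) : IsFiniteMeasure (S.itinMeasure f k) := by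
  have := S.unstable.isFiniteMeasure_leb k
  unfold itinMeasure
  infer_instance

end Scheme

namespace Scheme

section

variable [Nonempty ι] {S : Scheme d M Ks Ku ι} {f : M → M}

lemma mem_prepend_itin_iff {p : M} {i : ι} (hp : p ∈ S.cell i) {E : Set (ℕ → ι)} :
    p ∈ S.core f ∩ S.itin f ⁻¹' prepend [i] E ↔
      f^[S.time i] p ∈ S.core f ∩ S.itin f ⁻¹' E := by
  rw [← S.ret_eq f hp, mem_inter_iff, mem_inter_iff, mem_core_iff_ret hp]
  have h1 : S.itin f p 0 = i := cellIndex_eq hp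
  have h2 : shift (S.itin f p) = S.itin f (S.ret f p) := funext fun n => (itin_ret p n).symm
  simp [prepend, h1, h2]

end

section

variable [RiemannianBundle (fun x : M => TangentSpace (𝓡 d) x)]
  {S : Scheme d M Ks Ku ι}

lemma tangentDet_pos {k : Ku} {z : EuclideanSpace ℝ (Fin S.du)} (hz : z ∈ unitDisk S.du)
    {g : M → M} (hg : Function.Injective (mfderiv (𝓡 d) (𝓡 d) g (S.unstable.toFun k z))) :
    0 < S.unstable.tangentDet g k z := by
  refine div_pos (gramVol_pos ?_) (S.unstable.gramVol_frame_pos k hz)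
  let D : EuclideanSpace ℝ (Fin d) →L[ℝ] EuclideanSpace ℝ (Fin d) :=
    mfderiv (𝓡 d) (𝓡 d) g (S.unstable.toFun k z)
  have hD : Function.Injective D := hg
  exact (S.unstable.linearIndependent_frame k hz).map'
    (D : EuclideanSpace ℝ (Fin d) →ₗ[ℝ] EuclideanSpace ℝ (Fin d)) (LinearMap.ker_eq_bot.2 hD)

end

end Scheme

namespace IsYoung

variable [Countable ι] [Nonempty ι] [MeasurableSpace ι] [MeasurableSingletonClass ι]
  [RiemannianBundle (fun x : M => TangentSpace (𝓡 d) x)]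
  [IsContMDiffRiemannianBundle (𝓡 d) ∞ (EuclideanSpace ℝ (Fin d))
    (fun x : M => TangentSpace (𝓡 d) x)]
  {S : Scheme d M Ks Ku ι} {f : M → M} {C β : ℝ} (hS : IsYoung S f C β) (hf : Measurable f)
include hS hf

open Scheme

/-- The distribution of the itineraries in an unstable disk, computed on another one. -/
lemma exists_itinMeasure_eq (k k' : Ku) : ∃ ρ : M → ℝ,
    (∀ x ∈ S.unstable.disk k' ∩ S.Lam, 0 < ρ x) ∧
    (∀ x ∈ S.unstable.disk k' ∩ S.Lam, ∀ y ∈ S.unstable.disk k' ∩ S.Lam,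
      Real.log (ρ x / ρ y) ≤ C * epow β (S.sep f x y)) ∧
    ∀ F, MeasurableSet F → S.itinMeasure f k F =
      ∫⁻ x in (S.core f ∩ S.itin f ⁻¹' F) ∩ S.unstable.disk k',
        ENNReal.ofReal (ρ x) ∂(S.unstable.leb k') := by
  obtain ⟨ρ, hρm, hρpos, hρ, hρ1, _, hρlog⟩ := hS.holonomy_regular k k'
  have hfin := S.unstable.isFiniteMeasure_leb k
  have hfin' := S.unstable.isFiniteMeasure_leb k'
  have hcore := S.measurableSet_core hf
  have hLam := S.measurableSet_Lam
  have hdisk := S.unstable.measurableSet_disk k'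
  -- Measurability of the holonomy comes for free: the push-forward by a non-measurable map is zero
  -- by convention, which the lower bound 1 / C for the integral of ρ excludes.
  have hmeas : AEMeasurable (S.holonomy k') ((S.unstable.leb k).restrict S.Lam) := by
    by_contra hn
    rw [Measure.map_of_not_aemeasurable hn] at hρ
    have h1 : ∫ x in S.Lam, ρ x ∂(S.unstable.leb k') = 0 := by
      have h2 := (withDensity_eq_zero_iff (hρm.ennreal_ofReal.aemeasurable)).1 hρ.symm
      have h3 : ∀ᵐ x ∂((S.unstable.leb k').restrict S.Lam), ρ x ≤ 0 := by
        filter_upwards [h2] with x hx using ENNReal.ofReal_eq_zero.1 hx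
      have h4 : ∀ᵐ x ∂((S.unstable.leb k').restrict S.Lam), x ∈ S.unstable.disk k' :=
        ae_restrict_of_ae (S.unstable.leb_compl_disk k')
      have h5 : ∀ᵐ x ∂((S.unstable.leb k').restrict S.Lam), False := by
        filter_upwards [h3, h4, ae_restrict_mem hLam] with x h3 h4 h5
        exact absurd (hρpos x ⟨h4, h5⟩) (not_lt.2 h3)
      exact integral_eq_zero_of_ae (h5.mono fun x hx => hx.elim)
    rw [h1] at hρ1
    exact absurd hρ1 (not_le.2 (one_div_pos.2 hS.C_pos))
  refine ⟨ρ, hρpos, hρlog, fun F hF => ?_⟩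
  have hQ : MeasurableSet (S.core f ∩ S.itin f ⁻¹' F) := hcore.inter (S.measurable_itin hf hF)
  have h1 : ((S.unstable.leb k).restrict S.Lam).map (S.holonomy k') (S.core f ∩ S.itin f ⁻¹' F) =
      S.itinMeasure f k F := by
    rw [Measure.map_apply_of_aemeasurable hmeas hQ, Measure.restrict_apply' hLam,
      itinMeasure_apply hf k hF]
    refine measure_congr ?_
    have h2 : ∀ᵐ x ∂(S.unstable.leb k), x ∈ S.unstable.disk k := S.unstable.leb_compl_disk k
    filter_upwards [h2] with x hx
    refine propext ?_
    change (S.holonomy k' x ∈ S.core f ∩ S.itin f ⁻¹' F ∧ x ∈ S.Lam) ↔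
      x ∈ S.core f ∩ S.itin f ⁻¹' F
    -- The holonomy moves points along stable disks, so it preserves Λ' and itineraries.
    by_cases hxL : x ∈ S.Lam
    · obtain ⟨j, _, hj, _⟩ := S.mem_Lam.1 hxL
      rw [S.holonomy_eq k' hj]
      obtain ⟨hpj, hpk⟩ := S.inter_mem j k'
      have hpL := S.inter_mem_Lam j k'
      constructor
      · rintro ⟨⟨h1, h2⟩, _⟩
        refine ⟨hS.core_of_stable h1 hpj hj hxL, ?_⟩
        rw [mem_preimage, hS.itin_of_stable h1 hpj hj hxL]
        exact h2
      · rintro ⟨h1, h2⟩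
        refine ⟨⟨hS.core_of_stable h1 hj hpj hpL, ?_⟩, hxL⟩
        rw [mem_preimage, hS.itin_of_stable h1 hj hpj hpL]
        exact h2
    · exact iff_of_false (fun h => hxL h.2) (fun h => hxL h.1.1)
  rw [← h1, hρ, withDensity_apply _ hQ, Measure.restrict_restrict hQ]
  have h3 : (S.core f ∩ S.itin f ⁻¹' F) ∩ S.Lam = S.core f ∩ S.itin f ⁻¹' F :=
    inter_eq_left.2 fun x hx => hx.1.1
  rw [h3]
  refine setLIntegral_congr ?_
  have h2 : ∀ᵐ x ∂(S.unstable.leb k'), x ∈ S.unstable.disk k' := S.unstable.leb_compl_disk k'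
  filter_upwards [h2] with x hx
  refine propext ?_
  change x ∈ S.core f ∩ S.itin f ⁻¹' F ↔ x ∈ S.core f ∩ S.itin f ⁻¹' F ∧ x ∈ S.unstable.disk k'
  tauto

/-- The distributions of the itineraries in different unstable disks are comparable. -/
lemma itinMeasure_mul_le (k k' : Ku) {s : ℕ} {E E' : Set (ℕ → ι)} (hE : MeasurableSet E)
    (hE' : MeasurableSet E') (h : ∀ x ∈ E, ∀ x' ∈ E', ∀ m < s, x m = x' m) :
    S.itinMeasure f k E * S.itinMeasure f k' E' ≤
      ENNReal.ofReal (Real.exp (C * β ^ s)) * S.itinMeasure f k E' * S.itinMeasure f k' E := by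
  obtain ⟨ρ, hρpos, hρlog, key⟩ := hS.exists_itinMeasure_eq hf k k'
  have hcore := S.measurableSet_core hf
  have hdisk := S.unstable.measurableSet_disk k'
  have key' : ∀ F, MeasurableSet F → S.itinMeasure f k' F =
      ∫⁻ x in (S.core f ∩ S.itin f ⁻¹' F) ∩ S.unstable.disk k', 1 ∂(S.unstable.leb k') := by
    intro F hF
    rw [setLIntegral_one, itinMeasure_apply hf k' hF]
    refine measure_congr ?_
    have h2 : ∀ᵐ x ∂(S.unstable.leb k'), x ∈ S.unstable.disk k' := S.unstable.leb_compl_disk k'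
    filter_upwards [h2] with x hx
    refine propext ?_
    change x ∈ S.core f ∩ S.itin f ⁻¹' F ↔ x ∈ S.core f ∩ S.itin f ⁻¹' F ∧ x ∈ S.unstable.disk k'
    tauto
  have hle := lintegral_mul_lintegral_le_of_le (μ := S.unstable.leb k')
    ((hcore.inter (S.measurable_itin hf hE)).inter hdisk)
    ((hcore.inter (S.measurable_itin hf hE')).inter hdisk) (G := fun _ => 1)
    (u := fun x => ENNReal.ofReal (ρ x)) (c := ENNReal.ofReal (Real.exp (C * β ^ s)))
    ENNReal.ofReal_ne_top (by rw [← key' E hE]; exact measure_ne_top _ _)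
    (by simp only [one_mul]; rw [← key E hE]; exact measure_ne_top _ _)
    (fun _ _ => ENNReal.ofReal_ne_top) (fun x hx y hy => by
      rw [← ENNReal.ofReal_mul (Real.exp_nonneg _)]
      refine ENNReal.ofReal_le_ofReal ?_
      have hxp := hρpos x ⟨hx.2, hx.1.1.1⟩
      have hyp := hρpos y ⟨hy.2, hy.1.1.1⟩
      have h1 := hρlog x ⟨hx.2, hx.1.1.1⟩ y ⟨hy.2, hy.1.1.1⟩
      have h2 := epow_sep_le hx.1.1 hy.1.1 hS.β_pos hS.β_lt_one
        (h _ hx.1.2 _ hy.1.2)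
      have h3 : Real.log (ρ x / ρ y) ≤ C * β ^ s := h1.trans (by gcongr; exact hS.C_pos.le)
      rwa [Real.log_le_iff_le_exp (div_pos hxp hyp), div_le_iff₀ hyp] at h3)
  simp only [one_mul] at hle
  rw [key E hE, key E' hE', key' E hE, key' E' hE']
  exact hle

lemma itinMeasure_null (k k' : Ku) {E : Set (ℕ → ι)} (hE : MeasurableSet E)
    (h : S.itinMeasure f k E = 0) : S.itinMeasure f k' E = 0 := by
  obtain ⟨ρ, _, _, key⟩ := hS.exists_itinMeasure_eq hf k' k
  rw [key E hE]
  rw [itinMeasure_apply hf k hE] at h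
  exact setLIntegral_measure_zero _ _ (measure_mono_null inter_subset_left h)

/-- The branch of the return map over cell i covers an unstable disk `k'`. The Gibbs condition
compares the disk k with `k'` at the cost C, and the holonomy compares `k'` with k at the cost of
another C. -/
lemma isGibbsOn_itinMeasure (k : Ku) :
    IsGibbsOn (fun w => w.length = 1) (S.itinMeasure f k) (2 * C) β := by
  intro w hw s E E' hE hE' hEE'
  obtain ⟨i, rfl⟩ := List.length_eq_one_iff.1 hw
  by_cases hx₀ : ∃ x₀, x₀ ∈ S.core f ∧ x₀ ∈ S.cell i ∧ x₀ ∈ S.unstable.disk k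
  swap
  · have h0 : S.itinMeasure f k (prepend [i] E) = 0 := by
      rw [itinMeasure_apply hf k (measurableSet_prepend _ hE)]
      refine measure_mono_null ?_ (S.unstable.leb_compl_disk k)
      rintro x ⟨hx, hxi⟩ hxk
      refine hx₀ ⟨x, hx, ?_, hxk⟩
      have h1 : S.itin f x 0 = i := hxi.1
      rw [← h1]
      exact mem_cell_itin hx 0
    simp [h0]
  obtain ⟨x₀, hx₀, hx₀i, hx₀k⟩ := hx₀
  obtain ⟨V, hcV, hC1, hV⟩ := hS.markov i
  obtain ⟨k', hk'sub, hk'ret, hk'cell⟩ := hS.exists_unstable_ret hx₀i hx₀k hcV hC1.2.1 hV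
  have hcore := S.measurableSet_core hf
  have hPm : ∀ F, MeasurableSet F → MeasurableSet (S.core f ∩ S.itin f ⁻¹' F) := fun F hF =>
    hcore.inter (S.measurable_itin hf hF)
  have hcell : ∀ F, ∀ p ∈ S.core f ∩ S.itin f ⁻¹' prepend [i] F, p ∈ S.cell i := fun F p hp => by
    have h1 : S.itin f p 0 = i := hp.2.1
    rw [← h1]
    exact mem_cell_itin hp.1 0
  have hPB : ∀ F, ∀ p ∈ S.unstable.disk k, p ∈ V → f^[S.time i] p ∈ S.unstable.disk k' →
      (p ∈ S.core f ∩ S.itin f ⁻¹' prepend [i] F ↔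
        f^[S.time i] p ∈ S.core f ∩ S.itin f ⁻¹' F) := by
    intro F p hpk hpV hpk'
    constructor
    · exact fun hp => (mem_prepend_itin_iff (hcell F p hp)).1 hp
    · intro hp
      exact (mem_prepend_itin_iff (hk'cell p hpk hpV hpk' hp.1.1)).2 hp
  have hPV : ∀ F, ∀ p ∈ S.unstable.disk k, p ∈ S.core f ∩ S.itin f ⁻¹' prepend [i] F →
      p ∈ V ∧ f^[S.time i] p ∈ S.unstable.disk k' := by
    intro F p hpk hp
    have hpi := hcell F p hp
    refine ⟨hcV hpi, ?_⟩
    rw [← S.ret_eq f hpi]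
    exact hk'ret p hp.1 hpi hpk
  have hgibbs : ∀ F F', MeasurableSet F → MeasurableSet F' → ∀ t : ℕ,
      (∀ x ∈ F, ∀ x' ∈ F', ∀ m < t, x m = x' m) →
      S.itinMeasure f k (prepend [i] F) * S.itinMeasure f k' F' ≤
        ENNReal.ofReal (Real.exp (C * β ^ t)) * S.itinMeasure f k (prepend [i] F') *
          S.itinMeasure f k' F := by
    intro F F' hF hF' t hFF'
    rw [itinMeasure_apply hf k (measurableSet_prepend _ hF),
      itinMeasure_apply hf k (measurableSet_prepend _ hF'), itinMeasure_apply hf k' hF,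
      itinMeasure_apply hf k' hF']
    refine S.unstable.leb_mul_leb_le hC1 hk'sub (hPm _ (measurableSet_prepend _ hF)) (hPm _ hF)
      (hPm _ (measurableSet_prepend _ hF')) (hPm _ hF') (hPB F) (hPB F') (hPV F) (hPV F')
      (Real.exp_nonneg _) ?_
    intro z hz w hw hzP hwP
    have hzi := hcell F _ hzP
    have hwi := hcell F' _ hwP
    have hJz : 0 < S.unstable.tangentDet (f^[S.time i]) k z :=
      tangentDet_pos hz (hC1.2.2.2 _ (hcV hzi)).1
    have hJw : 0 < S.unstable.tangentDet (f^[S.time i]) k w :=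
      tangentDet_pos hw (hC1.2.2.2 _ (hcV hwi)).1
    have h1 := hS.gibbs i k w hw z hz hwi hzi
    have hz' := (mem_prepend_itin_iff hzi).1 hzP
    have hw' := (mem_prepend_itin_iff hwi).1 hwP
    have h2 := epow_sep_le hw'.1 hz'.1 hS.β_pos hS.β_lt_one (n := t) fun m hm =>
      (hFF' _ hz'.2 _ hw'.2 m hm).symm
    have h3 := h1.trans (mul_le_mul_of_nonneg_left h2 hS.C_pos.le)
    rwa [Real.log_le_iff_le_exp (div_pos hJw hJz), div_le_iff₀ hJz] at h3
  -- The intermediate measures on `k'` must be cancelled, so their vanishing is treated apart; null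
  -- sets of itineraries are the same for all disks.
  by_cases hy : S.itinMeasure f k' E = 0
  · by_cases hu : S.itinMeasure f k' univ = 0
    · have h1 := hS.itinMeasure_null hf k' k MeasurableSet.univ hu
      rw [measure_mono_null (subset_univ _) h1]
      simp
    · have h1 := hgibbs E univ hE MeasurableSet.univ 0 (by simp)
      rw [hy, mul_zero] at h1
      rw [(mul_eq_zero.1 (le_antisymm h1 zero_le)).resolve_right hu]
      simp
  by_cases hz : S.itinMeasure f k' E' = 0
  · rw [hS.itinMeasure_null hf k' k hE' hz]
    simp
  refine ENNReal_mul_le_mul_of_chain hy (measure_ne_top _ _) hz (measure_ne_top _ _)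
    (hgibbs E E' hE hE' s hEE') (hS.itinMeasure_mul_le hf k' k hE hE' hEE') (le_of_eq ?_)
  rw [← ENNReal.ofReal_mul (Real.exp_nonneg _), ← Real.exp_add]
  congr 2
  ring

lemma isGibbs_itinMeasure (k : Ku) : IsGibbs (S.itinMeasure f k) (2 * C / (1 - β)) β :=
  (hS.isGibbsOn_itinMeasure hf k).isGibbs (by linarith [hS.C_pos]) hS.β_pos hS.β_lt_one

end IsYoung
end SymbolicMeasure

/-! ### Taylor type inequalities for p-th powers. -/

section MomentBounds

/-- For |t| ≤ 1/p, bound (1 + t)^p by exp (p t), whose remainder is at most p² t². For |t| > 1/p,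
everything is dominated by |t|^p with constant (p + 1)^p, and the linear term is at least -p² t². -/
lemma exists_abs_one_add_rpow_le {p : ℝ} (hp : 2 ≤ p) : ∃ C : ℝ, 0 < C ∧ ∀ t : ℝ,
    |1 + t| ^ p ≤ 1 + p * t + C * (t ^ 2 + |t| ^ p) := by
  have hp0 : 0 < p := by linarith
  refine ⟨p ^ 2 + (p + 1) ^ p, by positivity, fun t => ?_⟩
  have h1 : (0 : ℝ) ≤ |t| ^ p := by positivity
  have h2 : (0 : ℝ) ≤ (p + 1) ^ p := by positivity
  rcases le_or_gt |t| (1 / p) with ht | ht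
  · have hpt : |p * t| ≤ 1 := by
      rw [abs_mul, abs_of_pos hp0]
      rwa [le_div_iff₀ hp0, mul_comm] at ht
    have ht2 : |t| ≤ 1 := ht.trans (by rw [div_le_one hp0]; linarith)
    have h0 : 0 ≤ 1 + t := by linarith [neg_abs_le t]
    have h3 : |1 + t| ^ p ≤ Real.exp (p * t) := by
      rw [abs_of_nonneg h0, mul_comm, Real.exp_mul]
      exact Real.rpow_le_rpow h0 (by linarith [Real.add_one_le_exp t]) hp0.le
    have h4 := (abs_le.1 (Real.abs_exp_sub_one_sub_id_le hpt)).2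
    nlinarith [sq_nonneg t, mul_nonneg h2 h1, mul_nonneg h2 (sq_nonneg t),
      mul_nonneg (sq_nonneg p) h1]
  · have hpt : 1 < p * |t| := by rwa [div_lt_iff₀ hp0, mul_comm] at ht
    have h3 : |1 + t| ^ p ≤ (p + 1) ^ p * |t| ^ p := by
      rw [← Real.mul_rpow (by positivity) (abs_nonneg _)]
      refine Real.rpow_le_rpow (abs_nonneg _) ?_ hp0.le
      have := abs_add_le 1 t
      rw [abs_one] at this
      linarith
    have h4 : -(p * |t|) ≤ p * t := by nlinarith [neg_abs_le t]
    have h5 : p * |t| ≤ p ^ 2 * t ^ 2 := by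
      have : p ^ 2 * t ^ 2 = (p * |t|) * (p * |t|) := by rw [← sq_abs t]; ring
      rw [this]
      nlinarith
    nlinarith [sq_nonneg t, mul_nonneg h2 h1, mul_nonneg h2 (sq_nonneg t),
      mul_nonneg (sq_nonneg p) h1]

lemma exists_abs_add_rpow_le {p : ℝ} (hp : 2 ≤ p) : ∃ C : ℝ, 0 < C ∧ ∀ s d : ℝ,
    |s + d| ^ p ≤ |s| ^ p + p * (|s| ^ (p - 2) * s) * d +
      C * (|s| ^ (p - 2) * d ^ 2 + |d| ^ p) := by
  obtain ⟨C, hC, h⟩ := exists_abs_one_add_rpow_le hp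
  have hp0 : 0 < p := by linarith
  refine ⟨C + 1, by positivity, fun s d => ?_⟩
  rcases eq_or_ne s 0 with rfl | hs
  · have h1 : (0 : ℝ) ≤ |(0 : ℝ)| ^ (p - 2) * d ^ 2 := by positivity
    have h2 : (0 : ℝ) ≤ |d| ^ p := by positivity
    simp only [zero_add, mul_zero, zero_mul, abs_zero, Real.zero_rpow hp0.ne'] at h1 ⊢
    nlinarith
  · have hs' : 0 < |s| := abs_pos.2 hs
    have h1 := mul_le_mul_of_nonneg_left (h (d / s)) (Real.rpow_nonneg hs'.le p)
    have e1 : |s| ^ p * |1 + d / s| ^ p = |s + d| ^ p := by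
      rw [← Real.mul_rpow hs'.le (abs_nonneg _), ← abs_mul]
      congr 2
      field_simp
    have e2 : |s| ^ p = |s| ^ (p - 2) * s ^ 2 := by
      rw [← sq_abs, ← Real.rpow_natCast |s| 2, ← Real.rpow_add hs']
      norm_num
    have e3 : |s| ^ p * |d / s| ^ p = |d| ^ p := by
      rw [← Real.mul_rpow hs'.le (abs_nonneg _), ← abs_mul]
      congr 2
      field_simp
    have e4 : |s| ^ p * (d / s) ^ 2 = |s| ^ (p - 2) * d ^ 2 := by rw [e2]; field_simp
    have e5 : |s| ^ p * (d / s) = |s| ^ (p - 2) * s * d := by rw [e2]; field_simp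
    have e6 : |s| ^ p * (1 + p * (d / s) + C * ((d / s) ^ 2 + |d / s| ^ p)) =
        |s| ^ p + p * (|s| ^ p * (d / s)) + C * (|s| ^ p * (d / s) ^ 2 + |s| ^ p * |d / s| ^ p) := by
      ring
    rw [e1, e6, e3, e4, e5] at h1
    have h2 : (0 : ℝ) ≤ |s| ^ (p - 2) * d ^ 2 := by positivity
    have h3 : (0 : ℝ) ≤ |d| ^ p := by positivity
    nlinarith

/-- Young's inequality, obtained by distinguishing whether d² is below or above e s². -/
lemma rpow_mul_sq_le {p : ℝ} (hp : 2 ≤ p) {e : ℝ} (he : 0 < e) (s d : ℝ) :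
    |s| ^ (p - 2) * d ^ 2 ≤ e * |s| ^ p + e ^ (-((p - 2) / 2)) * |d| ^ p := by
  have hA : |s| ^ (p - 2) * s ^ 2 ≤ |s| ^ p := by
    rcases eq_or_ne s 0 with rfl | hs
    · simp; positivity
    · have hs' : 0 < |s| := abs_pos.2 hs
      rw [← sq_abs, ← Real.rpow_natCast |s| 2, ← Real.rpow_add hs']
      norm_num
  have hB : |d| ^ (p - 2) * d ^ 2 ≤ |d| ^ p := by
    rcases eq_or_ne d 0 with rfl | hs
    · simp; positivity
    · have hs' : 0 < |d| := abs_pos.2 hs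
      rw [← sq_abs, ← Real.rpow_natCast |d| 2, ← Real.rpow_add hs']
      norm_num
  have h0 : 0 ≤ e ^ (-((p - 2) / 2)) * |d| ^ p := by positivity
  have h1 : 0 ≤ e * |s| ^ p := by positivity
  rcases le_or_gt (d ^ 2) (e * s ^ 2) with h | h
  · have := mul_le_mul_of_nonneg_left h (Real.rpow_nonneg (abs_nonneg s) (p - 2))
    nlinarith
  · have h2 : |s| ≤ e ^ (-(1 / 2) : ℝ) * |d| := by
      refine abs_le_of_sq_le_sq' ?_ (by positivity) |>.2
      rw [mul_pow, ← Real.rpow_natCast (e ^ _) 2, ← Real.rpow_mul he.le, sq_abs, sq_abs]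
      norm_num [Real.rpow_neg_one]
      rw [inv_mul_eq_div, le_div_iff₀ he]
      linarith
    have h3 : |s| ^ (p - 2) ≤ e ^ (-((p - 2) / 2)) * |d| ^ (p - 2) := by
      refine (Real.rpow_le_rpow (abs_nonneg _) h2 (by linarith)).trans (le_of_eq ?_)
      rw [Real.mul_rpow (by positivity) (abs_nonneg _), ← Real.rpow_mul he.le]
      congr 2
      ring
    have h4 := mul_le_mul_of_nonneg_right h3 (sq_nonneg d)
    have h5 := mul_le_mul_of_nonneg_left hB (Real.rpow_nonneg he.le (-((p - 2) / 2)))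
    nlinarith

/-- A convexity inequality for `|·| ^ p` with a small increment of the main term. -/
lemma exists_abs_add_rpow_le_nat {p : ℝ} (hp : 2 ≤ p) : ∃ K : ℝ, 0 < K ∧
    ∀ n : ℕ, 1 ≤ n → ∀ s d : ℝ, |s + d| ^ p ≤
      (1 + 1 / (2 * n)) * |s| ^ p + p * (|s| ^ (p - 2) * s) * d + K * (n : ℝ) ^ (p / 2 - 1) * |d| ^ p := by
  obtain ⟨C, hC, h⟩ := exists_abs_add_rpow_le hp
  refine ⟨C * (2 * C) ^ (p / 2 - 1) + C, by positivity, fun n hn s d => ?_⟩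
  have hn' : (1 : ℝ) ≤ n := by exact_mod_cast hn
  have hn0 : (0 : ℝ) < n := by linarith
  -- The weight 1 / (2 C n) turns the coefficient of |s|^p into 1 + 1 / (2n), a growth that a bound
  -- of order n^(p/2) can afford at the n-th step; the price is the factor n^(p/2 - 1) in front of
  -- |d|^p.
  have h1 := mul_le_mul_of_nonneg_left
    (rpow_mul_sq_le hp (e := 1 / (2 * C * n)) (by positivity) s d) hC.le
  have e1 : (1 / (2 * C * n)) ^ (-((p - 2) / 2)) = (2 * C) ^ (p / 2 - 1) * (n : ℝ) ^ (p / 2 - 1) := by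
    rw [one_div, Real.inv_rpow (by positivity), ← Real.rpow_neg (by positivity), neg_neg,
      Real.mul_rpow (by positivity) hn0.le]
    congr 2 <;> ring
  have e2 : C * (1 / (2 * C * n)) = 1 / (2 * n) := by field_simp
  rw [e1, mul_add, ← mul_assoc, ← mul_assoc, e2] at h1
  have h2 : (1 : ℝ) ≤ (n : ℝ) ^ (p / 2 - 1) := Real.one_le_rpow hn' (by linarith)
  have h3 : (0 : ℝ) ≤ |d| ^ p := by positivity
  have h4 := h s d
  have h5 : C * |d| ^ p ≤ C * (n : ℝ) ^ (p / 2 - 1) * |d| ^ p := by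
    have := mul_le_mul_of_nonneg_left h2 hC.le
    nlinarith
  nlinarith

end MomentBounds

/-! ### Moments of sums of functions orthogonal to the future. -/

section Orthogonal

variable {X : Type*} [MeasurableSpace X] {μ : Measure X} [IsProbabilityMeasure μ] {T : X → X}

/-- `D` is orthogonal to the bounded functions of `T ^ Q`. -/
def IsOrth (μ : Measure X) (T : X → X) (Q : ℕ) (D : X → ℝ) : Prop :=
  ∀ g : X → ℝ, Measurable g → (∃ B, ∀ x, |g x| ≤ B) → ∫ x, D x * g (T^[Q] x) ∂μ = 0

lemma integrable_of_bdd {g : X → ℝ} (hg : Measurable g) {B : ℝ} (h : ∀ x, |g x| ≤ B) :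
    Integrable g μ :=
  Integrable.of_bound hg.aestronglyMeasurable B (ae_of_all _ fun x => by simpa using h x)

/-- The partial sums of `D ∘ T ^ (j Q)`. -/
def gapSum (T : X → X) (Q : ℕ) (D : X → ℝ) (n : ℕ) (x : X) : ℝ :=
  ∑ j ∈ Finset.range n, D (T^[j * Q] x)

/-- The first term is split off, not the last: the remaining sum is a function of T^Q, to which D is
orthogonal. -/
lemma gapSum_succ (T : X → X) (Q : ℕ) (D : X → ℝ) (n : ℕ) (x : X) :
    gapSum T Q D (n + 1) x = gapSum T Q D n (T^[Q] x) + D x := by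
  simp only [gapSum, Finset.sum_range_succ']
  congr 1
  · refine Finset.sum_congr rfl fun j _ => ?_
    rw [add_mul, one_mul, Function.iterate_add_apply]
  · simp

lemma abs_sum_le_of_bdd {D : X → ℝ} {B : ℝ} (hB : ∀ x, |D x| ≤ B) (n : ℕ) (g : ℕ → X) :
    |∑ j ∈ Finset.range n, D (g j)| ≤ n * B := by
  refine (Finset.abs_sum_le_sum_abs _ _).trans ((Finset.sum_le_sum fun j _ => hB _).trans ?_)
  simp

variable (hT : MeasurePreserving T μ μ)
include hT

lemma measurable_gapSum {D : X → ℝ} (hD : Measurable D) (Q n : ℕ) :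
    Measurable (gapSum T Q D n) :=
  Finset.measurable_sum _ fun j _ => hD.comp (hT.measurable.iterate _)

lemma integral_comp_iterate {g : X → ℝ} (hg : Measurable g) (n : ℕ) :
    ∫ x, g (T^[n] x) ∂μ = ∫ x, g x ∂μ := by
  have h := (hT.iterate n)
  rw [← integral_map (φ := T^[n]) h.measurable.aemeasurable hg.aestronglyMeasurable, h.map_eq]

/-- Burkholder-type inequality for reverse martingale differences. -/
lemma exists_integral_gapSum_rpow_le {p : ℝ} (hp : 2 ≤ p) : ∃ K : ℝ, 0 < K ∧
    ∀ (D : X → ℝ), Measurable D → (∃ B, ∀ x, |D x| ≤ B) → ∀ Q : ℕ, IsOrth μ T Q D → ∀ n : ℕ,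
      ∫ x, |gapSum T Q D n x| ^ p ∂μ ≤ K * (n : ℝ) ^ (p / 2) * ∫ x, |D x| ^ p ∂μ := by
  obtain ⟨K, hK, h⟩ := exists_abs_add_rpow_le_nat hp
  have hp0 : 0 < p := by linarith
  refine ⟨2 * K + 1, by positivity, fun D hD hDB Q hQ n => ?_⟩
  obtain ⟨B, hB⟩ := hDB
  have ha : 0 ≤ ∫ x, |D x| ^ p ∂μ := integral_nonneg fun x => by positivity
  set a := ∫ x, |D x| ^ p ∂μ with ha'
  have hW : ∀ n, ∀ x, |gapSum T Q D n x| ≤ n * B := fun n x => abs_sum_le_of_bdd hB n _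
  have hWm : ∀ n, Measurable (gapSum T Q D n) := measurable_gapSum hT hD Q
  have hWi : ∀ n, Integrable (fun x => |gapSum T Q D n x| ^ p) μ := fun n =>
    integrable_of_bdd ((hWm n).abs.pow_const p) (B := (n * B) ^ p) fun x => by
      rw [abs_of_nonneg (by positivity)]
      exact Real.rpow_le_rpow (abs_nonneg _) (hW n x) hp0.le
  have hDi : Integrable (fun x => |D x| ^ p) μ :=
    integrable_of_bdd (hD.abs.pow_const p) (B := B ^ p) fun x => by
      rw [abs_of_nonneg (by positivity)]
      exact Real.rpow_le_rpow (abs_nonneg _) (hB x) hp0.le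
  induction n with
  | zero => simp [gapSum, Real.zero_rpow hp0.ne', Real.zero_rpow (by positivity : p / 2 ≠ 0)]
  | succ n ih =>
    rcases Nat.eq_zero_or_pos n with rfl | hn
    · simp only [gapSum_succ]
      simp only [gapSum, Finset.range_zero, Finset.sum_empty, zero_add, Nat.cast_one, Real.one_rpow,
        mul_one]
      nlinarith
    have hn' : (1 : ℝ) ≤ n := by exact_mod_cast hn
    have hn0 : (0 : ℝ) < n := by linarith
    set g : X → ℝ := fun x => p * (|gapSum T Q D n x| ^ (p - 2) * gapSum T Q D n x) with hg
    have hgm : Measurable g := ((((hWm n).abs.pow_const _).mul (hWm n)).const_mul _)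
    have hgB : ∀ x, |g x| ≤ p * ((n * B) ^ (p - 2) * (n * B)) := fun x => by
      have h0 := hW n x
      have h1 : |gapSum T Q D n x| ^ (p - 2) ≤ (n * B) ^ (p - 2) :=
        Real.rpow_le_rpow (abs_nonneg _) h0 (by linarith)
      rw [hg, abs_mul, abs_mul, abs_of_pos hp0, abs_of_nonneg (by positivity : (0:ℝ) ≤
        |gapSum T Q D n x| ^ (p - 2))]
      gcongr
      exact Real.rpow_nonneg ((abs_nonneg _).trans h0) _
    -- The linear term of the convexity inequality is D times a function of T^Q, so its integral
    -- vanishes.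
    have horth := hQ g hgm ⟨_, hgB⟩
    have hi1 : Integrable (fun x => |gapSum T Q D n (T^[Q] x)| ^ p) μ :=
      (hT.iterate Q).integrable_comp_of_integrable (hWi n)
    have hi2 : Integrable (fun x => g (T^[Q] x) * D x) μ := by
      refine (integrable_of_bdd hD hB).bdd_mul (c := p * ((n * B) ^ (p - 2) * (n * B)))
        (hgm.comp (hT.measurable.iterate Q)).aestronglyMeasurable (ae_of_all _ fun x => ?_)
      simpa using hgB _
    have h1 : ∫ x, |gapSum T Q D (n + 1) x| ^ p ∂μ ≤
        ∫ x, ((1 + 1 / (2 * n)) * |gapSum T Q D n (T^[Q] x)| ^ p + g (T^[Q] x) * D x +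
          K * (n : ℝ) ^ (p / 2 - 1) * |D x| ^ p) ∂μ := by
      refine integral_mono (hWi _) (((hi1.const_mul _).add hi2).add (hDi.const_mul _)) fun x => ?_
      simp only [gapSum_succ]
      exact h n hn _ _
    have hi3 : Integrable (fun x => (1 + 1 / (2 * (n : ℝ))) * |gapSum T Q D n (T^[Q] x)| ^ p +
      g (T^[Q] x) * D x) μ := (hi1.const_mul _).add hi2
    rw [integral_add hi3 (hDi.const_mul _), integral_add (hi1.const_mul _) hi2, integral_const_mul, integral_const_mul,
      integral_comp_iterate hT ((hWm n).abs.pow_const p)] at h1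
    have h2 : ∫ x, g (T^[Q] x) * D x ∂μ = 0 := by rw [← horth]; simp only [mul_comm]
    rw [h2, add_zero] at h1
    refine h1.trans ?_
    -- Since p / 2 ≥ 1, passing from n to n + 1 gains the factor 1 + 1 / n. Half of the gain pays
    -- for the growth 1 + 1 / (2n), the other half for the new term, because 2 K + 1 ≥ 2 K.
    have h3 : (n : ℝ) ^ (p / 2) * (1 + 1 / n) ≤ ((n + 1 : ℕ) : ℝ) ^ (p / 2) := by
      have h4 : ((n + 1 : ℕ) : ℝ) = n * (1 + 1 / n) := by push_cast; field_simp
      rw [h4, Real.mul_rpow hn0.le (by positivity)]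
      gcongr
      refine Real.self_le_rpow_of_one_le ?_ (by linarith)
      have : (0 : ℝ) ≤ 1 / n := by positivity
      linarith
    have h5 : (n : ℝ) ^ (p / 2) = (n : ℝ) ^ (p / 2 - 1) * n := by
      rw [Real.rpow_sub_one hn0.ne']
      field_simp
    have h6 := mul_le_mul_of_nonneg_left ih (by positivity : (0:ℝ) ≤ 1 + 1 / (2 * n))
    refine (add_le_add_left h6 _).trans ?_
    have h7 := mul_le_mul_of_nonneg_left h3 (by positivity : (0:ℝ) ≤ (2 * K + 1) * a)
    refine le_trans (b := (2 * K + 1) * a * ((n : ℝ) ^ (p / 2) * (1 + 1 / (2 * n))) +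
      K * a * (n : ℝ) ^ (p / 2 - 1)) (le_of_eq (by ring)) ((le_trans ?_ h7).trans (le_of_eq ?_))
    · have h8 : (n : ℝ) ^ (p / 2) * (1 / n) = (n : ℝ) ^ (p / 2 - 1) := by rw [h5]; field_simp
      have h9 : (n : ℝ) ^ (p / 2) * (1 / (2 * n)) = (n : ℝ) ^ (p / 2 - 1) / 2 := by
        rw [h5]; field_simp
      have e1 : (n : ℝ) ^ (p / 2) * (1 + 1 / n) = (n : ℝ) ^ (p / 2) + (n : ℝ) ^ (p / 2 - 1) := by
        rw [mul_add, mul_one, h8]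
      have e2 : (n : ℝ) ^ (p / 2) * (1 + 1 / (2 * n)) =
          (n : ℝ) ^ (p / 2) + (n : ℝ) ^ (p / 2 - 1) / 2 := by rw [mul_add, mul_one, h9]
      rw [e1, e2]
      have : 0 ≤ a * (n : ℝ) ^ (p / 2 - 1) := by positivity
      nlinarith
    · ring

end Orthogonal

/-! ### Birkhoff sums under gap orthogonality: moments and Azuma's inequality. -/

section OrthogonalSums

variable {X : Type*} [MeasurableSpace X] {μ : Measure X} [IsProbabilityMeasure μ] {T : X → X}

/-- The times below Q M are sorted by their residue modulo Q; each class is a shifted sum with gap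
Q. -/
lemma birkhoffSum_mul (T : X → X) (D : X → ℝ) (Q M : ℕ) (x : X) :
    birkhoffSum T D (Q * M) x = birkhoffSum T (gapSum T Q D M) Q x := by
  induction M with
  | zero => simp [birkhoffSum, gapSum]
  | succ M ih =>
    rw [mul_add, mul_one, birkhoffSum_add, ih]
    simp only [birkhoffSum, gapSum, Finset.sum_range_succ, Finset.sum_add_distrib]
    congr 1
    refine Finset.sum_congr rfl fun r _ => ?_
    rw [← Function.iterate_add_apply, ← Function.iterate_add_apply, add_comm, mul_comm]

lemma abs_birkhoffSum_le {D : X → ℝ} {B : ℝ} (hB : ∀ x, |D x| ≤ B) (n : ℕ) (x : X) :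
    |birkhoffSum T D n x| ≤ n * B := abs_sum_le_of_bdd hB n _

variable (hT : MeasurePreserving T μ μ)
include hT

lemma measurable_birkhoffSum {D : X → ℝ} (hD : Measurable D) (n : ℕ) :
    Measurable (birkhoffSum T D n) :=
  Finset.measurable_sum _ fun j _ => hD.comp (hT.measurable.iterate j)

lemma integral_birkhoffSum_rpow_le {p : ℝ} (hp : 1 ≤ p) {D : X → ℝ} (hD : Measurable D)
    (hDB : ∃ B, ∀ x, |D x| ≤ B) (n : ℕ) :
    ∫ x, |birkhoffSum T D n x| ^ p ∂μ ≤ (n : ℝ) ^ p * ∫ x, |D x| ^ p ∂μ := by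
  obtain ⟨B, hB⟩ := hDB
  have hp0 : 0 < p := by linarith
  rcases Nat.eq_zero_or_pos n with rfl | hn
  · simp [birkhoffSum, Real.zero_rpow hp0.ne']
  have hn0 : (0 : ℝ) < n := by exact_mod_cast hn
  have hi : ∀ (D : X → ℝ) (B : ℝ), Measurable D → (∀ x, |D x| ≤ B) →
      Integrable (fun x => |D x| ^ p) μ := fun D B hD hB =>
    integrable_of_bdd (hD.abs.pow_const p) (B := B ^ p) fun x => by
      rw [abs_of_nonneg (by positivity)]
      exact Real.rpow_le_rpow (abs_nonneg _) (hB x) hp0.le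
  have h1 : ∫ x, |birkhoffSum T D n x| ^ p ∂μ ≤
      ∫ x, (n : ℝ) ^ (p - 1) * ∑ i ∈ Finset.range n, |D (T^[i] x)| ^ p ∂μ := by
    refine integral_mono (hi _ _ (measurable_birkhoffSum hT hD n) (abs_birkhoffSum_le hB n))
      ((integrable_finsetSum _ fun i _ =>
        (hT.iterate i).integrable_comp_of_integrable (hi D B hD hB)).const_mul _) fun x => ?_
    have h2 := Real.rpow_sum_le_const_mul_sum_rpow (Finset.range n) (fun i => D (T^[i] x)) hp
    rw [Finset.card_range] at h2
    exact (Real.rpow_le_rpow (abs_nonneg _) (Finset.abs_sum_le_sum_abs _ _) hp0.le).trans h2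
  refine h1.trans (le_of_eq ?_)
  have hi' : ∀ i ∈ Finset.range n, Integrable (fun x => |D (T^[i] x)| ^ p) μ := fun i _ =>
    (hT.iterate i).integrable_comp_of_integrable (hi D B hD hB)
  rw [integral_const_mul, integral_finsetSum _ hi']
  rw [Finset.sum_congr rfl fun i _ => integral_comp_iterate hT (hD.abs.pow_const p) i]
  rw [Finset.sum_const, Finset.card_range, nsmul_eq_mul, ← mul_assoc, Real.rpow_sub_one hn0.ne',
    div_mul_cancel₀ _ hn0.ne']

/-- Moments of the Birkhoff sums of a function with a gap orthogonality property. -/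
lemma exists_integral_birkhoffSum_rpow_le {p : ℝ} (hp : 2 ≤ p) : ∃ K : ℝ, 0 < K ∧
    ∀ (D : X → ℝ), Measurable D → (∃ B, ∀ x, |D x| ≤ B) → ∀ Q : ℕ, IsOrth μ T Q D → ∀ M : ℕ,
      ∫ x, |birkhoffSum T D (Q * M) x| ^ p ∂μ ≤
        K * (Q : ℝ) ^ p * (M : ℝ) ^ (p / 2) * ∫ x, |D x| ^ p ∂μ := by
  obtain ⟨K, hK, h⟩ := exists_integral_gapSum_rpow_le hT hp
  refine ⟨K, hK, fun D hD hDB Q hQ M => ?_⟩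
  simp only [birkhoffSum_mul]
  refine (integral_birkhoffSum_rpow_le hT (by linarith) (measurable_gapSum hT hD Q M) ?_ Q).trans ?_
  · obtain ⟨B, hB⟩ := hDB
    exact ⟨M * B, fun x => abs_sum_le_of_bdd hB M _⟩
  · have h1 := mul_le_mul_of_nonneg_left (h D hD hDB Q hQ M)
      (by positivity : (0 : ℝ) ≤ (Q : ℝ) ^ p)
    refine h1.trans (le_of_eq (by ring))

-- Hoeffding's argument: on [-lB, lB] the exponential lies below its chord. The linear part of the
-- chord disappears after integration against a function of T^Q.
omit hT in
lemma exp_mul_le_cosh_add {B : ℝ} (hB : 0 < B) {d : ℝ} (hd : |d| ≤ B) (l : ℝ) :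
    Real.exp (l * d) ≤ Real.cosh (l * B) + d * (Real.sinh (l * B) / B) := by
  obtain ⟨h1, h2⟩ := abs_le.1 hd
  have hcc := convexOn_exp
  have hc := hcc.2 (mem_univ (l * B)) (mem_univ (-(l * B)))
    (show (0 : ℝ) ≤ (B + d) / (2 * B) from div_nonneg (by linarith) (by linarith))
    (show (0 : ℝ) ≤ (B - d) / (2 * B) from div_nonneg (by linarith) (by linarith))
    (by field_simp; ring)
  have e1 : (B + d) / (2 * B) * (l * B) + (B - d) / (2 * B) * -(l * B) = l * d := by
    field_simp; ring
  simp only [smul_eq_mul] at hc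
  rw [e1] at hc
  refine hc.trans (le_of_eq ?_)
  rw [Real.cosh_eq, Real.sinh_eq]
  field_simp
  ring

lemma integral_exp_gapSum_le {D : X → ℝ} (hD : Measurable D) {B : ℝ} (hB0 : 0 < B)
    (hB : ∀ x, |D x| ≤ B) {Q : ℕ} (hQ : IsOrth μ T Q D) (l : ℝ) (n : ℕ) :
    ∫ x, Real.exp (l * gapSum T Q D n x) ∂μ ≤ Real.exp (n * ((l * B) ^ 2 / 2)) := by
  have hWm : ∀ n, Measurable fun x => Real.exp (l * gapSum T Q D n x) := fun n =>
    Real.measurable_exp.comp ((measurable_gapSum hT hD Q n).const_mul l)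
  have hWB : ∀ n x, |Real.exp (l * gapSum T Q D n x)| ≤ Real.exp (|l| * (n * B)) := fun n x => by
    rw [abs_of_nonneg (Real.exp_nonneg _), Real.exp_le_exp]
    refine (le_abs_self _).trans ?_
    rw [abs_mul]
    exact mul_le_mul_of_nonneg_left (abs_sum_le_of_bdd hB n _) (abs_nonneg _)
  induction n with
  | zero => simp [gapSum]
  | succ n ih =>
    set g : X → ℝ := fun x => Real.exp (l * gapSum T Q D n x) with hg
    have hi1 : Integrable (fun x => g (T^[Q] x)) μ :=
      (hT.iterate Q).integrable_comp_of_integrable (integrable_of_bdd (hWm n) (hWB n))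
    have hi2 : Integrable (fun x => D x * g (T^[Q] x)) μ :=
      hi1.bdd_mul hD.aestronglyMeasurable (ae_of_all _ fun x => by simpa using hB x)
    have h1 : ∫ x, Real.exp (l * gapSum T Q D (n + 1) x) ∂μ ≤
        ∫ x, (Real.cosh (l * B) * g (T^[Q] x) +
          (Real.sinh (l * B) / B) * (D x * g (T^[Q] x))) ∂μ := by
      refine integral_mono (integrable_of_bdd (hWm (n + 1)) (hWB (n + 1)))
        ((hi1.const_mul _).add (hi2.const_mul _)) fun x => ?_
      simp only [gapSum_succ, mul_add, Real.exp_add]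
      have h2 := mul_le_mul_of_nonneg_left (exp_mul_le_cosh_add hB0 (hB x) l)
        (Real.exp_nonneg (l * gapSum T Q D n (T^[Q] x)))
      refine h2.trans (le_of_eq ?_)
      simp only [hg]
      ring
    rw [integral_add (hi1.const_mul _) (hi2.const_mul _), integral_const_mul, integral_const_mul,
      hQ g (hWm n) ⟨_, hWB n⟩, mul_zero, add_zero, integral_comp_iterate hT (hWm n)] at h1
    refine h1.trans ?_
    have h3 := mul_le_mul (Real.cosh_le_exp_half_sq (l * B)) ih
      (integral_nonneg fun x => Real.exp_nonneg _) (Real.exp_nonneg _)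
    refine h3.trans (le_of_eq ?_)
    rw [← Real.exp_add]
    congr 1
    push_cast
    ring

lemma measureReal_le_birkhoffSum_le_aux {D : X → ℝ} (hD : Measurable D) {B : ℝ} (hB0 : 0 < B)
    (hB : ∀ x, |D x| ≤ B) {Q : ℕ} (hQ : IsOrth μ T Q D) {M : ℕ} (hQ0 : 0 < Q) (hM0 : 0 < M)
    {t : ℝ} (ht : 0 ≤ t) :
    μ.real {x | t ≤ birkhoffSum T D (Q * M) x} ≤
      Real.exp (-(t ^ 2 / (2 * Q ^ 2 * M * B ^ 2))) := by
  have hQ' : (0 : ℝ) < Q := by exact_mod_cast hQ0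
  have hM' : (0 : ℝ) < M := by exact_mod_cast hM0
  set W := gapSum T Q D M with hW
  have hWm : Measurable W := measurable_gapSum hT hD Q M
  have hWB : ∀ x, |W x| ≤ M * B := fun x => abs_sum_le_of_bdd hB M _
  have hSm : Measurable (birkhoffSum T D (Q * M)) := measurable_birkhoffSum hT hD _
  -- This l minimises -l t + M (l Q B)² / 2.
  set l : ℝ := t / (Q ^ 2 * M * B ^ 2) with hl
  have hl0 : 0 ≤ l := by positivity
  have hexpB : ∀ (F : X → ℝ) (c : ℝ), Measurable F → (∀ x, |F x| ≤ c) → ∀ a : ℝ,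
      Integrable (fun x => Real.exp (a * F x)) μ := fun F c hF hc a =>
    integrable_of_bdd (Real.measurable_exp.comp (hF.const_mul a)) (B := Real.exp (|a| * c))
      fun x => by
        rw [abs_of_nonneg (Real.exp_nonneg _), Real.exp_le_exp]
        refine (le_abs_self _).trans ?_
        rw [abs_mul]
        exact mul_le_mul_of_nonneg_left (hc x) (abs_nonneg _)
  have h1 := ProbabilityTheory.measure_ge_le_exp_mul_mgf (μ := μ) (X := birkhoffSum T D (Q * M)) t hl0
    (hexpB _ _ hSm (abs_birkhoffSum_le hB _) l)
  refine h1.trans ?_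
  -- Jensen's inequality over the Q residue classes: each enters with weight 1 / Q and its sum is
  -- multiplied by Q.
  have h2 : ProbabilityTheory.mgf (birkhoffSum T D (Q * M)) μ l ≤
      ∫ x, ∑ r ∈ Finset.range Q, (1 / (Q : ℝ)) * Real.exp ((l * Q) * W (T^[r] x)) ∂μ := by
    refine integral_mono (hexpB _ _ hSm (abs_birkhoffSum_le hB _) l)
      (integrable_finsetSum _ fun r _ => ((hT.iterate r).integrable_comp_of_integrable
        (hexpB W _ hWm hWB (l * Q))).const_mul _) fun x => ?_
    have h3 := convexOn_exp.map_sum_le (t := Finset.range Q) (w := fun _ => 1 / (Q : ℝ))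
      (p := fun r => (l * Q) * W (T^[r] x)) (fun _ _ => by positivity)
      (by simp [hQ'.ne']) (fun _ _ => mem_univ _)
    simp only [smul_eq_mul] at h3
    refine le_trans (le_of_eq ?_) h3
    rw [birkhoffSum_mul, birkhoffSum, Finset.mul_sum]
    congr 1
    refine Finset.sum_congr rfl fun r _ => ?_
    field_simp
    rfl
  have h4 : ∫ x, ∑ r ∈ Finset.range Q, (1 / (Q : ℝ)) * Real.exp ((l * Q) * W (T^[r] x)) ∂μ =
      ∫ x, Real.exp ((l * Q) * W x) ∂μ := by
    have hi' : ∀ r ∈ Finset.range Q,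
        Integrable (fun x => (1 / (Q : ℝ)) * Real.exp ((l * Q) * W (T^[r] x))) μ := fun r _ =>
      ((hT.iterate r).integrable_comp_of_integrable (hexpB W _ hWm hWB (l * Q))).const_mul _
    rw [integral_finsetSum _ hi']
    simp only [integral_const_mul]
    have hWi : ∀ r, ∫ x, Real.exp (l * Q * W (T^[r] x)) ∂μ = ∫ x, Real.exp (l * Q * W x) ∂μ :=
      fun r => integral_comp_iterate hT (Real.measurable_exp.comp (hWm.const_mul (l * Q))) r
    simp only [hWi]
    rw [Finset.sum_const, Finset.card_range, nsmul_eq_mul, ← mul_assoc, mul_one_div_cancel hQ'.ne',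
      one_mul]
  rw [h4] at h2
  have h5 := h2.trans (integral_exp_gapSum_le hT hD hB0 hB hQ (l * Q) M)
  refine (mul_le_mul_of_nonneg_left h5 (Real.exp_nonneg _)).trans (le_of_eq ?_)
  rw [← Real.exp_add]
  congr 1
  rw [hl]
  field_simp
  ring

/-- Azuma's inequality for the Birkhoff sums of a function with a gap orthogonality property. -/
lemma measureReal_le_abs_birkhoffSum_le {D : X → ℝ} (hD : Measurable D) {B : ℝ} (hB0 : 0 < B)
    (hB : ∀ x, |D x| ≤ B) {Q : ℕ} (hQ : IsOrth μ T Q D) {M : ℕ} (hQ0 : 0 < Q) (hM0 : 0 < M)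
    {t : ℝ} (ht : 0 ≤ t) :
    μ.real {x | t ≤ |birkhoffSum T D (Q * M) x|} ≤
      2 * Real.exp (-(t ^ 2 / (2 * Q ^ 2 * M * B ^ 2))) := by
  have h1 := measureReal_le_birkhoffSum_le_aux hT hD hB0 hB hQ hQ0 hM0 ht
  have hQn : IsOrth μ T Q (fun x => -D x) := fun g hg hgB => by
    simp only [neg_mul, integral_neg, hQ g hg hgB, neg_zero]
  have h2 := measureReal_le_birkhoffSum_le_aux (D := fun x => -D x) hT hD.neg hB0
    (by simpa using hB) hQn hQ0 hM0 ht
  have h3 : {x | t ≤ |birkhoffSum T D (Q * M) x|} ⊆ {x | t ≤ birkhoffSum T D (Q * M) x} ∪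
      {x | t ≤ birkhoffSum T (fun x => -D x) (Q * M) x} := by
    intro x hx
    rcases le_abs.1 (show t ≤ |birkhoffSum T D (Q * M) x| from hx) with h | h
    · exact Or.inl h
    · refine Or.inr ?_
      simpa [birkhoffSum] using h
  refine (measureReal_mono h3).trans ((measureReal_union_le _ _).trans ?_)
  linarith

end OrthogonalSums

/-! ### From dyadic times to all large times; polynomial bounds. -/

section Chaining

variable {X : Type*} [MeasurableSpace X] {μ : Measure X} [IsProbabilityMeasure μ] {T : X → X}

lemma measureReal_iUnion_le_tsum {s : ℕ → Set X} {b : ℕ → ℝ} (h : ∀ i, μ.real (s i) ≤ b i)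
    (hb : Summable b) : μ.real (⋃ i, s i) ≤ ∑' i, b i := by
  have hb0 : ∀ i, 0 ≤ b i := fun i => measureReal_nonneg.trans (h i)
  refine ENNReal.toReal_le_of_le_ofReal (tsum_nonneg hb0) ?_
  rw [ENNReal.ofReal_tsum_of_nonneg hb0 hb]
  refine (measure_iUnion_le s).trans (ENNReal.tsum_le_tsum fun i => ?_)
  rw [← ofReal_measureReal]
  exact ENNReal.ofReal_le_ofReal (h i)

/-- Dyadic decomposition of an orbit segment. -/
lemma abs_birkhoffSum_le_of_dyadic (T : X → X) (Y : X → ℝ) {a : ℕ → ℝ} (ha : ∀ l, 0 ≤ a l) (L : ℕ)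
    (x : X) (h : ∀ l < L, ∀ i < 2 ^ (L - l), |birkhoffSum T Y (2 ^ l) (T^[i * 2 ^ l] x)| < a l)
    {j : ℕ} (hj : j < 2 ^ L) : |birkhoffSum T Y j x| ≤ ∑ l ∈ Finset.range L, a l := by
  induction L generalizing x j with
  | zero =>
    have : j = 0 := by simpa using hj
    simp [this]
  | succ L ih =>
    rw [Finset.sum_range_succ]
    rcases lt_or_ge j (2 ^ L) with hjL | hjL
    · refine (ih x (fun l hl i hi => h l (by omega) i (hi.trans_le ?_)) hjL).trans
        (le_add_of_nonneg_right (ha L))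
      exact Nat.pow_le_pow_right (by norm_num) (by omega)
    -- The segment is the block [0, 2^L) followed by a segment shorter than 2^L, whose blocks of
    -- length 2^l have indices shifted by 2^(L - l).
    · obtain ⟨j', rfl⟩ := Nat.exists_eq_add_of_le hjL
      rw [birkhoffSum_add, add_comm]
      refine (abs_add_le _ _).trans (add_le_add (ih _ (fun l hl i hi => ?_) ?_) ?_)
      · have h1 := h l (by omega) (i + 2 ^ (L - l)) (by
          rw [show L + 1 - l = (L - l) + 1 by omega, pow_succ]; omega)
        have e : (i + 2 ^ (L - l)) * 2 ^ l = i * 2 ^ l + 2 ^ L := by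
          rw [add_mul, ← pow_add, Nat.sub_add_cancel hl.le]
        rwa [e, Function.iterate_add_apply] at h1
      · rw [pow_succ] at hj; omega
      · simpa using (h L (by omega) 0 (by positivity)).le

lemma measureReal_preimage_iterate (hT : MeasurePreserving T μ μ) {s : Set X}
    (hs : MeasurableSet s) (n : ℕ) : μ.real (T^[n] ⁻¹' s) = μ.real s := by
  rw [Measure.real, (hT.iterate n).measure_preimage hs.nullMeasurableSet, Measure.real]

/-- Deviations of all sufficiently long Birkhoff sums in terms of deviations of dyadic ones. -/
lemma measureReal_exists_lt_abs_birkhoffSum_le (hT : MeasurePreserving T μ μ) {Y : X → ℝ}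
    (hY : Measurable Y) {e : ℝ} {a : ℕ → ℕ → ℝ} (ha : ∀ L l, 0 ≤ a L l)
    (hae : ∀ L, ∑ l ∈ Finset.range (L + 1), a L l ≤ e * 2 ^ L) (he : 0 ≤ e) {n L₀ : ℕ}
    (hn : 2 ^ L₀ ≤ n)
    {b : ℕ → ℝ} (hb : ∀ j, ∑ l ∈ Finset.range (L₀ + j + 1), (2 : ℝ) ^ (L₀ + j + 1 - l) *
      μ.real {x | a (L₀ + j) l ≤ |birkhoffSum T Y (2 ^ l) x|} ≤ b j) (hbs : Summable b) :
    μ.real {x | ∃ j, n ≤ j ∧ e * j < |birkhoffSum T Y j x|} ≤ ∑' j, b j := by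
  have hm : ∀ (c : ℝ) (l : ℕ), MeasurableSet {x | c ≤ |birkhoffSum T Y l x|} := fun c l =>
    measurableSet_le measurable_const (measurable_birkhoffSum hT hY l).abs
  -- The bad set of scale L = L₀ + j: some dyadic block of length 2^l inside [0, 2^(L+1)) exceeds
  -- its allowance. Outside it, all sums of length k with 2^L ≤ k < 2^(L+1) are at most e 2^L ≤ e k.
  set s : ℕ → Set X := fun j => ⋃ l ∈ Finset.range (L₀ + j + 1), ⋃ i ∈ Finset.range (2 ^ (L₀ + j + 1 - l)),
    T^[i * 2 ^ l] ⁻¹' {x | a (L₀ + j) l ≤ |birkhoffSum T Y (2 ^ l) x|} with hs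
  have hsub : {x | ∃ j, n ≤ j ∧ e * j < |birkhoffSum T Y j x|} ⊆ ⋃ j, s j := by
    rintro x ⟨k, hnk, hk⟩
    have hk0 : k ≠ 0 := by
      rintro rfl
      have : 0 < 2 ^ L₀ := by positivity
      omega
    have hL : L₀ ≤ Nat.log 2 k := (Nat.le_log_iff_pow_le (by norm_num) hk0).2 (hn.trans hnk)
    obtain ⟨j, hj⟩ := Nat.exists_eq_add_of_le hL
    refine mem_iUnion.2 ⟨j, ?_⟩
    by_contra hx
    simp only [hs, mem_iUnion, Finset.mem_range, mem_preimage, not_exists] at hx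
    have h1 := abs_birkhoffSum_le_of_dyadic T Y (ha (L₀ + j)) (L₀ + j + 1) x
      (fun l hl i hi => not_le.1 (hx l hl i hi)) (j := k)
      (by rw [← hj]; exact Nat.lt_pow_succ_log_self (by norm_num) k)
    have h2 : (2 : ℝ) ^ (L₀ + j) ≤ k := by
      rw [← hj]; exact_mod_cast Nat.pow_log_le_self 2 hk0
    have h3 := mul_le_mul_of_nonneg_left h2 he
    exact absurd hk (not_lt.2 ((h1.trans (hae _)).trans h3))
  refine (measureReal_mono hsub).trans (measureReal_iUnion_le_tsum (fun j => le_trans ?_ (hb j)) hbs)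
  refine (measureReal_biUnion_finset_le _ _).trans (Finset.sum_le_sum fun l _ => ?_)
  refine (measureReal_biUnion_finset_le _ _).trans (le_of_eq ?_)
  simp only [measureReal_preimage_iterate hT (hm _ _)]
  simp

lemma sum_range_rpow_neg_le {u : ℝ} (hu : 0 < u) (L : ℕ) :
    ∑ l ∈ Finset.range (L + 1), (2 : ℝ) ^ (-u * ((L : ℝ) - l)) ≤ (1 - (2 : ℝ) ^ (-u))⁻¹ := by
  have h1 : (2 : ℝ) ^ (-u) < 1 := Real.rpow_lt_one_of_one_lt_of_neg (by norm_num) (by linarith)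
  have h0 : (0 : ℝ) < (2 : ℝ) ^ (-u) := by positivity
  rw [← Finset.sum_range_reflect]
  rw [← tsum_geometric_of_lt_one h0.le h1]
  have h2 : ∀ j ∈ Finset.range (L + 1), (2 : ℝ) ^ (-u * ((L : ℝ) - ((L + 1 - 1 - j : ℕ) : ℝ))) =
      ((2 : ℝ) ^ (-u)) ^ j := by
    intro j hj
    have hj' : j ≤ L := by simpa [Nat.lt_succ_iff] using hj
    rw [← Real.rpow_natCast, ← Real.rpow_mul (by norm_num), show L + 1 - 1 - j = L - j by omega,
      Nat.cast_sub hj']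
    congr 1
    ring
  rw [Finset.sum_congr rfl h2]
  exact (summable_geometric_of_lt_one h0.le h1).sum_le_tsum _ fun j _ => by positivity

lemma rpow_neg_lt_one {u : ℝ} (hu : 0 < u) : (2 : ℝ) ^ (-u) < 1 :=
  Real.rpow_lt_one_of_one_lt_of_neg (by norm_num) (by linarith)

/-- Polynomial maximal large deviations from polynomial large deviations at dyadic times. -/
lemma exists_measureReal_exists_lt_le_of_poly (hT : MeasurePreserving T μ μ) {α p : ℝ} (hα : 0 < α)
    (hp : 1 + α < p) (K : ℝ) : ∃ K' : ℝ, 0 < K' ∧ ∀ Y : X → ℝ, Measurable Y → ∀ D : ℝ, 0 ≤ D →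
      (∀ (l : ℕ) (e : ℝ), 0 < e → μ.real {x | e * 2 ^ l ≤ |birkhoffSum T Y (2 ^ l) x|} ≤
        K * D * e ^ (-p) * (2 : ℝ) ^ (-α * l)) →
      ∀ (n : ℕ) (e : ℝ), 1 ≤ n → 0 < e →
        μ.real {x | ∃ j, n ≤ j ∧ e * j < |birkhoffSum T Y j x|} ≤
          K' * D * e ^ (-p) * (n : ℝ) ^ (-α) := by
  have hp0 : 0 < p := by linarith
  -- A block of length 2^l is allowed the fraction w 2^(-δ(L-l)) of e 2^L, with w normalising the
  -- sum. There are 2^(L+1-l) such blocks, and the exponents combine to 2^(-αL)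
  -- 2^(-(p-1-α-δp)(L-l)); taking δ p as half of p - 1 - α leaves the summable factor 2^(-u(L-l)).
  set δ : ℝ := (p - 1 - α) / (2 * p) with hδ
  have hδ0 : 0 < δ := div_pos (by linarith) (by linarith)
  set u : ℝ := (p - 1 - α) / 2 with hu
  have hu0 : 0 < u := by rw [hu]; linarith
  have hδp : δ * p = u := by rw [hδ, hu]; field_simp
  set w : ℝ := 1 - (2 : ℝ) ^ (-δ) with hw
  have hw0 : 0 < w := by have := rpow_neg_lt_one hδ0; rw [hw]; linarith
  set g : ℝ := (1 - (2 : ℝ) ^ (-u))⁻¹ with hg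
  have hg0 : 0 < g := by have := rpow_neg_lt_one hu0; exact inv_pos.2 (by linarith)
  have hgα : 0 < (1 - (2 : ℝ) ^ (-α))⁻¹ := by
    have := rpow_neg_lt_one hα; exact inv_pos.2 (by linarith)
  refine ⟨2 * |K| * w ^ (-p) * g * 2 ^ α * (1 - (2 : ℝ) ^ (-α))⁻¹ + 1, by positivity,
    fun Y hY D hD h n e hn he => ?_⟩
  have hn0 : n ≠ 0 := by omega
  set L₀ := Nat.log 2 n with hL₀
  have hbsum : HasSum (fun j : ℕ => 2 * |K| * D * w ^ (-p) * e ^ (-p) * g * (2 : ℝ) ^ (-α * L₀) *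
      ((2 : ℝ) ^ (-α)) ^ j) (2 * |K| * D * w ^ (-p) * e ^ (-p) * g * (2 : ℝ) ^ (-α * L₀) *
        (1 - (2 : ℝ) ^ (-α))⁻¹) :=
    (hasSum_geometric_of_lt_one (by positivity) (rpow_neg_lt_one hα)).mul_left _
  have hmain := measureReal_exists_lt_abs_birkhoffSum_le hT hY (e := e) (n := n) (L₀ := L₀)
    (a := fun L l => (e * w * (2 : ℝ) ^ ((1 - δ) * ((L : ℝ) - l))) * 2 ^ l)
    (fun L l => by positivity) (fun L => ?_) he.le (Nat.pow_log_le_self 2 hn0)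
    (b := fun j => 2 * |K| * D * w ^ (-p) * e ^ (-p) * g * (2 : ℝ) ^ (-α * L₀) *
      ((2 : ℝ) ^ (-α)) ^ j) (fun j => ?_) hbsum.summable
  · rw [hbsum.tsum_eq] at hmain
    refine hmain.trans ?_
    have h1 : (2 : ℝ) ^ (-α * L₀) ≤ 2 ^ α * (n : ℝ) ^ (-α) := by
      have h2 : (n : ℝ) ≤ 2 ^ ((L₀ : ℝ) + 1) := by
        rw [← Nat.cast_succ, Real.rpow_natCast]
        exact_mod_cast (Nat.lt_pow_succ_log_self (by norm_num) n).le
      have hn' : (0 : ℝ) < n := by positivity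
      have h3 := Real.rpow_le_rpow hn'.le h2 hα.le
      rw [← Real.rpow_mul (by norm_num)] at h3
      rw [Real.rpow_neg hn'.le, ← div_eq_mul_inv, le_div_iff₀ (by positivity)]
      refine (mul_le_mul_of_nonneg_left h3 (by positivity)).trans (le_of_eq ?_)
      rw [← Real.rpow_add (by norm_num)]
      congr 1
      ring
    have h4 : 0 ≤ D * e ^ (-p) * (n : ℝ) ^ (-α) := by positivity
    calc _ ≤ 2 * |K| * D * w ^ (-p) * e ^ (-p) * g * (2 ^ α * (n : ℝ) ^ (-α)) *
        (1 - (2 : ℝ) ^ (-α))⁻¹ := by gcongr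
      _ ≤ _ := by nlinarith
  · have h1 : ∀ l ∈ Finset.range (L + 1), e * w * (2 : ℝ) ^ ((1 - δ) * ((L : ℝ) - l)) * 2 ^ l =
        e * w * 2 ^ L * (2 : ℝ) ^ (-δ * ((L : ℝ) - l)) := by
      intro l _
      rw [← Real.rpow_natCast 2 l, ← Real.rpow_natCast 2 L, mul_assoc (e * w), mul_assoc (e * w),
        ← Real.rpow_add (by norm_num), ← Real.rpow_add (by norm_num)]
      congr 2
      ring
    rw [Finset.sum_congr rfl h1, ← Finset.mul_sum]
    have h2 := mul_le_mul_of_nonneg_left (sum_range_rpow_neg_le hδ0 L)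
      (by positivity : 0 ≤ e * w * 2 ^ L)
    refine h2.trans (le_of_eq ?_)
    rw [← hw]
    field_simp
  · set L := L₀ + j with hL
    have h1 : ∀ l ∈ Finset.range (L + 1), (2 : ℝ) ^ (L + 1 - l) * μ.real {x | e * w *
        (2 : ℝ) ^ ((1 - δ) * ((L : ℝ) - l)) * 2 ^ l ≤ |birkhoffSum T Y (2 ^ l) x|} ≤
        2 * |K| * D * w ^ (-p) * e ^ (-p) * (2 : ℝ) ^ (-α * L) * (2 : ℝ) ^ (-u * ((L : ℝ) - l)) := by
      intro l hl
      have hl' : l ≤ L := by simpa [Nat.lt_succ_iff] using hl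
      have h2 := h l (e * w * (2 : ℝ) ^ ((1 - δ) * ((L : ℝ) - l))) (by positivity)
      have h3 := mul_le_mul_of_nonneg_left h2 (by positivity : (0 : ℝ) ≤ (2 : ℝ) ^ (L + 1 - l))
      refine h3.trans ?_
      have h4 : (2 : ℝ) ^ (L + 1 - l) = 2 * (2 : ℝ) ^ ((L : ℝ) - l) := by
        rw [← Nat.cast_sub hl', Real.rpow_natCast, ← pow_succ']
        congr 1
        omega
      rw [h4, Real.mul_rpow (by positivity) (by positivity), Real.mul_rpow he.le hw0.le,
        ← Real.rpow_mul (by norm_num)]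
      have h5 : (2 : ℝ) ^ ((L : ℝ) - l) * (2 : ℝ) ^ ((1 - δ) * ((L : ℝ) - l) * -p) *
          (2 : ℝ) ^ (-α * (l : ℝ)) = (2 : ℝ) ^ (-α * L) * (2 : ℝ) ^ (-u * ((L : ℝ) - l)) := by
        rw [← Real.rpow_add (by norm_num), ← Real.rpow_add (by norm_num),
          ← Real.rpow_add (by norm_num)]
        congr 1
        have : (1 - δ) * ((L : ℝ) - l) * -p = (-p + δ * p) * ((L : ℝ) - l) := by ring
        rw [this, hδp, hu]
        ring
      calc _ = 2 * K * D * w ^ (-p) * e ^ (-p) * ((2 : ℝ) ^ ((L : ℝ) - l) *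
            (2 : ℝ) ^ ((1 - δ) * ((L : ℝ) - l) * -p) * (2 : ℝ) ^ (-α * (l : ℝ))) := by ring
        _ = 2 * K * D * w ^ (-p) * e ^ (-p) * ((2 : ℝ) ^ (-α * L) *
            (2 : ℝ) ^ (-u * ((L : ℝ) - l))) := by rw [h5]
        _ ≤ 2 * |K| * D * w ^ (-p) * e ^ (-p) * ((2 : ℝ) ^ (-α * L) *
            (2 : ℝ) ^ (-u * ((L : ℝ) - l))) := by gcongr; exact le_abs_self K
        _ = _ := by ring
    refine (Finset.sum_le_sum h1).trans ?_
    rw [← Finset.mul_sum]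
    have h2 := mul_le_mul_of_nonneg_left (sum_range_rpow_neg_le hu0 L)
      (by positivity : 0 ≤ 2 * |K| * D * w ^ (-p) * e ^ (-p) * (2 : ℝ) ^ (-α * L))
    refine h2.trans (le_of_eq ?_)
    have h6 : (2 : ℝ) ^ (-α * (L : ℝ)) = (2 : ℝ) ^ (-α * L₀) * ((2 : ℝ) ^ (-α)) ^ j := by
      rw [← Real.rpow_natCast _ j, ← Real.rpow_mul (by norm_num), ← Real.rpow_add (by norm_num), hL]
      congr 1
      push_cast
      ring
    rw [h6]
    ring

end Chaining

/-! ### From dyadic times to all large times; stretched exponential bounds. -/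

section ExponentialChaining

/-- The exponential of c z^θ dominates a single term of its series, of degree n ≥ k / θ. -/
lemma exists_pow_mul_exp_neg_rpow_le (k : ℕ) {c θ : ℝ} (hc : 0 < c) (hθ : 0 < θ) :
    ∃ C : ℝ, 0 < C ∧ ∀ z : ℝ, 1 ≤ z → z ^ k * Real.exp (-c * z ^ θ) ≤ C := by
  obtain ⟨n, hn⟩ := exists_nat_ge ((k : ℝ) / θ)
  refine ⟨n.factorial / c ^ n, by positivity, fun z hz => ?_⟩
  have hz0 : 0 < z := by linarith
  have h1 := Real.pow_div_factorial_le_exp (c * z ^ θ) (by positivity) n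
  have h2 : z ^ k ≤ (z ^ θ) ^ n := by
    rw [← Real.rpow_natCast, ← Real.rpow_natCast, ← Real.rpow_mul hz0.le]
    exact Real.rpow_le_rpow_of_exponent_le hz (by rwa [div_le_iff₀ hθ, mul_comm] at hn)
  rw [neg_mul, Real.exp_neg, ← div_eq_mul_inv, div_le_iff₀ (Real.exp_pos _)]
  have h3 : (0 : ℝ) < n.factorial := by positivity
  have h4 : (0 : ℝ) < c ^ n := by positivity
  have h5 := mul_le_mul_of_nonneg_left h1 (by positivity : (0 : ℝ) ≤ n.factorial / c ^ n)
  refine h2.trans (le_trans (le_of_eq ?_) h5)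
  rw [mul_pow]
  field_simp

/-- One half of the exponent is kept for the final bound, the other half is spent on making the sum
over blocks and scales converge. -/
lemma neg_mul_le_of_le {c a U s V : ℝ} (hc : 0 < c) (ha : 0 ≤ a) (haU : a ≤ U) (hs : 1 ≤ s)
    (hV : U * s ≤ V) : -c * V ≤ -(c * U / 2) + -(c * a / 2) * s := by
  have h1 : U ≤ U * s := le_mul_of_one_le_right (ha.trans haU) hs
  have h2 : a * s ≤ U * s := mul_le_mul_of_nonneg_right haU (by linarith)
  have h3 : (U + a * s) / 2 ≤ V := by linarith
  have h4 := mul_le_mul_of_nonneg_left h3 hc.le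
  linarith

variable {X : Type*} [MeasurableSpace X] {μ : Measure X} [IsProbabilityMeasure μ] {T : X → X}

set_option maxHeartbeats 800000 in
/-- Stretched exponential maximal large deviations from stretched exponential large deviations at
dyadic times. -/
lemma exists_measureReal_exists_lt_le_of_exp (hT : MeasurePreserving T μ μ) {c θ : ℝ} (hc : 0 < c)
    (hθ : 0 < θ) (K : ℝ) : ∃ K' c' : ℝ, 0 < K' ∧ 0 < c' ∧ ∀ Y : X → ℝ, Measurable Y →
      (∀ (l : ℕ) (e : ℝ), 0 < e → μ.real {x | e * 2 ^ l ≤ |birkhoffSum T Y (2 ^ l) x|} ≤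
        K * Real.exp (-c * (2 ^ l * e ^ 2) ^ θ)) →
      ∀ (n : ℕ) (e : ℝ), 1 ≤ n → 0 < e →
        μ.real {x | ∃ j, n ≤ j ∧ e * j < |birkhoffSum T Y j x|} ≤
          K' * Real.exp (-c' * (n * e ^ 2) ^ θ) := by
  set w : ℝ := 1 - (2 : ℝ) ^ (-(1 / 4) : ℝ) with hw
  have hw0 : 0 < w := by have := rpow_neg_lt_one (u := 1 / 4) (by norm_num); rw [hw]; linarith
  set a₀ : ℝ := (w ^ 2 / 2) ^ θ with ha₀
  have ha₀0 : 0 < a₀ := by positivity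
  obtain ⟨C, hC, hCb⟩ := exists_pow_mul_exp_neg_rpow_le 4 (c := c * a₀ / 2) (by positivity) hθ
  refine ⟨8 * |K| * C + Real.exp (c * a₀ / 2), c * a₀ / 2, by positivity, by positivity,
    fun Y hY h n e hn he => ?_⟩
  have hn0 : n ≠ 0 := by omega
  have hn' : (1 : ℝ) ≤ n := by exact_mod_cast hn
  -- For n e² < 1 the second summand of the constant makes the right side at least 1.
  rcases lt_or_ge (n * e ^ 2) 1 with hsmall | hlarge
  · have h1 : (n * e ^ 2) ^ θ ≤ 1 := Real.rpow_le_one (by positivity) hsmall.le hθ.le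
    have h2 : (1 : ℝ) ≤ Real.exp (c * a₀ / 2) * Real.exp (-(c * a₀ / 2) * (n * e ^ 2) ^ θ) := by
      rw [← Real.exp_add]
      refine Real.one_le_exp ?_
      nlinarith [mul_pos hc ha₀0]
    refine (measureReal_le_one).trans (h2.trans ?_)
    gcongr
    have : 0 ≤ 8 * |K| * C := by positivity
    linarith
  set L₀ := Nat.log 2 n with hL₀
  set U : ℝ := a₀ * (n * e ^ 2) ^ θ with hU
  have hne : 1 ≤ (n * e ^ 2) ^ θ := Real.one_le_rpow hlarge hθ.le
  have hUa : a₀ ≤ U := by rw [hU]; nlinarith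
  have hbsum : HasSum (fun j : ℕ => 4 * |K| * C * Real.exp (-(c * U / 2)) * (1 / 2 : ℝ) ^ j)
      (4 * |K| * C * Real.exp (-(c * U / 2)) * 2) := by
    have := hasSum_geometric_two.mul_left (4 * |K| * C * Real.exp (-(c * U / 2)))
    exact this
  have hnL : (n : ℝ) ≤ 2 * 2 ^ L₀ := by
    rw [← pow_succ']
    exact_mod_cast (Nat.lt_pow_succ_log_self (by norm_num) n).le
  have hmain := measureReal_exists_lt_abs_birkhoffSum_le hT hY (e := e) (n := n) (L₀ := L₀)
    (a := fun L l => (e * w * (2 : ℝ) ^ ((3 / 4 : ℝ) * ((L : ℝ) - l))) * 2 ^ l)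
    (fun L l => by positivity) (fun L => ?_) he.le (Nat.pow_log_le_self 2 hn0)
    (b := fun j => 4 * |K| * C * Real.exp (-(c * U / 2)) * (1 / 2 : ℝ) ^ j) (fun j => ?_)
    hbsum.summable
  · rw [hbsum.tsum_eq] at hmain
    refine hmain.trans ?_
    have h1 : -(c * a₀ / 2) * (n * e ^ 2) ^ θ = -(c * U / 2) := by rw [hU]; ring
    rw [h1]
    have h2 := Real.exp_pos (-(c * U / 2))
    have h3 := Real.exp_pos (c * a₀ / 2)
    nlinarith [mul_pos h2 h3]
  · have h1 : ∀ l ∈ Finset.range (L + 1), e * w * (2 : ℝ) ^ ((3 / 4 : ℝ) * ((L : ℝ) - l)) * 2 ^ l =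
        e * w * 2 ^ L * (2 : ℝ) ^ (-(1 / 4 : ℝ) * ((L : ℝ) - l)) := by
      intro l _
      rw [← Real.rpow_natCast 2 l, ← Real.rpow_natCast 2 L, mul_assoc (e * w), mul_assoc (e * w),
        ← Real.rpow_add (by norm_num), ← Real.rpow_add (by norm_num)]
      congr 2
      ring
    rw [Finset.sum_congr rfl h1, ← Finset.mul_sum]
    have h2 := mul_le_mul_of_nonneg_left (sum_range_rpow_neg_le (u := 1 / 4) (by norm_num) L)
      (by positivity : 0 ≤ e * w * 2 ^ L)
    refine h2.trans (le_of_eq ?_)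
    rw [← hw]
    field_simp
  · set L := L₀ + j with hL
    have h1 : ∀ l ∈ Finset.range (L + 1), (2 : ℝ) ^ (L + 1 - l) * μ.real {x | e * w *
        (2 : ℝ) ^ ((3 / 4 : ℝ) * ((L : ℝ) - l)) * 2 ^ l ≤ |birkhoffSum T Y (2 ^ l) x|} ≤
        2 * |K| * C * Real.exp (-(c * U / 2)) * (1 / 2 : ℝ) ^ j *
          (2 : ℝ) ^ (-1 * ((L : ℝ) - l)) := by
      intro l hl
      have hl' : l ≤ L := by simpa [Nat.lt_succ_iff] using hl
      have h2 := h l (e * w * (2 : ℝ) ^ ((3 / 4 : ℝ) * ((L : ℝ) - l))) (by positivity)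
      have h3 := mul_le_mul_of_nonneg_left h2 (by positivity : (0 : ℝ) ≤ (2 : ℝ) ^ (L + 1 - l))
      refine h3.trans ?_
      obtain ⟨m, hm⟩ := Nat.exists_eq_add_of_le hl'
      have hLl : (L : ℝ) - l = m := by rw [hm]; push_cast; ring
      rw [hLl, show L + 1 - l = m + 1 by omega]
      -- With allowances 2^(-(L-l)/4), the quantity 2^l e² of a block is 2^L₀ e² z up to a constant.
      -- The factor z⁻⁴ = 2^(-4j) 2^(-2m) pays for the 2^(m+1) blocks and leaves geometric decay in
      -- both j and m.
      set z : ℝ := 2 ^ j * (2 : ℝ) ^ ((m : ℝ) / 2) with hz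
      have hz1 : 1 ≤ z := by
        have h4 : (1 : ℝ) ≤ 2 ^ j := one_le_pow₀ (by norm_num)
        have h5 : (1 : ℝ) ≤ (2 : ℝ) ^ ((m : ℝ) / 2) := Real.one_le_rpow (by norm_num) (by positivity)
        rw [hz]; nlinarith
      have hz0 : 0 < z := by linarith
      have e1 : (2 : ℝ) ^ l * (e * w * (2 : ℝ) ^ ((3 / 4 : ℝ) * (m : ℝ))) ^ 2 =
          w ^ 2 * e ^ 2 * 2 ^ L₀ * z := by
        have : (2 : ℝ) ^ l * ((2 : ℝ) ^ ((3 / 4 : ℝ) * (m : ℝ))) ^ 2 = 2 ^ L₀ * z := by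
          rw [hz, ← mul_assoc, ← pow_add, ← hL, hm, ← Real.rpow_natCast 2 l,
            ← Real.rpow_natCast 2 (l + m),
            ← Real.rpow_natCast _ 2, ← Real.rpow_mul (by norm_num), ← Real.rpow_add (by norm_num),
            ← Real.rpow_add (by norm_num)]
          congr 1
          push_cast
          ring
        rw [mul_pow, mul_pow]
        linear_combination (e ^ 2 * w ^ 2) * this
      have h4 : U * z ^ θ ≤ ((2 : ℝ) ^ l * (e * w * (2 : ℝ) ^ ((3 / 4 : ℝ) * (m : ℝ))) ^ 2) ^ θ := by
        rw [e1, hU, ha₀, ← Real.mul_rpow (by positivity) (by positivity),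
          ← Real.mul_rpow (by positivity) (by positivity)]
        refine Real.rpow_le_rpow (by positivity) ?_ hθ.le
        refine mul_le_mul_of_nonneg_right ?_ hz0.le
        nlinarith [mul_le_mul_of_nonneg_left hnL (by positivity : 0 ≤ w ^ 2 * e ^ 2)]
      have hzθ : 1 ≤ z ^ θ := Real.one_le_rpow hz1 hθ.le
      have h5 : -c * ((2 : ℝ) ^ l * (e * w * (2 : ℝ) ^ ((3 / 4 : ℝ) * (m : ℝ))) ^ 2) ^ θ ≤
          -(c * U / 2) + -(c * a₀ / 2) * z ^ θ := by
        exact neg_mul_le_of_le hc ha₀0.le hUa hzθ h4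
      have h6 : Real.exp (-c * ((2 : ℝ) ^ l * (e * w * (2 : ℝ) ^ ((3 / 4 : ℝ) * (m : ℝ))) ^ 2) ^ θ) ≤
          Real.exp (-(c * U / 2)) * (C / z ^ 4) := by
        refine (Real.exp_le_exp.2 h5).trans ?_
        rw [Real.exp_add]
        refine mul_le_mul_of_nonneg_left ?_ (Real.exp_nonneg _)
        rw [le_div_iff₀ (by positivity), mul_comm]
        exact hCb z hz1
      have hz4 : z ^ 4 = 2 ^ (4 * j) * 2 ^ (2 * m) := by
        rw [hz, mul_pow, ← pow_mul, mul_comm j 4, ← Real.rpow_natCast ((2 : ℝ) ^ ((m : ℝ) / 2)) 4,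
          ← Real.rpow_mul (by norm_num)]
        congr 1
        rw [← Real.rpow_natCast 2 (2 * m)]
        congr 1
        push_cast
        ring
      have e2 : (2 : ℝ) ^ (-1 * (m : ℝ)) = 1 / 2 ^ m := by
        rw [neg_one_mul, Real.rpow_neg (by norm_num), Real.rpow_natCast, one_div]
      rw [e2]
      have h7 : (2 : ℝ) ^ (m + 1) / z ^ 4 ≤ 2 * (1 / 2 : ℝ) ^ j * (1 / 2 ^ m) := by
        rw [hz4, div_le_iff₀ (by positivity), one_div_pow]
        have h8 : (2 : ℝ) ^ (2 * m) = 2 ^ m * 2 ^ m := by rw [two_mul, pow_add]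
        have h9 : (2 : ℝ) ^ (4 * j) = 2 ^ j * 2 ^ (3 * j) := by rw [← pow_add]; congr 1; ring
        have h10 : (1 : ℝ) ≤ 2 ^ (3 * j) := one_le_pow₀ (by norm_num)
        rw [h8, h9, pow_succ]
        have h11 : 2 * (1 / (2 : ℝ) ^ j) * (1 / 2 ^ m) * (2 ^ j * 2 ^ (3 * j) * (2 ^ m * 2 ^ m)) =
          2 * 2 ^ (3 * j) * 2 ^ m := by field_simp
        rw [h11]
        have h12 : (0 : ℝ) < 2 ^ m := by positivity
        nlinarith
      calc _ ≤ (2 : ℝ) ^ (m + 1) * (|K| * (Real.exp (-(c * U / 2)) * (C / z ^ 4))) := by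
            gcongr
            exact le_abs_self K
        _ = |K| * C * Real.exp (-(c * U / 2)) * ((2 : ℝ) ^ (m + 1) / z ^ 4) := by ring
        _ ≤ |K| * C * Real.exp (-(c * U / 2)) * (2 * (1 / 2 : ℝ) ^ j * (1 / 2 ^ m)) := by gcongr
        _ = _ := by ring
    refine (Finset.sum_le_sum h1).trans ?_
    rw [← Finset.mul_sum]
    have h2 := mul_le_mul_of_nonneg_left (sum_range_rpow_neg_le (u := 1) (by norm_num) L)
      (by positivity : 0 ≤ 2 * |K| * C * Real.exp (-(c * U / 2)) * (1 / 2 : ℝ) ^ j)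
    refine h2.trans (le_of_eq ?_)
    have : (1 - (2 : ℝ) ^ (-1 : ℝ))⁻¹ = 2 := by
      rw [Real.rpow_neg_one]; norm_num
    rw [this]
    ring

end ExponentialChaining

/-! ### Decomposition of a Birkhoff sum along the scales 2^r. -/

section MultiScale

variable {X Z : Type*} [MeasurableSpace X] [MeasurableSpace Z] {μ : Measure X} {ζ : Measure Z}
  [IsProbabilityMeasure μ] [IsProbabilityMeasure ζ] {T : X → X} {F : Z → Z} {q : X → Z}

lemma IsOrth.add {Q : ℕ} {D : Z → ℝ} (hF : MeasurePreserving F ζ ζ) (h : IsOrth ζ F Q D) (j : ℕ) :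
    IsOrth ζ F (Q + j) D := by
  rintro g hg ⟨B, hB⟩
  have := h (fun x => g (F^[j] x)) (hg.comp (hF.measurable.iterate j)) ⟨B, fun x => hB _⟩
  simpa only [← Function.iterate_add_apply, add_comm] using this

lemma IsOrth.comp_iterate {Q : ℕ} {D : Z → ℝ} (hF : MeasurePreserving F ζ ζ) (hD : Measurable D)
    (h : IsOrth ζ F Q D) (j : ℕ) : IsOrth ζ F (Q + j) (fun x => D (F^[j] x)) := by
  intro g hg hB
  have h1 := h g hg hB
  have h2 := integral_comp_iterate hF (hD.mul (hg.comp (hF.measurable.iterate Q))) j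
  simp only [Pi.mul_apply, Function.comp_apply, ← Function.iterate_add_apply] at h2
  rw [h2]
  exact h1

lemma IsOrth.sub {Q : ℕ} {D D' : Z → ℝ} (hF : MeasurePreserving F ζ ζ)
    (hD : Integrable D ζ) (hD' : Integrable D' ζ)
    (h : IsOrth ζ F Q D) (h' : IsOrth ζ F Q D') : IsOrth ζ F Q (fun x => D x - D' x) := by
  rintro g hg ⟨B, hB⟩
  have hi : ∀ {D : Z → ℝ}, Integrable D ζ → Integrable (fun x => D x * g (F^[Q] x)) ζ := fun h =>
    h.mul_bdd (c := B) (hg.comp (hF.measurable.iterate Q)).aestronglyMeasurable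
      (ae_of_all _ fun x => by simpa using hB _)
  simp only [sub_mul]
  rw [integral_sub (hi hD) (hi hD'), h g hg ⟨B, hB⟩, h' g hg ⟨B, hB⟩, sub_zero]

/-- Differences of the approximations at consecutive scales. -/
def scaleDiff (F : Z → Z) (v : ℕ → Z → ℝ) (r : ℕ) (z : Z) : ℝ := v (r + 1) z - v r (F^[2 ^ r] z)

/-- The error of the approximation at the scale `r`. -/
def scaleErr (T : X → X) (q : X → Z) (Y : X → ℝ) (v : ℕ → Z → ℝ) (r : ℕ) (x : X) : ℝ :=
  Y (T^[2 ^ r] x) - v r (q x)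

/-- Both v (r + 1) and v r after 2^r steps are meant to approximate the observable at time 2^(r+1),
so their difference is small; the delays here bring all scales to the common time 2^(r+k). -/
lemma scale_telescope (F : Z → Z) (v : ℕ → Z → ℝ) (r k : ℕ) (z : Z) :
    v (r + k) z = v r (F^[2 ^ (r + k) - 2 ^ r] z) +
      ∑ j ∈ Finset.range k, scaleDiff F v (r + j) (F^[2 ^ (r + k) - 2 ^ (r + j + 1)] z) := by
  induction k generalizing z with
  | zero => simp
  | succ k ih =>
    have h1 : v (r + (k + 1)) z = scaleDiff F v (r + k) z + v (r + k) (F^[2 ^ (r + k)] z) := by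
      rw [scaleDiff, ← add_assoc]; ring
    have e : ∀ j ≤ k, 2 ^ (r + k) - 2 ^ (r + j) + 2 ^ (r + k) = 2 ^ (r + (k + 1)) - 2 ^ (r + j) := by
      intro j hj
      have : 2 ^ (r + j) ≤ 2 ^ (r + k) := Nat.pow_le_pow_right (by norm_num) (by omega)
      rw [← add_assoc, pow_succ]
      omega
    rw [h1, ih, Finset.sum_range_succ, ← Function.iterate_add_apply, show 2 ^ (r + k) - 2 ^ r + 2 ^ (r + k) =
      2 ^ (r + (k + 1)) - 2 ^ r from e 0 (Nat.zero_le _)]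
    have h2 : ∀ j ∈ Finset.range k,
        scaleDiff F v (r + j) (F^[2 ^ (r + k) - 2 ^ (r + j + 1)] (F^[2 ^ (r + k)] z)) =
        scaleDiff F v (r + j) (F^[2 ^ (r + (k + 1)) - 2 ^ (r + j + 1)] z) := by
      intro j hj
      rw [← Function.iterate_add_apply, add_assoc r j 1,
        e (j + 1) (Nat.succ_le_of_lt (Finset.mem_range.1 hj))]
    rw [Finset.sum_congr rfl h2]
    simp only [add_assoc, Nat.sub_self, Function.iterate_zero, id_eq, add_zero]
    ring

lemma iterate_semiconj (hq : ∀ x, q (T x) = F (q x)) (n : ℕ) (x : X) :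
    q (T^[n] x) = F^[n] (q x) := by
  induction n with
  | zero => rfl
  | succ n ih => rw [Function.iterate_succ_apply', Function.iterate_succ_apply', hq, ih]

lemma iterate_iterate_comm (F : Z → Z) (m n : ℕ) (z : Z) : F^[m] (F^[n] z) = F^[n] (F^[m] z) := by
  rw [← Function.iterate_add_apply, ← Function.iterate_add_apply, add_comm]

lemma birkhoffSum_scale (hq : ∀ x, q (T x) = F (q x)) (Y : X → ℝ) (v : ℕ → Z → ℝ) (r k N : ℕ) (x : X) :
    birkhoffSum T Y N (T^[2 ^ (r + k)] x) =
      birkhoffSum F (v r) N (F^[2 ^ (r + k) - 2 ^ r] (q x)) +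
      ∑ j ∈ Finset.range k, birkhoffSum F (scaleDiff F v (r + j)) N
        (F^[2 ^ (r + k) - 2 ^ (r + j + 1)] (q x)) +
      birkhoffSum T (scaleErr T q Y v (r + k)) N x := by
  simp only [birkhoffSum]
  rw [Finset.sum_comm, ← Finset.sum_add_distrib, ← Finset.sum_add_distrib]
  refine Finset.sum_congr rfl fun i _ => ?_
  rw [scaleErr, iterate_semiconj hq, scale_telescope F v r k, iterate_iterate_comm T i]
  simp only [iterate_iterate_comm F i]
  ring

variable (hT : MeasurePreserving T μ μ) (hF : MeasurePreserving F ζ ζ)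
  (hqm : MeasurePreserving q μ ζ) (hq : ∀ x, q (T x) = F (q x))
include hT hF hqm hq

/-- Union bound for the multi-scale decomposition. -/
lemma measureReal_scale_le {Y : X → ℝ} (hY : Measurable Y) {v : ℕ → Z → ℝ}
    (hv : ∀ r, Measurable (v r)) (r k N : ℕ) {t : ℝ} {a c : ℝ} {b : ℕ → ℝ}
    (hsum : a + ∑ j ∈ Finset.range k, b j + c ≤ t) :
    μ.real {x | t ≤ |birkhoffSum T Y N x|} ≤
      ζ.real {z | a ≤ |birkhoffSum F (v r) N z|} +
      ∑ j ∈ Finset.range k, ζ.real {z | b j ≤ |birkhoffSum F (scaleDiff F v (r + j)) N z|} +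
      μ.real {x | c ≤ |birkhoffSum T (scaleErr T q Y v (r + k)) N x|} := by
  have hsd : ∀ r, Measurable (scaleDiff F v r) := fun r =>
    (hv (r + 1)).sub ((hv r).comp (hF.measurable.iterate _))
  have hm : ∀ {D : Z → ℝ} (c : ℝ), Measurable D →
      MeasurableSet {z | c ≤ |birkhoffSum F D N z|} := fun c hD =>
    measurableSet_le measurable_const (measurable_birkhoffSum hF hD N).abs
  have hpre : ∀ {s : Set Z}, MeasurableSet s → ∀ m : ℕ,
      μ.real ((fun x => F^[m] (q x)) ⁻¹' s) = ζ.real s := by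
    intro s hs m
    have h1 := ((hF.iterate m).comp hqm).measure_preimage hs.nullMeasurableSet
    rw [Measure.real, Measure.real, ← h1]
    rfl
  -- By invariance the sum may be started at time 2^(r+k), where the observable is expressed through
  -- the functions v.
  rw [← measureReal_preimage_iterate hT (measurableSet_le measurable_const
    (measurable_birkhoffSum hT hY N).abs) (2 ^ (r + k))]
  have hsub : T^[2 ^ (r + k)] ⁻¹' {x | t ≤ |birkhoffSum T Y N x|} ⊆
      ((fun x => F^[2 ^ (r + k) - 2 ^ r] (q x)) ⁻¹' {z | a ≤ |birkhoffSum F (v r) N z|} ∪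
      ⋃ j ∈ Finset.range k, (fun x => F^[2 ^ (r + k) - 2 ^ (r + j + 1)] (q x)) ⁻¹'
        {z | b j ≤ |birkhoffSum F (scaleDiff F v (r + j)) N z|}) ∪
      {x | c ≤ |birkhoffSum T (scaleErr T q Y v (r + k)) N x|} := by
    intro x hx
    by_contra hn
    simp only [mem_union, mem_iUnion, mem_preimage, mem_ofPred_eq, not_or, not_exists, not_le] at hn
    obtain ⟨⟨h1, h2⟩, h3⟩ := hn
    have h4 : t ≤ |birkhoffSum T Y N (T^[2 ^ (r + k)] x)| := hx
    rw [birkhoffSum_scale hq Y v] at h4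
    have h5 : |∑ j ∈ Finset.range k, birkhoffSum F (scaleDiff F v (r + j)) N
        (F^[2 ^ (r + k) - 2 ^ (r + j + 1)] (q x))| ≤ ∑ j ∈ Finset.range k, b j :=
      (Finset.abs_sum_le_sum_abs _ _).trans (Finset.sum_le_sum fun j hj => (h2 j hj).le)
    have h6 := abs_add_three (birkhoffSum F (v r) N (F^[2 ^ (r + k) - 2 ^ r] (q x)))
      (∑ j ∈ Finset.range k, birkhoffSum F (scaleDiff F v (r + j)) N
        (F^[2 ^ (r + k) - 2 ^ (r + j + 1)] (q x)))
      (birkhoffSum T (scaleErr T q Y v (r + k)) N x)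
    linarith
  refine (measureReal_mono hsub).trans ((measureReal_union_le _ _).trans (add_le_add ?_ le_rfl))
  refine (measureReal_union_le _ _).trans (add_le_add (hpre (hm _ (hv r)) _).le ?_)
  refine (measureReal_biUnion_finset_le _ _).trans (Finset.sum_le_sum fun j _ => ?_)
  exact (hpre (hm _ (hsd _)) _).le

-- Here v (r + 1) has gap 2^(r+2), while v r delayed by 2^r has gap 2^(r+1) + 2^r, which is enlarged
-- by another 2^r.
omit hT hq hqm in
lemma isOrth_scaleDiff {v : ℕ → Z → ℝ} (hv : ∀ r, Measurable (v r))
    (hvB : ∀ r, ∃ B, ∀ z, |v r z| ≤ B) (ho : ∀ r, IsOrth ζ F (2 ^ (r + 1)) (v r)) (r : ℕ) :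
    IsOrth ζ F (2 ^ (r + 2)) (scaleDiff F v r) := by
  obtain ⟨B, hB⟩ := hvB (r + 1)
  obtain ⟨B', hB'⟩ := hvB r
  refine IsOrth.sub hF (integrable_of_bdd (hv _) hB)
    (integrable_of_bdd ((hv r).comp (hF.measurable.iterate _)) fun z => hB' _) (ho (r + 1)) ?_
  have h := ((ho r).comp_iterate hF (hv r) (2 ^ r)).add hF (2 ^ r)
  rwa [show 2 ^ (r + 1) + 2 ^ r + 2 ^ r = 2 ^ (r + 2) by ring] at h

/-- Moments of the differences in terms of moments of the errors. -/
lemma integral_scaleDiff_rpow_le {p : ℝ} (hp : 1 ≤ p) {Y : X → ℝ} (hY : Measurable Y)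
    (hYB : ∃ B, ∀ x, |Y x| ≤ B) {v : ℕ → Z → ℝ} (hv : ∀ r, Measurable (v r))
    (hvB : ∀ r, ∃ B, ∀ z, |v r z| ≤ B) (r : ℕ) :
    ∫ z, |scaleDiff F v r z| ^ p ∂ζ ≤
      2 ^ (p - 1) * (∫ x, |scaleErr T q Y v r x| ^ p ∂μ + ∫ x, |scaleErr T q Y v (r + 1) x| ^ p ∂μ) := by
  have hp0 : 0 < p := by linarith
  have hsd : Measurable (scaleDiff F v r) := (hv (r + 1)).sub ((hv r).comp (hF.measurable.iterate _))
  have hem : ∀ r, Measurable (scaleErr T q Y v r) := fun r =>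
    (hY.comp (hT.measurable.iterate _)).sub ((hv r).comp hqm.measurable)
  obtain ⟨B, hB⟩ := hYB
  have heB : ∀ r, ∃ B, ∀ x, |scaleErr T q Y v r x| ≤ B := fun r => by
    obtain ⟨B', hB'⟩ := hvB r
    exact ⟨B + B', fun x => (abs_sub _ _).trans (add_le_add (hB _) (hB' _))⟩
  have hei : ∀ r, Integrable (fun x => |scaleErr T q Y v r x| ^ p) μ := fun r => by
    obtain ⟨B', hB'⟩ := heB r
    refine integrable_of_bdd ((hem r).abs.pow_const p) (B := B' ^ p) fun x => ?_
    rw [abs_of_nonneg (by positivity)]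
    exact Real.rpow_le_rpow (abs_nonneg _) (hB' x) hp0.le
  have hei' : Integrable (fun x => |scaleErr T q Y v r (T^[2 ^ r] x)| ^ p) μ :=
    (hT.iterate _).integrable_comp_of_integrable (hei r)
  have h1 : ∫ z, |scaleDiff F v r z| ^ p ∂ζ = ∫ x, |scaleDiff F v r (q x)| ^ p ∂μ := by
    rw [← hqm.map_eq, integral_map hqm.measurable.aemeasurable
      (hsd.abs.pow_const p).aestronglyMeasurable]
  -- The observable at time 2^(r+1) cancels, so the difference is a difference of two errors.
  have h2 : ∀ x, scaleDiff F v r (q x) =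
      scaleErr T q Y v r (T^[2 ^ r] x) - scaleErr T q Y v (r + 1) x := by
    intro x
    rw [scaleDiff, scaleErr, scaleErr, iterate_semiconj hq, ← Function.iterate_add_apply, pow_succ,
      mul_two]
    ring
  have h3 : ∀ a b : ℝ, |a - b| ^ p ≤ 2 ^ (p - 1) * (|a| ^ p + |b| ^ p) := by
    intro a b
    refine (Real.rpow_le_rpow (abs_nonneg _) (abs_sub a b) hp0.le).trans ?_
    have := NNReal.rpow_add_le_mul_rpow_add_rpow ⟨|a|, abs_nonneg a⟩ ⟨|b|, abs_nonneg b⟩ hp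
    exact_mod_cast this
  rw [h1, ← integral_comp_iterate hT ((hem r).abs.pow_const p) (2 ^ r), ← integral_add hei' (hei _),
    ← integral_const_mul]
  refine integral_mono_of_nonneg (ae_of_all _ fun x => by positivity)
    ((hei'.add (hei _)).const_mul _) (ae_of_all _ fun x => ?_)
  simp only [h2]
  exact h3 _ _

end MultiScale

/-! ### Markov's inequality for p-th moments. -/

section Markov

variable {X : Type*} [MeasurableSpace X] {μ : Measure X} [IsProbabilityMeasure μ]

lemma measureReal_le_abs_le_of_moment {p : ℝ} (hp : 0 < p) {S : X → ℝ} (hS : Measurable S)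
    (hSB : ∃ B, ∀ x, |S x| ≤ B) {t : ℝ} (ht : 0 < t) :
    μ.real {x | t ≤ |S x|} ≤ t ^ (-p) * ∫ x, |S x| ^ p ∂μ := by
  obtain ⟨B, hB⟩ := hSB
  have h1 := mul_meas_ge_le_integral_of_nonneg (μ := μ) (f := fun x => |S x| ^ p)
    (ae_of_all _ fun x => by positivity)
    (integrable_of_bdd (hS.abs.pow_const p) (B := B ^ p) fun x => by
      rw [abs_of_nonneg (by positivity)]
      exact Real.rpow_le_rpow (abs_nonneg _) (hB x) hp.le) (t ^ p)
  have h2 : {x | t ^ p ≤ |S x| ^ p} = {x | t ≤ |S x|} := by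
    ext x
    exact Real.rpow_le_rpow_iff ht.le (abs_nonneg _) hp
  rw [h2] at h1
  rw [Real.rpow_neg ht.le, inv_mul_eq_div, le_div_iff₀ (by positivity), mul_comm]
  exact h1

end Markov

/-! ### Large deviations at the times 2^l. -/

section DyadicDeviations

variable {X Z : Type*} [MeasurableSpace X] [MeasurableSpace Z] {μ : Measure X} {ζ : Measure Z}
  [IsProbabilityMeasure μ] [IsProbabilityMeasure ζ] {T : X → X} {F : Z → Z} {q : X → Z}

/-- Deviations of the Birkhoff sums of one term of the multi-scale decomposition. -/
lemma exists_measureReal_scale_term_le (hF : MeasurePreserving F ζ ζ) {α p w : ℝ} (hα : 0 < α)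
    (hp : 2 ≤ p) (hpα : 2 * α < p) (hw : 0 < w) : ∃ K : ℝ, 0 < K ∧
    ∀ d : Z → ℝ, Measurable d → (∃ B, ∀ z, |d z| ≤ B) → ∀ i : ℕ, IsOrth ζ F (2 ^ (i + 1)) d →
      ∀ D : ℝ, 0 ≤ D → ∫ z, |d z| ^ p ∂ζ ≤ D * (2 : ℝ) ^ (-α * i) → ∀ l : ℕ, i ≤ l → ∀ e : ℝ, 0 < e →
        ζ.real {z | e * 2 ^ l * (w * (2 : ℝ) ^ (-((p / 2 - α) / (2 * p)) * ((l : ℝ) - i))) ≤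
          |birkhoffSum F d (2 ^ l) z|} ≤
        K * D * e ^ (-p) * (2 : ℝ) ^ (-α * l) * (2 : ℝ) ^ (-((p / 2 - α) / 2) * ((l : ℝ) - i)) := by
  obtain ⟨K, hK, h⟩ := exists_integral_birkhoffSum_rpow_le hF hp
  have hp0 : 0 < p := by linarith
  refine ⟨(K * 2 ^ (p / 2) + 1) * w ^ (-p), by positivity,
    fun d hd hdB i ho D hD hdp l hil e he => ?_⟩
  have hSB : ∃ B, ∀ z, |birkhoffSum F d (2 ^ l) z| ≤ B := by
    obtain ⟨B, hB⟩ := hdB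
    exact ⟨_, abs_birkhoffSum_le hB _⟩
  have hI0 : 0 ≤ ∫ z, |d z| ^ p ∂ζ := integral_nonneg fun z => by positivity
  -- With gap Q = 2^(i+1) and 2^l = Q M, the moment bound Q^p M^(p/2) is 2^(lp - (l-i)p/2) up to a
  -- constant: the loss decreases geometrically with the distance l - i to the top scale. For i = l
  -- the gap exceeds the length and the trivial bound is used.
  have hmom : ∫ z, |birkhoffSum F d (2 ^ l) z| ^ p ∂ζ ≤
      (K * 2 ^ (p / 2) + 1) * (2 : ℝ) ^ (l * p - ((l : ℝ) - i) * (p / 2)) *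
        (D * (2 : ℝ) ^ (-α * i)) := by
    rcases hil.lt_or_eq with hlt | rfl
    · have h1 := h d hd hdB _ ho (2 ^ (l - i - 1))
      rw [← pow_add, show i + 1 + (l - i - 1) = l by omega] at h1
      refine h1.trans ?_
      have e1 : (K * ((2 ^ (i + 1) : ℕ) : ℝ) ^ p * ((2 ^ (l - i - 1) : ℕ) : ℝ) ^ (p / 2)) =
          K * 2 ^ (p / 2) * (2 : ℝ) ^ (l * p - ((l : ℝ) - i) * (p / 2)) := by
        have e2 : ((l - i - 1 : ℕ) : ℝ) = (l : ℝ) - i - 1 := by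
          rw [Nat.cast_sub (by omega), Nat.cast_sub hil, Nat.cast_one]
        rw [mul_assoc, mul_assoc]
        congr 1
        rw [Nat.cast_pow, Nat.cast_pow, Nat.cast_ofNat, ← Real.rpow_natCast 2 (i + 1),
          ← Real.rpow_natCast 2 (l - i - 1), ← Real.rpow_mul (by norm_num),
          ← Real.rpow_mul (by norm_num), ← Real.rpow_add (by norm_num),
          ← Real.rpow_add (by norm_num), e2]
        congr 1
        push_cast
        ring
      rw [e1]
      have h2 : 0 ≤ (2 : ℝ) ^ (l * p - ((l : ℝ) - i) * (p / 2)) := by positivity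
      have h3 : 0 ≤ K * 2 ^ (p / 2) := by positivity
      gcongr
      linarith
    · refine (integral_birkhoffSum_rpow_le hF (by linarith) hd hdB _).trans ?_
      rw [Nat.cast_pow, Nat.cast_ofNat, ← Real.rpow_natCast 2 i, ← Real.rpow_mul (by norm_num),
        sub_self, zero_mul, sub_zero]
      have h2 : 0 ≤ (2 : ℝ) ^ ((i : ℝ) * p) := by positivity
      have h3 : 0 ≤ K * 2 ^ (p / 2) := by positivity
      have h4 := mul_le_mul_of_nonneg_left hdp h2
      refine h4.trans ?_
      have h5 : 0 ≤ D * (2 : ℝ) ^ (-α * i) := by positivity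
      rw [mul_assoc]
      refine le_mul_of_one_le_left (by positivity) (by linarith)
  refine (measureReal_le_abs_le_of_moment hp0 (measurable_birkhoffSum hF hd _) hSB
    (by positivity)).trans ?_
  refine (mul_le_mul_of_nonneg_left hmom (by positivity)).trans (le_of_eq ?_)
  rw [Real.mul_rpow (by positivity) (by positivity), Real.mul_rpow (by positivity) (by positivity),
    Real.mul_rpow (by positivity) (by positivity), ← Real.rpow_natCast 2 l,
    ← Real.rpow_mul (by norm_num), ← Real.rpow_mul (by norm_num)]
  have e1 : (2 : ℝ) ^ ((l : ℝ) * -p) * (2 : ℝ) ^ (-((p / 2 - α) / (2 * p)) * ((l : ℝ) - i) * -p) *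
      (2 : ℝ) ^ (l * p - ((l : ℝ) - i) * (p / 2)) * (2 : ℝ) ^ (-α * (i : ℝ)) =
      (2 : ℝ) ^ (-α * l) * (2 : ℝ) ^ (-((p / 2 - α) / 2) * ((l : ℝ) - i)) := by
    rw [← Real.rpow_add (by norm_num), ← Real.rpow_add (by norm_num),
      ← Real.rpow_add (by norm_num), ← Real.rpow_add (by norm_num)]
    congr 1
    field_simp
    ring
  linear_combination (e ^ (-p) * w ^ (-p) * (K * 2 ^ (p / 2) + 1) * D) * e1

variable (hT : MeasurePreserving T μ μ) (hF : MeasurePreserving F ζ ζ)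
  (hqm : MeasurePreserving q μ ζ) (hq : ∀ x, q (T x) = F (q x))
include hT hF hqm hq

/-- Large deviations at dyadic times, polynomial case. -/
lemma exists_measureReal_dyadic_le_of_poly {α p : ℝ} (hα : 0 < α) (hp : 2 ≤ p)
    (hpα : 2 * α < p) : ∃ K : ℝ, 0 < K ∧ ∀ Y : X → ℝ, Measurable Y → (∃ B, ∀ x, |Y x| ≤ B) →
      ∀ v : ℕ → Z → ℝ, (∀ r, Measurable (v r)) → (∀ r, ∃ B, ∀ z, |v r z| ≤ B) →
      (∀ r, IsOrth ζ F (2 ^ (r + 1)) (v r)) → ∀ D : ℝ, 0 ≤ D →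
      (∀ r : ℕ, ∫ x, |scaleErr T q Y v r x| ^ p ∂μ ≤ D * (2 : ℝ) ^ (-α * r)) →
      ∫ z, |v 0 z| ^ p ∂ζ ≤ D → ∀ (l : ℕ) (e : ℝ), 0 < e →
        μ.real {x | e * 2 ^ l ≤ |birkhoffSum T Y (2 ^ l) x|} ≤
          K * D * e ^ (-p) * (2 : ℝ) ^ (-α * l) := by
  have hp0 : 0 < p := by linarith
  -- The scale i receives the fraction w 2^(-u(l-i)) of the deviation. The moments provide
  -- 2^(-(p/2-α)(l-i)), which decays because 2 α < p; since u p is half of p/2 - α, the factor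
  -- 2^(-κ(l-i)) remains.
  set u : ℝ := (p / 2 - α) / (2 * p) with hu
  have hu0 : 0 < u := div_pos (by linarith) (by linarith)
  set w : ℝ := (1 - (2 : ℝ) ^ (-u)) / 2 with hw
  have hw0 : 0 < w := by have := rpow_neg_lt_one hu0; rw [hw]; linarith
  set κ : ℝ := (p / 2 - α) / 2 with hκ
  have hκ0 : 0 < κ := by rw [hκ]; linarith
  set g : ℝ := (1 - (2 : ℝ) ^ (-κ))⁻¹ with hg
  have hg0 : 0 < g := by have := rpow_neg_lt_one hκ0; exact inv_pos.2 (by linarith)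
  obtain ⟨K, hK, hterm⟩ := exists_measureReal_scale_term_le hF hα hp hpα hw0
  refine ⟨K * (2 ^ p * 2 ^ α) * g + 2 ^ p, by positivity,
    fun Y hY hYB v hv hvB ho D hD herr hv0 l e he => ?_⟩
  -- The difference with index j has gap 2^(j+2) and is counted at scale j + 1; 2^α pays for this
  -- shift and 2^p for the two errors of which it is made.
  set D' : ℝ := 2 ^ p * 2 ^ α * D with hD'
  have hD'0 : 0 ≤ D' := by positivity
  have hDD' : D ≤ D' := by
    have h1 : (1 : ℝ) ≤ 2 ^ p := Real.one_le_rpow (by norm_num) hp0.le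
    have h2 : (1 : ℝ) ≤ 2 ^ α := Real.one_le_rpow (by norm_num) hα.le
    exact le_mul_of_one_le_left hD (one_le_mul_of_one_le_of_one_le h1 h2)
  have hsd : ∀ j, ∫ z, |scaleDiff F v j z| ^ p ∂ζ ≤ D' * (2 : ℝ) ^ (-α * ((j + 1 : ℕ) : ℝ)) := by
    intro j
    refine (integral_scaleDiff_rpow_le hT hF hqm hq (by linarith) hY hYB hv hvB j).trans ?_
    have h1 := herr j
    have h2 : ∫ x, |scaleErr T q Y v (j + 1) x| ^ p ∂μ ≤ D * (2 : ℝ) ^ (-α * (j : ℝ)) := by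
      refine (herr (j + 1)).trans (mul_le_mul_of_nonneg_left ?_ hD)
      refine Real.rpow_le_rpow_of_exponent_le (by norm_num) ?_
      push_cast
      nlinarith
    have h3 := mul_le_mul_of_nonneg_left (add_le_add h1 h2)
      (by positivity : (0 : ℝ) ≤ 2 ^ (p - 1))
    refine h3.trans (le_of_eq ?_)
    rw [hD', Real.rpow_sub_one (by norm_num)]
    have h4 : (2 : ℝ) ^ (-α * ((j + 1 : ℕ) : ℝ)) = (2 : ℝ) ^ (-α * (j : ℝ)) * ((2 : ℝ) ^ α)⁻¹ := by
      rw [← Real.rpow_neg (by norm_num), ← Real.rpow_add (by norm_num)]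
      congr 1
      push_cast
      ring
    rw [h4]
    field_simp
    ring
  set b : ℕ → ℝ := fun i => e * 2 ^ l * (w * (2 : ℝ) ^ (-u * ((l : ℝ) - i))) with hb
  have hbsum : b 0 + ∑ j ∈ Finset.range l, b (j + 1) ≤ e * 2 ^ l / 2 := by
    rw [add_comm, ← Finset.sum_range_succ' b, hb]
    simp only [← mul_assoc]
    rw [← Finset.mul_sum]
    refine (mul_le_mul_of_nonneg_left (sum_range_rpow_neg_le hu0 l) (by positivity)).trans
      (le_of_eq ?_)
    have h1 : 1 - (2 : ℝ) ^ (-u) = 2 * w := by rw [hw]; ring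
    rw [h1]
    field_simp
  have hscale := measureReal_scale_le hT hF hqm hq hY hv 0 l (2 ^ l) (t := e * 2 ^ l) (a := b 0)
    (c := e * 2 ^ l / 2) (b := fun j => b (j + 1)) (by linarith)
  simp only [zero_add] at hscale
  refine hscale.trans ?_
  have hscm : Measurable (scaleErr T q Y v l) :=
    (hY.comp (hT.measurable.iterate _)).sub ((hv l).comp hqm.measurable)
  have hscB : ∃ B, ∀ x, |scaleErr T q Y v l x| ≤ B := by
    obtain ⟨B, hB⟩ := hYB
    obtain ⟨B', hB'⟩ := hvB l
    exact ⟨B + B', fun x => (abs_sub _ _).trans (add_le_add (hB _) (hB' _))⟩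
  have h3 : μ.real {x | e * 2 ^ l / 2 ≤ |birkhoffSum T (scaleErr T q Y v l) (2 ^ l) x|} ≤
      2 ^ p * D * e ^ (-p) * (2 : ℝ) ^ (-α * l) := by
    have hSB : ∃ B, ∀ z, |birkhoffSum T (scaleErr T q Y v l) (2 ^ l) z| ≤ B := by
      obtain ⟨B, hB⟩ := hscB
      exact ⟨_, abs_birkhoffSum_le hB _⟩
    refine (measureReal_le_abs_le_of_moment hp0 (measurable_birkhoffSum hT hscm _) hSB
      (by positivity)).trans ?_
    have h4 := (integral_birkhoffSum_rpow_le hT (by linarith) hscm hscB (p := p) (2 ^ l)).trans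
      (mul_le_mul_of_nonneg_left (herr l) (by positivity))
    refine (mul_le_mul_of_nonneg_left h4 (by positivity)).trans (le_of_eq ?_)
    rw [Real.div_rpow (by positivity) (by norm_num), Real.mul_rpow he.le (by positivity)]
    push_cast
    rw [Real.rpow_neg (by positivity : (0 : ℝ) ≤ 2 ^ l), Real.rpow_neg (by norm_num : (0 : ℝ) ≤ 2)]
    have : (0 : ℝ) < ((2 : ℝ) ^ l) ^ p := by positivity
    field_simp
  have h1 : ζ.real {z | b 0 ≤ |birkhoffSum F (v 0) (2 ^ l) z|} ≤
      K * D' * e ^ (-p) * (2 : ℝ) ^ (-α * l) * (2 : ℝ) ^ (-κ * ((l : ℝ) - (0 : ℕ))) :=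
    hterm (v 0) (hv 0) (hvB 0) 0 (ho 0) D' hD'0 (by simpa using hv0.trans hDD') l (Nat.zero_le _) e he
  have h2 : ∀ j ∈ Finset.range l, ζ.real {z | b (j + 1) ≤ |birkhoffSum F (scaleDiff F v j) (2 ^ l) z|} ≤
      K * D' * e ^ (-p) * (2 : ℝ) ^ (-α * l) * (2 : ℝ) ^ (-κ * ((l : ℝ) - (j + 1 : ℕ))) := by
    intro j hj
    refine hterm _ ((hv (j + 1)).sub ((hv j).comp (hF.measurable.iterate _))) ?_ (j + 1)
      (isOrth_scaleDiff hF hv hvB ho j) D' hD'0 (hsd j) l (Finset.mem_range.1 hj) e he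
    obtain ⟨B, hB⟩ := hvB (j + 1)
    obtain ⟨B', hB'⟩ := hvB j
    exact ⟨B + B', fun x => (abs_sub _ _).trans (add_le_add (hB _) (hB' _))⟩
  refine (add_le_add (add_le_add h1 (Finset.sum_le_sum h2)) h3).trans ?_
  rw [add_comm (K * D' * e ^ (-p) * _ * _), ← Finset.sum_range_succ' (fun i : ℕ =>
    K * D' * e ^ (-p) * (2 : ℝ) ^ (-α * l) * (2 : ℝ) ^ (-κ * ((l : ℝ) - i))), ← Finset.mul_sum]
  have h5 := mul_le_mul_of_nonneg_left (sum_range_rpow_neg_le hκ0 l)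
    (by positivity : 0 ≤ K * D' * e ^ (-p) * (2 : ℝ) ^ (-α * l))
  refine (add_le_add h5 le_rfl).trans (le_of_eq ?_)
  rw [← hg, hD']
  ring

set_option maxHeartbeats 1600000 in
/-- Large deviations at dyadic times, stretched exponential case. -/
lemma exists_measureReal_dyadic_le_of_exp {c θ B C : ℝ} (hc : 0 < c) (hθ : 0 < θ) (hB : 0 < B)
    (hC : 0 < C) : ∃ K c' : ℝ, 0 < K ∧ 0 < c' ∧ ∀ Y : X → ℝ, Measurable Y → (∀ x, |Y x| ≤ B) →
      ∀ v : ℕ → Z → ℝ, (∀ r, Measurable (v r)) → (∀ r z, |v r z| ≤ B) →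
      (∀ r, IsOrth ζ F (2 ^ (r + 1)) (v r)) →
      (∀ r : ℕ, ∫ x, |scaleErr T q Y v r x| ^ (2 : ℝ) ∂μ ≤ C * Real.exp (-c * (2 ^ r) ^ θ)) →
      ∀ (l : ℕ) (e : ℝ), 0 < e →
        μ.real {x | e * 2 ^ l ≤ |birkhoffSum T Y (2 ^ l) x|} ≤
          K * Real.exp (-c' * (2 ^ l * e ^ 2) ^ (θ / (1 + θ))) := by
  obtain ⟨K, hK, hmom⟩ := exists_integral_birkhoffSum_rpow_le hF (le_refl (2 : ℝ))
  obtain ⟨C₃, hC₃, hdecay⟩ := exists_pow_mul_exp_neg_rpow_le 4 (c := c / 2) (by positivity) hθ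
  obtain ⟨C₅, hC₅, hdecay₁⟩ := exists_pow_mul_exp_neg_rpow_le 1 hc hθ
  set ϑ : ℝ := θ / (1 + θ) with hϑ
  have hϑ0 : 0 < ϑ := by positivity
  set a₁ : ℝ := (8 * B ^ 2)⁻¹ ^ ϑ with ha₁
  have ha₁0 : 0 < a₁ := by positivity
  set c' : ℝ := a₁ * min (1 / 8) (c / 2 * 2 ^ (-θ)) with hc'
  have hc'0 : 0 < c' := mul_pos ha₁0 (lt_min (by norm_num) (by positivity))
  set K₄ : ℝ := 512 * (K + 1) * C * C₃ / (8 * B ^ 2) with hK₄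
  have hK₄0 : 0 < K₄ := by positivity
  refine ⟨2 + K₄ + Real.exp (c' * (8 * B ^ 2) ^ ϑ), c', by positivity, hc'0,
    fun Y hY hYB v hv hvB ho herr l e he => ?_⟩
  have hN : (0 : ℝ) < 2 ^ l := by positivity
  have hK0 : 0 ≤ (2 + K₄ + Real.exp (c' * (8 * B ^ 2) ^ ϑ)) *
    Real.exp (-c' * (2 ^ l * e ^ 2) ^ ϑ) := by positivity
  rcases lt_or_ge B e with heB | heB
  · have h0 : {x | e * 2 ^ l ≤ |birkhoffSum T Y (2 ^ l) x|} = ∅ := by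
      refine eq_empty_of_forall_notMem fun x (hx : e * 2 ^ l ≤ _) => ?_
      have h1 := abs_birkhoffSum_le (T := T) hYB (2 ^ l) x
      push_cast at h1
      nlinarith
    rw [h0]
    simpa using hK0
  set x := (2 : ℝ) ^ l * e ^ 2 with hx
  have hx0 : 0 < x := by positivity
  rcases lt_or_ge x (8 * B ^ 2) with hxs | hxl
  · refine measureReal_le_one.trans ?_
    have h1 : (1 : ℝ) ≤ Real.exp (c' * (8 * B ^ 2) ^ ϑ) * Real.exp (-c' * x ^ ϑ) := by
      rw [← Real.exp_add]
      refine Real.one_le_exp ?_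
      have := Real.rpow_le_rpow hx0.le hxs.le hϑ0.le
      nlinarith
    refine h1.trans ?_
    gcongr
    linarith
  set y := x / (8 * B ^ 2) with hy
  have hy1 : 1 ≤ y := by rw [hy, le_div_iff₀ (by positivity)]; linarith
  have hy0 : 0 < y := by linarith
  have hyx : y ^ ϑ = a₁ * x ^ ϑ := by
    rw [hy, ha₁, div_eq_inv_mul, Real.mul_rpow (by positivity) hx0.le]
  -- At scale r₀ Azuma's inequality has an exponent of order y / 2^r₀ and the approximation an
  -- exponent of order 2^(r₀θ). The choice of 2^r₀ within a factor 2 of y^(1/(1+θ)) makes both of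
  -- order y^(θ/(1+θ)).
  obtain ⟨r₀, hr₀, hr₀'⟩ := exists_nat_pow_near (x := y ^ (1 / (1 + θ))) (y := 2)
    (Real.one_le_rpow hy1 (by positivity)) (by norm_num)
  have hyy : y ^ (1 / (1 + θ)) ≤ y := by
    conv_rhs => rw [← Real.rpow_one y]
    exact Real.rpow_le_rpow_of_exponent_le hy1 (by rw [div_le_one (by linarith)]; linarith)
  have hyl : y ≤ 2 ^ l / 8 := by
    rw [hy, hx, div_le_div_iff₀ (by positivity) (by norm_num)]
    have : e ^ 2 ≤ B ^ 2 := by gcongr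
    nlinarith
  have hr₀l : r₀ + 1 ≤ l := by
    have h1 : (2 : ℝ) ^ (r₀ + 1) ≤ 2 ^ l := by rw [pow_succ]; linarith
    exact (pow_le_pow_iff_right₀ (by norm_num)).1 h1
  have hsplit : y = y ^ ϑ * y ^ (1 / (1 + θ)) := by
    rw [← Real.rpow_add hy0, hϑ, ← add_div, show θ + 1 = 1 + θ by ring,
      div_self (by positivity), Real.rpow_one]
  have hr₀0 : (0 : ℝ) < 2 ^ r₀ := by positivity
  -- the main term
  have h1 : ζ.real {z | e * 2 ^ l / 4 ≤ |birkhoffSum F (v r₀) (2 ^ l) z|} ≤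
      2 * Real.exp (-c' * x ^ ϑ) := by
    have h2 := measureReal_le_abs_birkhoffSum_le hF (hv r₀) hB (hvB r₀) (ho r₀)
      (M := 2 ^ (l - (r₀ + 1))) (by positivity) (by positivity) (t := e * 2 ^ l / 4) (by positivity)
    rw [← pow_add, Nat.add_sub_cancel' hr₀l] at h2
    refine h2.trans (mul_le_mul_of_nonneg_left (Real.exp_le_exp.2 ?_) (by norm_num))
    have e1 : ((2 ^ (r₀ + 1) : ℕ) : ℝ) ^ 2 * ((2 ^ (l - (r₀ + 1)) : ℕ) : ℝ) = 2 * 2 ^ r₀ * 2 ^ l := by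
      push_cast
      rw [sq, mul_assoc, ← pow_add, Nat.add_sub_cancel' hr₀l, pow_succ]
      ring
    have e2 : (e * 2 ^ l / 4) ^ 2 / (2 * ((2 ^ (r₀ + 1) : ℕ) : ℝ) ^ 2 *
        ((2 ^ (l - (r₀ + 1)) : ℕ) : ℝ) * B ^ 2) = y / (8 * 2 ^ r₀) := by
      rw [mul_assoc 2, e1, hy, hx]
      field_simp
      ring
    rw [e2, neg_mul, neg_le_neg_iff, le_div_iff₀ (by positivity)]
    have h3 : c' * x ^ ϑ ≤ y ^ ϑ / 8 := by
      rw [hyx, hc']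
      have := min_le_left (1 / 8 : ℝ) (c / 2 * 2 ^ (-θ))
      have h4 : 0 ≤ a₁ * x ^ ϑ := by positivity
      nlinarith
    have h5 := mul_le_mul h3 hr₀ hr₀0.le (by positivity)
    nlinarith
  -- the differences
  have hsd : ∀ j : ℕ, ζ.real {z | e * 2 ^ l / 4 * (1 / 2) ^ j ≤
      |birkhoffSum F (scaleDiff F v (r₀ + j)) (2 ^ l) z|} ≤
      K₄ / 2 * Real.exp (-c' * x ^ ϑ) * (1 / 2) ^ j := by
    intro j
    set r := r₀ + j with hr
    have hsm : Measurable (scaleDiff F v r) := (hv (r + 1)).sub ((hv r).comp (hF.measurable.iterate _))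
    have hsB : ∃ B, ∀ z, |scaleDiff F v r z| ≤ B :=
      ⟨B + B, fun x => (abs_sub _ _).trans (add_le_add (hvB _ _) (hvB _ _))⟩
    have hSB : ∃ B, ∀ z, |birkhoffSum F (scaleDiff F v r) (2 ^ l) z| ≤ B := by
      obtain ⟨B, hB⟩ := hsB
      exact ⟨_, abs_birkhoffSum_le hB _⟩
    set E := Real.exp (-c * (2 ^ r) ^ θ) with hE
    have hE0 : 0 < E := Real.exp_pos _
    have hI : ∫ z, |scaleDiff F v r z| ^ (2 : ℝ) ∂ζ ≤ 4 * C * E := by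
      refine (integral_scaleDiff_rpow_le hT hF hqm hq (by norm_num) hY ⟨B, hYB⟩ hv
        (fun r => ⟨B, hvB r⟩) r).trans ?_
      have h2 : C * Real.exp (-c * (2 ^ (r + 1)) ^ θ) ≤ C * E := by
        refine mul_le_mul_of_nonneg_left (Real.exp_le_exp.2 ?_) hC.le
        rw [neg_mul, neg_mul, neg_le_neg_iff]
        gcongr
        · norm_num
        · omega
      have h3 := herr r
      have h4 := herr (r + 1)
      rw [show (2 : ℝ) ^ ((2 : ℝ) - 1) = 2 by norm_num]
      linarith [h4.trans h2]
    have hI0 : 0 ≤ ∫ z, |scaleDiff F v r z| ^ (2 : ℝ) ∂ζ := integral_nonneg fun z => by positivity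
    have hM : ∫ z, |birkhoffSum F (scaleDiff F v r) (2 ^ l) z| ^ (2 : ℝ) ∂ζ ≤
        (K + 1) * (4 * 2 ^ r) * 2 ^ l * (4 * C * E) := by
      rcases le_or_gt (r + 2) l with hrl | hrl
      · have h2 := hmom _ hsm hsB _ (isOrth_scaleDiff hF hv (fun r => ⟨B, hvB r⟩) ho r)
          (2 ^ (l - (r + 2)))
        rw [← pow_add, Nat.add_sub_cancel' hrl] at h2
        refine h2.trans ?_
        have e1 : K * ((2 ^ (r + 2) : ℕ) : ℝ) ^ (2 : ℝ) * ((2 ^ (l - (r + 2)) : ℕ) : ℝ) ^ ((2 : ℝ) / 2) =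
            K * (4 * 2 ^ r) * 2 ^ l := by
          rw [div_self (by norm_num), Real.rpow_one, Real.rpow_two]
          push_cast
          rw [sq, mul_assoc, mul_assoc, ← pow_add, Nat.add_sub_cancel' hrl, pow_add]
          ring
        rw [e1]
        gcongr
        linarith
      · refine (integral_birkhoffSum_rpow_le hF (by norm_num) hsm hsB _).trans ?_
        rw [Real.rpow_two]
        push_cast
        have h2 : (2 : ℝ) ^ l ≤ 4 * 2 ^ r := by
          have : (2 : ℝ) ^ l ≤ 2 ^ (r + 2) := pow_le_pow_right₀ (by norm_num) hrl.le
          rw [pow_add] at this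
          linarith
        have h3 : ((2 : ℝ) ^ l) ^ 2 ≤ (K + 1) * (4 * 2 ^ r) * 2 ^ l := by
          rw [sq]
          refine mul_le_mul_of_nonneg_right (h2.trans ?_) hN.le
          exact le_mul_of_one_le_left (by positivity) (by linarith)
        exact mul_le_mul h3 hI hI0 (by positivity)
    refine (measureReal_le_abs_le_of_moment (p := 2) (by norm_num) (measurable_birkhoffSum hF hsm _)
      hSB (by positivity)).trans ?_
    refine (mul_le_mul_of_nonneg_left hM (by positivity)).trans ?_
    have e1 : (e * 2 ^ l / 4 * (1 / 2) ^ j) ^ (-2 : ℝ) = 16 * (2 ^ j) ^ 2 / (2 ^ l * x) := by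
      rw [Real.rpow_neg (by positivity), Real.rpow_two, hx, one_div_pow]
      field_simp
      ring
    rw [e1]
    have hz : (1 : ℝ) ≤ 2 ^ r := one_le_pow₀ (by norm_num)
    -- One half of the exponent absorbs the powers of 2^r and provides geometric decay in j; the
    -- other gives the required bound.
    have h2 : E = Real.exp (-(c / 2) * (2 ^ r) ^ θ) * Real.exp (-(c / 2) * (2 ^ r) ^ θ) := by
      rw [hE, ← Real.exp_add]; congr 1; ring
    have h3 := hdecay (2 ^ r) hz
    have h4 : Real.exp (-(c / 2) * (2 ^ r) ^ θ) ≤ Real.exp (-c' * x ^ ϑ) := by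
      refine Real.exp_le_exp.2 ?_
      rw [neg_mul, neg_mul, neg_le_neg_iff]
      have h5 : y ^ ϑ * 2 ^ (-θ) ≤ (2 ^ r) ^ θ := by
        have h6 : y ^ (1 / (1 + θ)) * 2⁻¹ ≤ 2 ^ r := by
          have : (2 : ℝ) ^ r₀ ≤ 2 ^ r := pow_le_pow_right₀ (by norm_num) (by omega)
          rw [pow_succ] at hr₀'
          linarith
        have h7 := Real.rpow_le_rpow (by positivity) h6 hθ.le
        rwa [Real.mul_rpow (by positivity) (by norm_num), ← Real.rpow_mul hy0.le,
          Real.inv_rpow (by norm_num), ← Real.rpow_neg (by norm_num),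
          show 1 / (1 + θ) * θ = ϑ by rw [hϑ]; ring] at h7
      have h6 := min_le_right (1 / 8 : ℝ) (c / 2 * 2 ^ (-θ))
      have h7 : c' * x ^ ϑ ≤ (c / 2 * 2 ^ (-θ)) * y ^ ϑ := by
        rw [hyx, hc']
        have h4 : 0 ≤ a₁ * x ^ ϑ := by positivity
        nlinarith
      refine h7.trans ?_
      have := mul_le_mul_of_nonneg_left h5 (by positivity : 0 ≤ c / 2)
      linarith
    have h5 : ((2 : ℝ) ^ j) ^ 2 * 2 ^ r * E ≤ C₃ * Real.exp (-c' * x ^ ϑ) * (1 / 2) ^ j := by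
      set G := Real.exp (-(c / 2) * (2 ^ r) ^ θ) with hG
      have hG0 : 0 < G := Real.exp_pos _
      have hjr : (2 : ℝ) ^ j ≤ 2 ^ r := pow_le_pow_right₀ (by norm_num) (by omega)
      have hj0 : (0 : ℝ) < 2 ^ j := by positivity
      rw [one_div_pow, mul_one_div, le_div_iff₀ hj0, h2]
      calc ((2 : ℝ) ^ j) ^ 2 * 2 ^ r * (G * G) * 2 ^ j = (2 ^ j) ^ 3 * 2 ^ r * G * G := by ring
        _ ≤ (2 ^ r) ^ 3 * 2 ^ r * G * G := by gcongr
        _ = (2 ^ r) ^ 4 * G * G := by ring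
        _ ≤ C₃ * Real.exp (-c' * x ^ ϑ) := mul_le_mul h3 h4 hG0.le hC₃.le
    have e2 : 16 * ((2 : ℝ) ^ j) ^ 2 / (2 ^ l * x) * ((K + 1) * (4 * 2 ^ r) * 2 ^ l * (4 * C * E)) =
        256 * (K + 1) * C / x * ((2 ^ j) ^ 2 * 2 ^ r * E) := by
      field_simp
      ring
    rw [e2]
    have h6 : 256 * (K + 1) * C / x ≤ 256 * (K + 1) * C / (8 * B ^ 2) := by gcongr
    refine (mul_le_mul h6 h5 (by positivity) (by positivity)).trans (le_of_eq ?_)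
    rw [hK₄]
    ring
  -- the error
  have herr' : ∀ k : ℕ, μ.real {x | e * 2 ^ l / 4 ≤
      |birkhoffSum T (scaleErr T q Y v (r₀ + k)) (2 ^ l) x|} ≤ 16 / e ^ 2 * C * C₅ * (1 / 2) ^ k := by
    intro k
    have hscm : Measurable (scaleErr T q Y v (r₀ + k)) :=
      (hY.comp (hT.measurable.iterate _)).sub ((hv _).comp hqm.measurable)
    have hscB : ∃ B, ∀ x, |scaleErr T q Y v (r₀ + k) x| ≤ B :=
      ⟨B + B, fun x => (abs_sub _ _).trans (add_le_add (hYB _) (hvB _ _))⟩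
    have hSB : ∃ B, ∀ z, |birkhoffSum T (scaleErr T q Y v (r₀ + k)) (2 ^ l) z| ≤ B := by
      obtain ⟨B, hB⟩ := hscB
      exact ⟨_, abs_birkhoffSum_le hB _⟩
    refine (measureReal_le_abs_le_of_moment (p := 2) (by norm_num) (measurable_birkhoffSum hT hscm _)
      hSB (by positivity)).trans ?_
    have h4 := (integral_birkhoffSum_rpow_le hT (p := 2) (by norm_num) hscm hscB (2 ^ l)).trans
      (mul_le_mul_of_nonneg_left (herr (r₀ + k)) (by positivity))
    refine (mul_le_mul_of_nonneg_left h4 (by positivity)).trans ?_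
    have hz : (1 : ℝ) ≤ 2 ^ (r₀ + k) := one_le_pow₀ (by norm_num)
    have h5 := hdecay₁ _ hz
    have h6 : Real.exp (-c * (2 ^ (r₀ + k)) ^ θ) ≤ C₅ * (1 / 2) ^ k := by
      rw [one_div_pow, mul_one_div, le_div_iff₀ (by positivity), mul_comm]
      refine le_trans (mul_le_mul_of_nonneg_right ?_ (Real.exp_nonneg _)) h5
      rw [pow_one]
      exact pow_le_pow_right₀ (by norm_num) (by omega)
    have e1 : (e * 2 ^ l / 4) ^ (-2 : ℝ) * ((((2 ^ l : ℕ) : ℝ)) ^ (2 : ℝ) *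
        (C * Real.exp (-c * (2 ^ (r₀ + k)) ^ θ))) =
        16 / e ^ 2 * C * Real.exp (-c * (2 ^ (r₀ + k)) ^ θ) := by
      rw [Real.rpow_neg (by positivity), Real.rpow_two, Real.rpow_two]
      push_cast
      field_simp
      ring
    rw [e1, mul_assoc _ C₅]
    exact mul_le_mul_of_nonneg_left h6 (by positivity)
  have hgeo : ∀ k, ∑ j ∈ Finset.range k, (1 / 2 : ℝ) ^ j ≤ 2 := fun k => by
    exact (summable_geometric_two.sum_le_tsum _ fun j _ => by positivity).trans_eq
      tsum_geometric_two
  -- The number k of scales is free: the first two contributions are bounded uniformly in k and the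
  -- error disappears as k tends to infinity.
  have hall : ∀ k : ℕ, μ.real {x | e * 2 ^ l ≤ |birkhoffSum T Y (2 ^ l) x|} ≤
      (2 + K₄) * Real.exp (-c' * x ^ ϑ) + 16 / e ^ 2 * C * C₅ * (1 / 2) ^ k := by
    intro k
    refine (measureReal_scale_le hT hF hqm hq hY hv r₀ k (2 ^ l) (t := e * 2 ^ l)
      (a := e * 2 ^ l / 4) (c := e * 2 ^ l / 4) (b := fun j => e * 2 ^ l / 4 * (1 / 2) ^ j) ?_).trans ?_
    · rw [← Finset.mul_sum]
      have := mul_le_mul_of_nonneg_left (hgeo k) (by positivity : 0 ≤ e * 2 ^ l / 4)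
      linarith
    · refine (add_le_add (add_le_add h1 (Finset.sum_le_sum fun j _ => hsd j)) (herr' k)).trans ?_
      rw [← Finset.mul_sum]
      have := mul_le_mul_of_nonneg_left (hgeo k)
        (by positivity : 0 ≤ K₄ / 2 * Real.exp (-c' * x ^ ϑ))
      linarith
  have hlim : Filter.Tendsto (fun k : ℕ => (2 + K₄) * Real.exp (-c' * x ^ ϑ) +
      16 / e ^ 2 * C * C₅ * (1 / 2 : ℝ) ^ k) Filter.atTop
      (nhds ((2 + K₄) * Real.exp (-c' * x ^ ϑ) + 16 / e ^ 2 * C * C₅ * 0)) :=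
    ((tendsto_pow_atTop_nhds_zero_of_lt_one (by norm_num) (by norm_num)).const_mul _).const_add _
  have hfin := ge_of_tendsto' hlim hall
  refine hfin.trans ?_
  have : 0 ≤ Real.exp (c' * (8 * B ^ 2) ^ ϑ) * Real.exp (-c' * x ^ ϑ) := by positivity
  linarith

end DyadicDeviations

/-! ### The symbolic tower -/

section SymbolicTower

variable {ι : Type*}

/-- The tower map on pairs of a level and an itinerary. -/
def symStep (τ : ι → ℕ) (z : ℕ × (ℕ → ι)) : ℕ × (ℕ → ι) :=
  if z.1 + 1 < τ (z.2 0) then (z.1 + 1, z.2) else (0, shift z.2)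

/-- The number of visits to the base at the times `1, …, n`. -/
def returns (τ : ι → ℕ) : ℕ → ℕ × (ℕ → ι) → ℕ
  | 0, _ => 0
  | n + 1, z => returns τ n z + if ((symStep τ)^[n + 1] z).1 = 0 then 1 else 0

variable (τ : ι → ℕ)

lemma symStep_of_lt {z : ℕ × (ℕ → ι)} (h : z.1 + 1 < τ (z.2 0)) :
    symStep τ z = (z.1 + 1, z.2) := if_pos h

lemma symStep_of_le {z : ℕ × (ℕ → ι)} (h : τ (z.2 0) ≤ z.1 + 1) :
    symStep τ z = (0, shift z.2) := if_neg (not_lt.2 h)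

lemma returns_succ (n : ℕ) (z : ℕ × (ℕ → ι)) :
    returns τ (n + 1) z = returns τ n z + if ((symStep τ)^[n + 1] z).1 = 0 then 1 else 0 := rfl

lemma returns_mono (z : ℕ × (ℕ → ι)) : Monotone fun n => returns τ n z :=
  monotone_nat_of_le_succ fun n => by rw [returns_succ]; omega

lemma returns_le (n : ℕ) (z : ℕ × (ℕ → ι)) : returns τ n z ≤ n := by
  induction n with
  | zero => exact le_rfl
  | succ n ih => rw [returns_succ]; split_ifs <;> omega

lemma iterate_symStep_snd (n : ℕ) (z : ℕ × (ℕ → ι)) :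
    ((symStep τ)^[n] z).2 = shift^[returns τ n z] z.2 := by
  induction n with
  | zero => rfl
  | succ n ih =>
    rw [returns_succ, Function.iterate_succ_apply']
    rcases lt_or_ge (((symStep τ)^[n] z).1 + 1) (τ (((symStep τ)^[n] z).2 0)) with h | h
    · rw [symStep_of_lt τ h, if_neg (by simp), ih, add_zero]
    · rw [symStep_of_le τ h, if_pos rfl, Function.iterate_succ_apply', ih]

lemma returns_add (m n : ℕ) (z : ℕ × (ℕ → ι)) :
    returns τ (m + n) z = returns τ m z + returns τ n ((symStep τ)^[m] z) := by
  induction n with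
  | zero => rfl
  | succ n ih =>
    rw [← add_assoc, returns_succ, returns_succ, ih, ← Function.iterate_add_apply,
      show n + 1 + m = m + n + 1 by omega, add_assoc]

/-- The number of returns before the number of symbols seen is exhausted is determined by these
symbols. -/
lemma iterate_symStep_congr {z z' : ℕ × (ℕ → ι)} (h1 : z.1 = z'.1) {s : ℕ}
    (h : ∀ m < s, z.2 m = z'.2 m) {n : ℕ} (hn : returns τ n z < s) :
    ((symStep τ)^[n] z').1 = ((symStep τ)^[n] z).1 ∧ returns τ n z' = returns τ n z := by
  induction n with
  | zero => exact ⟨h1.symm, rfl⟩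
  | succ n ih =>
    have hn' : returns τ n z < s := (returns_mono τ z n.le_succ).trans_lt hn
    obtain ⟨h2, h3⟩ := ih hn'
    have h4 : ((symStep τ)^[n] z').2 0 = ((symStep τ)^[n] z).2 0 := by
      rw [iterate_symStep_snd, iterate_symStep_snd, shift_iterate_apply, shift_iterate_apply, h3,
        zero_add, h _ hn']
    have h5 : ((symStep τ)^[n + 1] z').1 = ((symStep τ)^[n + 1] z).1 := by
      rw [Function.iterate_succ_apply', Function.iterate_succ_apply', symStep, symStep, h2, h4]
      split_ifs <;> rfl
    exact ⟨h5, by rw [returns_succ, returns_succ, h3, h5]⟩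

/-- A stopping time property: whether s returns have occurred by time n is decided by the level and
the first s symbols. -/
lemma le_returns_iff {z z' : ℕ × (ℕ → ι)} (h1 : z.1 = z'.1) {s : ℕ}
    (h : ∀ m < s, z.2 m = z'.2 m) {n : ℕ} : s ≤ returns τ n z ↔ s ≤ returns τ n z' := by
  constructor
  · intro h2
    by_contra h3
    rw [(iterate_symStep_congr τ h1.symm (fun m hm => (h m hm).symm) (not_le.1 h3)).2] at h2
    exact h3 h2
  · intro h2
    by_contra h3
    rw [(iterate_symStep_congr τ h1 h (not_le.1 h3)).2] at h2
    exact h3 h2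

/-- Elapsed time plus the initial height equals the heights of the completed columns plus the
present height. -/
lemma add_fst_lt_sum {z : ℕ × (ℕ → ι)} (hz : z.1 < τ (z.2 0)) (hτ : ∀ i, 0 < τ i) (n : ℕ) :
    ((symStep τ)^[n] z).1 < τ (((symStep τ)^[n] z).2 0) ∧
    n + z.1 = ∑ j ∈ Finset.range (returns τ n z), τ (z.2 j) + ((symStep τ)^[n] z).1 := by
  induction n with
  | zero => exact ⟨hz, by simp [returns]⟩
  | succ n ih =>
    obtain ⟨h1, h2⟩ := ih
    rw [Function.iterate_succ_apply', returns_succ, Function.iterate_succ_apply']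
    rcases lt_or_ge (((symStep τ)^[n] z).1 + 1) (τ (((symStep τ)^[n] z).2 0)) with h | h
    · rw [symStep_of_lt τ h]
      refine ⟨h, ?_⟩
      rw [if_neg (by simp), add_zero]
      omega
    · rw [symStep_of_le τ h]
      refine ⟨hτ _, ?_⟩
      rw [if_pos rfl, Finset.sum_range_succ]
      have h3 : ((symStep τ)^[n] z).2 0 = z.2 (returns τ n z) := by
        rw [iterate_symStep_snd, shift_iterate_apply, zero_add]
      rw [h3] at h1 h
      dsimp only
      omega

lemma add_fst_lt_sum_of_returns_le {z : ℕ × (ℕ → ι)} (hz : z.1 < τ (z.2 0)) (hτ : ∀ i, 0 < τ i)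
    {n m : ℕ} (h : returns τ n z ≤ m) : n + z.1 < ∑ j ∈ Finset.range (m + 1), τ (z.2 j) := by
  obtain ⟨h1, h2⟩ := add_fst_lt_sum τ hz hτ n
  rw [iterate_symStep_snd, shift_iterate_apply, zero_add] at h1
  have h3 : ∑ j ∈ Finset.range (returns τ n z + 1), τ (z.2 j) ≤
      ∑ j ∈ Finset.range (m + 1), τ (z.2 j) :=
    Finset.sum_le_sum_of_subset (Finset.range_mono (by omega))
  rw [Finset.sum_range_succ] at h3
  omega

variable [MeasurableSpace ι] [Countable ι] [MeasurableSingletonClass ι]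

lemma measurable_symStep : Measurable (symStep τ) := by
  have h0 : Measurable fun z : ℕ × (ℕ → ι) => τ (z.2 0) :=
    (measurable_of_countable τ).comp ((measurable_pi_apply 0).comp measurable_snd)
  refine Measurable.ite (measurableSet_lt (measurable_fst.add_const 1) h0) ?_ ?_
  · exact (measurable_fst.add_const 1).prodMk measurable_snd
  · exact measurable_const.prodMk (measurable_shift.comp measurable_snd)

lemma measurable_returns (n : ℕ) : Measurable (returns τ n) := by
  induction n with
  | zero => exact measurable_const
  | succ n ih =>
    refine ih.add (Measurable.ite ?_ measurable_const measurable_const)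
    exact (measurable_fst.comp ((measurable_symStep τ).iterate (n + 1))) (measurableSet_singleton 0)

/-- The measure on itineraries induced on the base of the tower. -/
def baseMeasure (ζ : Measure (ℕ × (ℕ → ι))) : Measure (ℕ → ι) :=
  (ζ.restrict {z | z.1 = 0}).map Prod.snd

omit [Countable ι] [MeasurableSingletonClass ι] in
lemma measurableSet_fst_eq (l : ℕ) : MeasurableSet {z : ℕ × (ℕ → ι) | z.1 = l} :=
  measurable_fst (measurableSet_singleton l)

omit [Countable ι] [MeasurableSingletonClass ι] in
lemma baseMeasure_apply (ζ : Measure (ℕ × (ℕ → ι))) {E : Set (ℕ → ι)} (hE : MeasurableSet E) :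
    baseMeasure ζ E = ζ {z | z.1 = 0 ∧ z.2 ∈ E} := by
  rw [baseMeasure, Measure.map_apply measurable_snd hE,
    Measure.restrict_apply' (measurableSet_fst_eq 0), inter_comm]
  rfl

instance (ζ : Measure (ℕ × (ℕ → ι))) [IsFiniteMeasure ζ] : IsFiniteMeasure (baseMeasure ζ) := by
  unfold baseMeasure; infer_instance

variable {τ} {ζ : Measure (ℕ × (ℕ → ι))} [IsProbabilityMeasure ζ]
  (hζ : MeasurePreserving (symStep τ) ζ ζ) (hval : ∀ᵐ z ∂ζ, z.1 < τ (z.2 0))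
include hζ hval

omit [IsProbabilityMeasure ζ] in
/-- The measures of the subsets of the levels of the tower. -/
lemma measure_level (l : ℕ) {E : Set (ℕ → ι)} (hE : MeasurableSet E) :
    ζ {z | z.1 = l ∧ z.2 ∈ E} = baseMeasure ζ (E ∩ {x | l < τ (x 0)}) := by
  have hm : ∀ l, MeasurableSet {x : ℕ → ι | l < τ (x 0)} := fun l =>
    measurableSet_lt measurable_const ((measurable_of_countable τ).comp (measurable_pi_apply 0))
  induction l generalizing E with
  | zero =>
    rw [baseMeasure_apply ζ (hE.inter (hm 0))]
    refine measure_congr ?_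
    filter_upwards [hval] with z hz
    refine propext ?_
    change (z.1 = 0 ∧ z.2 ∈ E) ↔ (z.1 = 0 ∧ z.2 ∈ E ∧ 0 < τ (z.2 0))
    constructor
    · exact fun h => ⟨h.1, h.2, by omega⟩
    · exact fun h => ⟨h.1, h.2.1⟩
  | succ l ih =>
    have h1 : MeasurableSet {z : ℕ × (ℕ → ι) | z.1 = l + 1 ∧ z.2 ∈ E} :=
      (measurableSet_fst_eq (l + 1)).inter (measurable_snd hE)
    rw [← hζ.measure_preimage h1.nullMeasurableSet]
    have h2 : symStep τ ⁻¹' {z | z.1 = l + 1 ∧ z.2 ∈ E} =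
        {z | z.1 = l ∧ z.2 ∈ E ∩ {x | l + 1 < τ (x 0)}} := by
      ext z
      simp only [mem_preimage, mem_ofPred_eq, mem_inter_iff]
      rcases lt_or_ge (z.1 + 1) (τ (z.2 0)) with h | h
      · rw [symStep_of_lt τ h]
        constructor
        · rintro ⟨h3, h4⟩
          exact ⟨by simpa using h3, h4, by simp at h3; omega⟩
        · rintro ⟨h3, h4, _⟩
          exact ⟨by simpa using h3, h4⟩
      · rw [symStep_of_le τ h]
        constructor
        · rintro ⟨h3, _⟩
          simp at h3
        · rintro ⟨h3, _, h4⟩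
          omega
    rw [h2, ih (hE.inter (hm _))]
    congr 1
    ext x
    simp only [mem_inter_iff, mem_ofPred_eq]
    constructor
    · rintro ⟨⟨h3, h4⟩, _⟩
      exact ⟨h3, h4⟩
    · rintro ⟨h3, h4⟩
      exact ⟨⟨h3, h4⟩, by omega⟩

/-- The measure induced on the base is shift invariant. -/
lemma measurePreserving_shift_baseMeasure :
    MeasurePreserving shift (baseMeasure ζ) (baseMeasure ζ) := by
  have hm : ∀ l, MeasurableSet {x : ℕ → ι | τ (x 0) = l + 1} := fun l =>
    ((measurable_of_countable τ).comp (measurable_pi_apply 0)) (measurableSet_singleton (l + 1))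
  refine ⟨measurable_shift, Measure.ext fun E hE => ?_⟩
  have h0 : MeasurableSet {z : ℕ × (ℕ → ι) | z.1 = 0 ∧ z.2 ∈ E} :=
    (measurableSet_fst_eq 0).inter (measurable_snd hE)
  rw [Measure.map_apply measurable_shift hE, baseMeasure_apply ζ hE,
    ← hζ.measure_preimage h0.nullMeasurableSet]
  -- The points that enter the base are the tops of the columns; sorted by their level l, they are
  -- the points of level l with τ = l + 1.
  have h1 : ζ (symStep τ ⁻¹' {z | z.1 = 0 ∧ z.2 ∈ E}) =
      ζ (⋃ l : ℕ, {z | z.1 = l ∧ z.2 ∈ shift ⁻¹' E ∩ {x | τ (x 0) = l + 1}}) := by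
    refine measure_congr ?_
    filter_upwards [hval] with z hz
    refine propext ?_
    change (symStep τ z).1 = 0 ∧ (symStep τ z).2 ∈ E ↔ _
    change _ ↔ z ∈ (⋃ l : ℕ, {z | z.1 = l ∧ z.2 ∈ shift ⁻¹' E ∩ {x | τ (x 0) = l + 1}})
    simp only [mem_iUnion, mem_ofPred_eq, mem_inter_iff, mem_preimage]
    rcases lt_or_ge (z.1 + 1) (τ (z.2 0)) with h | h
    · rw [symStep_of_lt τ h]
      constructor
      · rintro ⟨h3, _⟩
        simp at h3
      · rintro ⟨l, rfl, _, h4⟩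
        omega
    · rw [symStep_of_le τ h]
      constructor
      · rintro ⟨_, h4⟩
        exact ⟨z.1, rfl, h4, by omega⟩
      · rintro ⟨l, rfl, h3, _⟩
        exact ⟨rfl, h3⟩
  have hmm : ∀ l : ℕ, MeasurableSet (shift ⁻¹' E ∩ {x : ℕ → ι | τ (x 0) = l + 1}) := fun l =>
    (measurable_shift hE).inter (hm l)
  rw [h1, measure_iUnion]
  · have h2 : ∀ l : ℕ, ζ {z | z.1 = l ∧ z.2 ∈ shift ⁻¹' E ∩ {x | τ (x 0) = l + 1}} =
        baseMeasure ζ (shift ⁻¹' E ∩ {x | τ (x 0) = l + 1}) := by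
      intro l
      rw [measure_level hζ hval l (hmm l)]
      congr 1
      ext x
      simp only [mem_inter_iff, mem_ofPred_eq]
      constructor
      · exact fun h => h.1
      · exact fun h => ⟨h, by omega⟩
    simp only [h2]
    rw [← measure_iUnion _ hmm]
    · refine measure_congr ?_
      have hae : ∀ᵐ x ∂(baseMeasure ζ), 0 < τ (x 0) := by
        have hs : MeasurableSet {x : ℕ → ι | 0 < τ (x 0)}ᶜ :=
          (measurableSet_lt measurable_const
            ((measurable_of_countable τ).comp (measurable_pi_apply 0))).compl
        change baseMeasure ζ {x : ℕ → ι | 0 < τ (x 0)}ᶜ = 0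
        rw [baseMeasure_apply ζ hs]
        refine measure_mono_null ?_ hval
        rintro z ⟨h3, h4⟩ h5
        have h6 : z.1 < τ (z.2 0) := h5
        have h7 : ¬ 0 < τ (z.2 0) := h4
        omega
      filter_upwards [hae] with x hx
      refine propext ?_
      change x ∈ shift ⁻¹' E ↔ x ∈ ⋃ l : ℕ, shift ⁻¹' E ∩ {x | τ (x 0) = l + 1}
      simp only [mem_iUnion, mem_inter_iff, mem_ofPred_eq]
      exact ⟨fun h => ⟨τ (x 0) - 1, h, by omega⟩, fun ⟨l, h, _⟩ => h⟩
    · intro l l' hll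
      refine Set.disjoint_left.2 fun x hx hx' => hll ?_
      have h3 : τ (x 0) = l + 1 := hx.2
      have h4 : τ (x 0) = l' + 1 := hx'.2
      omega
  · intro l l' hll
    refine Set.disjoint_left.2 fun x hx hx' => hll ?_
    have h3 : x.1 = l := hx.1
    have h4 : x.1 = l' := hx'.1
    omega
  · exact fun l => (measurableSet_fst_eq l).inter (measurable_snd (hmm l))

/-- Integrals with respect to the measure of the tower. -/
lemma lintegral_tower {g : ℕ × (ℕ → ι) → ℝ≥0∞} (hg : Measurable g) :
    ∫⁻ z, g z ∂ζ = ∑' l : ℕ, ∫⁻ x in {x | l < τ (x 0)}, g (l, x) ∂(baseMeasure ζ) := by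
  have hm : ∀ l, MeasurableSet {x : ℕ → ι | l < τ (x 0)} := fun l =>
    measurableSet_lt measurable_const ((measurable_of_countable τ).comp (measurable_pi_apply 0))
  have h1 : (univ : Set (ℕ × (ℕ → ι))) = ⋃ l : ℕ, {z | z.1 = l} := by ext z; simp
  have h2 : ∀ l : ℕ, (ζ.restrict {z | z.1 = l}) =
      ((baseMeasure ζ).restrict {x | l < τ (x 0)}).map (fun x => (l, x)) := by
    intro l
    refine Measure.ext fun S hS => ?_
    have hS' : MeasurableSet {x : ℕ → ι | (l, x) ∈ S} := measurable_prodMk_left hS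
    rw [Measure.map_apply measurable_prodMk_left hS, Measure.restrict_apply' (hm l),
      Measure.restrict_apply' (measurableSet_fst_eq l)]
    rw [show (fun x : ℕ → ι => (l, x)) ⁻¹' S = {x | (l, x) ∈ S} from rfl,
      ← measure_level hζ hval l hS']
    congr 1
    ext ⟨a, x⟩
    simp only [mem_inter_iff, mem_ofPred_eq]
    constructor
    · rintro ⟨h3, rfl⟩; exact ⟨rfl, h3⟩
    · rintro ⟨rfl, h3⟩; exact ⟨h3, rfl⟩
  rw [← setLIntegral_univ, h1, lintegral_iUnion (fun l => measurableSet_fst_eq l)]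
  · refine tsum_congr fun l => ?_
    rw [h2, lintegral_map hg measurable_prodMk_left]
  · intro l l' hll
    refine Set.disjoint_left.2 fun x hx hx' => hll ?_
    have h3 : x.1 = l := hx
    have h4 : x.1 = l' := hx'
    omega

end SymbolicTower

/-! ### Few returns are unlikely; polynomial tails. -/

section ReturnTails

variable {ι : Type*} [MeasurableSpace ι] [Countable ι] [MeasurableSingletonClass ι]

/-- Bounded distortion implies that the first symbol is almost independent of the others. -/
lemma IsGibbsOn.lintegral_mul_shift_le {μ : Measure (ℕ → ι)} [IsFiniteMeasure μ] {C β : ℝ}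
    (h : IsGibbs μ C β) (f : ι → ℝ≥0∞) {g : (ℕ → ι) → ℝ≥0∞} (hg : Measurable g) :
    ∫⁻ x, f (x 0) * g (shift x) ∂μ ≤
      ENNReal.ofReal (Real.exp C) / μ univ * (∫⁻ x, f (x 0) ∂μ) * ∫⁻ x, g x ∂μ := by
  by_cases hu : μ univ = 0
  · rw [Measure.measure_univ_eq_zero.1 hu]; simp
  have hm : ∀ i, MeasurableSet {x : ℕ → ι | x 0 = i} := fun i =>
    measurable_pi_apply (X := fun _ : ℕ => ι) 0 (measurableSet_singleton i)
  have hd : Pairwise (Function.onFun Disjoint fun i => {x : ℕ → ι | x 0 = i}) := fun i j hij =>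
    Set.disjoint_left.2 fun x (hx : x 0 = i) (hx' : x 0 = j) => hij (hx.symm.trans hx')
  have hun : (univ : Set (ℕ → ι)) = ⋃ i, {x | x 0 = i} := by ext x; simp
  set K := ENNReal.ofReal (Real.exp C) / μ univ with hK
  -- Distortion with s = 0 for a one-letter word, compared with the whole space.
  have h1 : ∀ i, ((μ.restrict {x | x 0 = i}).map shift) ≤ (K * μ {x | x 0 = i}) • μ := by
    intro i
    refine Measure.le_iff.2 fun E hE => ?_
    rw [Measure.map_apply measurable_shift hE, Measure.restrict_apply' (hm i), Measure.smul_apply,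
      smul_eq_mul]
    have h2 := h [i] trivial 0 E univ hE MeasurableSet.univ (by simp)
    have h3 : prepend [i] E = shift ⁻¹' E ∩ {x | x 0 = i} := by
      ext x; simp [prepend, and_comm]
    have h4 : prepend [i] univ = {x : ℕ → ι | x 0 = i} := by
      ext x; simp [prepend]
    rw [h3, h4, pow_zero, mul_one] at h2
    have h5 : K * μ {x | x 0 = i} * μ E =
        ENNReal.ofReal (Real.exp C) * μ {x | x 0 = i} * μ E / μ univ := by
      rw [hK]; simp only [div_eq_mul_inv]; ring
    rw [h5, ENNReal.le_div_iff_mul_le (Or.inl hu) (Or.inl (measure_ne_top _ _))]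
    exact h2
  have h5 : ∀ i, ∫⁻ x in {x | x 0 = i}, f (x 0) * g (shift x) ∂μ ≤
      K * (f i * μ {x | x 0 = i}) * ∫⁻ x, g x ∂μ := by
    intro i
    have h6 : ∫⁻ x in {x | x 0 = i}, f (x 0) * g (shift x) ∂μ =
        ∫⁻ x in {x | x 0 = i}, f i * g (shift x) ∂μ :=
      setLIntegral_congr_fun (hm i) fun x (hx : x 0 = i) => by rw [hx]
    rw [h6, lintegral_const_mul _ (show Measurable fun x => g (shift x) from hg.comp measurable_shift), ← lintegral_map hg measurable_shift]
    refine (mul_le_mul_right (lintegral_mono' (h1 i) le_rfl) _).trans (le_of_eq ?_)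
    rw [lintegral_smul_measure, smul_eq_mul]
    ring
  have h7 : ∀ i, ∫⁻ x in {x | x 0 = i}, f (x 0) ∂μ = f i * μ {x | x 0 = i} := by
    intro i
    rw [setLIntegral_congr_fun (g := fun _ => f i) (hm i) fun x (hx : x 0 = i) => by simp only [hx],
      setLIntegral_const]
  rw [← setLIntegral_univ, hun, lintegral_iUnion hm hd]
  conv_rhs => rw [← setLIntegral_univ (fun x : ℕ → ι => f (x 0)), hun, lintegral_iUnion hm hd]
  simp only [h7]
  rw [← ENNReal.tsum_mul_left, ← ENNReal.tsum_mul_right]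
  exact ENNReal.tsum_le_tsum h5

variable {τ : ι → ℕ} {ζ : Measure (ℕ × (ℕ → ι))} [IsProbabilityMeasure ζ]
  (hζ : MeasurePreserving (symStep τ) ζ ζ) (hval : ∀ᵐ z ∂ζ, z.1 < τ (z.2 0))
include hζ hval

/-- The column over x has τ (x 0) levels. So on the tower the first symbol is biased by its return
time. -/
lemma lintegral_tower_snd {g : (ℕ → ι) → ℝ≥0∞} (hg : Measurable g) :
    ∫⁻ z, g z.2 ∂ζ = ∫⁻ x, (τ (x 0) : ℝ≥0∞) * g x ∂(baseMeasure ζ) := by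
  have hm : ∀ l, MeasurableSet {x : ℕ → ι | l < τ (x 0)} := fun l =>
    measurableSet_lt measurable_const ((measurable_of_countable τ).comp (measurable_pi_apply 0))
  rw [lintegral_tower hζ hval (g := fun z => g z.2) (hg.comp measurable_snd)]
  simp only [← lintegral_indicator (hm _)]
  rw [← lintegral_tsum fun l => (hg.indicator (hm l)).aemeasurable]
  refine lintegral_congr fun x => ?_
  have h1 : ∀ l : ℕ, ({x : ℕ → ι | l < τ (x 0)}.indicator (fun x => g x) x) =
      if l ∈ Finset.range (τ (x 0)) then g x else 0 := by
    intro l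
    simp [indicator, Finset.mem_range]
  change ∑' l : ℕ, ({x : ℕ → ι | l < τ (x 0)}.indicator (fun x => g x) x) = _
  simp only [h1]
  rw [tsum_eq_sum (s := Finset.range (τ (x 0))) (fun l hl => by rw [if_neg hl])]
  rw [Finset.sum_congr rfl fun l hl => if_pos hl]
  simp

/-- Kac's formula. -/
lemma lintegral_time : ∫⁻ x, (τ (x 0) : ℝ≥0∞) ∂(baseMeasure ζ) = 1 := by
  have := lintegral_tower_snd hζ hval (g := fun _ => 1) measurable_const
  simpa using this.symm

lemma baseMeasure_univ_ne_zero : baseMeasure ζ univ ≠ 0 := by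
  intro h
  have := lintegral_time hζ hval
  rw [Measure.measure_univ_eq_zero.1 h] at this
  simp at this

omit hζ hval in
lemma baseMeasure_univ_le_one : baseMeasure ζ univ ≤ 1 := by
  rw [baseMeasure_apply ζ MeasurableSet.univ]
  exact prob_le_one

lemma baseMeasure_lt_time (n : ℕ) : baseMeasure ζ {x | n < τ (x 0)} ≤ ζ {z | n ≤ z.1} := by
  have h := measure_level hζ hval n MeasurableSet.univ
  rw [univ_inter] at h
  rw [← h]
  exact measure_mono fun z hz => hz.1.ge

/-- A point with more than n steps left in its column, the last one included, is at height at least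
n after n steps; invariance does the rest. -/
lemma measure_lt_time_sub (n : ℕ) : ζ {z | n < τ (z.2 0) - z.1} ≤ ζ {z | n ≤ z.1} := by
  rw [← (hζ.iterate n).measure_preimage
    (measurableSet_le measurable_const measurable_fst).nullMeasurableSet]
  refine measure_mono fun z hz => ?_
  have key : ∀ j ≤ n, ((symStep τ)^[j] z) = (z.1 + j, z.2) := by
    intro j hj
    induction j with
    | zero => rfl
    | succ j ih =>
      have hz' : n < τ (z.2 0) - z.1 := hz
      rw [Function.iterate_succ_apply', ih (by omega), symStep_of_lt τ (by dsimp only; omega)]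
      rfl
  change n ≤ ((symStep τ)^[n] z).1
  rw [key n le_rfl]
  dsimp only
  omega

variable {C β : ℝ} (hG : IsGibbs (baseMeasure ζ) C β)
include hG

/-- Bounded distortion decouples the symbol j + 1 from the size bias of the first one, and the bias
integrates to 1 by `lintegral_time`. -/
lemma measure_lt_time_coord (n j : ℕ) : ζ {z | n < τ (z.2 (j + 1))} ≤
    ENNReal.ofReal (Real.exp C) / baseMeasure ζ univ * ζ {z | n ≤ z.1} := by
  have hm : ∀ j, MeasurableSet {x : ℕ → ι | n < τ (x j)} := fun j =>
    measurableSet_lt measurable_const ((measurable_of_countable τ).comp (measurable_pi_apply j))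
  have h1 : ζ {z | n < τ (z.2 (j + 1))} =
      ∫⁻ z, ({x : ℕ → ι | n < τ (x (j + 1))}.indicator 1 z.2) ∂ζ := by
    have := lintegral_indicator_one (μ := ζ) (s := {z | n < τ (z.2 (j + 1))})
      (measurable_snd (hm (j + 1)))
    rw [← this]
    rfl
  rw [h1, lintegral_tower_snd hζ hval (measurable_one.indicator (hm (j + 1)))]
  refine (hG.lintegral_mul_shift_le (fun i => (τ i : ℝ≥0∞))
    (measurable_one.indicator (hm j))).trans ?_
  rw [lintegral_time hζ hval, mul_one, lintegral_indicator_one (hm j)]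
  gcongr
  have hs := ((measurePreserving_shift_baseMeasure hζ hval).iterate j).measure_preimage
    (hm 0).nullMeasurableSet
  have h2 : shift^[j] ⁻¹' {x : ℕ → ι | n < τ (x 0)} = {x | n < τ (x j)} := by
    ext x
    simp only [mem_preimage, mem_ofPred_eq, shift_iterate_apply, zero_add]
  rw [← h2, hs]
  exact baseMeasure_lt_time hζ hval n

variable (hτ : ∀ i, 0 < τ i)
include hτ

/-- Union bound for the number of returns. -/
lemma exists_measureReal_returns_le : ∃ K : ℝ, 0 < K ∧ ∀ k m n : ℕ, (m + 1) * n ≤ k →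
    ζ.real {z | returns τ k z ≤ m} ≤ K * (m + 1) * ζ.real {z | n ≤ z.1} := by
  set K := ENNReal.ofReal (Real.exp C) / baseMeasure ζ univ with hK
  have hKtop : K ≠ ⊤ := (ENNReal.div_lt_top ENNReal.ofReal_ne_top
    (baseMeasure_univ_ne_zero hζ hval)).ne
  refine ⟨K.toReal + 1, by positivity, fun k m n hkmn => ?_⟩
  -- At most m returns in at least (m + 1) n steps: one of the m + 1 columns visited takes more than
  -- n steps. The first column counts only from the initial height.
  have hsub : ∀ᵐ z ∂ζ, z ∈ {z | returns τ k z ≤ m} → z ∈ {z : ℕ × (ℕ → ι) | n < τ (z.2 0) - z.1} ∪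
      ⋃ j ∈ Finset.range m, {z : ℕ × (ℕ → ι) | n < τ (z.2 (j + 1))} := by
    filter_upwards [hval] with z hz hk
    have h1 := add_fst_lt_sum_of_returns_le τ hz hτ (show returns τ k z ≤ m from hk)
    by_contra hn
    simp only [mem_union, mem_iUnion, mem_ofPred_eq, not_or, not_exists, not_lt,
      Finset.mem_range] at hn
    obtain ⟨h2, h3⟩ := hn
    rw [Finset.sum_range_succ'] at h1
    have h4 : ∑ j ∈ Finset.range m, τ (z.2 (j + 1)) ≤ m * n := by
      refine (Finset.sum_le_sum fun j hj => h3 j (Finset.mem_range.1 hj)).trans ?_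
      simp
    have h5 : (m + 1) * n = m * n + n := by ring
    omega
  have h1 : ζ.real {z | returns τ k z ≤ m} ≤ ζ.real ({z : ℕ × (ℕ → ι) | n < τ (z.2 0) - z.1} ∪
      ⋃ j ∈ Finset.range m, {z : ℕ × (ℕ → ι) | n < τ (z.2 (j + 1))}) :=
    ENNReal.toReal_mono (measure_ne_top _ _) (measure_mono_ae hsub)
  have hT0 : 0 ≤ ζ.real {z | n ≤ z.1} := measureReal_nonneg
  refine h1.trans ((measureReal_union_le _ _).trans ?_)
  have h2 : ζ.real {z : ℕ × (ℕ → ι) | n < τ (z.2 0) - z.1} ≤ ζ.real {z | n ≤ z.1} :=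
    ENNReal.toReal_mono (measure_ne_top _ _) (measure_lt_time_sub hζ hval n)
  have h3 : ζ.real (⋃ j ∈ Finset.range m, {z : ℕ × (ℕ → ι) | n < τ (z.2 (j + 1))}) ≤
      m * (K.toReal * ζ.real {z | n ≤ z.1}) := by
    refine (measureReal_biUnion_finset_le _ _).trans ?_
    refine (Finset.sum_le_sum fun j _ => (?_ : _ ≤ K.toReal * ζ.real {z | n ≤ z.1})).trans ?_
    · rw [Measure.real, Measure.real, ← ENNReal.toReal_mul]
      exact ENNReal.toReal_mono (ENNReal.mul_ne_top hKtop (measure_ne_top _ _))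
        (measure_lt_time_coord hζ hval hG n j)
    · simp
  have hK0 : 0 ≤ K.toReal := ENNReal.toReal_nonneg
  have hm0 : (0 : ℝ) ≤ m := by positivity
  nlinarith [mul_nonneg hm0 hT0, mul_nonneg hK0 hT0]

/-- Polynomial tails of the number of returns. -/
lemma exists_measureReal_returns_le_of_poly {α C' : ℝ} (hα : 0 < α) (hC' : 0 < C')
    (htail : ∀ n : ℕ, 1 ≤ n → ζ.real {z | n + 1 ≤ z.1} ≤ C' * (n : ℝ) ^ (-α)) :
    ∃ K : ℝ, 0 < K ∧ ∀ k m : ℕ, 1 ≤ k →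
      ζ.real {z | returns τ k z ≤ m} ≤ K * ((m : ℝ) + 1) ^ (1 + α) * (k : ℝ) ^ (-α) := by
  obtain ⟨K, hK, h⟩ := exists_measureReal_returns_le hζ hval hG hτ
  refine ⟨K * C' * 3 ^ α + 2 ^ α, by positivity, fun k m hk => ?_⟩
  have hk0 : (0 : ℝ) < k := by exact_mod_cast hk
  have hm0 : (0 : ℝ) < (m : ℝ) + 1 := by positivity
  have e1 : ((m : ℝ) + 1) ^ (1 + α) = ((m : ℝ) + 1) * ((m : ℝ) + 1) ^ α := by
    rw [Real.rpow_add hm0, Real.rpow_one]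
  rcases lt_or_ge k (2 * (m + 1)) with hkm | hkm
  · refine measureReal_le_one.trans ?_
    have h1 : (k : ℝ) ^ α ≤ 2 ^ α * ((m : ℝ) + 1) ^ α := by
      rw [← Real.mul_rpow (by norm_num) hm0.le]
      refine Real.rpow_le_rpow hk0.le ?_ hα.le
      exact_mod_cast hkm.le
    have h2 : (1 : ℝ) ≤ 2 ^ α * ((m : ℝ) + 1) ^ α * (k : ℝ) ^ (-α) := by
      rw [Real.rpow_neg hk0.le, ← div_eq_mul_inv, le_div_iff₀ (by positivity), one_mul]
      exact h1
    refine h2.trans ?_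
    have h3 : ((m : ℝ) + 1) ^ α ≤ ((m : ℝ) + 1) ^ (1 + α) := by
      rw [e1]
      exact le_mul_of_one_le_left (by positivity) (by linarith [(Nat.cast_nonneg m : (0 : ℝ) ≤ m)])
    gcongr
    have : 0 ≤ K * C' * 3 ^ α := by positivity
    linarith
  -- The tail hypothesis is about heights at least n + 1 with n ≥ 1, so the quotient k / (m + 1) ≥ 2
  -- is written n + 1.
  · obtain ⟨n, hn⟩ : ∃ n, k / (m + 1) = n + 1 := ⟨k / (m + 1) - 1, by
      have : 2 ≤ k / (m + 1) := (Nat.le_div_iff_mul_le (by omega)).2 hkm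
      omega⟩
    have hn1 : 1 ≤ n := by
      have : 2 ≤ k / (m + 1) := (Nat.le_div_iff_mul_le (by omega)).2 hkm
      omega
    have h1 := h k m (n + 1) (by rw [← hn]; exact Nat.mul_div_le k (m + 1))
    refine h1.trans ?_
    have h2 := mul_le_mul_of_nonneg_left (htail n hn1) (by positivity : 0 ≤ K * ((m : ℝ) + 1))
    refine h2.trans ?_
    have hn0 : (0 : ℝ) < n := by exact_mod_cast hn1
    have h3 : (k : ℝ) ≤ 3 * n * (m + 1) := by
      have h4 : k < (n + 2) * (m + 1) := by
        have := Nat.lt_div_mul_add (a := k) (b := m + 1) (by omega)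
        rw [hn] at this
        linarith
      have h5 : (n + 2) * (m + 1) ≤ 3 * n * (m + 1) := Nat.mul_le_mul_right _ (by omega)
      exact_mod_cast h4.le.trans h5
    have h4 : (n : ℝ) ^ (-α) ≤ 3 ^ α * ((m : ℝ) + 1) ^ α * (k : ℝ) ^ (-α) := by
      rw [Real.rpow_neg hk0.le, Real.rpow_neg hn0.le, ← div_eq_mul_inv, le_div_iff₀ (by positivity),
        inv_mul_eq_div, div_le_iff₀ (by positivity), ← Real.mul_rpow (by norm_num) hm0.le,
        ← Real.mul_rpow (by positivity) hn0.le]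
      exact Real.rpow_le_rpow hk0.le (by linarith) hα.le
    have h5 := mul_le_mul_of_nonneg_left h4 (by positivity : 0 ≤ K * ((m : ℝ) + 1) * C')
    rw [e1]
    have h6 : (0 : ℝ) ≤ 2 ^ α * (((m : ℝ) + 1) * ((m : ℝ) + 1) ^ α) * (k : ℝ) ^ (-α) := by positivity
    nlinarith

omit hG hτ hval hζ in
lemma integrable_pow_returns {b : ℝ} (hb0 : 0 ≤ b) (hb1 : b ≤ 1) (k : ℕ) :
    Integrable (fun z => b ^ returns τ k z) ζ :=
  integrable_of_bdd ((measurable_of_countable fun n : ℕ => b ^ n).comp (measurable_returns τ k))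
    (B := 1) fun z => by
      rw [abs_of_nonneg (by positivity)]
      exact pow_le_one₀ hb0 hb1

/-- Bound b^N by the sum over m of b^m times the indicator of N ≤ m; the factors (m + 1)^(1+α) are
summable against b^m. -/
lemma exists_integral_pow_returns_le_of_poly {α C' : ℝ} (hα : 0 < α) (hC' : 0 < C')
    (htail : ∀ n : ℕ, 1 ≤ n → ζ.real {z | n + 1 ≤ z.1} ≤ C' * (n : ℝ) ^ (-α)) {b : ℝ} (hb0 : 0 < b)
    (hb1 : b < 1) : ∃ K : ℝ, 0 < K ∧ ∀ k : ℕ, 1 ≤ k →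
      ∫ z, b ^ returns τ k z ∂ζ ≤ K * (k : ℝ) ^ (-α) := by
  obtain ⟨K, hK, h⟩ := exists_measureReal_returns_le_of_poly hζ hval hG hτ hα hC' htail
  obtain ⟨p, hp⟩ := exists_nat_ge (1 + α)
  have hs : Summable fun m : ℕ => ((m : ℝ) + 1) ^ p * b ^ m := by
    have h1 := summable_pow_mul_geometric_of_norm_lt_one p (r := b)
      (by rwa [Real.norm_eq_abs, abs_of_pos hb0])
    have h2 := ((summable_nat_add_iff 1).2 h1).mul_right b⁻¹
    refine h2.congr fun m => ?_
    push_cast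
    rw [pow_succ]
    field_simp
  set A := ∑' m : ℕ, ((m : ℝ) + 1) ^ p * b ^ m with hA
  have hA0 : 0 ≤ A := tsum_nonneg fun m => by positivity
  refine ⟨K * (A + 1), by positivity, fun k hk => ?_⟩
  have hms : ∀ m, MeasurableSet {z | returns τ k z ≤ m} := fun m =>
    measurableSet_le (measurable_returns τ k) measurable_const
  have h1 : ∫ z, b ^ returns τ k z ∂ζ ≤
      ∫ z, ∑ m ∈ Finset.range (k + 1), b ^ m * {z | returns τ k z ≤ m}.indicator 1 z ∂ζ := by
    refine integral_mono (integrable_pow_returns hb0.le hb1.le k)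
      (integrable_finsetSum _ fun m _ =>
        ((integrable_const (1 : ℝ)).indicator (hms m)).const_mul _) fun z => ?_
    have h2 := Finset.single_le_sum (f := fun m => b ^ m * {z | returns τ k z ≤ m}.indicator 1 z)
      (fun m _ => mul_nonneg (by positivity) (indicator_nonneg (fun _ _ => zero_le_one) _))
      (Finset.mem_range.2 (Nat.lt_succ_of_le (returns_le τ k z)))
    refine le_trans (le_of_eq ?_) h2
    simp
  refine h1.trans ?_
  have hi : ∀ m ∈ Finset.range (k + 1),
      Integrable (fun z => b ^ m * {z | returns τ k z ≤ m}.indicator 1 z) ζ := fun m _ =>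
    ((integrable_const (1 : ℝ)).indicator (hms m)).const_mul _
  rw [integral_finsetSum _ hi]
  have h2 : ∀ m ∈ Finset.range (k + 1), ∫ z, b ^ m * {z | returns τ k z ≤ m}.indicator 1 z ∂ζ ≤
      K * (k : ℝ) ^ (-α) * (((m : ℝ) + 1) ^ p * b ^ m) := by
    intro m _
    rw [integral_const_mul, integral_indicator_one (hms m)]
    have h3 := mul_le_mul_of_nonneg_left (h k m hk) (by positivity : 0 ≤ b ^ m)
    refine h3.trans ?_
    have h4 : ((m : ℝ) + 1) ^ (1 + α) ≤ ((m : ℝ) + 1) ^ p := by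
      rw [← Real.rpow_natCast]
      exact Real.rpow_le_rpow_of_exponent_le (by linarith [(Nat.cast_nonneg m : (0 : ℝ) ≤ m)]) hp
    calc b ^ m * (K * ((m : ℝ) + 1) ^ (1 + α) * (k : ℝ) ^ (-α)) ≤
        b ^ m * (K * ((m : ℝ) + 1) ^ p * (k : ℝ) ^ (-α)) := by gcongr
      _ = _ := by ring
  refine (Finset.sum_le_sum h2).trans ?_
  rw [← Finset.mul_sum]
  have h5 := hs.sum_le_tsum (Finset.range (k + 1)) fun m _ => by positivity
  have h6 : (0 : ℝ) ≤ K * (k : ℝ) ^ (-α) := by positivity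
  nlinarith

end ReturnTails

/-! ### Few returns are unlikely; stretched exponential tails. -/

section ExponentialReturnTails

variable {ι : Type*} [MeasurableSpace ι] [Countable ι] [MeasurableSingletonClass ι]

lemma lintegral_prod_coord_le {μ : Measure (ℕ → ι)} [IsFiniteMeasure μ] {C β : ℝ}
    (h : IsGibbs μ C β) (f : ι → ℝ≥0∞) (m : ℕ) :
    ∫⁻ x, ∏ j ∈ Finset.range m, f (x j) ∂μ ≤
      (ENNReal.ofReal (Real.exp C) / μ univ * ∫⁻ x, f (x 0) ∂μ) ^ m * μ univ := by
  induction m with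
  | zero => simp
  | succ m ih =>
    have hg : Measurable fun x : ℕ → ι => ∏ j ∈ Finset.range m, f (x j) :=
      Finset.measurable_fun_prod _ fun j _ =>
        (measurable_of_countable f).comp (measurable_pi_apply j)
    have h1 := h.lintegral_mul_shift_le f hg
    have h2 : ∀ x : ℕ → ι, ∏ j ∈ Finset.range (m + 1), f (x j) =
        f (x 0) * ∏ j ∈ Finset.range m, f (shift x j) := fun x => by
      rw [Finset.prod_range_succ', mul_comm]; rfl
    simp only [h2]
    refine h1.trans ((mul_le_mul_right ih _).trans (le_of_eq ?_))
    rw [pow_succ]; ring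

lemma sum_rpow_le_sum_rpow {θ : ℝ} (hθ : 0 < θ) (hθ1 : θ ≤ 1) (s : Finset ℕ) (a : ℕ → ℕ) :
    ((∑ j ∈ s, a j : ℕ) : ℝ) ^ θ ≤ ∑ j ∈ s, (a j : ℝ) ^ θ := by
  induction s using Finset.cons_induction with
  | empty => simp [Real.zero_rpow hθ.ne']
  | cons i s hi ih =>
    rw [Finset.sum_cons, Finset.sum_cons, Nat.cast_add]
    exact (Real.rpow_add_le_add_rpow (by positivity) (by positivity) hθ.le hθ1).trans (by gcongr)

variable {τ : ι → ℕ} {ζ : Measure (ℕ × (ℕ → ι))} [IsProbabilityMeasure ζ]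
  (hζ : MeasurePreserving (symStep τ) ζ ζ) (hval : ∀ᵐ z ∂ζ, z.1 < τ (z.2 0))
include hζ hval

lemma lintegral_exp_time_lt_top {c θ C' : ℝ} (hc : 0 < c) (hθ : 0 < θ) (hθ1 : θ ≤ 1)
    (hC' : 0 < C')
    (htail : ∀ n : ℕ, 1 ≤ n → ζ.real {z | n + 1 ≤ z.1} ≤ C' * Real.exp (-c * (n : ℝ) ^ θ)) :
    ∫⁻ x, ENNReal.ofReal ((τ (x 0) : ℝ) * Real.exp (c / 2 * (τ (x 0) : ℝ) ^ θ)) ∂(baseMeasure ζ)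
      < ⊤ := by
  have hmt : Measurable fun x : ℕ → ι => τ (x 0) :=
    (measurable_of_countable τ).comp (measurable_pi_apply 0)
  have h2θ : (0 : ℝ) ≤ 2 ^ θ := by positivity
  set D := (C' + 1) * Real.exp (c * 2 ^ θ) with hD
  have hDpos : 0 < D := by positivity
  have h1 : ∀ n : ℕ, baseMeasure ζ {x | τ (x 0) = n} ≤
      ENNReal.ofReal (D * Real.exp (-c * (n : ℝ) ^ θ)) := by
    intro n
    rcases lt_or_ge n 3 with hn | hn
    -- The tail hypothesis says nothing about return times below 3; the factor exp (c 2^θ) in D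
    -- makes the bound trivial there.
    · refine (measure_mono (subset_univ _)).trans (baseMeasure_univ_le_one.trans ?_)
      rw [← ENNReal.ofReal_one]
      refine ENNReal.ofReal_le_ofReal ?_
      have hn2 : (n : ℝ) ^ θ ≤ 2 ^ θ := by
        refine Real.rpow_le_rpow (by positivity) ?_ hθ.le
        exact_mod_cast Nat.le_of_lt_succ hn
      rw [hD, mul_assoc, ← Real.exp_add]
      have h3 : 1 ≤ Real.exp (c * 2 ^ θ + -c * (n : ℝ) ^ θ) := Real.one_le_exp (by nlinarith)
      nlinarith
    · obtain ⟨m, rfl⟩ : ∃ m, n = m + 2 := ⟨n - 2, by omega⟩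
      have h3 : baseMeasure ζ {x | τ (x 0) = m + 2} ≤ ζ {z | m + 1 ≤ z.1} := by
        refine le_trans (measure_mono ?_) (baseMeasure_lt_time hζ hval (m + 1))
        intro x hx
        have hx' : τ (x 0) = m + 2 := hx
        change m + 1 < τ (x 0)
        omega
      refine h3.trans ?_
      rw [← ENNReal.ofReal_toReal (measure_ne_top ζ {z | m + 1 ≤ z.1})]
      refine ENNReal.ofReal_le_ofReal ((htail m (by omega)).trans ?_)
      have h4 : ((m + 2 : ℕ) : ℝ) ^ θ ≤ (m : ℝ) ^ θ + 2 ^ θ := by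
        push_cast
        exact Real.rpow_add_le_add_rpow (by positivity) (by positivity) hθ.le hθ1
      rw [hD, mul_assoc, ← Real.exp_add]
      have h5 : Real.exp (-c * (m : ℝ) ^ θ) ≤
          Real.exp (c * 2 ^ θ + -c * ((m + 2 : ℕ) : ℝ) ^ θ) := Real.exp_le_exp.2 (by nlinarith)
      have h6 := Real.exp_pos (-c * (m : ℝ) ^ θ)
      nlinarith
  obtain ⟨C3, hC3, h3⟩ := exists_pow_mul_exp_neg_rpow_le 3 (half_pos hc) hθ
  have e1 : ∫⁻ x, ENNReal.ofReal ((τ (x 0) : ℝ) * Real.exp (c / 2 * (τ (x 0) : ℝ) ^ θ))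
      ∂(baseMeasure ζ) = ∑' n : ℕ, ENNReal.ofReal ((n : ℝ) * Real.exp (c / 2 * (n : ℝ) ^ θ)) *
        baseMeasure ζ {x | τ (x 0) = n} := by
    have h4 := lintegral_map (μ := baseMeasure ζ) (f := fun n : ℕ =>
      ENNReal.ofReal ((n : ℝ) * Real.exp (c / 2 * (n : ℝ) ^ θ))) (measurable_of_countable _) hmt
    rw [← h4, lintegral_countable']
    refine tsum_congr fun n => ?_
    rw [Measure.map_apply hmt (measurableSet_singleton n)]
    rfl
  rw [e1]
  have hs : Summable fun n : ℕ => D * C3 * (1 / (n : ℝ) ^ 2) :=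
    (Real.summable_one_div_nat_pow.2 one_lt_two).mul_left _
  refine lt_of_le_of_lt (ENNReal.tsum_le_tsum fun n => ?_) (lt_top_iff_ne_top.2 hs.tsum_ofReal_ne_top)
  refine (mul_le_mul_right (h1 n) _).trans ?_
  rw [← ENNReal.ofReal_mul (by positivity)]
  refine ENNReal.ofReal_le_ofReal ?_
  rcases Nat.eq_zero_or_pos n with rfl | hn
  · simp
  have hn1 : (1 : ℝ) ≤ n := by exact_mod_cast hn
  have h5 := h3 n hn1
  have h6 : (n : ℝ) * Real.exp (c / 2 * (n : ℝ) ^ θ) * (D * Real.exp (-c * (n : ℝ) ^ θ)) =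
      D * (n * Real.exp (-(c / 2) * (n : ℝ) ^ θ)) := by
    have : Real.exp (-(c / 2) * (n : ℝ) ^ θ) =
        Real.exp (c / 2 * (n : ℝ) ^ θ) * Real.exp (-c * (n : ℝ) ^ θ) := by
      rw [← Real.exp_add]; ring_nf
    rw [this]; ring
  rw [h6, mul_assoc D C3]
  refine mul_le_mul_of_nonneg_left ?_ hDpos.le
  rw [mul_one_div, le_div_iff₀ (by positivity)]
  calc (n : ℝ) * Real.exp (-(c / 2) * (n : ℝ) ^ θ) * (n : ℝ) ^ 2 =
      (n : ℝ) ^ 3 * Real.exp (-(c / 2) * (n : ℝ) ^ θ) := by ring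
    _ ≤ C3 := h5

variable {C β : ℝ} (hG : IsGibbs (baseMeasure ζ) C β) (hτ : ∀ i, 0 < τ i)
include hG hτ

/-- Few returns have an exponentially small probability. -/
lemma exists_measureReal_returns_le_of_exp {c θ C' : ℝ} (hc : 0 < c) (hθ : 0 < θ) (hθ1 : θ ≤ 1)
    (hC' : 0 < C')
    (htail : ∀ n : ℕ, 1 ≤ n → ζ.real {z | n + 1 ≤ z.1} ≤ C' * Real.exp (-c * (n : ℝ) ^ θ)) :
    ∃ K : ℝ, 1 < K ∧ ∀ k m : ℕ, 
      ζ.real {z | returns τ k z ≤ m} ≤ K ^ (m + 1) * Real.exp (-(c / 2) * (k : ℝ) ^ θ) := by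
  set K := ENNReal.ofReal (Real.exp C) / baseMeasure ζ univ with hK
  have hKtop : K ≠ ⊤ := (ENNReal.div_lt_top ENNReal.ofReal_ne_top
    (baseMeasure_univ_ne_zero hζ hval)).ne
  set f : ι → ℝ≥0∞ := fun i => ENNReal.ofReal (Real.exp (c / 2 * (τ i : ℝ) ^ θ)) with hf
  set A := ∫⁻ x, (τ (x 0) : ℝ≥0∞) * f (x 0) ∂(baseMeasure ζ) with hA
  have hAtop : A ≠ ⊤ := by
    refine ne_of_eq_of_ne ?_ (lintegral_exp_time_lt_top hζ hval hc hθ hθ1 hC' htail).ne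
    refine lintegral_congr fun x => ?_
    rw [ENNReal.ofReal_mul (by positivity), ENNReal.ofReal_natCast]
  have hKA : K * A ≠ ⊤ := ENNReal.mul_ne_top hKtop hAtop
  have hfm : Measurable f := measurable_of_countable f
  have h1 : ∀ m, ∫⁻ x, (τ (x 0) : ℝ≥0∞) * ∏ j ∈ Finset.range (m + 1), f (x j) ∂(baseMeasure ζ) ≤
      (K * A) ^ (m + 1) := by
    intro m
    have hg : Measurable fun x : ℕ → ι => ∏ j ∈ Finset.range m, f (x j) :=
      Finset.measurable_fun_prod _ fun j _ => hfm.comp (measurable_pi_apply j)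
    have h2 := hG.lintegral_mul_shift_le (fun i => (τ i : ℝ≥0∞) * f i) hg
    have h3 : ∀ x : ℕ → ι, (τ (x 0) : ℝ≥0∞) * ∏ j ∈ Finset.range (m + 1), f (x j) =
        (τ (x 0) : ℝ≥0∞) * f (x 0) * ∏ j ∈ Finset.range m, f (shift x j) := fun x => by
      rw [Finset.prod_range_succ', mul_comm (∏ j ∈ Finset.range m, _), mul_assoc]; rfl
    simp only [h3]
    refine h2.trans ?_
    rw [pow_succ']
    refine mul_le_mul_right ((lintegral_prod_coord_le hG f m).trans ?_) _
    calc _ ≤ (K * ∫⁻ x, f (x 0) ∂(baseMeasure ζ)) ^ m * 1 := by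
          gcongr
          exact baseMeasure_univ_le_one
      _ ≤ _ := by
          rw [mul_one]
          gcongr
          refine lintegral_mono fun x => ?_
          have : (1 : ℝ≥0∞) ≤ τ (x 0) := by exact_mod_cast hτ (x 0)
          calc f (x 0) = 1 * f (x 0) := (one_mul _).symm
            _ ≤ _ := by gcongr
  refine ⟨(K * A).toReal + 2, by linarith [ENNReal.toReal_nonneg (a := K * A)], fun k m => ?_⟩
  have hmE : MeasurableSet {z | returns τ k z ≤ m} :=
    measurableSet_le (measurable_returns τ k) measurable_const
  have hmg : Measurable fun x : ℕ → ι => ∏ j ∈ Finset.range (m + 1), f (x j) :=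
    Finset.measurable_fun_prod _ fun j _ => hfm.comp (measurable_pi_apply j)
  -- An exponential Markov inequality: on this event k is less than the sum of the first m + 1
  -- return times, and subadditivity of t^θ for θ ≤ 1 bounds exp (c/2 k^θ) by a product of functions
  -- of single symbols, which bounded distortion decouples.
  have h2 : ζ {z | returns τ k z ≤ m} ≤
      ENNReal.ofReal (Real.exp (-(c / 2) * (k : ℝ) ^ θ)) * (K * A) ^ (m + 1) := by
    rw [← lintegral_indicator_one hmE]
    calc ∫⁻ z, {z | returns τ k z ≤ m}.indicator 1 z ∂ζ ≤
        ∫⁻ z, ENNReal.ofReal (Real.exp (-(c / 2) * (k : ℝ) ^ θ)) *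
          ∏ j ∈ Finset.range (m + 1), f (z.2 j) ∂ζ := by
          refine lintegral_mono_ae ?_
          filter_upwards [hval] with z hz
          by_cases hzm : returns τ k z ≤ m
          · have h3 := add_fst_lt_sum_of_returns_le τ hz hτ hzm
            have h4 : (k : ℝ) ^ θ ≤ ∑ j ∈ Finset.range (m + 1), (τ (z.2 j) : ℝ) ^ θ := by
              refine le_trans ?_ (sum_rpow_le_sum_rpow hθ hθ1 _ fun j => τ (z.2 j))
              refine Real.rpow_le_rpow (by positivity) ?_ hθ.le
              exact_mod_cast (by omega)
            rw [indicator_of_mem (show z ∈ {z | returns τ k z ≤ m} from hzm), Pi.one_apply]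
            rw [← ENNReal.ofReal_prod_of_nonneg fun j _ => (Real.exp_pos _).le, ← Real.exp_sum,
              ← ENNReal.ofReal_mul (Real.exp_pos _).le, ← Real.exp_add, ← ENNReal.ofReal_one,
              ← Finset.mul_sum]
            refine ENNReal.ofReal_le_ofReal (Real.one_le_exp ?_)
            nlinarith
          · rw [indicator_of_notMem (show z ∉ {z | returns τ k z ≤ m} from hzm)]
            exact zero_le
      _ = ENNReal.ofReal (Real.exp (-(c / 2) * (k : ℝ) ^ θ)) *
          ∫⁻ x, (τ (x 0) : ℝ≥0∞) * ∏ j ∈ Finset.range (m + 1), f (x j) ∂(baseMeasure ζ) := by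
          rw [lintegral_const_mul _ (show Measurable fun z : ℕ × (ℕ → ι) =>
            ∏ j ∈ Finset.range (m + 1), f (z.2 j) from hmg.comp measurable_snd),
            lintegral_tower_snd hζ hval hmg]
      _ ≤ _ := by gcongr; exact h1 m
  have h3 := ENNReal.toReal_mono (ENNReal.mul_ne_top ENNReal.ofReal_ne_top
    (ENNReal.pow_ne_top hKA)) h2
  rw [ENNReal.toReal_mul, ENNReal.toReal_pow, ENNReal.toReal_ofReal (Real.exp_pos _).le,
    mul_comm] at h3
  refine h3.trans ?_
  gcongr
  linarith

/-- Split at δ k^θ returns: with δ = c / (4 log K) the factor K^m costs at most exp (c/4 k^θ), half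
of the available decay, and with more returns b^N is itself small enough. -/
lemma exists_integral_pow_returns_le_of_exp {c θ C' : ℝ} (hc : 0 < c) (hθ : 0 < θ) (hθ1 : θ ≤ 1)
    (hC' : 0 < C')
    (htail : ∀ n : ℕ, 1 ≤ n → ζ.real {z | n + 1 ≤ z.1} ≤ C' * Real.exp (-c * (n : ℝ) ^ θ))
    {b : ℝ} (hb0 : 0 < b) (hb1 : b < 1) : ∃ K c' : ℝ, 0 < K ∧ 0 < c' ∧ ∀ k : ℕ,
      ∫ z, b ^ returns τ k z ∂ζ ≤ K * Real.exp (-c' * (k : ℝ) ^ θ) := by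
  obtain ⟨K, hK, h⟩ := exists_measureReal_returns_le_of_exp hζ hval hG hτ hc hθ hθ1 hC' htail
  have hlK : 0 < Real.log K := Real.log_pos hK
  have hlb : 0 < -Real.log b := by linarith [Real.log_neg hb0 hb1]
  have hK0 : 0 < K := by linarith
  set δ := c / (4 * Real.log K) with hδ
  have hδ0 : 0 < δ := by positivity
  refine ⟨1 + K, min (δ * -Real.log b) (c / 4), by positivity, by positivity, fun k => ?_⟩
  set x := (k : ℝ) ^ θ with hx
  have hx0 : 0 ≤ x := by positivity
  set M := ⌊δ * x⌋₊ with hM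
  have hM1 : (M : ℝ) ≤ δ * x := Nat.floor_le (by positivity)
  have hM2 : δ * x < M + 1 := Nat.lt_floor_add_one _
  have hms : MeasurableSet {z | returns τ k z ≤ M} :=
    measurableSet_le (measurable_returns τ k) measurable_const
  have h1 : ∫ z, b ^ returns τ k z ∂ζ ≤ b ^ (M + 1) + ζ.real {z | returns τ k z ≤ M} := by
    have hi : Integrable (fun z => {z | returns τ k z ≤ M}.indicator (1 : ℕ × (ℕ → ι) → ℝ) z) ζ :=
      (integrable_const (1 : ℝ)).indicator hms
    calc ∫ z, b ^ returns τ k z ∂ζ ≤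
        ∫ z, (b ^ (M + 1) + {z | returns τ k z ≤ M}.indicator (1 : ℕ × (ℕ → ι) → ℝ) z) ∂ζ := by
          refine integral_mono (integrable_pow_returns hb0.le hb1.le k)
            ((integrable_const _).add hi) fun z => ?_
          by_cases hz : returns τ k z ≤ M
          · have : z ∈ {z | returns τ k z ≤ M} := hz
            simp only [indicator_of_mem this, Pi.one_apply]
            have := pow_le_one₀ (n := returns τ k z) hb0.le hb1.le
            have : 0 ≤ b ^ (M + 1) := by positivity
            linarith
          · have : z ∉ {z | returns τ k z ≤ M} := hz
            simp only [indicator_of_notMem this, add_zero]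
            exact pow_le_pow_of_le_one hb0.le hb1.le (by omega)
      _ = _ := by
          rw [integral_add (integrable_const _) hi, integral_indicator_one hms]
          simp
  have h2 : b ^ (M + 1) ≤ Real.exp (-min (δ * -Real.log b) (c / 4) * x) := by
    rw [← Real.exp_log (pow_pos hb0 (M + 1)), Real.log_pow]
    refine Real.exp_le_exp.2 ?_
    push_cast
    have := mul_le_mul_of_nonneg_right (min_le_left (δ * -Real.log b) (c / 4)) hx0
    nlinarith
  have h3 : K ^ (M + 1) * Real.exp (-(c / 2) * x) ≤
      K * Real.exp (-min (δ * -Real.log b) (c / 4) * x) := by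
    rw [pow_succ', mul_assoc]
    refine mul_le_mul_of_nonneg_left ?_ hK0.le
    rw [← Real.exp_log (pow_pos hK0 M), Real.log_pow, ← Real.exp_add]
    refine Real.exp_le_exp.2 ?_
    have h4 := mul_le_mul_of_nonneg_right (min_le_right (δ * -Real.log b) (c / 4)) hx0
    have h5 : (M : ℝ) * Real.log K ≤ c / 4 * x := by
      calc (M : ℝ) * Real.log K ≤ δ * x * Real.log K := by gcongr
        _ = c / 4 * x := by rw [hδ]; field_simp
    nlinarith
  have h6 := h k M
  rw [← hx] at h6
  calc _ ≤ _ := h1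
    _ ≤ Real.exp (-min (δ * -Real.log b) (c / 4) * x) +
        K * Real.exp (-min (δ * -Real.log b) (c / 4) * x) := by linarith
    _ = _ := by ring

end ExponentialReturnTails

/-! ### Conditional expectations given a factor map, with everywhere bounded versions. -/

section Conditioning

variable {X Z : Type*} [MeasurableSpace X] [MeasurableSpace Z] {ν : Measure X} {ζ : Measure Z}

/-- `G ∘ q` is the conditional expectation of `Ψ` given the map `q`. -/
def IsCond (ν : Measure X) (ζ : Measure Z) (q : X → Z) (Ψ : X → ℝ) (G : Z → ℝ) : Prop :=
  ∀ g : Z → ℝ, Measurable g → (∃ B, ∀ z, |g z| ≤ B) → ∫ x, Ψ x * g (q x) ∂ν = ∫ z, G z * g z ∂ζ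

variable {q : X → Z} {Ψ : X → ℝ} {G : Z → ℝ}

lemma IsCond.neg (h : IsCond ν ζ q Ψ G) :
    IsCond ν ζ q (fun x => -Ψ x) (fun z => -G z) := by
  intro g hg hB
  simp only [neg_mul, integral_neg, h g hg hB]

lemma IsCond.congr (h : IsCond ν ζ q Ψ G) {G' : Z → ℝ} (h' : G =ᵐ[ζ] G') : IsCond ν ζ q Ψ G' := by
  intro g hg hB
  rw [h g hg hB]
  exact integral_congr_ae (h'.mono fun z hz => by simp only [hz])

lemma IsCond.integral_eq (h : IsCond ν ζ q Ψ G) : ∫ x, Ψ x ∂ν = ∫ z, G z ∂ζ := by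
  simpa using h (fun _ => 1) measurable_const ⟨1, by simp⟩

lemma IsCond.setIntegral_eq (h : IsCond ν ζ q Ψ G) (hq : Measurable q) {E : Set Z}
    (hE : MeasurableSet E) : ∫ x in q ⁻¹' E, Ψ x ∂ν = ∫ z in E, G z ∂ζ := by
  have h1 := h (E.indicator 1) (measurable_one.indicator hE) ⟨1, fun z => by
    by_cases hz : z ∈ E <;> simp [hz]⟩
  rw [← integral_indicator hE, ← integral_indicator (hq hE)]
  convert h1 using 2
  · ext x
    by_cases hx : q x ∈ E <;> simp [indicator, hx]
  · ext x
    by_cases hx : x ∈ E <;> simp [indicator, hx]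

variable [IsProbabilityMeasure ν] [IsProbabilityMeasure ζ]

/-- The density of the image of Ψ ν under q; truncation at A makes the bounds hold everywhere. -/
lemma exists_isCond (hq : MeasurePreserving q ν ζ) (hΨ : Measurable Ψ) {A : ℝ} (hA0 : 0 ≤ A)
    (h0 : ∀ x, 0 ≤ Ψ x) (hA : ∀ x, Ψ x ≤ A) :
    ∃ G : Z → ℝ, Measurable G ∧ (∀ z, 0 ≤ G z) ∧ (∀ z, G z ≤ A) ∧ IsCond ν ζ q Ψ G := by
  set l := (ν.withDensity fun x => ENNReal.ofReal (Ψ x)).map q with hl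
  have hΨ' : Measurable fun x => ENNReal.ofReal (Ψ x) := hΨ.ennreal_ofReal
  have hle : l ≤ ENNReal.ofReal A • ζ := by
    refine Measure.le_iff.2 fun E hE => ?_
    rw [hl, Measure.map_apply hq.measurable hE, withDensity_apply _ (hq.measurable hE),
      Measure.smul_apply, smul_eq_mul, ← hq.measure_preimage hE.nullMeasurableSet,
      ← setLIntegral_const]
    exact lintegral_mono fun x => ENNReal.ofReal_le_ofReal (hA x)
  have hfin : IsFiniteMeasure l := ⟨(hle univ).trans_lt (by
    rw [Measure.smul_apply, smul_eq_mul]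
    exact ENNReal.mul_lt_top ENNReal.ofReal_lt_top (measure_lt_top _ _))⟩
  have hac : l ≪ ζ := (Measure.absolutelyContinuous_of_le hle).trans
    (Measure.smul_absolutelyContinuous)
  have hwd : ζ.withDensity (l.rnDeriv ζ) = l := Measure.withDensity_rnDeriv_eq l ζ hac
  have hrn : l.rnDeriv ζ ≤ᵐ[ζ] fun _ => ENNReal.ofReal A := by
    refine ae_le_of_forall_setLIntegral_le_of_sigmaFinite (Measure.measurable_rnDeriv _ _)
      fun s hs _ => ?_
    rw [← withDensity_apply _ hs, hwd, setLIntegral_const]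
    exact hle s
  have hmG : Measurable fun z => (l.rnDeriv ζ z).toReal :=
    (Measure.measurable_rnDeriv _ _).ennreal_toReal
  refine ⟨fun z => min (l.rnDeriv ζ z).toReal A, hmG.min measurable_const,
    fun z => le_min ENNReal.toReal_nonneg hA0, fun z => min_le_right _ _, fun g hg _ => ?_⟩
  have e1 : ∫ x, Ψ x * g (q x) ∂ν =
      ∫ x, g (q x) ∂(ν.withDensity fun x => ENNReal.ofReal (Ψ x)) := by
    rw [integral_withDensity_eq_integral_toReal_smul hΨ' (by simp)]
    refine integral_congr_ae (Filter.Eventually.of_forall fun x => ?_)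
    simp [ENNReal.toReal_ofReal (h0 x)]
  rw [e1, ← integral_map hq.measurable.aemeasurable hg.aestronglyMeasurable, ← hl, ← hwd,
    integral_withDensity_eq_integral_toReal_smul (Measure.measurable_rnDeriv _ _)
      (Measure.rnDeriv_lt_top _ _)]
  refine integral_congr_ae ?_
  filter_upwards [hrn] with z hz
  have : (l.rnDeriv ζ z).toReal ≤ A := by
    have := ENNReal.toReal_mono ENNReal.ofReal_ne_top hz
    rwa [ENNReal.toReal_ofReal hA0] at this
  simp only [smul_eq_mul, hwd, min_eq_left this]

lemma ae_le_of_setIntegral_le {C : Set Z} (hC : MeasurableSet C) (hG : Measurable G) {A c : ℝ}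
    (hA : ∀ z, |G z| ≤ A)
    (h : ∀ E ⊆ C, MeasurableSet E → ∫ z in E, G z ∂ζ ≤ c * ζ.real E) : ∀ᵐ z ∂ζ, z ∈ C → G z ≤ c := by
  set D := C ∩ {z | c < G z} with hD
  have hDm : MeasurableSet D := hC.inter (measurableSet_lt measurable_const hG)
  have hi : Integrable G ζ := integrable_of_bdd hG hA
  have h1 := h D inter_subset_left hDm
  have hi' : IntegrableOn (fun z => G z - c) D ζ := (hi.sub (integrable_const c)).integrableOn
  have h2 : ∫ z in D, (G z - c) ∂ζ = 0 := by
    refine le_antisymm ?_ (setIntegral_nonneg hDm fun z hz => (sub_pos.2 hz.2).le)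
    rw [integral_sub hi.integrableOn (integrable_const c)]
    simp only [integral_const, smul_eq_mul, measureReal_restrict_apply_univ]
    linarith [mul_comm c (ζ.real D)]
  have h3 := (setIntegral_eq_zero_iff_of_nonneg_ae
    ((ae_restrict_iff' hDm).2 (Filter.Eventually.of_forall fun z hz => (sub_pos.2 hz.2).le))
    hi').1 h2
  have h4 := (ae_restrict_iff' hDm).1 h3
  filter_upwards [h4] with z hz hzC
  by_contra hzc
  have h5 : G z - c = 0 := hz ⟨hzC, not_le.1 hzc⟩
  exact hzc (by linarith)

lemma IsCond.ae_le (h : IsCond ν ζ q Ψ G) (hq : MeasurePreserving q ν ζ) (hG : Measurable G)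
    (hΨ : Measurable Ψ) {A c : ℝ} (hA : ∀ z, |G z| ≤ A) (hA' : ∀ x, |Ψ x| ≤ A) {C : Set Z}
    (hC : MeasurableSet C) (hc : ∀ x, q x ∈ C → Ψ x ≤ c) : ∀ᵐ z ∂ζ, z ∈ C → G z ≤ c := by
  refine ae_le_of_setIntegral_le hC hG hA fun E hE hEm => ?_
  rw [← h.setIntegral_eq hq.measurable hEm]
  calc ∫ x in q ⁻¹' E, Ψ x ∂ν ≤ ∫ _ in q ⁻¹' E, c ∂ν :=
        setIntegral_mono_on (integrable_of_bdd hΨ hA').integrableOn (integrable_const c)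
          (hq.measurable hEm) fun x hx => hc x (hE hx)
    _ = c * ζ.real E := by
        rw [setIntegral_const, smul_eq_mul, mul_comm,
          measureReal_def, hq.measure_preimage hEm.nullMeasurableSet, measureReal_def]

/-- If `Ψ` oscillates by at most `c` over the set `C`, then it is `2 c`-close to its conditional
expectation. -/
lemma IsCond.ae_abs_sub_le (h : IsCond ν ζ q Ψ G) (hq : MeasurePreserving q ν ζ)
    (hG : Measurable G) (hΨ : Measurable Ψ) {A c : ℝ} (hA : ∀ z, |G z| ≤ A)
    (hA' : ∀ x, |Ψ x| ≤ A) {C : Set Z} (hC : MeasurableSet C)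
    (hc : ∀ x x', q x ∈ C → q x' ∈ C → |Ψ x - Ψ x'| ≤ c) :
    ∀ᵐ x ∂ν, q x ∈ C → |Ψ x - G (q x)| ≤ 2 * c := by
  by_cases hx : ∃ x, q x ∈ C
  swap
  · exact Filter.Eventually.of_forall fun x hxC => (hx ⟨x, hxC⟩).elim
  obtain ⟨x₀, hx₀⟩ := hx
  have h1 := h.ae_le hq hG hΨ hA hA' hC (c := Ψ x₀ + c) fun x hx => by
    linarith [(abs_le.1 (hc x x₀ hx hx₀)).2]
  have h2 := h.neg.ae_le hq hG.neg hΨ.neg (c := -Ψ x₀ + c) (A := A) (by simpa using hA)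
    (by simpa using hA') hC fun x hx => by
    linarith [(abs_le.1 (hc x x₀ hx hx₀)).1]
  filter_upwards [hq.quasiMeasurePreserving.ae h1, hq.quasiMeasurePreserving.ae h2] with x h3 h4 hx
  have h5 := h3 hx
  have h6 := h4 hx
  have h7 := abs_le.1 (hc x x₀ hx hx₀)
  rw [abs_le]
  constructor <;> linarith [h7.1, h7.2]

end Conditioning

/-! ### Observables that are almost functions of the symbols. -/

section Oscillation

variable {ι : Type*} {X : Type*}

/-- The oscillation of `Φ ∘ T^h` over points whose symbolic representations agree for a while. -/
def SymOsc (T : X → X) (q : X → ℕ × (ℕ → ι)) (τ : ι → ℕ) (Φ : X → ℝ) (B b : ℝ) : Prop :=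
  ∀ (x x' : X) (h s : ℕ), (q x).1 = (q x').1 → (∀ m < s, (q x).2 m = (q x').2 m) →
    returns τ h (q x) < s → |Φ (T^[h] x) - Φ (T^[h] x')| ≤
      B * (b ^ (2 * returns τ h (q x)) + b ^ (2 * (s - returns τ h (q x))))

variable [MeasurableSpace ι] [Countable ι] [MeasurableSingletonClass ι] [MeasurableSpace X]

lemma measurableSet_symCylinder (l s : ℕ) (w : List ι) :
    MeasurableSet {z : ℕ × (ℕ → ι) | z.1 = l ∧ initial s z.2 = w} :=
  (measurableSet_fst_eq l).inter (measurable_snd (measurableSet_initial_eq s w))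

variable {ν : Measure X} {ζ : Measure (ℕ × (ℕ → ι))} [IsProbabilityMeasure ν]
  [IsProbabilityMeasure ζ] {q : X → ℕ × (ℕ → ι)} {T : X → X} {τ : ι → ℕ} {Φ : X → ℝ} {B b : ℝ}

/-- After many returns the observable is almost a function of the symbols. -/
lemma SymOsc.ae_abs_sub_le (hO : SymOsc T q τ Φ B b) (hb0 : 0 < b) (hb1 : b < 1)
    (hq : MeasurePreserving q ν ζ) {k : ℕ} {G : ℕ × (ℕ → ι) → ℝ}
    (h : IsCond ν ζ q (fun x => Φ (T^[k] x)) G) (hG : Measurable G)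
    (hΦ : Measurable fun x => Φ (T^[k] x)) {A : ℝ} (hA : ∀ z, |G z| ≤ A) (hA' : ∀ x, |Φ x| ≤ A) :
    ∀ᵐ x ∂ν, |Φ (T^[k] x) - G (q x)| ≤ 2 * B * b ^ (2 * returns τ k (q x)) := by
  -- On each of the countably many cylinders of length s the observable oscillates little, hence is
  -- close to its conditional expectation. Letting s grow removes the part of the oscillation due to
  -- the unknown future.
  have key : ∀ s : ℕ, ∀ᵐ x ∂ν, returns τ k (q x) < s → |Φ (T^[k] x) - G (q x)| ≤
      2 * (B * (b ^ (2 * returns τ k (q x)) + b ^ (2 * (s - returns τ k (q x))))) := by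
    intro s
    have h1 : ∀ p : ℕ × ℕ × List ι, ∀ᵐ x ∂ν,
        q x ∈ {z : ℕ × (ℕ → ι) | returns τ k z = p.1 ∧ p.1 < s ∧ z.1 = p.2.1 ∧
          initial s z.2 = p.2.2} →
        |Φ (T^[k] x) - G (q x)| ≤ 2 * (B * (b ^ (2 * p.1) + b ^ (2 * (s - p.1)))) := by
      rintro ⟨n, l, w⟩
      refine h.ae_abs_sub_le hq hG hΦ hA (fun x => hA' _) ?_ ?_
      · exact (measurable_returns τ k (measurableSet_singleton n)).inter
          ((MeasurableSet.const _).inter (measurableSet_symCylinder l s w))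
      · rintro x x' ⟨h1, h2, h3, h4⟩ ⟨_, _, h5, h6⟩
        have := hO x x' k s (h3.trans h5.symm) (initial_eq_initial.1 (h4.trans h6.symm))
          (by rw [h1]; exact h2)
        rwa [h1] at this
    filter_upwards [ae_all_iff.2 h1] with x hx hs
    exact hx (returns τ k (q x), (q x).1, initial s (q x).2) ⟨rfl, hs, rfl, rfl⟩
  filter_upwards [ae_all_iff.2 key] with x hx
  set n := returns τ k (q x) with hn
  have h2 : Filter.Tendsto (fun s : ℕ => 2 * (B * (b ^ (2 * n) + b ^ (2 * s)))) Filter.atTop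
      (nhds (2 * (B * (b ^ (2 * n) + 0)))) := by
    refine ((tendsto_const_nhds.add ?_).const_mul B).const_mul 2
    simp only [pow_mul]
    exact tendsto_pow_atTop_nhds_zero_of_lt_one (by positivity) (by nlinarith)
  refine ge_of_tendsto (h2.trans (le_of_eq (by ring_nf))) ?_
  filter_upwards [Filter.eventually_ge_atTop 1] with s hs
  have := hx (s + n) (by omega)
  rwa [Nat.add_sub_cancel] at this

end Oscillation

/-! ### Partition of the symbolic tower by the past up to time n. -/

section Histories

variable {ι : Type*}

/-- The points with initial level `i.1` whose returns up to time `n` consume exactly the symbols of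
the word `i.2`. -/
def history (τ : ι → ℕ) (n : ℕ) (i : ℕ × List ι) : Set (ℕ × (ℕ → ι)) :=
  {z | z.1 = i.1 ∧ returns τ n z = i.2.length ∧ initial i.2.length z.2 = i.2}

/-- Two symbolic points have the same level and the same first `s` symbols. -/
def Agree (s : ℕ) (z z' : ℕ × (ℕ → ι)) : Prop := z.1 = z'.1 ∧ ∀ m < s, z.2 m = z'.2 m

lemma Agree.symm {s : ℕ} {z z' : ℕ × (ℕ → ι)} (h : Agree s z z') : Agree s z' z :=
  ⟨h.1.symm, fun m hm => (h.2 m hm).symm⟩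

lemma Agree.trans {s : ℕ} {z z' z'' : ℕ × (ℕ → ι)} (h : Agree s z z') (h' : Agree s z' z'') :
    Agree s z z'' := ⟨h.1.trans h'.1, fun m hm => (h.2 m hm).trans (h'.2 m hm)⟩

lemma Agree.mono {s s' : ℕ} (hs : s' ≤ s) {z z' : ℕ × (ℕ → ι)} (h : Agree s z z') :
    Agree s' z z' := ⟨h.1, fun m hm => h.2 m (hm.trans_le hs)⟩

variable {τ : ι → ℕ} {n : ℕ}

lemma iUnion_history : ⋃ i, history τ n i = univ := by
  ext z
  simp only [mem_iUnion, mem_univ, iff_true]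
  exact ⟨(z.1, initial (returns τ n z) z.2), rfl, by simp [length_initial], by
    simp [length_initial]⟩

lemma pairwise_disjoint_history : Pairwise (Function.onFun Disjoint (history τ n)) := by
  rintro ⟨l, w⟩ ⟨l', w'⟩ hne
  refine Set.disjoint_left.2 ?_
  rintro z ⟨h1, h2, h3⟩ ⟨h4, h5, h6⟩
  refine hne ?_
  dsimp only at *
  rw [← h2] at h3
  rw [← h5] at h6
  rw [Prod.mk.injEq]
  exact ⟨h1.symm.trans h4, h3.symm.trans h6⟩

lemma agree_of_mem_history {i : ℕ × List ι} {z z' : ℕ × (ℕ → ι)} {s : ℕ} (hz : z ∈ history τ n i)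
    (hz' : z' ∈ history τ n i) (h : Agree s ((symStep τ)^[n] z) ((symStep τ)^[n] z')) :
    Agree (s + i.2.length) z z' := by
  refine ⟨hz.1.trans hz'.1.symm, ?_⟩
  have h1 := h.2
  rw [iterate_symStep_snd, iterate_symStep_snd, hz.2.1, hz'.2.1] at h1
  intro m hm
  by_cases hmw : m < i.2.length
  · exact initial_eq_initial.1 (hz.2.2.trans hz'.2.2.symm) m hmw
  · have := h1 (m - i.2.length) (by omega)
    rwa [shift_iterate_apply, shift_iterate_apply, Nat.sub_add_cancel (by omega)] at this

/-- As soon as one point of the history reaches the cylinder of `z₁`, every point with the same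
level and word, continued in E, makes the same returns. So the pull-back of E within the history is
E preceded by the word, to which the Gibbs property applies. -/
lemma history_inter_preimage {i : ℕ × List ι} {s : ℕ} (hs : 1 ≤ s) {z₀ z₁ : ℕ × (ℕ → ι)}
    (hz₀ : z₀ ∈ history τ n i) (h : Agree s ((symStep τ)^[n] z₀) z₁) {E : Set (ℕ × (ℕ → ι))}
    (hE : ∀ z ∈ E, Agree s z z₁) :
    history τ n i ∩ (symStep τ)^[n] ⁻¹' E = {z | z.1 = i.1 ∧ z.2 ∈ prepend i.2 {x | (z₁.1, x) ∈ E}} := by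
  ext z
  simp only [mem_inter_iff, mem_preimage, mem_ofPred_eq]
  constructor
  · rintro ⟨⟨h1, h2, h3⟩, h4⟩
    refine ⟨h1, mem_prepend.2 ⟨h3, ?_⟩⟩
    have h5 : ((symStep τ)^[n] z) = (z₁.1, shift^[i.2.length] z.2) := by
      refine Prod.ext (hE _ h4).1 ?_
      rw [iterate_symStep_snd, h2]
    rw [h5] at h4
    exact h4
  · rintro ⟨h1, h2⟩
    obtain ⟨h3, h4⟩ := mem_prepend.1 h2
    have h5 : ∀ m < s + i.2.length, z₀.2 m = z.2 m := by
      intro m hm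
      by_cases hmw : m < i.2.length
      · exact initial_eq_initial.1 (hz₀.2.2.trans h3.symm) m hmw
      · have h6 := (h.trans (hE _ h4).symm).2 (m - i.2.length) (by omega)
        rw [iterate_symStep_snd, hz₀.2.1] at h6
        dsimp only at h6
        rwa [shift_iterate_apply, shift_iterate_apply, Nat.sub_add_cancel (by omega)] at h6
    obtain ⟨h6, h7⟩ := iterate_symStep_congr τ (hz₀.1.trans h1.symm) h5
      (n := n) (by rw [hz₀.2.1]; omega)
    refine ⟨⟨h1, h7.trans hz₀.2.1, h3⟩, ?_⟩
    have h8 : ((symStep τ)^[n] z) = (z₁.1, shift^[i.2.length] z.2) := by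
      refine Prod.ext (h6.trans h.1) ?_
      rw [iterate_symStep_snd, h7, hz₀.2.1]
    rw [h8]
    exact h4

variable [MeasurableSpace ι] [Countable ι] [MeasurableSingletonClass ι]

lemma measurableSet_history (i : ℕ × List ι) : MeasurableSet (history τ n i) :=
  (measurableSet_fst_eq i.1).inter ((measurable_returns τ n (measurableSet_singleton _)).inter
    (measurable_snd (measurableSet_initial_eq _ _)))

variable {ζ : Measure (ℕ × (ℕ → ι))} [IsProbabilityMeasure ζ]
  (hζ : MeasurePreserving (symStep τ) ζ ζ) (hval : ∀ᵐ z ∂ζ, z.1 < τ (z.2 0)) {C b : ℝ}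
  (hG : IsGibbs (baseMeasure ζ) C b)
include hζ hval

lemma measure_level_cylinder {l : ℕ} {E : Set (ℕ → ι)} (hE : MeasurableSet E) {i : ι}
    (hi : ∀ x ∈ E, x 0 = i) :
    ζ {z | z.1 = l ∧ z.2 ∈ E} = if l < τ i then baseMeasure ζ E else 0 := by
  rw [measure_level hζ hval l hE]
  split_ifs with h
  · congr 1
    exact inter_eq_left.2 fun x hx => show l < τ (x 0) by rwa [hi x hx]
  · rw [← measure_empty (μ := baseMeasure ζ)]
    congr 1
    refine eq_empty_of_forall_notMem fun x hx => h ?_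
    have h1 : l < τ (x 0) := hx.2
    rwa [hi x hx.1] at h1

include hG

/-- Bounded distortion along a history. -/
lemma measure_history_mul_le (i : ℕ × List ι) {s : ℕ} (hs : 1 ≤ s) {z₁ : ℕ × (ℕ → ι)}
    {E E' : Set (ℕ × (ℕ → ι))} (hE : MeasurableSet E) (hE' : MeasurableSet E')
    (hEz : ∀ z ∈ E, Agree s z z₁) (hEz' : ∀ z ∈ E', Agree s z z₁) :
    ζ (history τ n i ∩ (symStep τ)^[n] ⁻¹' E) * ζ E' ≤
      ENNReal.ofReal (Real.exp (C * b ^ s)) *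
        ζ (history τ n i ∩ (symStep τ)^[n] ⁻¹' E') * ζ E := by
  rcases (history τ n i ∩ (symStep τ)^[n] ⁻¹' E).eq_empty_or_nonempty with h0 | ⟨z₀, hz₀, hz₀E⟩
  · simp [h0]
  have hz₀' := hEz _ hz₀E
  rw [history_inter_preimage hs hz₀ hz₀' hEz, history_inter_preimage hs hz₀ hz₀' hEz']
  set E1 := {x | (z₁.1, x) ∈ E} with hE1
  set E1' := {x | (z₁.1, x) ∈ E'} with hE1'
  have hm : MeasurableSet E1 := measurable_prodMk_left hE
  have hm' : MeasurableSet E1' := measurable_prodMk_left hE'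
  have e1 : ∀ {E : Set (ℕ × (ℕ → ι))}, (∀ z ∈ E, Agree s z z₁) →
      E = {z | z.1 = z₁.1 ∧ z.2 ∈ {x | (z₁.1, x) ∈ E}} := by
    intro E hEz
    ext ⟨l, x⟩
    constructor
    · intro h
      have : l = z₁.1 := (hEz _ h).1
      subst this
      exact ⟨rfl, h⟩
    · rintro ⟨h1, h2⟩
      dsimp only at h1
      subst h1
      exact h2
  have h2 : ∀ {E : Set (ℕ × (ℕ → ι))}, (∀ z ∈ E, Agree s z z₁) → 
      ∀ x ∈ prepend i.2 {x | (z₁.1, x) ∈ E}, x 0 = z₀.2 0 := by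
    intro E hEz x hx
    have hz : (i.1, x) ∈ history τ n i ∩ (symStep τ)^[n] ⁻¹' E := by
      rw [history_inter_preimage hs hz₀ hz₀' hEz]
      exact ⟨rfl, hx⟩
    exact (agree_of_mem_history hz.1 hz₀ ((hEz _ hz.2).trans hz₀'.symm)).2 0 (by omega)
  have h3 : ∀ {E : Set (ℕ × (ℕ → ι))}, (∀ z ∈ E, Agree s z z₁) → 
      ∀ x ∈ {x | (z₁.1, x) ∈ E}, x 0 = z₁.2 0 := by
    intro E hEz x hx
    exact (hEz _ hx).2 0 (by omega)
  rw [measure_level_cylinder hζ hval (measurableSet_prepend _ hm) (h2 hEz),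
    measure_level_cylinder hζ hval (measurableSet_prepend _ hm') (h2 hEz')]
  rw [e1 hEz, e1 hEz', measure_level_cylinder hζ hval hm (h3 hEz),
    measure_level_cylinder hζ hval hm' (h3 hEz')]
  have h4 := hG i.2 trivial s E1 E1' hm hm' fun x hx x' hx' m hms =>
    ((hEz _ hx).trans (hEz' _ hx').symm).2 m hms
  split_ifs
  · exact h4
  all_goals simp

end Histories

lemma setLIntegral_mul_le_of_forall_le {X : Type*} [MeasurableSpace X] {ν : Measure X}
    {S S' : Set X} (hS : MeasurableSet S) (hS' : MeasurableSet S') {f g : X → ℝ≥0∞}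
    (h : ∀ x ∈ S, ∀ x' ∈ S', f x ≤ g x') :
    (∫⁻ x in S, f x ∂ν) * ν S' ≤ (∫⁻ x in S', g x ∂ν) * ν S := by
  have h1 : ∀ x ∈ S, f x * ν S' ≤ ∫⁻ x in S', g x ∂ν := fun x hx => by
    rw [← setLIntegral_const]
    exact setLIntegral_mono' hS' fun x' hx' => h x hx x' hx'
  by_cases h0 : ν S' = 0
  · rw [h0, mul_zero]; exact zero_le
  by_cases htop : ν S' = ⊤
  · by_cases hz : ∫⁻ x in S, f x ∂ν = 0
    · rw [hz, zero_mul]; exact zero_le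
    have hνS : ν S ≠ 0 := fun h0 => hz (setLIntegral_measure_zero _ _ h0)
    by_cases hex : ∃ x ∈ S, f x ≠ 0
    · obtain ⟨x, hx, hfx⟩ := hex
      have := h1 x hx
      rw [htop, ENNReal.mul_top hfx, top_le_iff] at this
      rw [this, ENNReal.top_mul hνS]
      exact le_top
    · push Not at hex
      exact (hz (by rw [setLIntegral_congr_fun hS hex]; simp)).elim
  rw [← lintegral_mul_const' _ _ htop, ← setLIntegral_const]
  exact setLIntegral_mono' hS h1

/-! ### Comparison of averages seen from the past. -/

section Smoothing

variable {ι X : Type*} [MeasurableSpace ι] [Countable ι] [MeasurableSingletonClass ι]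
  [MeasurableSpace X] {ν : Measure X} {ζ : Measure (ℕ × (ℕ → ι))} [IsProbabilityMeasure ν]
  [IsProbabilityMeasure ζ] {q : X → ℕ × (ℕ → ι)} {T : X → X} {τ : ι → ℕ} {Φ : X → ℝ} {B b C : ℝ}

/-- The observable, restricted to the points with at least `K₀` returns up to time `k`. -/
def cutoff (τ : ι → ℕ) (q : X → ℕ × (ℕ → ι)) (Φ : X → ℝ) (K₀ k : ℕ) (x : X) : ℝ :=
  if K₀ ≤ returns τ k (q x) then Φ x else 0

lemma measurable_cutoff (hqm : Measurable q) (hΦ : Measurable Φ) (K₀ k : ℕ) :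
    Measurable (cutoff τ q Φ K₀ k) :=
  Measurable.ite (measurableSet_le measurable_const ((measurable_returns τ k).comp hqm)) hΦ
    measurable_const

omit [MeasurableSpace ι] [Countable ι] [MeasurableSingletonClass ι] [MeasurableSpace X] in
lemma cutoff_nonneg (hΦ : ∀ x, 0 ≤ Φ x) (K₀ k : ℕ) (x : X) : 0 ≤ cutoff τ q Φ K₀ k x := by
  rw [cutoff]; split_ifs
  exacts [hΦ x, le_rfl]

omit [MeasurableSpace ι] [Countable ι] [MeasurableSingletonClass ι] [MeasurableSpace X] in
lemma cutoff_le {A : ℝ} (hA : 0 ≤ A) (hΦ : ∀ x, Φ x ≤ A) (K₀ k : ℕ) (x : X) :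
    cutoff τ q Φ K₀ k x ≤ A := by
  rw [cutoff]; split_ifs
  exacts [hΦ x, hA]

/-- In a common history with a common continuation both points have the same returns, so the cutoff
treats them alike. If it keeps them, at least `K₀` returns follow time h before the s further common
symbols, whence the exponent 2 (K₀ + s). -/
lemma SymOsc.cutoff_le_add (hO : SymOsc T q τ Φ B b) (hB : 0 ≤ B) (hb0 : 0 < b) (hb1 : b < 1)
    (hq : ∀ x, q (T x) = symStep τ (q x)) {h k K₀ s : ℕ} (hs : 1 ≤ s)
    {i : ℕ × List ι} {x x' : X} (hx : q x ∈ history τ (h + k) i) (hx' : q x' ∈ history τ (h + k) i)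
    (hxx : Agree s ((symStep τ)^[h + k] (q x)) ((symStep τ)^[h + k] (q x'))) :
    cutoff τ q Φ K₀ k (T^[h] x) ≤ cutoff τ q Φ K₀ k (T^[h] x') +
      B * (b ^ (2 * returns τ h (q x')) + b ^ (2 * (K₀ + s))) := by
  have h1 := agree_of_mem_history hx hx' hxx
  have h2 : returns τ h (q x) ≤ i.2.length := by
    rw [← hx.2.1]; exact returns_mono τ (q x) (Nat.le_add_right h k)
  have h3 := (iterate_symStep_congr τ h1.1 h1.2 (n := h) (by omega)).2
  have e1 := returns_add τ h k (q x)
  have e2 := returns_add τ h k (q x')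
  rw [hx.2.1] at e1
  rw [hx'.2.1] at e2
  have h4 := hO x x' h _ h1.1 h1.2 (by omega)
  rw [cutoff, cutoff, iterate_semiconj hq, iterate_semiconj hq]
  have h5 : returns τ k ((symStep τ)^[h] (q x)) = returns τ k ((symStep τ)^[h] (q x')) := by omega
  rw [h5]
  split_ifs with h6
  · have h7 : b ^ (2 * (s + i.2.length - returns τ h (q x))) ≤ b ^ (2 * (K₀ + s)) :=
      pow_le_pow_of_le_one hb0.le hb1.le (by omega)
    rw [h3]
    have h8 := (abs_le.1 h4).2
    nlinarith
  · positivity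

variable (hζ : MeasurePreserving (symStep τ) ζ ζ) (hval : ∀ᵐ z ∂ζ, z.1 < τ (z.2 0))
  (hG : IsGibbs (baseMeasure ζ) C b) (hT : MeasurePreserving T ν ν)
  (hqm : MeasurePreserving q ν ζ) (hq : ∀ x, q (T x) = symStep τ (q x))
include hζ hval hG hT hqm hq

/-- Comparison of the averages of the observable over two subsets of the same cylinder, seen from
the time `h` in the past. -/
lemma SymOsc.lintegral_mul_le (hO : SymOsc T q τ Φ B b) (hB : 0 ≤ B) (hb0 : 0 < b) (hb1 : b < 1)
    (hΦm : Measurable Φ) {s : ℕ} (hs : 1 ≤ s)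
    {z₁ : ℕ × (ℕ → ι)} {E E' : Set (ℕ × (ℕ → ι))} (hE : MeasurableSet E) (hE' : MeasurableSet E')
    (hEz : ∀ z ∈ E, Agree s z z₁) (hEz' : ∀ z ∈ E', Agree s z z₁) (K₀ k h : ℕ) :
    (∫⁻ x in (fun x => (symStep τ)^[k] (q x)) ⁻¹' E, ENNReal.ofReal (cutoff τ q Φ K₀ k x) ∂ν) *
        ζ E' ≤ ENNReal.ofReal (Real.exp (C * b ^ s)) *
      (∫⁻ x in (fun x => (symStep τ)^[k] (q x)) ⁻¹' E', ENNReal.ofReal (cutoff τ q Φ K₀ k x) ∂ν +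
        (∫⁻ z, ENNReal.ofReal (B * b ^ (2 * returns τ h z)) ∂ζ +
          ENNReal.ofReal (B * b ^ (2 * (K₀ + s))) * ζ E')) * ζ E := by
  have hF := measurable_symStep τ
  have hpm : ∀ n, Measurable fun x => (symStep τ)^[n] (q x) := fun n =>
    (hF.iterate n).comp hqm.measurable
  have hcm := measurable_cutoff (τ := τ) hqm.measurable hΦm K₀ k
  set ψ : X → ℝ≥0∞ := fun x => ENNReal.ofReal (cutoff τ q Φ K₀ k (T^[h] x)) with hψ
  have hψm : Measurable ψ := (hcm.comp (hT.measurable.iterate h)).ennreal_ofReal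
  set W : ℕ × (ℕ → ι) → ℝ≥0∞ := fun z =>
    ENNReal.ofReal (B * (b ^ (2 * returns τ h z) + b ^ (2 * (K₀ + s)))) with hW
  have hWm : Measurable W :=
    (measurable_of_countable fun n : ℕ =>
      ENNReal.ofReal (B * (b ^ (2 * n) + b ^ (2 * (K₀ + s))))).comp (measurable_returns τ h)
  -- Invariance moves both integrals h steps into the past, where the observable is Φ ∘ T^h.
  have e1 : ∀ {E : Set (ℕ × (ℕ → ι))}, MeasurableSet E →
      ∫⁻ x in (fun x => (symStep τ)^[k] (q x)) ⁻¹' E, ENNReal.ofReal (cutoff τ q Φ K₀ k x) ∂ν =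
      ∫⁻ x in q ⁻¹' ((symStep τ)^[h + k] ⁻¹' E), ψ x ∂ν := by
    intro E hE
    rw [← (hT.iterate h).setLIntegral_comp_preimage (hpm k hE) hcm.ennreal_ofReal]
    have : T^[h] ⁻¹' ((fun x => (symStep τ)^[k] (q x)) ⁻¹' E) =
        q ⁻¹' ((symStep τ)^[h + k] ⁻¹' E) := by
      ext x
      simp only [mem_preimage]
      rw [iterate_semiconj hq, ← Function.iterate_add_apply, add_comm k h]
    rw [this]
  set n := h + k with hn
  have hH : ∀ (E : Set (ℕ × (ℕ → ι))), MeasurableSet E → ∀ i, MeasurableSet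
      (q ⁻¹' (history τ n i ∩ (symStep τ)^[n] ⁻¹' E)) := fun E hE i =>
    hqm.measurable ((measurableSet_history i).inter (hF.iterate n hE))
  have e2 : ∀ {E : Set (ℕ × (ℕ → ι))}, MeasurableSet E → ∀ g : X → ℝ≥0∞,
      ∫⁻ x in q ⁻¹' ((symStep τ)^[n] ⁻¹' E), g x ∂ν =
        ∑' i, ∫⁻ x in q ⁻¹' (history τ n i ∩ (symStep τ)^[n] ⁻¹' E), g x ∂ν := by
    intro E hE g
    rw [← lintegral_iUnion (hH E hE)]
    · congr 2
      rw [← preimage_iUnion, ← iUnion_inter, iUnion_history, univ_inter]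
    · intro i j hij
      exact ((pairwise_disjoint_history hij).mono inter_subset_left inter_subset_left).preimage q
  -- On one history, the oscillation bound compares the integrands and bounded distortion compares
  -- the measures of the two sets.
  have h3 : ∀ i, (∫⁻ x in q ⁻¹' (history τ n i ∩ (symStep τ)^[n] ⁻¹' E), ψ x ∂ν) * ζ E' ≤
      ENNReal.ofReal (Real.exp (C * b ^ s)) *
        (∫⁻ x in q ⁻¹' (history τ n i ∩ (symStep τ)^[n] ⁻¹' E'), (ψ x + W (q x)) ∂ν) * ζ E := by
    intro i
    have hg := measure_history_mul_le hζ hval hG (n := n) i hs hE hE' hEz hEz'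
    have hν : ∀ (E : Set (ℕ × (ℕ → ι))), MeasurableSet E →
        ν (q ⁻¹' (history τ n i ∩ (symStep τ)^[n] ⁻¹' E)) =
          ζ (history τ n i ∩ (symStep τ)^[n] ⁻¹' E) := fun E hE =>
      hqm.measure_preimage ((measurableSet_history i).inter (hF.iterate n hE)).nullMeasurableSet
    rw [← hν E hE, ← hν E' hE'] at hg
    have hd := setLIntegral_mul_le_of_forall_le (ν := ν) (hH E hE i) (hH E' hE' i) (f := ψ)
      (g := fun x => ψ x + W (q x)) fun x hx x' hx' => by
        have := hO.cutoff_le_add hB hb0 hb1 hq (h := h) (k := k) (K₀ := K₀) hs hx.1 hx'.1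
          ((hEz _ hx.2).trans (hEz' _ hx'.2).symm)
        refine (ENNReal.ofReal_le_ofReal this).trans ?_
        exact ENNReal.ofReal_add_le
    set S := q ⁻¹' (history τ n i ∩ (symStep τ)^[n] ⁻¹' E) with hS
    set S' := q ⁻¹' (history τ n i ∩ (symStep τ)^[n] ⁻¹' E') with hS'
    by_cases h0 : ν S' = 0
    · rw [h0, mul_zero, zero_mul] at hg
      rcases mul_eq_zero.1 (le_antisymm hg zero_le) with h1 | h1
      · rw [setLIntegral_measure_zero _ _ h1, zero_mul]; exact zero_le
      · rw [h1, mul_zero]; exact zero_le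
    · have : (∫⁻ x in S, ψ x ∂ν) * ζ E' * ν S' ≤ ENNReal.ofReal (Real.exp (C * b ^ s)) *
          (∫⁻ x in S', (ψ x + W (q x)) ∂ν) * ζ E * ν S' := by
        calc (∫⁻ x in S, ψ x ∂ν) * ζ E' * ν S' = ((∫⁻ x in S, ψ x ∂ν) * ν S') * ζ E' := by ring
          _ ≤ ((∫⁻ x in S', (ψ x + W (q x)) ∂ν) * ν S) * ζ E' := by gcongr
          _ = (∫⁻ x in S', (ψ x + W (q x)) ∂ν) * (ν S * ζ E') := by ring
          _ ≤ (∫⁻ x in S', (ψ x + W (q x)) ∂ν) *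
              (ENNReal.ofReal (Real.exp (C * b ^ s)) * ν S' * ζ E) := by gcongr
          _ = _ := by ring
      exact (ENNReal.mul_le_mul_iff_left h0 (measure_ne_top ν S')).1 this
  have hWint : ∫⁻ x in q ⁻¹' ((symStep τ)^[n] ⁻¹' E'), W (q x) ∂ν ≤
      ∫⁻ z, ENNReal.ofReal (B * b ^ (2 * returns τ h z)) ∂ζ +
          ENNReal.ofReal (B * b ^ (2 * (K₀ + s))) * ζ E' := by
    rw [hqm.setLIntegral_comp_preimage (hF.iterate n hE') hWm]
    calc ∫⁻ z in (symStep τ)^[n] ⁻¹' E', W z ∂ζ ≤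
        ∫⁻ z in (symStep τ)^[n] ⁻¹' E', (ENNReal.ofReal (B * b ^ (2 * returns τ h z)) +
          ENNReal.ofReal (B * b ^ (2 * (K₀ + s)))) ∂ζ := by
          refine lintegral_mono fun z => ?_
          rw [hW]
          dsimp only
          rw [mul_add]
          exact ENNReal.ofReal_add_le
      _ = ∫⁻ z in (symStep τ)^[n] ⁻¹' E', ENNReal.ofReal (B * b ^ (2 * returns τ h z)) ∂ζ +
          ENNReal.ofReal (B * b ^ (2 * (K₀ + s))) * ζ E' := by
          rw [lintegral_add_right _ measurable_const, setLIntegral_const,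
            (hζ.iterate n).measure_preimage hE'.nullMeasurableSet]
      _ ≤ _ := by
          gcongr
          exact Measure.restrict_le_self
  rw [e1 hE, e1 hE', e2 hE, ← ENNReal.tsum_mul_right]
  refine (ENNReal.tsum_le_tsum h3).trans ?_
  rw [ENNReal.tsum_mul_right, ENNReal.tsum_mul_left, ← e2 hE', lintegral_add_left hψm]
  gcongr

end Smoothing

/-! ### Lipschitz versions of functions with almost constant averages. -/

section RegularDensity

variable {ι : Type*}

/-- The points that agree with `z` up to `s`. -/
def symCyl (s : ℕ) (z : ℕ × (ℕ → ι)) : Set (ℕ × (ℕ → ι)) := {z' | Agree s z' z}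

lemma Agree.refl (s : ℕ) (z : ℕ × (ℕ → ι)) : Agree s z z := ⟨rfl, fun _ _ => rfl⟩

lemma symCyl_eq_of_agree {s : ℕ} {z z' : ℕ × (ℕ → ι)} (h : Agree s z z') :
    symCyl s z = symCyl s z' := by
  ext y
  exact ⟨fun hy => Agree.trans hy h, fun hy => Agree.trans hy h.symm⟩

lemma symCyl_anti {s s' : ℕ} (hs : s' ≤ s) (z : ℕ × (ℕ → ι)) : symCyl s z ⊆ symCyl s' z :=
  fun _ hy => Agree.mono hs hy

lemma agree_iff_initial {s : ℕ} {z z' : ℕ × (ℕ → ι)} :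
    Agree s z z' ↔ z.1 = z'.1 ∧ initial s z.2 = initial s z'.2 := by
  rw [Agree, initial_eq_initial]

variable [MeasurableSpace ι] [Countable ι] [MeasurableSingletonClass ι]

omit [Countable ι] in
lemma measurableSet_symCyl (s : ℕ) (z : ℕ × (ℕ → ι)) : MeasurableSet (symCyl s z) := by
  have : symCyl s z = {z' | z'.1 = z.1 ∧ initial s z'.2 = initial s z.2} := by
    ext; exact agree_iff_initial
  rw [this]
  exact (measurableSet_fst_eq _).inter (measurable_snd (measurableSet_initial_eq _ _))

lemma measurable_of_agree {n : ℕ} {f : ℕ × (ℕ → ι) → ℝ} (h : ∀ z z', Agree n z z' → f z = f z') :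
    Measurable f := by
  intro S _
  have : f ⁻¹' S = ⋃ p ∈ {p : ℕ × List ι | ∃ z, f z ∈ S ∧ p = (z.1, initial n z.2)},
      {z : ℕ × (ℕ → ι) | z.1 = p.1 ∧ initial n z.2 = p.2} := by
    ext z
    simp only [mem_preimage, mem_iUnion, mem_ofPred_eq]
    constructor
    · exact fun hz => ⟨(z.1, initial n z.2), ⟨z, hz, rfl⟩, rfl, rfl⟩
    · rintro ⟨p, ⟨z', hz', rfl⟩, h1, h2⟩
      rwa [h z z' (agree_iff_initial.2 ⟨h1, h2⟩)]
  rw [this]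
  exact MeasurableSet.biUnion (to_countable _) fun p _ =>
    (measurableSet_fst_eq _).inter (measurable_snd (measurableSet_initial_eq _ _))

/-- The average of a function over the smallest cylinder of positive measure around a point, among
those of length at most `n`. -/
def cylAverage (ζ : Measure (ℕ × (ℕ → ι))) (G : ℕ × (ℕ → ι) → ℝ) : ℕ → ℕ × (ℕ → ι) → ℝ
  | 0, z => (∫ y in symCyl 0 z, G y ∂ζ) / ζ.real (symCyl 0 z)
  | n + 1, z => if ζ.real (symCyl (n + 1) z) = 0 then cylAverage ζ G n z else
      (∫ y in symCyl (n + 1) z, G y ∂ζ) / ζ.real (symCyl (n + 1) z)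

variable {ζ : Measure (ℕ × (ℕ → ι))} {G : ℕ × (ℕ → ι) → ℝ}

omit [Countable ι] [MeasurableSingletonClass ι] in
lemma cylAverage_congr {n : ℕ} {z z' : ℕ × (ℕ → ι)} (h : Agree n z z') :
    cylAverage ζ G n z = cylAverage ζ G n z' := by
  induction n with
  | zero => rw [cylAverage, cylAverage, symCyl_eq_of_agree h]
  | succ n ih => rw [cylAverage, cylAverage, symCyl_eq_of_agree h, ih (h.mono n.le_succ)]

omit [Countable ι] [MeasurableSingletonClass ι] in
lemma cylAverage_of_ne_zero {n : ℕ} {z : ℕ × (ℕ → ι)} (h : ζ.real (symCyl n z) ≠ 0) :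
    cylAverage ζ G n z = (∫ y in symCyl n z, G y ∂ζ) / ζ.real (symCyl n z) := by
  cases n with
  | zero => rfl
  | succ n => rw [cylAverage, if_neg h]

omit [Countable ι] [MeasurableSingletonClass ι] in
lemma cylAverage_eq_or {m n : ℕ} (hmn : m ≤ n) (z : ℕ × (ℕ → ι)) :
    cylAverage ζ G n z = cylAverage ζ G m z ∨ ∃ n', m ≤ n' ∧ ζ.real (symCyl n' z) ≠ 0 ∧
      cylAverage ζ G n z = (∫ y in symCyl n' z, G y ∂ζ) / ζ.real (symCyl n' z) := by
  induction n, hmn using Nat.le_induction with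
  | base => exact Or.inl rfl
  | succ n hn ih =>
    by_cases h : ζ.real (symCyl (n + 1) z) = 0
    · rwa [cylAverage, if_pos h]
    · exact Or.inr ⟨n + 1, by omega, h, cylAverage_of_ne_zero h⟩

variable [IsProbabilityMeasure ζ]

/-- A bounded function whose averages over subsets of cylinders are close to each other has a
version that is Lipschitz. -/
lemma exists_ae_eq_lipschitz (hG : Measurable G) {A L b : ℝ} (hA0 : ∀ z, 0 ≤ G z)
    (hA : ∀ z, G z ≤ A) (hL : 0 ≤ L) (hb0 : 0 < b) (hb1 : b < 1)
    (h : ∀ (s : ℕ) (z₁ : ℕ × (ℕ → ι)) (E E' : Set (ℕ × (ℕ → ι))), MeasurableSet E →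
      MeasurableSet E' → E ⊆ symCyl s z₁ → E' ⊆ symCyl s z₁ →
      (∫ z in E, G z ∂ζ) * ζ.real E' ≤
        (∫ z in E', G z ∂ζ) * ζ.real E + L * b ^ s * ζ.real E * ζ.real E') :
    ∃ g : ℕ × (ℕ → ι) → ℝ, Measurable g ∧ (∀ z, 0 ≤ g z) ∧ (∀ z, g z ≤ A) ∧
      (∀ s z z', Agree s z z' → |g z - g z'| ≤ 2 * L * b ^ s) ∧ G =ᵐ[ζ] g := by
  have hAabs : ∀ z, |G z| ≤ A := fun z => by rw [abs_of_nonneg (hA0 z)]; exact hA z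
  have hA00 : 0 ≤ A := (hA0 (0, fun _ => Classical.choice (by
    by_contra hι
    rw [not_nonempty_iff] at hι
    have : IsEmpty (ℕ × (ℕ → ι)) := ⟨fun z => hι.elim (z.2 0)⟩
    have h1 := measure_univ (μ := ζ)
    rw [univ_eq_empty_iff.2 this, measure_empty] at h1
    exact zero_ne_one h1))).trans (hA _)
  have hGi : Integrable G ζ := integrable_of_bdd hG hAabs
  set a := cylAverage ζ G with ha
  have ham : ∀ n, Measurable (a n) := fun n => measurable_of_agree fun z z' => cylAverage_congr
  have hr0 : ∀ E : Set (ℕ × (ℕ → ι)), 0 ≤ (∫ y in E, G y ∂ζ) / ζ.real E := fun E =>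
    div_nonneg (integral_nonneg hA0) measureReal_nonneg
  have hrA : ∀ E : Set (ℕ × (ℕ → ι)), (∫ y in E, G y ∂ζ) / ζ.real E ≤ A := fun E => by
    refine div_le_of_le_mul₀ measureReal_nonneg hA00 ?_
    have := integral_mono (μ := ζ.restrict E) hGi.integrableOn (integrable_const A) hA
    simpa [mul_comm] using this
  have ha0A : ∀ n z, 0 ≤ a n z ∧ a n z ≤ A := by
    intro n z
    induction n with
    | zero => exact ⟨hr0 _, hrA _⟩
    | succ n ih =>
      rw [ha, cylAverage]
      split_ifs
      exacts [ih, ⟨hr0 _, hrA _⟩]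
  -- The hypothesis for a cylinder and a smaller cylinder inside it, in both orders.
  have hclose : ∀ m n z, m ≤ n → |a n z - a m z| ≤ L * b ^ m := by
    intro m n z hmn
    rcases cylAverage_eq_or (ζ := ζ) (G := G) hmn z with h1 | ⟨n', h1, h2, h3⟩
    · rw [ha, h1, sub_self, abs_zero]; positivity
    have hsub := symCyl_anti h1 z
    have h4 : ζ.real (symCyl m z) ≠ 0 := fun h0 =>
      h2 (le_antisymm ((measureReal_mono hsub).trans h0.le) measureReal_nonneg)
    rw [ha, h3, cylAverage_of_ne_zero h4]
    have h5 := h m z _ _ (measurableSet_symCyl n' z) (measurableSet_symCyl m z) hsub subset_rfl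
    have h6 := h m z _ _ (measurableSet_symCyl m z) (measurableSet_symCyl n' z) subset_rfl hsub
    have h7 : 0 < ζ.real (symCyl m z) := lt_of_le_of_ne measureReal_nonneg h4.symm
    have h8 : 0 < ζ.real (symCyl n' z) := lt_of_le_of_ne measureReal_nonneg h2.symm
    rw [div_sub_div _ _ h8.ne' h7.ne', abs_le, le_div_iff₀ (by positivity),
      div_le_iff₀ (by positivity)]
    constructor <;> nlinarith
  have hbn : Filter.Tendsto (fun n : ℕ => L * b ^ n) Filter.atTop (nhds 0) := by
    simpa using (tendsto_pow_atTop_nhds_zero_of_lt_one hb0.le hb1).const_mul L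
  have hcs : ∀ z, CauchySeq fun n => a n z := fun z => by
    refine cauchySeq_of_le_tendsto_0 (fun n => L * b ^ n + L * b ^ n) (fun n m N hn hm => ?_)
      (by simpa using hbn.add hbn)
    rw [Real.dist_eq, abs_le]
    have h1 := abs_le.1 (hclose N n z hn)
    have h2 := abs_le.1 (hclose N m z hm)
    constructor <;> linarith [h1.1, h1.2, h2.1, h2.2]
  choose g hg using fun z => cauchySeq_tendsto_of_complete (hcs z)
  have hga : ∀ m z, |g z - a m z| ≤ L * b ^ m := fun m z => by
    refine le_of_tendsto ((hg z).sub_const (a m z)).abs ?_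
    filter_upwards [Filter.eventually_ge_atTop m] with n hn
    exact hclose m n z hn
  refine ⟨g, measurable_of_tendsto_metrizable ham (tendsto_pi_nhds.2 hg),
    fun z => ge_of_tendsto' (hg z) fun n => (ha0A n z).1,
    fun z => le_of_tendsto' (hg z) fun n => (ha0A n z).2, fun s z z' hzz => ?_, ?_⟩
  · have h1 := abs_le.1 (hga s z)
    have h2 := abs_le.1 (hga s z')
    rw [show a s z' = a s z from (cylAverage_congr hzz).symm] at h2
    rw [abs_le]
    constructor <;> linarith [h1.1, h1.2, h2.1, h2.2]
  -- The hypothesis for a cylinder and an arbitrary subset of it: G itself is close to the average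
  -- over the cylinder almost everywhere.
  have hGa : ∀ m : ℕ, ∀ᵐ z ∂ζ, |G z - a m z| ≤ L * b ^ m := by
    intro m
    have h1 : ∀ p : ℕ × List ι, ∀ᵐ z ∂ζ,
        (z.1 = p.1 ∧ initial m z.2 = p.2) → |G z - a m z| ≤ L * b ^ m := by
      intro p
      by_cases hp : ∃ z : ℕ × (ℕ → ι), z.1 = p.1 ∧ initial m z.2 = p.2
      swap
      · exact Filter.Eventually.of_forall fun z hz => (hp ⟨z, hz⟩).elim
      obtain ⟨z₁, hz₁⟩ := hp
      have hmem : ∀ z : ℕ × (ℕ → ι), (z.1 = p.1 ∧ initial m z.2 = p.2) → z ∈ symCyl m z₁ :=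
        fun z hz => agree_iff_initial.2 ⟨hz.1.trans hz₁.1.symm, hz.2.trans hz₁.2.symm⟩
      by_cases h0 : ζ.real (symCyl m z₁) = 0
      · have h2 : ζ (symCyl m z₁) = 0 := by
          rwa [measureReal_eq_zero_iff] at h0
        filter_upwards [measure_eq_zero_iff_ae_notMem.1 h2] with z hz hzp
        exact (hz (hmem z hzp)).elim
      · have h7 : 0 < ζ.real (symCyl m z₁) := lt_of_le_of_ne measureReal_nonneg (Ne.symm h0)
        have e1 : ∀ z ∈ symCyl m z₁, a m z = (∫ y in symCyl m z₁, G y ∂ζ) / ζ.real (symCyl m z₁) :=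
          fun z hz => (cylAverage_congr hz).trans (cylAverage_of_ne_zero h0)
        set r := (∫ y in symCyl m z₁, G y ∂ζ) / ζ.real (symCyl m z₁) with hr
        have hrr : (∫ y in symCyl m z₁, G y ∂ζ) = r * ζ.real (symCyl m z₁) := by
          rw [hr, div_mul_cancel₀ _ h0]
        have h3 := ae_le_of_setIntegral_le (c := r + L * b ^ m) (measurableSet_symCyl m z₁) hG hAabs
          fun E hE hEm => by
            have h4 := h m z₁ _ _ hEm (measurableSet_symCyl m z₁) hE subset_rfl
            rw [hrr] at h4
            refine le_of_mul_le_mul_right ?_ h7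
            linarith
        have h4 := ae_le_of_setIntegral_le (G := fun z => -G z) (c := -r + L * b ^ m)
          (measurableSet_symCyl m z₁) hG.neg (fun z => by rw [abs_neg]; exact hAabs z)
          fun E hE hEm => by
            have h4 := h m z₁ _ _ (measurableSet_symCyl m z₁) hEm subset_rfl hE
            rw [hrr] at h4
            rw [integral_neg]
            refine le_of_mul_le_mul_right ?_ h7
            linarith
        filter_upwards [h3, h4] with z h5 h6 hz
        have hz' := hmem z hz
        rw [e1 z hz', abs_le]
        constructor <;> linarith [h5 hz', h6 hz']
    filter_upwards [ae_all_iff.2 h1] with z hz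
    exact hz (z.1, initial m z.2) ⟨rfl, rfl⟩
  filter_upwards [ae_all_iff.2 hGa] with z hz
  refine tendsto_nhds_unique ?_ (hg z)
  refine tendsto_iff_dist_tendsto_zero.2 (squeeze_zero (fun _ => dist_nonneg) (fun m => ?_) hbn)
  rw [Real.dist_eq, abs_sub_comm]
  exact hz m

end RegularDensity

/-! ### Conditional expectations given the future are Lipschitz. -/

section Smoothing

variable {ι X : Type*} [MeasurableSpace ι] [Countable ι] [MeasurableSingletonClass ι]
  [MeasurableSpace X] {ν : Measure X} {ζ : Measure (ℕ × (ℕ → ι))} [IsProbabilityMeasure ν]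
  [IsProbabilityMeasure ζ] {q : X → ℕ × (ℕ → ι)} {T : X → X} {τ : ι → ℕ} {Φ : X → ℝ} {B b C : ℝ}
  (hζ : MeasurePreserving (symStep τ) ζ ζ) (hval : ∀ᵐ z ∂ζ, z.1 < τ (z.2 0))
  (hG : IsGibbs (baseMeasure ζ) C b) (hT : MeasurePreserving T ν ν)
  (hqm : MeasurePreserving q ν ζ) (hq : ∀ x, q (T x) = symStep τ (q x))
include hζ hval hG hT hqm hq

/-- The conditional expectations of an observable with respect to the future are Lipschitz. -/
lemma SymOsc.exists_lipschitz_isCond (hO : SymOsc T q τ Φ B b) (hB : 0 ≤ B) (hC : 0 ≤ C)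
    (hb0 : 0 < b) (hb1 : b < 1) (hΦm : Measurable Φ) {A : ℝ} (hΦ0 : ∀ x, 0 ≤ Φ x)
    (hΦA : ∀ x, Φ x ≤ A)
    (hret : Filter.Tendsto (fun h => ∫ z, b ^ returns τ h z ∂ζ) Filter.atTop (nhds 0))
    (K₀ k : ℕ) :
    ∃ g : ℕ × (ℕ → ι) → ℝ, Measurable g ∧ (∀ z, 0 ≤ g z) ∧ (∀ z, g z ≤ A) ∧
      (∀ s z z', Agree s z z' →
        |g z - g z'| ≤ 2 * (Real.exp C * (C * A + B * b ^ K₀) + A) * b ^ s) ∧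
      IsCond ν ζ (fun x => (symStep τ)^[k] (q x)) (cutoff τ q Φ K₀ k) g := by
  obtain ⟨x₀⟩ : Nonempty X := by
    by_contra hX
    rw [not_nonempty_iff] at hX
    have h1 := measure_univ (μ := ν)
    rw [univ_eq_empty_iff.2 hX, measure_empty] at h1
    exact zero_ne_one h1
  have hA : 0 ≤ A := (hΦ0 x₀).trans (hΦA x₀)
  have hqk : MeasurePreserving (fun x => (symStep τ)^[k] (q x)) ν ζ := (hζ.iterate k).comp hqm
  have hcm := measurable_cutoff (τ := τ) hqm.measurable hΦm K₀ k
  have hc0 := cutoff_nonneg (τ := τ) (q := q) hΦ0 K₀ k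
  have hcA := cutoff_le (τ := τ) (q := q) hA hΦA K₀ k
  obtain ⟨G, hGm, hG0, hGA, hGc⟩ := exists_isCond hqk hcm hA hc0 hcA
  have hGi : Integrable G ζ := integrable_of_bdd hGm (B := A) fun z => by
    rw [abs_of_nonneg (hG0 z)]; exact hGA z
  set L := Real.exp C * (C * A + B * b ^ K₀) + A with hL
  have hAE : ∀ E : Set (ℕ × (ℕ → ι)), ∫ z in E, G z ∂ζ ≤ A * ζ.real E := fun E => by
    have := integral_mono (μ := ζ.restrict E) hGi.integrableOn (integrable_const A) hGA
    simpa [mul_comm] using this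
  have h0E : ∀ E : Set (ℕ × (ℕ → ι)), 0 ≤ ∫ z in E, G z ∂ζ := fun E => integral_nonneg hG0
  obtain ⟨g, hgm, hg0, hgA, hgL, hge⟩ := exists_ae_eq_lipschitz (L := L) hGm hG0 hGA (by positivity)
    hb0 hb1 fun s z₁ E E' hE hE' hEz hEz' => by
      have hE0 : 0 ≤ ζ.real E := measureReal_nonneg
      have hE0' : 0 ≤ ζ.real E' := measureReal_nonneg
      -- With no common symbol the bound is trivial, thanks to the summand A in L.
      rcases Nat.eq_zero_or_pos s with rfl | hs
      · have h1 := mul_le_mul_of_nonneg_right (hAE E) hE0'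
        have h2 : 0 ≤ Real.exp C * (C * A + B * b ^ K₀) * (ζ.real E * ζ.real E') := by positivity
        have h3 := mul_nonneg (h0E E') hE0
        rw [pow_zero, mul_one, hL]
        linarith
      have e1 : ∀ {E : Set (ℕ × (ℕ → ι))}, MeasurableSet E →
          (∫⁻ x in (fun x => (symStep τ)^[k] (q x)) ⁻¹' E,
            ENNReal.ofReal (cutoff τ q Φ K₀ k x) ∂ν) = ENNReal.ofReal (∫ z in E, G z ∂ζ) := by
        intro E hE
        rw [← hGc.setIntegral_eq hqk.measurable hE]
        refine (ofReal_integral_eq_lintegral_ofReal ?_ ?_).symm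
        · exact (integrable_of_bdd hcm (B := A) fun x => by
            rw [abs_of_nonneg (hc0 x)]; exact hcA x).integrableOn
        · exact Filter.Eventually.of_forall hc0
      have key : ∀ h, (∫ z in E, G z ∂ζ) * ζ.real E' ≤ Real.exp (C * b ^ s) *
          ((∫ z in E', G z ∂ζ) + (B * (∫ z, b ^ returns τ h z ∂ζ) +
            B * b ^ (2 * (K₀ + s)) * ζ.real E')) * ζ.real E := by
        intro h
        have h1 := hO.lintegral_mul_le hζ hval hG hT hqm hq hB hb0 hb1 hΦm hs hE hE'
          (fun z hz => hEz hz) (fun z hz => hEz' hz) K₀ k h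
        rw [e1 hE, e1 hE'] at h1
        have h2 : ∫⁻ z, ENNReal.ofReal (B * b ^ (2 * returns τ h z)) ∂ζ ≤
            ENNReal.ofReal (B * ∫ z, b ^ returns τ h z ∂ζ) := by
          rw [← integral_const_mul, ofReal_integral_eq_lintegral_ofReal
            ((integrable_pow_returns hb0.le hb1.le h).const_mul B)
            (Filter.Eventually.of_forall fun z => by positivity)]
          refine lintegral_mono fun z => ENNReal.ofReal_le_ofReal ?_
          exact mul_le_mul_of_nonneg_left (pow_le_pow_of_le_one hb0.le hb1.le (by omega)) hB
        have hI : 0 ≤ ∫ z, b ^ returns τ h z ∂ζ := integral_nonneg fun z => by positivity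
        have e2 : ∀ E : Set (ℕ × (ℕ → ι)), ζ E = ENNReal.ofReal (ζ.real E) := fun E =>
          (ENNReal.ofReal_toReal (measure_ne_top ζ E)).symm
        have h3 := h1.trans (mul_le_mul_left (mul_le_mul_right (add_le_add_right
          (add_le_add_left h2 _) _) _) _)
        have hJ := h0E E'
        have n1 : 0 ≤ B * b ^ (2 * (K₀ + s)) := by positivity
        have n2 : 0 ≤ B * ∫ z, b ^ returns τ h z ∂ζ := by positivity
        have n3 : 0 ≤ B * b ^ (2 * (K₀ + s)) * ζ.real E' := by positivity
        rw [e2 E, e2 E', ← ENNReal.ofReal_mul (h0E E), ← ENNReal.ofReal_mul n1,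
          ← ENNReal.ofReal_add n2 n3, ← ENNReal.ofReal_add hJ (by positivity),
          ← ENNReal.ofReal_mul (Real.exp_pos _).le, ← ENNReal.ofReal_mul (by positivity)] at h3
        exact (ENNReal.ofReal_le_ofReal_iff (by positivity)).1 h3
      -- Going infinitely far into the past removes the term due to contraction on stable disks.
      have hlim := ge_of_tendsto' (((((hret.const_mul B).add_const
        (B * b ^ (2 * (K₀ + s)) * ζ.real E')).const_add (∫ z in E', G z ∂ζ)).const_mul
        (Real.exp (C * b ^ s))).mul_const (ζ.real E)) key
      rw [mul_zero, zero_add] at hlim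
      have hbs : b ^ s ≤ 1 := pow_le_one₀ hb0.le hb1.le
      have hbs0 : 0 ≤ b ^ s := by positivity
      have he1 : Real.exp (C * b ^ s) ≤ Real.exp C :=
        Real.exp_le_exp.2 (mul_le_of_le_one_right hC hbs)
      have he2 : Real.exp (C * b ^ s) ≤ 1 + Real.exp C * (C * b ^ s) := by
        have h1 := Real.add_one_le_exp (-(C * b ^ s))
        have h2 : Real.exp (C * b ^ s) * Real.exp (-(C * b ^ s)) = 1 := by
          rw [← Real.exp_add]; simp
        have h3 := mul_le_mul_of_nonneg_left h1 (Real.exp_pos (C * b ^ s)).le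
        have h4 := mul_le_mul_of_nonneg_right he1 (by positivity : 0 ≤ C * b ^ s)
        nlinarith
      have hbK : b ^ (2 * (K₀ + s)) ≤ b ^ K₀ * b ^ s := by
        rw [← pow_add]
        exact pow_le_pow_of_le_one hb0.le hb1.le (by omega)
      have t1 : Real.exp (C * b ^ s) * ((∫ z in E', G z ∂ζ) * ζ.real E) ≤
          (∫ z in E', G z ∂ζ) * ζ.real E +
            Real.exp C * (C * b ^ s) * (A * ζ.real E' * ζ.real E) := by
        have h1 := mul_nonneg (h0E E') hE0
        have h2 := mul_le_mul_of_nonneg_right he2 h1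
        have h3 := mul_le_mul_of_nonneg_left (mul_le_mul_of_nonneg_right (hAE E') hE0)
          (by positivity : 0 ≤ Real.exp C * (C * b ^ s))
        linarith
      have t2 : Real.exp (C * b ^ s) * (B * b ^ (2 * (K₀ + s)) * ζ.real E' * ζ.real E) ≤
          Real.exp C * (B * (b ^ K₀ * b ^ s) * ζ.real E' * ζ.real E) := by gcongr
      have t3 : 0 ≤ A * b ^ s * ζ.real E * ζ.real E' := by positivity
      rw [hL]
      linarith
  exact ⟨g, hgm, hg0, hgA, hgL, hGc.congr hge⟩

end Smoothing

/-! ### Decay of correlations on the symbolic tower. -/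

section Correlations

variable {ι : Type*} [MeasurableSpace ι]

/-- Bounded functions on the symbolic tower that are Lipschitz for `b ^ s`. -/
def IsSymLip (b A L : ℝ) (u : ℕ × (ℕ → ι) → ℝ) : Prop :=
  Measurable u ∧ (∀ z, |u z| ≤ A) ∧ ∀ s z z', Agree s z z' → |u z - u z'| ≤ L * b ^ s

/-- Decay of correlations of the Lipschitz functions on the symbolic tower. -/
def DecayCor (ζ : Measure (ℕ × (ℕ → ι))) (τ : ι → ℕ) (b C : ℝ) (r : ℕ → ℝ) : Prop :=
  ∀ (u g : ℕ × (ℕ → ι) → ℝ) (A L A' L' : ℝ), IsSymLip b A L u → IsSymLip b A' L' g → ∀ n, 1 ≤ n →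
    |∫ z, u z * g ((symStep τ)^[n] z) ∂ζ - (∫ z, u z ∂ζ) * ∫ z, g z ∂ζ| ≤
      C * (A + L) * (A' + L') * r n

omit [MeasurableSpace ι] in
lemma iterate_symStep_fst_le (τ : ι → ℕ) (n : ℕ) (z : ℕ × (ℕ → ι)) :
    ((symStep τ)^[n] z).1 ≤ z.1 + n := by
  induction n with
  | zero => exact le_rfl
  | succ n ih =>
    rw [Function.iterate_succ_apply', symStep]
    split_ifs
    · dsimp only; omega
    · dsimp only; omega

omit [MeasurableSpace ι] in
lemma indicator_sub_indicator_le {Z : Type*} (S : Set Z) (z z' : Z) :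
    |S.indicator (1 : Z → ℝ) z - S.indicator (1 : Z → ℝ) z'| ≤ 1 := by
  by_cases h : z ∈ S <;> by_cases h' : z' ∈ S <;> simp [h, h']

omit [MeasurableSpace ι] in
lemma abs_indicator_one_le {Z : Type*} (S : Set Z) (z : Z) : |S.indicator (1 : Z → ℝ) z| ≤ 1 := by
  by_cases h : z ∈ S <;> simp [h]

variable [Countable ι] [MeasurableSingletonClass ι] {τ : ι → ℕ} {ζ : Measure (ℕ × (ℕ → ι))}
  [IsProbabilityMeasure ζ] (hζ : MeasurePreserving (symStep τ) ζ ζ)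
  (hval : ∀ᵐ z ∂ζ, z.1 < τ (z.2 0)) {b : ℝ}
include hζ hval

/-- Decay of correlations bounds the tails of the height of the tower. -/
lemma DecayCor.exists_tail_le {C : ℝ} {r : ℕ → ℝ} (h : DecayCor ζ τ b C r) (hC : 0 < C) :
    ∃ C' : ℝ, 0 < C' ∧ ∀ n : ℕ, 1 ≤ n → ζ.real {z | n + 1 ≤ z.1} ≤ C' * r n := by
  set p := ζ.real {z | z.1 = 0} with hp
  have hp0 : 0 < p := by
    refine lt_of_le_of_ne measureReal_nonneg fun h0 => baseMeasure_univ_ne_zero hζ hval ?_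
    rw [baseMeasure_apply ζ MeasurableSet.univ]
    have h1 : ζ {z | z.1 = 0} = 0 := (measureReal_eq_zero_iff).1 h0.symm
    exact measure_mono_null (fun z hz => hz.1) h1
  refine ⟨C / p, by positivity, fun n hn => ?_⟩
  have hm1 : MeasurableSet {z : ℕ × (ℕ → ι) | z.1 = 0} := measurableSet_fst_eq 0
  have hm2 : MeasurableSet {z : ℕ × (ℕ → ι) | n + 1 ≤ z.1} :=
    measurableSet_le measurable_const measurable_fst
  have key : ∀ S : Set (ℕ × (ℕ → ι)), MeasurableSet S →
      (∀ z z' : ℕ × (ℕ → ι), z.1 = z'.1 → (z ∈ S ↔ z' ∈ S)) →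
      IsSymLip b 1 0 (S.indicator 1) := fun S hS hSz =>
    ⟨measurable_one.indicator hS, abs_indicator_one_le S, fun s z z' hzz => by
      have := hSz z z' hzz.1
      by_cases h1 : z ∈ S
      · simp [h1, this.1 h1]
      · have h2 : z' ∉ S := fun h2 => h1 (this.2 h2)
        simp [h1, h2]⟩
  have h1 := h _ _ 1 0 1 0 (key _ hm1 fun z z' hz => by simp [hz])
    (key _ hm2 fun z z' hz => by simp [hz]) n hn
  -- From the base one climbs at most n levels in n steps, so the product vanishes and the
  -- correlation is the product of the two measures.
  have h2 : ∀ z : ℕ × (ℕ → ι), {z : ℕ × (ℕ → ι) | z.1 = 0}.indicator (1 : _ × _ → ℝ) z *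
      {z : ℕ × (ℕ → ι) | n + 1 ≤ z.1}.indicator (1 : _ × _ → ℝ) ((symStep τ)^[n] z) = 0 := by
    intro z
    by_cases hz : z.1 = 0
    · have h3 := iterate_symStep_fst_le τ n z
      rw [indicator_of_notMem (s := {z : ℕ × (ℕ → ι) | n + 1 ≤ z.1}), mul_zero]
      simp only [mem_ofPred_eq]
      omega
    · rw [indicator_of_notMem (s := {z : ℕ × (ℕ → ι) | z.1 = 0}) hz, zero_mul]
  simp only [h2, integral_zero, zero_sub, abs_neg] at h1
  rw [integral_indicator_one hm1, integral_indicator_one hm2, ← hp] at h1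
  have h3 := le_of_abs_le h1
  rw [div_mul_eq_mul_div, le_div_iff₀ hp0]
  linarith

end Correlations

/-! ### The mean given the future is almost constant. -/

section Estimates

variable {ι X : Type*} [MeasurableSpace ι] [Countable ι] [MeasurableSingletonClass ι]
  [MeasurableSpace X] {ν : Measure X} {ζ : Measure (ℕ × (ℕ → ι))} [IsProbabilityMeasure ν]
  [IsProbabilityMeasure ζ] {q : X → ℕ × (ℕ → ι)} {T : X → X} {τ : ι → ℕ} {Φ : X → ℝ} {B b C : ℝ}

-- The event is decided by `K₀` symbols. Points that agree on fewer, s < K₀, cost at most A ≤ A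
-- b^(-K₀) b^s.
omit [IsProbabilityMeasure ζ] in
lemma IsSymLip.mul_indicator_returns {A L : ℝ} {u : ℕ × (ℕ → ι) → ℝ} (hb0 : 0 < b) (hb1 : b < 1)
    (hA : 0 ≤ A) (h0 : ∀ z, 0 ≤ u z) (h : IsSymLip b A L u) (K₀ k : ℕ) :
    IsSymLip b A (L + A * (b ^ K₀)⁻¹)
      (fun z => u z * {z | K₀ ≤ returns τ k z}.indicator 1 z) := by
  obtain ⟨h1, h2, h3⟩ := h
  have hmS : MeasurableSet {z | K₀ ≤ returns τ k z} :=
    measurableSet_le measurable_const (measurable_returns τ k)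
  refine ⟨h1.mul (measurable_one.indicator hmS), fun z => ?_, fun s z z' hzz => ?_⟩
  · rw [abs_mul]
    exact (mul_le_mul (h2 z) (abs_indicator_one_le _ z) (abs_nonneg _) hA).trans (mul_one A).le
  · have hL : 0 ≤ L := by
      have := (abs_nonneg _).trans (h3 0 z z (Agree.refl 0 z))
      simpa using this
    have hbs : 0 < b ^ s := by positivity
    have hbK : 0 < b ^ K₀ := by positivity
    rcases le_or_gt K₀ s with hs | hs
    · have h4 := le_returns_iff τ hzz.1 (fun m hm => hzz.2 m (lt_of_lt_of_le hm hs)) (n := k)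
      have h5 : {z | K₀ ≤ returns τ k z}.indicator (1 : _ × _ → ℝ) z' =
          {z | K₀ ≤ returns τ k z}.indicator (1 : _ × _ → ℝ) z := by
        by_cases h6 : K₀ ≤ returns τ k z
        · simp [h6, h4.1 h6]
        · have h7 : ¬ K₀ ≤ returns τ k z' := fun h7 => h6 (h4.2 h7)
          simp only [indicator, mem_ofPred_eq, h6, h7, if_false]
      dsimp only
      rw [h5, ← sub_mul, abs_mul]
      have h6 := mul_le_mul (h3 s z z' hzz) (abs_indicator_one_le {z | K₀ ≤ returns τ k z} z)
        (abs_nonneg _) (by positivity)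
      refine h6.trans ?_
      rw [mul_one]
      gcongr
      have : 0 ≤ A * (b ^ K₀)⁻¹ := by positivity
      linarith
    · have h4 : ∀ z : ℕ × (ℕ → ι), 0 ≤ u z * {z | K₀ ≤ returns τ k z}.indicator (1 : _ × _ → ℝ) z ∧
          u z * {z | K₀ ≤ returns τ k z}.indicator (1 : _ × _ → ℝ) z ≤ A := by
        intro z
        have h5 : u z ≤ A := (le_abs_self _).trans (h2 z)
        by_cases h6 : z ∈ {z | K₀ ≤ returns τ k z}
        · rw [indicator_of_mem h6]; simpa using ⟨h0 z, h5⟩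
        · rw [indicator_of_notMem h6]; simpa using hA
      have h5 : |u z * {z | K₀ ≤ returns τ k z}.indicator (1 : _ × _ → ℝ) z -
          u z' * {z | K₀ ≤ returns τ k z}.indicator (1 : _ × _ → ℝ) z'| ≤ A := by
        rw [abs_le]
        constructor <;> linarith [(h4 z).1, (h4 z).2, (h4 z').1, (h4 z').2]
      refine h5.trans ?_
      have h6 : b ^ K₀ ≤ b ^ s := pow_le_pow_of_le_one hb0.le hb1.le hs.le
      have h7 : 1 ≤ (b ^ K₀)⁻¹ * b ^ s := by
        rw [inv_mul_eq_div, le_div_iff₀ hbK, one_mul]; exact h6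
      have h8 : 0 ≤ L * b ^ s := by positivity
      calc A = A * 1 := (mul_one A).symm
        _ ≤ A * ((b ^ K₀)⁻¹ * b ^ s) := by gcongr
        _ ≤ _ := by linarith

lemma integral_sub_sq_eq {Z : Type*} [MeasurableSpace Z] {ζ : Measure Z} [IsProbabilityMeasure ζ]
    {G : Z → ℝ} (hG : Measurable G) {A : ℝ} (hA : ∀ z, |G z| ≤ A) :
    ∫ z, (G z - ∫ y, G y ∂ζ) ^ 2 ∂ζ = ∫ z, G z * G z ∂ζ - (∫ z, G z ∂ζ) * ∫ z, G z ∂ζ := by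
  set m := ∫ z, G z ∂ζ with hm
  have hi : Integrable G ζ := integrable_of_bdd hG hA
  have hi2 : Integrable (fun z => G z * G z) ζ := integrable_of_bdd (hG.mul hG) (B := A * A)
    fun z => by
      rw [abs_mul]
      exact mul_le_mul (hA z) (hA z) (abs_nonneg _) ((abs_nonneg _).trans (hA z))
  have e1 : ∀ z, (G z - m) ^ 2 = G z * G z - (2 * m) * G z + m * m := fun z => by ring
  have hi3 : Integrable (fun z => (2 * m) * G z) ζ := hi.const_mul _
  have hi4 : Integrable (fun z => G z * G z - (2 * m) * G z) ζ := hi2.sub hi3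
  simp only [e1]
  rw [integral_add hi4 (integrable_const _), integral_sub hi2 hi3, integral_const_mul, ← hm]
  simp
  ring

variable (hζ : MeasurePreserving (symStep τ) ζ ζ) (hval : ∀ᵐ z ∂ζ, z.1 < τ (z.2 0))
  (hG : IsGibbs (baseMeasure ζ) C b) (hT : MeasurePreserving T ν ν)
  (hqm : MeasurePreserving q ν ζ) (hq : ∀ x, q (T x) = symStep τ (q x))
include hζ hval hG hT hqm hq

/-- The conditional expectation of an observable given the future after time `k` is close to its
mean in `L²`. -/
lemma SymOsc.exists_isCond_sub_sq_le (hO : SymOsc T q τ Φ B b) (hB : 0 ≤ B) (hC : 0 ≤ C)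
    (hb0 : 0 < b) (hb1 : b < 1) (hΦm : Measurable Φ) {A : ℝ} (hA : 0 ≤ A) (hΦ0 : ∀ x, 0 ≤ Φ x)
    (hΦA : ∀ x, Φ x ≤ A)
    (hret : Filter.Tendsto (fun h => ∫ z, b ^ returns τ h z ∂ζ) Filter.atTop (nhds 0))
    {Cc : ℝ} {r : ℕ → ℝ} (hcor : DecayCor ζ τ b Cc r) (K₀ : ℕ) {k : ℕ} (hk : 1 ≤ k) :
    ∃ G : ℕ × (ℕ → ι) → ℝ, Measurable G ∧ (∀ z, 0 ≤ G z) ∧ (∀ z, G z ≤ 2 * A) ∧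
      IsCond ν ζ (fun x => (symStep τ)^[k] (q x)) Φ G ∧
      ∫ z, (G z - ∫ x, Φ x ∂ν) ^ 2 ∂ζ ≤
        2 * (Cc * (A + (2 * (Real.exp C * (C * A + B) + A) + A * (b ^ K₀)⁻¹)) *
          (A + 2 * (Real.exp C * (C * A + B * b ^ K₀) + A)) * r k) +
        2 * (A ^ 2 * ζ.real {z | returns τ k z < K₀}) := by
  have hF := measurable_symStep τ
  have hqk : MeasurePreserving (fun x => (symStep τ)^[k] (q x)) ν ζ := (hζ.iterate k).comp hqm
  -- The first function is the regular part of the conditional expectation after time k; the second,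
  -- with both parameters zero so that nothing is cut off, is that of Φ given all symbols.
  obtain ⟨g, hgm, hg0, hgA, hgL, hgc⟩ := hO.exists_lipschitz_isCond hζ hval hG hT hqm hq hB hC hb0
    hb1 hΦm hΦ0 hΦA hret K₀ k
  obtain ⟨w, hwm, hw0, hwA, hwL, hwc⟩ := hO.exists_lipschitz_isCond hζ hval hG hT hqm hq hB hC hb0
    hb1 hΦm hΦ0 hΦA hret 0 0
  have hcm := measurable_cutoff (τ := τ) hqm.measurable hΦm K₀ k
  have hc0 := cutoff_nonneg (τ := τ) (q := q) hΦ0 K₀ k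
  have hcΦ : ∀ x, cutoff τ q Φ K₀ k x ≤ Φ x := fun x => by
    rw [cutoff]; split_ifs
    exacts [le_rfl, hΦ0 x]
  obtain ⟨g', hgm', hg0', hgA', hgc'⟩ := exists_isCond hqk (hΦm.sub hcm) hA
    (fun x => sub_nonneg.2 (hcΦ x)) fun x => by
      change Φ x - cutoff τ q Φ K₀ k x ≤ A
      linarith [hc0 x, hΦA x]
  have hΦabs : ∀ x, |Φ x| ≤ A := fun x => by rw [abs_of_nonneg (hΦ0 x)]; exact hΦA x
  have hcabs : ∀ x, |cutoff τ q Φ K₀ k x| ≤ A := fun x => by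
    rw [abs_of_nonneg (hc0 x)]; exact (hcΦ x).trans (hΦA x)
  have hgabs : ∀ z, |g z| ≤ A := fun z => by rw [abs_of_nonneg (hg0 z)]; exact hgA z
  have hgabs' : ∀ z, |g' z| ≤ A := fun z => by rw [abs_of_nonneg (hg0' z)]; exact hgA' z
  have hwabs : ∀ z, |w z| ≤ A := fun z => by rw [abs_of_nonneg (hw0 z)]; exact hwA z
  have hgi : Integrable g ζ := integrable_of_bdd hgm hgabs
  have hgi' : Integrable g' ζ := integrable_of_bdd hgm' hgabs'
  have hΦi : Integrable Φ ν := integrable_of_bdd hΦm hΦabs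
  have hci : Integrable (fun x => cutoff τ q Φ K₀ k x) ν := integrable_of_bdd hcm hcabs
  have hcond : IsCond ν ζ (fun x => (symStep τ)^[k] (q x)) Φ (fun z => g z + g' z) := by
    rintro f hf ⟨D, hD⟩
    have h1 := hgc f hf ⟨D, hD⟩
    have h2 := hgc' f hf ⟨D, hD⟩
    have hfq : Measurable fun x => f ((symStep τ)^[k] (q x)) := hf.comp hqk.measurable
    have i1 : Integrable (fun x => cutoff τ q Φ K₀ k x * f ((symStep τ)^[k] (q x))) ν :=
      hci.mul_bdd hfq.aestronglyMeasurable (Filter.Eventually.of_forall fun x => hD _)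
    have i2 : Integrable (fun x => (Φ - cutoff τ q Φ K₀ k) x * f ((symStep τ)^[k] (q x))) ν :=
      (hΦi.sub hci).mul_bdd hfq.aestronglyMeasurable (Filter.Eventually.of_forall fun x => hD _)
    have i3 : Integrable (fun z => g z * f z) ζ :=
      hgi.mul_bdd hf.aestronglyMeasurable (Filter.Eventually.of_forall fun x => hD _)
    have i4 : Integrable (fun z => g' z * f z) ζ :=
      hgi'.mul_bdd hf.aestronglyMeasurable (Filter.Eventually.of_forall fun x => hD _)
    simp only [add_mul]
    rw [integral_add i3 i4, ← h1, ← h2, ← integral_add i1 i2]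
    refine integral_congr_ae (Filter.Eventually.of_forall fun x => ?_)
    simp only [Pi.sub_apply]
    ring
  refine ⟨fun z => g z + g' z, hgm.add hgm', fun z => add_nonneg (hg0 z) (hg0' z),
    fun z => by linarith [hgA z, hgA' z], hcond, ?_⟩
  set I : ℕ × (ℕ → ι) → ℝ := {z | K₀ ≤ returns τ k z}.indicator 1 with hI
  have hIm : Measurable I :=
    measurable_one.indicator (measurableSet_le measurable_const (measurable_returns τ k))
  have hcI : ∀ x, cutoff τ q Φ K₀ k x = Φ x * I (q x) := fun x => by
    by_cases h : K₀ ≤ returns τ k (q x)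
    · rw [cutoff, if_pos h, hI, indicator_of_mem (show q x ∈ {z | K₀ ≤ returns τ k z} from h)]
      simp
    · rw [cutoff, if_neg h, hI, indicator_of_notMem (show q x ∉ {z | K₀ ≤ returns τ k z} from h)]
      simp
  have hw : ∀ f : ℕ × (ℕ → ι) → ℝ, Measurable f → (∃ D, ∀ z, |f z| ≤ D) →
      ∫ x, Φ x * f (q x) ∂ν = ∫ z, w z * f z ∂ζ := fun f hf hD => by
    have := hwc f hf hD
    simpa [cutoff] using this
  have hmw : ∫ z, w z * I z ∂ζ = ∫ z, g z ∂ζ := by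
    rw [← hw I hIm ⟨1, abs_indicator_one_le _⟩, ← hgc.integral_eq]
    simp only [hcI]
  -- The variance of g is a correlation at time k: the integral of g² is that of the cut-off Φ times
  -- g (F^k q), and conditioning on all symbols replaces Φ by w.
  have hcov : ∫ z, g z * g z ∂ζ = ∫ z, w z * I z * g ((symStep τ)^[k] z) ∂ζ := by
    rw [← hgc g hgm ⟨A, hgabs⟩]
    have h1 := hw (fun z => I z * g ((symStep τ)^[k] z)) (hIm.mul (hgm.comp (hF.iterate k)))
      ⟨1 * A, fun z => by
        rw [abs_mul]
        exact mul_le_mul (abs_indicator_one_le _ z) (hgabs _) (abs_nonneg _) zero_le_one⟩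
    simp only [hcI, mul_assoc]
    exact h1
  have hwL' : IsSymLip b A (2 * (Real.exp C * (C * A + B) + A)) w :=
    ⟨hwm, hwabs, fun s z z' h => by simpa using hwL s z z' h⟩
  have h1 := hcor _ _ _ _ _ _ (hwL'.mul_indicator_returns (τ := τ) hb0 hb1 hA hw0 K₀ k)
    ⟨hgm, hgabs, hgL⟩ k hk
  rw [hmw, ← hcov, ← integral_sub_sq_eq hgm hgabs] at h1
  have h2 := le_of_abs_le h1
  -- the points with few returns
  have h3 : ∫ z, (g' z - ∫ y, g' y ∂ζ) ^ 2 ∂ζ ≤ A ^ 2 * ζ.real {z | returns τ k z < K₀} := by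
    rw [integral_sub_sq_eq hgm' hgabs']
    have i1 : Integrable (fun z => g' z * g' z) ζ := hgi'.mul_bdd hgm'.aestronglyMeasurable
      (Filter.Eventually.of_forall fun x => hgabs' _)
    have h4 : ∫ z, g' z * g' z ∂ζ ≤ A * ∫ z, g' z ∂ζ := by
      rw [← integral_const_mul]
      exact integral_mono i1 (hgi'.const_mul A) fun z =>
        mul_le_mul_of_nonneg_right (hgA' z) (hg0' z)
    have hmS : MeasurableSet {z | returns τ k z < K₀} :=
      measurableSet_lt (measurable_returns τ k) measurable_const
    have h5 : ∫ z, g' z ∂ζ ≤ A * ζ.real {z | returns τ k z < K₀} := by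
      rw [← hgc'.integral_eq]
      calc ∫ x, (Φ - cutoff τ q Φ K₀ k) x ∂ν ≤
          ∫ x, A * (q ⁻¹' {z | returns τ k z < K₀}).indicator 1 x ∂ν := by
            refine integral_mono (hΦi.sub hci) (((integrable_const (1 : ℝ)).indicator
              (hqm.measurable hmS)).const_mul A) fun x => ?_
            by_cases h : K₀ ≤ returns τ k (q x)
            · have h6 : x ∉ q ⁻¹' {z | returns τ k z < K₀} := by
                simpa using h
              simp only [indicator_of_notMem h6, Pi.sub_apply, cutoff, if_pos h]
              simp
            · have h6 : x ∈ q ⁻¹' {z | returns τ k z < K₀} := by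
                simpa using h
              simp only [indicator_of_mem h6, Pi.sub_apply, cutoff, if_neg h]
              simpa using hΦA x
        _ = _ := by
            rw [integral_const_mul, integral_indicator_one (hqm.measurable hmS), measureReal_def,
              hqm.measure_preimage hmS.nullMeasurableSet, measureReal_def]
    have h6 := mul_self_nonneg (∫ z, g' z ∂ζ)
    have h7 := mul_le_mul_of_nonneg_left h5 hA
    nlinarith
  have hm : ∫ x, Φ x ∂ν = ∫ z, g z ∂ζ + ∫ z, g' z ∂ζ := by
    rw [hcond.integral_eq, integral_add hgi hgi']
  have hsq : ∀ {G : ℕ × (ℕ → ι) → ℝ}, Measurable G → (∀ z, |G z| ≤ A) → ∀ m : ℝ,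
      Integrable (fun z => 2 * (G z - m) ^ 2) ζ := fun {G} hGm hGA m =>
    integrable_of_bdd (((hGm.sub_const m).pow_const 2).const_mul 2) (B := 2 * (A + |m|) ^ 2)
      fun z => by
        rw [abs_of_nonneg (by positivity)]
        have h8 : |G z - m| ≤ A + |m| := (abs_sub _ _).trans (by linarith [hGA z])
        have h9 := pow_le_pow_left₀ (abs_nonneg _) h8 2
        rw [sq_abs] at h9
        linarith
  calc ∫ z, (g z + g' z - ∫ x, Φ x ∂ν) ^ 2 ∂ζ ≤
      ∫ z, (2 * (g z - ∫ y, g y ∂ζ) ^ 2 + 2 * (g' z - ∫ y, g' y ∂ζ) ^ 2) ∂ζ := by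
        refine integral_mono_of_nonneg (Filter.Eventually.of_forall fun z => sq_nonneg _)
          ((hsq hgm hgabs _).add (hsq hgm' hgabs' _)) (Filter.Eventually.of_forall fun z => ?_)
        dsimp only
        rw [hm]
        nlinarith [sq_nonneg ((g z - ∫ y, g y ∂ζ) - (g' z - ∫ y, g' y ∂ζ))]
    _ = 2 * ∫ z, (g z - ∫ y, g y ∂ζ) ^ 2 ∂ζ + 2 * ∫ z, (g' z - ∫ y, g' y ∂ζ) ^ 2 ∂ζ := by
        rw [integral_add (hsq hgm hgabs _) (hsq hgm' hgabs' _), integral_const_mul,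
          integral_const_mul]
    _ ≤ _ := by
        exact add_le_add (mul_le_mul_of_nonneg_left h2 (by norm_num))
          (mul_le_mul_of_nonneg_left h3 (by norm_num))

end Estimates

/-! ### Approximation by functions orthogonal to the future. -/

section Approximation

variable {ι X : Type*} [MeasurableSpace ι] [Countable ι] [MeasurableSingletonClass ι]
  [MeasurableSpace X] {ν : Measure X} {ζ : Measure (ℕ × (ℕ → ι))} [IsProbabilityMeasure ν]
  [IsProbabilityMeasure ζ] {q : X → ℕ × (ℕ → ι)} {T : X → X} {τ : ι → ℕ} {Φ : X → ℝ} {B b C : ℝ}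
  (hζ : MeasurePreserving (symStep τ) ζ ζ) (hT : MeasurePreserving T ν ν)
  (hqm : MeasurePreserving q ν ζ) (hq : ∀ x, q (T x) = symStep τ (q x))
include hζ hT hqm hq

/-- An observable at time `k` is close to a function of the symbols whose conditional
expectation given the future after time `2 * k` vanishes. -/
lemma SymOsc.exists_isOrth (hO : SymOsc T q τ Φ B b) (hB : 0 ≤ B)
    (hb0 : 0 < b) (hb1 : b < 1) (hΦm : Measurable Φ) {A : ℝ} (hA : 0 ≤ A) (hΦ0 : ∀ x, 0 ≤ Φ x)
    (hΦA : ∀ x, Φ x ≤ A) {k : ℕ} {G : ℕ × (ℕ → ι) → ℝ} (hGm : Measurable G) (hG0 : ∀ z, 0 ≤ G z)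
    (hGA : ∀ z, G z ≤ 2 * A) (hGc : IsCond ν ζ (fun x => (symStep τ)^[k] (q x)) Φ G) :
    ∃ v : ℕ × (ℕ → ι) → ℝ, Measurable v ∧ (∀ z, |v z| ≤ 2 * A) ∧
      IsOrth ζ (symStep τ) (2 * k) v ∧ ∀ p : ℝ, 2 ≤ p →
        ∫ x, |Φ (T^[k] x) - ∫ y, Φ y ∂ν - v (q x)| ^ p ∂ν ≤ (3 * A) ^ (p - 2) *
          (4 * A * B * ∫ z, b ^ returns τ k z ∂ζ + 2 * ∫ z, (G z - ∫ y, Φ y ∂ν) ^ 2 ∂ζ) := by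
  have hF := measurable_symStep τ
  have hΦk : Measurable fun x => Φ (T^[k] x) := hΦm.comp (hT.measurable.iterate k)
  obtain ⟨W, hWm, hW0, hWA, hWc⟩ := exists_isCond hqm hΦk hA (fun x => hΦ0 _) (fun x => hΦA _)
  have hΦabs : ∀ x, |Φ x| ≤ A := fun x => by rw [abs_of_nonneg (hΦ0 x)]; exact hΦA x
  have hWabs : ∀ z, |W z| ≤ A := fun z => by rw [abs_of_nonneg (hW0 z)]; exact hWA z
  have hGabs : ∀ z, |G z| ≤ 2 * A := fun z => by rw [abs_of_nonneg (hG0 z)]; exact hGA z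
  have hWi : Integrable W ζ := integrable_of_bdd hWm hWabs
  have hGF : Measurable fun z => G ((symStep τ)^[2 * k] z) := hGm.comp (hF.iterate _)
  have hGFi : Integrable (fun z => G ((symStep τ)^[2 * k] z)) ζ :=
    integrable_of_bdd hGF fun z => hGabs _
  set m := ∫ y, Φ y ∂ν with hm
  have hm0 : 0 ≤ m := integral_nonneg hΦ0
  have hmA : m ≤ A := by
    have := integral_mono (integrable_of_bdd hΦm hΦabs) (integrable_const (μ := ν) A) hΦA
    simpa using this
  -- Integrated against a function of F^(2k), both terms give the same result: the first by
  -- invariance under T^k, the second by invariance under F^(2k).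
  refine ⟨fun z => W z - G ((symStep τ)^[2 * k] z), hWm.sub hGF, fun z => ?_, ?_, fun p hp => ?_⟩
  · rw [abs_le]
    constructor <;> linarith [hW0 z, hWA z, hG0 ((symStep τ)^[2 * k] z), hGA ((symStep τ)^[2 * k] z)]
  · intro g hg ⟨D, hD⟩
    have hgF : Measurable fun z => g ((symStep τ)^[2 * k] z) := hg.comp (hF.iterate _)
    have i1 : Integrable (fun z => W z * g ((symStep τ)^[2 * k] z)) ζ :=
      hWi.mul_bdd hgF.aestronglyMeasurable (Filter.Eventually.of_forall fun x => hD _)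
    have i2 : Integrable (fun z => G ((symStep τ)^[2 * k] z) * g ((symStep τ)^[2 * k] z)) ζ :=
      hGFi.mul_bdd hgF.aestronglyMeasurable (Filter.Eventually.of_forall fun x => hD _)
    simp only [sub_mul]
    rw [integral_sub i1 i2, sub_eq_zero, ← hWc _ hgF ⟨D, fun z => hD _⟩]
    have h1 := integral_comp_iterate hζ (g := fun z => G z * g z) (hGm.mul hg) (2 * k)
    rw [h1, ← hGc g hg ⟨D, hD⟩]
    have h2 := integral_comp_iterate hT (g := fun x => Φ x * g ((symStep τ)^[k] (q x)))
      (hΦm.mul (hg.comp ((hF.iterate k).comp hqm.measurable))) k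
    rw [← h2]
    refine integral_congr_ae (Filter.Eventually.of_forall fun x => ?_)
    dsimp only
    rw [iterate_semiconj hq, ← Function.iterate_add_apply, two_mul]
  have hosc := hO.ae_abs_sub_le hb0 hb1 hqm hWc hWm hΦk hWabs hΦabs
  set D1 : X → ℝ := fun x => Φ (T^[k] x) - W (q x) with hD1
  have iN : Integrable (fun z => b ^ returns τ k z) ζ := integrable_pow_returns hb0.le hb1.le k
  have iN' : Integrable (fun x => (4 * A * B) * b ^ returns τ k (q x)) ν :=
    (hqm.integrable_comp_of_integrable iN).const_mul _
  have hsqm : Measurable fun z => (G z - m) ^ 2 := (hGm.sub_const m).pow_const 2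
  have iG : Integrable (fun z => (G z - m) ^ 2) ζ :=
    integrable_of_bdd hsqm (B := (2 * A) ^ 2) fun z => by
      rw [abs_of_nonneg (sq_nonneg _)]
      refine sq_le_sq' ?_ ?_ <;> linarith [hG0 z, hGA z]
  have iG' : Integrable (fun x => 2 * (G ((symStep τ)^[2 * k] (q x)) - m) ^ 2) ν :=
    (((hζ.iterate (2 * k)).comp hqm).integrable_comp_of_integrable iG).const_mul 2
  have hbound : ∀ᵐ x ∂ν, |Φ (T^[k] x) - m - (W (q x) - G ((symStep τ)^[2 * k] (q x)))| ^ p ≤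
      (3 * A) ^ (p - 2) * ((4 * A * B) * b ^ returns τ k (q x) +
        2 * (G ((symStep τ)^[2 * k] (q x)) - m) ^ 2) := by
    filter_upwards [hosc] with x hx
    set e := Φ (T^[k] x) - m - (W (q x) - G ((symStep τ)^[2 * k] (q x))) with he
    set t := G ((symStep τ)^[2 * k] (q x)) - m with ht
    set d := Φ (T^[k] x) - W (q x) with hd
    have hed : e = d + t := by rw [he, ht, hd]; ring
    have hdA : |d| ≤ A := by
      rw [abs_le]; constructor <;> linarith [hΦ0 (T^[k] x), hΦA (T^[k] x), hW0 (q x), hWA (q x)]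
    have htA : |t| ≤ 2 * A := by
      rw [abs_le]
      constructor <;>
        linarith [hG0 ((symStep τ)^[2 * k] (q x)), hGA ((symStep τ)^[2 * k] (q x))]
    have heA : |e| ≤ 3 * A := by
      rw [hed]; exact (abs_add_le _ _).trans (by linarith)
    -- All powers but two are bounded by the supremum, so that only an L² estimate of the error is
    -- needed.
    have h1 : |e| ^ p = |e| ^ (p - 2) * e ^ 2 := by
      rw [← sq_abs e, ← Real.rpow_natCast |e| 2, ← Real.rpow_add_of_nonneg (abs_nonneg _)
        (by linarith) (by norm_num)]
      norm_num
    rw [h1]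
    have h2 : |e| ^ (p - 2) ≤ (3 * A) ^ (p - 2) :=
      Real.rpow_le_rpow (abs_nonneg _) heA (by linarith)
    have h3 : e ^ 2 ≤ (4 * A * B) * b ^ returns τ k (q x) + 2 * t ^ 2 := by
      have h4 : d ^ 2 ≤ A * (2 * B * b ^ returns τ k (q x)) := by
        rw [← sq_abs, sq]
        refine mul_le_mul hdA (hx.trans ?_) (abs_nonneg _) hA
        gcongr ?_ * ?_
        exact pow_le_pow_of_le_one hb0.le hb1.le (by omega)
      rw [hed]
      nlinarith [sq_nonneg (d - t)]
    exact mul_le_mul h2 h3 (sq_nonneg _) (by positivity)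
  calc ∫ x, |Φ (T^[k] x) - m - (W (q x) - G ((symStep τ)^[2 * k] (q x)))| ^ p ∂ν ≤
      ∫ x, (3 * A) ^ (p - 2) * ((4 * A * B) * b ^ returns τ k (q x) +
        2 * (G ((symStep τ)^[2 * k] (q x)) - m) ^ 2) ∂ν :=
        integral_mono_of_nonneg (Filter.Eventually.of_forall fun x => by positivity)
          ((iN'.add iG').const_mul _) hbound
    _ = _ := by
        rw [integral_const_mul, integral_add iN' iG', integral_const_mul, integral_const_mul]
        have h1 : ∫ x, b ^ returns τ k (q x) ∂ν = ∫ z, b ^ returns τ k z ∂ζ := by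
          rw [← hqm.map_eq, integral_map hqm.measurable.aemeasurable]
          exact (hqm.map_eq.symm ▸ iN).aestronglyMeasurable
        have h2 : ∫ x, (G ((symStep τ)^[2 * k] (q x)) - m) ^ 2 ∂ν = ∫ z, (G z - m) ^ 2 ∂ζ := by
          rw [← integral_comp_iterate hζ hsqm (2 * k)]
          conv_rhs => rw [← hqm.map_eq]
          rw [integral_map hqm.measurable.aemeasurable]
          exact (hsqm.comp (hF.iterate (2 * k))).aestronglyMeasurable
        rw [h1, h2]

end Approximation

lemma exists_add_one_rpow_mul_pow_le (a : ℝ) {b : ℝ} (hb0 : 0 < b) (hb1 : b < 1) :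
    ∃ M : ℝ, 0 < M ∧ ∀ n : ℕ, ((n : ℝ) + 1) ^ a * b ^ n ≤ M := by
  obtain ⟨p, hp⟩ := exists_nat_ge a
  have h1 := summable_pow_mul_geometric_of_norm_lt_one p (r := b)
    (by rwa [Real.norm_eq_abs, abs_of_pos hb0])
  obtain ⟨M, hM⟩ := h1.tendsto_atTop_zero.bddAbove_range
  have hM' : ∀ n : ℕ, (n : ℝ) ^ p * b ^ n ≤ M := fun n => hM ⟨n, rfl⟩
  refine ⟨|M| / b + 1, by positivity, fun n => ?_⟩
  have h2 : ((n : ℝ) + 1) ^ a ≤ ((n : ℝ) + 1) ^ p := by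
    rw [← Real.rpow_natCast]
    exact Real.rpow_le_rpow_of_exponent_le (by linarith [(Nat.cast_nonneg n : (0 : ℝ) ≤ n)]) hp
  have h3 := hM' (n + 1)
  push_cast at h3
  rw [pow_succ, ← mul_assoc] at h3
  calc ((n : ℝ) + 1) ^ a * b ^ n ≤ ((n : ℝ) + 1) ^ p * b ^ n := by gcongr
    _ ≤ |M| / b := by rw [le_div_iff₀ hb0]; exact h3.trans (le_abs_self M)
    _ ≤ _ := by linarith

/-! ### Maximal large deviations from decay of correlations. -/

section MaximalLargeDeviations

variable {ι X : Type*} [MeasurableSpace ι] [Countable ι] [MeasurableSingletonClass ι]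
  [MeasurableSpace X] {ν : Measure X} {ζ : Measure (ℕ × (ℕ → ι))} [IsProbabilityMeasure ν]
  [IsProbabilityMeasure ζ] {q : X → ℕ × (ℕ → ι)} {T : X → X} {τ : ι → ℕ} {b C : ℝ}
  (hζ : MeasurePreserving (symStep τ) ζ ζ) (hval : ∀ᵐ z ∂ζ, z.1 < τ (z.2 0))
  (hG : IsGibbs (baseMeasure ζ) C b) (hτ : ∀ i, 0 < τ i) (hT : MeasurePreserving T ν ν)
  (hqm : MeasurePreserving q ν ζ) (hq : ∀ x, q (T x) = symStep τ (q x))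
include hζ hval hG hτ hT hqm hq

/-- Polynomial decay of correlations implies polynomial maximal large deviations. -/
theorem exists_measureReal_exists_lt_le_of_decayCor_poly (hC : 0 ≤ C) (hb0 : 0 < b) (hb1 : b < 1)
    {α p : ℝ} (hα : 0 < α) (hp : 2 ≤ p) (hpα : 2 * α < p) (hpα' : 1 + α < p) {Cc : ℝ} (hCc : 0 < Cc)
    (hcor : DecayCor ζ τ b Cc fun n => (n : ℝ) ^ (-α)) {CB : ℝ} (hCB : 0 ≤ CB) :
    ∃ K : ℝ, 0 < K ∧ ∀ (Φ : X → ℝ) (A H : ℝ), Measurable Φ → (∀ x, 0 ≤ Φ x) → (∀ x, Φ x ≤ A) →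
      0 < A → A ≤ H → SymOsc T q τ Φ (CB * H) b → ∀ (n : ℕ) (e : ℝ), 1 ≤ n → 0 < e →
        ν.real {x | ∃ j, n ≤ j ∧ e * j < |birkhoffSum T (fun x => Φ x - ∫ y, Φ y ∂ν) j x|} ≤
          K * (A ^ (p - 1) * H) * e ^ (-p) * (n : ℝ) ^ (-α) := by
  obtain ⟨C', hC', htail⟩ := hcor.exists_tail_le hζ hval hCc
  obtain ⟨Kr, hKr, hKr'⟩ := exists_measureReal_returns_le_of_poly hζ hval hG hτ hα hC' htail
  obtain ⟨KI, hKI, hKI'⟩ := exists_integral_pow_returns_le_of_poly hζ hval hG hτ hα hC' htail hb0 hb1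
  obtain ⟨M, hM, hM'⟩ := exists_add_one_rpow_mul_pow_le (1 + α) hb0 hb1
  have hret : Filter.Tendsto (fun h => ∫ z, b ^ returns τ h z ∂ζ) Filter.atTop (nhds 0) := by
    have h1 : Filter.Tendsto (fun k : ℕ => KI * (k : ℝ) ^ (-α)) Filter.atTop (nhds 0) := by
      simpa using ((tendsto_rpow_neg_atTop hα).comp tendsto_natCast_atTop_atTop).const_mul KI
    refine tendsto_of_tendsto_of_tendsto_of_le_of_le' tendsto_const_nhds h1
      (Filter.Eventually.of_forall fun h => integral_nonneg fun z => by positivity) ?_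
    filter_upwards [Filter.eventually_ge_atTop 1] with k hk
    exact hKI' k hk
  obtain ⟨K1, hK1, hdy⟩ := exists_measureReal_dyadic_le_of_poly hT hζ hqm hq hα hp hpα
  obtain ⟨K2, hK2, hch⟩ := exists_measureReal_exists_lt_le_of_poly hT hα hpα' K1
  set c1 := 2 + 2 * (Real.exp C * (C + CB) + 1) with hc1
  set c2 := 1 + 2 * (Real.exp C * (C + CB / b) + 1) with hc2
  set c3 := 4 * CB * KI + 2 * (2 * (Cc * c1 * c2) + 2 * (Kr * M)) with hc3
  set c4 := 3 ^ (p - 2) * c3 + 2 ^ p with hc4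
  have hc10 : 0 < c1 := by positivity
  have hc20 : 0 < c2 := by positivity
  have hc30 : 0 < c3 := by positivity
  have hc40 : 0 < c4 := by positivity
  refine ⟨K2 * c4, by positivity, fun Φ A H hΦm hΦ0 hΦA hA hAH hO n e hn he => ?_⟩
  have hH : 0 < H := hA.trans_le hAH
  -- With b^K₀ comparable to A / H, one factor of the correlation has norm of order H, because of
  -- the indicator, and the other of order A, because H b^K₀ is. The discarded points have measure
  -- at most a constant times (H / A) k^(-α). Every contribution is then of order A H k^(-α).
  obtain ⟨K₀, hK₀1, hK₀2⟩ := exists_nat_pow_near_of_lt_one (div_pos hA hH) ((div_le_one hH).2 hAH)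
    hb0 hb1
  have hbK : 0 < b ^ K₀ := by positivity
  have hbK1 : A * (b ^ K₀)⁻¹ ≤ H := by
    rw [div_le_iff₀ hH] at hK₀2
    rw [← div_eq_mul_inv, div_le_iff₀ hbK]
    linarith
  have hbK2 : H * b ^ K₀ ≤ A / b := by
    rw [lt_div_iff₀ hH, pow_succ] at hK₀1
    rw [le_div_iff₀ hb0]
    linarith
  have hbi : 0 < (b ^ K₀)⁻¹ := inv_pos.2 hbK
  have hcH : CB * H * b ^ K₀ ≤ CB / b * A := by
    calc CB * H * b ^ K₀ = CB * (H * b ^ K₀) := by ring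
      _ ≤ CB * (A / b) := by gcongr
      _ = _ := by ring
  have hk : ∀ k : ℕ, 1 ≤ k → ∃ v : ℕ × (ℕ → ι) → ℝ, Measurable v ∧ (∀ z, |v z| ≤ 2 * A) ∧
      IsOrth ζ (symStep τ) (2 * k) v ∧
        ∫ x, |Φ (T^[k] x) - ∫ y, Φ y ∂ν - v (q x)| ^ p ∂ν ≤
          c4 * (A ^ (p - 1) * H) * (k : ℝ) ^ (-α) := by
    intro k hk
    obtain ⟨G, hGm, hG0, hGA, hGc, hGv⟩ := hO.exists_isCond_sub_sq_le hζ hval hG hT hqm hq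
      (by positivity) hC hb0 hb1 hΦm hA.le hΦ0 hΦA hret hcor K₀ hk
    obtain ⟨v, hvm, hvA, hvo, hv⟩ := hO.exists_isOrth hζ hT hqm hq (by positivity) hb0 hb1 hΦm hA.le
      hΦ0 hΦA hGm hG0 hGA hGc
    refine ⟨v, hvm, hvA, hvo, (hv p hp).trans ?_⟩
    have hk0 : 0 < (k : ℝ) ^ (-α) := by
      have : (0 : ℝ) < k := by exact_mod_cast hk
      positivity
    have t1 : A + (2 * (Real.exp C * (C * A + CB * H) + A) + A * (b ^ K₀)⁻¹) ≤ c1 * H := by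
      have h1 : Real.exp C * (C * A + CB * H) ≤ Real.exp C * (C + CB) * H := by
        rw [mul_assoc]
        gcongr
        nlinarith
      rw [hc1]; linarith
    have t2 : A + 2 * (Real.exp C * (C * A + CB * H * b ^ K₀) + A) ≤ c2 * A := by
      have h1 : Real.exp C * (C * A + CB * H * b ^ K₀) ≤ Real.exp C * (C + CB / b) * A := by
        rw [mul_assoc (Real.exp C)]
        gcongr
        linarith
      rw [hc2]; linarith
    have t3 : A ^ 2 * ζ.real {z | returns τ k z < K₀} ≤ Kr * M * (A * H * (k : ℝ) ^ (-α)) := by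
      have h1 : ζ.real {z | returns τ k z < K₀} ≤ ζ.real {z | returns τ k z ≤ K₀} :=
        measureReal_mono fun z hz => le_of_lt (show returns τ k z < K₀ from hz)
      have h2 := h1.trans (hKr' k K₀ hk)
      have h3 : ((K₀ : ℝ) + 1) ^ (1 + α) ≤ M * (b ^ K₀)⁻¹ := by
        rw [← div_eq_mul_inv, le_div_iff₀ hbK]; exact hM' K₀
      calc A ^ 2 * ζ.real {z | returns τ k z < K₀} ≤
          A ^ 2 * (Kr * (M * (b ^ K₀)⁻¹) * (k : ℝ) ^ (-α)) := by
            gcongr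
            exact h2.trans (by gcongr)
        _ = Kr * M * (A * (A * (b ^ K₀)⁻¹) * (k : ℝ) ^ (-α)) := by ring
        _ ≤ _ := by gcongr
    have t4 : Cc * (A + (2 * (Real.exp C * (C * A + CB * H) + A) + A * (b ^ K₀)⁻¹)) *
          (A + 2 * (Real.exp C * (C * A + CB * H * b ^ K₀) + A)) * (k : ℝ) ^ (-α) ≤
          Cc * c1 * c2 * (A * H * (k : ℝ) ^ (-α)) := by
      calc _ ≤ Cc * (c1 * H) * (c2 * A) * (k : ℝ) ^ (-α) := by gcongr
        _ = _ := by ring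
    have t5 : 4 * A * (CB * H) * ∫ z, b ^ returns τ k z ∂ζ ≤
        4 * CB * KI * (A * H * (k : ℝ) ^ (-α)) := by
      calc _ ≤ 4 * A * (CB * H) * (KI * (k : ℝ) ^ (-α)) := by gcongr; exact hKI' k hk
        _ = _ := by ring
    have t6 : 4 * A * (CB * H) * ∫ z, b ^ returns τ k z ∂ζ +
        2 * ∫ z, (G z - ∫ y, Φ y ∂ν) ^ 2 ∂ζ ≤ c3 * (A * H * (k : ℝ) ^ (-α)) := by
      rw [hc3]; linarith
    refine (mul_le_mul_of_nonneg_left t6 (by positivity)).trans ?_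
    have e1 : A ^ (p - 1) = A ^ (p - 2) * A := by
      rw [← Real.rpow_add_one hA.ne']; ring_nf
    rw [Real.mul_rpow (by norm_num) hA.le, e1, hc4]
    have : 0 ≤ 2 ^ p * (A ^ (p - 2) * A * H * (k : ℝ) ^ (-α)) := by positivity
    linarith
  choose v hvm hvA hvo hv using fun r : ℕ => hk (2 ^ r) Nat.one_le_two_pow
  have hY : Measurable fun x => Φ x - ∫ y, Φ y ∂ν := hΦm.sub_const _
  have hD : 0 ≤ c4 * (A ^ (p - 1) * H) := by positivity
  have hfin := hch _ hY _ hD (hdy _ hY ⟨A + |∫ y, Φ y ∂ν|, fun x => by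
      refine (abs_sub _ _).trans ?_
      rw [abs_of_nonneg (hΦ0 x)]
      linarith [hΦA x]⟩ v hvm (fun r => ⟨2 * A, hvA r⟩)
      (fun r => by rw [pow_succ']; exact hvo r) _ hD (fun r => ?_) ?_) n e hn he
  · refine hfin.trans (le_of_eq ?_)
    ring
  · refine (hv r).trans (le_of_eq ?_)
    congr 1
    push_cast
    rw [← Real.rpow_natCast, ← Real.rpow_mul (by norm_num)]
    ring_nf
  · have h1 : ∀ z, |v 0 z| ^ p ≤ (2 * A) ^ p := fun z =>
      Real.rpow_le_rpow (abs_nonneg _) (hvA 0 z) (by linarith)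
    have h2 : ∫ z, |v 0 z| ^ p ∂ζ ≤ (2 * A) ^ p := by
      have := integral_mono_of_nonneg (μ := ζ)
        (Filter.Eventually.of_forall fun z => by positivity) (integrable_const ((2 * A) ^ p))
        (Filter.Eventually.of_forall h1)
      simpa using this
    refine h2.trans ?_
    have e1 : A ^ p = A ^ (p - 1) * A := by
      rw [← Real.rpow_add_one hA.ne']; ring_nf
    rw [Real.mul_rpow (by norm_num) hA.le, e1, hc4]
    have h3 : 2 ^ p * (A ^ (p - 1) * A) ≤ 2 ^ p * (A ^ (p - 1) * H) := by gcongr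
    have h4 : 0 ≤ 3 ^ (p - 2) * c3 * (A ^ (p - 1) * H) := by positivity
    linarith

/-- Stretched exponential decay of correlations implies stretched exponential maximal large
deviations. -/
theorem exists_measureReal_exists_lt_le_of_decayCor_exp (hC : 0 ≤ C) (hb0 : 0 < b) (hb1 : b < 1)
    {c θ : ℝ} (hc : 0 < c) (hθ : 0 < θ) (hθ1 : θ ≤ 1) {Cc : ℝ} (hCc : 0 < Cc)
    (hcor : DecayCor ζ τ b Cc fun n => Real.exp (-c * (n : ℝ) ^ θ)) {CB : ℝ} (hCB : 0 ≤ CB) :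
    ∃ K c' : ℝ, 0 < K ∧ 0 < c' ∧ ∀ Φ : X → ℝ, Measurable Φ → (∀ x, 0 ≤ Φ x) → (∀ x, Φ x ≤ 1) →
      SymOsc T q τ Φ CB b → ∀ (n : ℕ) (e : ℝ), 1 ≤ n → 0 < e →
        ν.real {x | ∃ j, n ≤ j ∧ e * j < |birkhoffSum T (fun x => Φ x - ∫ y, Φ y ∂ν) j x|} ≤
          K * Real.exp (-c' * (n * e ^ 2) ^ (θ / (1 + θ))) := by
  obtain ⟨C', hC', htail⟩ := hcor.exists_tail_le hζ hval hCc
  obtain ⟨KI, cI, hKI, hcI, hKI'⟩ := exists_integral_pow_returns_le_of_exp hζ hval hG hτ hc hθ hθ1 hC'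
    htail hb0 hb1
  have hret : Filter.Tendsto (fun h => ∫ z, b ^ returns τ h z ∂ζ) Filter.atTop (nhds 0) := by
    have h1 : Filter.Tendsto (fun k : ℕ => KI * Real.exp (-cI * (k : ℝ) ^ θ)) Filter.atTop
        (nhds 0) := by
      have h2 : Filter.Tendsto (fun k : ℕ => -cI * (k : ℝ) ^ θ) Filter.atTop Filter.atBot :=
        ((tendsto_rpow_atTop hθ).comp tendsto_natCast_atTop_atTop).const_mul_atTop_of_neg
          (by linarith)
      simpa using (Real.tendsto_exp_atBot.comp h2).const_mul KI
    exact squeeze_zero (fun h => integral_nonneg fun z => by positivity) hKI' h1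
  set c1 := 3 + 2 * (Real.exp C * (C + CB) + 1) with hc1
  set c3 := 4 * CB * KI + 2 * (2 * (Cc * c1 * c1)) with hc3
  have hc10 : 0 < c1 := by positivity
  have hc30 : 0 < c3 := by positivity
  set c0 := min cI c with hc0
  have hc00 : 0 < c0 := lt_min hcI hc
  obtain ⟨K1, c'', hK1, hc'', hdy⟩ := exists_measureReal_dyadic_le_of_exp hT hζ hqm hq hc00 hθ
    (B := 2) (by norm_num) hc30
  obtain ⟨K2, c', hK2, hc', hch⟩ := exists_measureReal_exists_lt_le_of_exp hT hc''
    (θ := θ / (1 + θ)) (by positivity) K1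
  refine ⟨K2, c', hK2, hc', fun Φ hΦm hΦ0 hΦA hO n e hn he => ?_⟩
  have hk : ∀ k : ℕ, 1 ≤ k → ∃ v : ℕ × (ℕ → ι) → ℝ, Measurable v ∧ (∀ z, |v z| ≤ 2 * 1) ∧
      IsOrth ζ (symStep τ) (2 * k) v ∧
        ∫ x, |Φ (T^[k] x) - ∫ y, Φ y ∂ν - v (q x)| ^ (2 : ℝ) ∂ν ≤
          c3 * Real.exp (-c0 * (k : ℝ) ^ θ) := by
    intro k hk
    -- After normalisation supremum and Hölder sizes are both of order 1, so no points are
    -- discarded.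
    obtain ⟨G, hGm, hG0, hGA, hGc, hGv⟩ := hO.exists_isCond_sub_sq_le hζ hval hG hT hqm hq
      hCB hC hb0 hb1 hΦm zero_le_one hΦ0 hΦA hret hcor 0 hk
    obtain ⟨v, hvm, hvA, hvo, hv⟩ := hO.exists_isOrth hζ hT hqm hq hCB hb0 hb1 hΦm zero_le_one
      hΦ0 hΦA hGm hG0 hGA hGc
    refine ⟨v, hvm, hvA, hvo, (hv 2 le_rfl).trans ?_⟩
    have hk0 : (0 : ℝ) ≤ (k : ℝ) ^ θ := by positivity
    have x1 : Real.exp (-cI * (k : ℝ) ^ θ) ≤ Real.exp (-c0 * (k : ℝ) ^ θ) :=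
      Real.exp_le_exp.2 (by nlinarith [min_le_left cI c])
    have x2 : Real.exp (-c * (k : ℝ) ^ θ) ≤ Real.exp (-c0 * (k : ℝ) ^ θ) :=
      Real.exp_le_exp.2 (by nlinarith [min_le_right cI c])
    set y := Real.exp (-c0 * (k : ℝ) ^ θ) with hy
    have hy0 : 0 < y := Real.exp_pos _
    simp only [pow_zero, inv_one, mul_one, not_lt_zero, ofPred_false, measureReal_empty, mul_zero,
      add_zero, sub_self, Real.rpow_zero, one_mul] at hGv ⊢
    have t1 : 1 + (2 * (Real.exp C * (C + CB) + 1) + 1) ≤ c1 := by rw [hc1]; linarith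
    have t2 : 1 + 2 * (Real.exp C * (C + CB) + 1) ≤ c1 := by rw [hc1]; linarith
    have t4 : Cc * (1 + (2 * (Real.exp C * (C + CB) + 1) + 1)) *
        (1 + 2 * (Real.exp C * (C + CB) + 1)) * Real.exp (-c * (k : ℝ) ^ θ) ≤
        Cc * c1 * c1 * y := by gcongr
    have t5 : 4 * CB * ∫ z, b ^ returns τ k z ∂ζ ≤ 4 * CB * (KI * y) := by
      gcongr
      exact (hKI' k).trans (by gcongr)
    rw [hc3]
    linarith
  choose v hvm hvA hvo hv using fun r : ℕ => hk (2 ^ r) Nat.one_le_two_pow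
  have hm0 : 0 ≤ ∫ y, Φ y ∂ν := integral_nonneg hΦ0
  have hm1 : ∫ y, Φ y ∂ν ≤ 1 := by
    have := integral_mono (integrable_of_bdd hΦm (B := 1) fun x => by
      rw [abs_of_nonneg (hΦ0 x)]; exact hΦA x) (integrable_const (μ := ν) (1 : ℝ)) hΦA
    simpa using this
  have hY : Measurable fun x => Φ x - ∫ y, Φ y ∂ν := hΦm.sub_const _
  refine hch _ hY (hdy _ hY (fun x => ?_) v hvm (fun r z => (hvA r z).trans (by norm_num))
      (fun r => by rw [pow_succ']; exact hvo r) (fun r => ?_)) n e hn he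
  · rw [abs_le]; constructor <;> linarith [hΦ0 x, hΦA x]
  · refine (hv r).trans (le_of_eq ?_)
    push_cast
    rfl

end MaximalLargeDeviations

lemma tendsto_exp_neg_rpow_mul_inv_pow {b c θ : ℝ} (hb0 : 0 < b) (hc : 0 < c) (hθ : 1 < θ) :
    Filter.Tendsto (fun n : ℕ => Real.exp (-c * (n : ℝ) ^ θ) * (b ^ n)⁻¹) Filter.atTop (nhds 0) := by
  have h1 : Filter.Tendsto (fun x : ℝ => x * (-c * x ^ (θ - 1) + -Real.log b)) Filter.atTop
      Filter.atBot :=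
    Filter.tendsto_id.atTop_mul_atBot₀ (Filter.tendsto_atBot_add_const_right _ _
      ((tendsto_rpow_atTop (by linarith : 0 < θ - 1)).const_mul_atTop_of_neg (by linarith)))
  refine (Real.tendsto_exp_atBot.comp (h1.comp tendsto_natCast_atTop_atTop)).congr' ?_
  filter_upwards [Filter.eventually_ge_atTop 1] with n hn
  have hn0 : (0 : ℝ) < n := by exact_mod_cast hn
  have h2 : (b ^ n)⁻¹ = Real.exp (n * -Real.log b) := by
    rw [mul_neg, Real.exp_neg, ← Real.log_pow, Real.exp_log (by positivity)]
  have h3 : (n : ℝ) ^ θ = n * (n : ℝ) ^ (θ - 1) := by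
    rw [← Real.rpow_one_add' hn0.le (by linarith)]; ring_nf
  simp only [Function.comp_apply]
  rw [h2, ← Real.exp_add, h3]
  ring_nf

/-! ### Superexponential decay of correlations trivialises the tower. -/

section Rigidity

variable {ι X : Type*} [MeasurableSpace ι] [Countable ι] [MeasurableSingletonClass ι]
  [MeasurableSpace X] {ν : Measure X} {ζ : Measure (ℕ × (ℕ → ι))} [IsProbabilityMeasure ν]
  [IsProbabilityMeasure ζ] {q : X → ℕ × (ℕ → ι)} {T : X → X} {τ : ι → ℕ} {b : ℝ}
  (hζ : MeasurePreserving (symStep τ) ζ ζ)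
include hζ

/-- Superexponential decay of correlations forces the first symbol to be deterministic. -/
lemma DecayCor.measureReal_eq_zero_or_one {c θ Cc : ℝ} (hb0 : 0 < b) (hb1 : b < 1) (hc : 0 < c)
    (hθ : 1 < θ) (hcor : DecayCor ζ τ b Cc fun n => Real.exp (-c * (n : ℝ) ^ θ)) (i : ι) :
    ζ.real {z | z.1 = 0 ∧ z.2 0 = i} = 0 ∨ ζ.real {z | z.1 = 0 ∧ z.2 0 = i} = 1 := by
  have hF := measurable_symStep τ
  set S : Set (ℕ × (ℕ → ι)) := {z | z.1 = 0 ∧ z.2 0 = i} with hS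
  have hSm : MeasurableSet S := (measurableSet_fst_eq 0).inter
    (measurable_snd (measurable_pi_apply (X := fun _ : ℕ => ι) 0 (measurableSet_singleton i)))
  set ξ : ℕ × (ℕ → ι) → ℝ := S.indicator 1 with hξ
  have hξm : Measurable ξ := measurable_one.indicator hSm
  set p := ζ.real S with hp
  have hp0 : 0 ≤ p := measureReal_nonneg
  have hp1 : p ≤ 1 := measureReal_le_one
  have hSagree : ∀ z z' : ℕ × (ℕ → ι), z.1 = z'.1 → z.2 0 = z'.2 0 → ξ z = ξ z' := by
    intro z z' h1 h2
    have : z ∈ S ↔ z' ∈ S := by simp only [hS, mem_ofPred_eq, h1, h2]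
    by_cases h : z ∈ S
    · rw [hξ, indicator_of_mem h, indicator_of_mem (this.1 h)]; rfl
    · rw [hξ, indicator_of_notMem h, indicator_of_notMem fun h' => h (this.2 h')]
  have hL1 : IsSymLip b 1 1 ξ := by
    refine ⟨hξm, abs_indicator_one_le S, fun s z z' hzz => ?_⟩
    rcases Nat.eq_zero_or_pos s with rfl | hs
    · rw [pow_zero, mul_one]; exact indicator_sub_indicator_le S z z'
    · rw [hSagree z z' hzz.1 (hzz.2 0 hs), sub_self, abs_zero]; positivity
  -- The factor b^n keeps the Lipschitz norm of ξ ∘ F^n bounded: points that agree on more than n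
  -- symbols give the same value, and otherwise b^n ≤ b^s.
  have hL2 : ∀ n : ℕ, IsSymLip b 1 1 fun z => b ^ n * ξ ((symStep τ)^[n] z) := by
    intro n
    have hbn : b ^ n ≤ 1 := pow_le_one₀ hb0.le hb1.le
    have hbn0 : 0 < b ^ n := by positivity
    refine ⟨(hξm.comp (hF.iterate n)).const_mul _, fun z => ?_, fun s z z' hzz => ?_⟩
    · rw [abs_mul, abs_of_pos hbn0]
      exact (mul_le_mul hbn (abs_indicator_one_le S _) (abs_nonneg _) zero_le_one).trans
        (mul_one 1).le
    · rcases lt_or_ge n s with hs | hs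
      · have h1 := (returns_le τ n z).trans_lt hs
        obtain ⟨h2, h3⟩ := iterate_symStep_congr τ hzz.1 hzz.2 h1
        have h4 : ((symStep τ)^[n] z).2 0 = ((symStep τ)^[n] z').2 0 := by
          rw [iterate_symStep_snd, iterate_symStep_snd, shift_iterate_apply, shift_iterate_apply, h3,
            zero_add, hzz.2 _ h1]
        dsimp only
        rw [hSagree _ _ h2.symm h4, sub_self, abs_zero]; positivity
      · rw [← mul_sub, abs_mul, abs_of_pos hbn0, one_mul]
        calc _ ≤ b ^ n * 1 := by gcongr; exact indicator_sub_indicator_le S _ _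
          _ ≤ b ^ s := by rw [mul_one]; exact pow_le_pow_of_le_one hb0.le hb1.le hs
  have hint : ∀ n : ℕ, ∫ z, ξ ((symStep τ)^[n] z) ∂ζ = p := fun n => by
    rw [integral_comp_iterate hζ hξm n, hξ, integral_indicator_one hSm]
  have hsq : ∀ z, ξ z * ξ z = ξ z := fun z => by
    by_cases h : z ∈ S <;> simp [hξ, h]
  -- The correlation at time n of b^n ξ ∘ F^n with ξ is b^n p (1 - p), while the hypothesis makes it
  -- o(b^n).
  have key : ∀ n : ℕ, 1 ≤ n → p - p * p ≤ 4 * Cc * (Real.exp (-c * (n : ℝ) ^ θ) * (b ^ n)⁻¹) := by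
    intro n hn
    have h1 := le_of_abs_le (hcor _ _ 1 1 1 1 (hL2 n) hL1 n hn)
    simp only [mul_assoc, hsq] at h1
    rw [integral_const_mul, hint n, hξ, integral_indicator_one hSm, ← hp] at h1
    have hbn0 : 0 < b ^ n := by positivity
    rw [← div_eq_mul_inv, mul_div_assoc', le_div_iff₀ hbn0]
    linarith
  have hlim := ge_of_tendsto ((tendsto_exp_neg_rpow_mul_inv_pow hb0 hc hθ).const_mul (4 * Cc))
    (Filter.eventually_atTop.2 ⟨1, key⟩)
  rw [mul_zero] at hlim
  have h2 : p * (1 - p) = 0 := le_antisymm (by linarith) (mul_nonneg hp0 (by linarith))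
  rcases mul_eq_zero.1 h2 with h | h
  · exact Or.inl h
  · exact Or.inr (by linarith)

variable (hval : ∀ᵐ z ∂ζ, z.1 < τ (z.2 0)) (hT : MeasurePreserving T ν ν)
  (hqm : MeasurePreserving q ν ζ)
include hval

/-- The base has positive measure, so for some i the event of being in the base with first symbol i
does not have measure 0. By the zero-one law it has measure 1, and by invariance it occurs at all
times. -/
lemma DecayCor.exists_ae_eq {c θ Cc : ℝ} (hb0 : 0 < b) (hb1 : b < 1) (hc : 0 < c)
    (hθ : 1 < θ) (hcor : DecayCor ζ τ b Cc fun n => Real.exp (-c * (n : ℝ) ^ θ)) :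
    ∃ i : ι, ∀ᵐ z ∂ζ, z.1 = 0 ∧ (∀ n, z.2 n = i) ∧ ∀ n, returns τ n z = n := by
  have hF := measurable_symStep τ
  obtain ⟨i, hi⟩ : ∃ i, ζ.real {z | z.1 = 0 ∧ z.2 0 = i} = 1 := by
    by_contra! hne
    have h0 : ∀ i, ζ {z | z.1 = 0 ∧ z.2 0 = i} = 0 := fun i =>
      (measureReal_eq_zero_iff).1 ((hcor.measureReal_eq_zero_or_one hζ hb0 hb1 hc hθ i).resolve_right
        (hne i))
    refine baseMeasure_univ_ne_zero hζ hval ?_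
    rw [baseMeasure_apply ζ MeasurableSet.univ]
    refine measure_mono_null (fun z hz => ?_) (measure_iUnion_null h0)
    exact mem_iUnion.2 ⟨z.2 0, hz.1, rfl⟩
  have hSm : MeasurableSet {z : ℕ × (ℕ → ι) | z.1 = 0 ∧ z.2 0 = i} := (measurableSet_fst_eq 0).inter
    (measurable_snd (measurable_pi_apply (X := fun _ : ℕ => ι) 0 (measurableSet_singleton i)))
  have h1 : ∀ᵐ z ∂ζ, z.1 = 0 ∧ z.2 0 = i := by
    have := (prob_compl_eq_zero_iff (μ := ζ) hSm).2 (by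
      rw [← ENNReal.ofReal_toReal (measure_ne_top ζ _)]
      have h2 : (ζ {z : ℕ × (ℕ → ι) | z.1 = 0 ∧ z.2 0 = i}).toReal = 1 := hi
      rw [h2, ENNReal.ofReal_one])
    exact this
  have h2 : ∀ᵐ z ∂ζ, ∀ n : ℕ, ((symStep τ)^[n] z).1 = 0 ∧ ((symStep τ)^[n] z).2 0 = i :=
    ae_all_iff.2 fun n => (hζ.iterate n).quasiMeasurePreserving.ae h1
  refine ⟨i, ?_⟩
  filter_upwards [h2] with z hz
  have hr : ∀ n, returns τ n z = n := by
    intro n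
    induction n with
    | zero => rfl
    | succ n ih => rw [returns_succ, ih, if_pos (hz (n + 1)).1]
  refine ⟨(hz 0).1, fun n => ?_, hr⟩
  have := (hz n).2
  rwa [iterate_symStep_snd, shift_iterate_apply, hr n, zero_add] at this

include hT hqm

/-- Superexponential decay of correlations forces the observables to be constant. -/
theorem SymOsc.ae_eq_integral_of_decayCor {c θ Cc B : ℝ} (hb0 : 0 < b) (hb1 : b < 1) (hc : 0 < c)
    (hθ : 1 < θ) (hcor : DecayCor ζ τ b Cc fun n => Real.exp (-c * (n : ℝ) ^ θ)) {Φ : X → ℝ}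
    (hO : SymOsc T q τ Φ B b) (hB : 0 ≤ B) (hΦ : Measurable Φ) {A : ℝ} (hA : ∀ x, |Φ x| ≤ A) :
    ∀ᵐ x ∂ν, Φ x = ∫ y, Φ y ∂ν := by
  obtain ⟨i, hi⟩ := hcor.exists_ae_eq hζ hval hb0 hb1 hc hθ
  have hgood := hqm.quasiMeasurePreserving.ae hi
  set m := ∫ y, Φ y ∂ν with hm
  -- Almost all points have the same symbols for ever and return at every step, so only the
  -- contraction after h returns separates them.
  have hosc : ∀ h : ℕ, ∀ᵐ x ∂ν, ∀ᵐ x' ∂ν, |Φ (T^[h] x) - Φ (T^[h] x')| ≤ 2 * B * b ^ (2 * h) := by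
    intro h
    filter_upwards [hgood] with x hx
    filter_upwards [hgood] with x' hx'
    have h1 := hO x x' h (2 * h + 1) (hx.1.trans hx'.1.symm)
      (fun m _ => (hx.2.1 m).trans (hx'.2.1 m).symm) (by rw [hx.2.2]; omega)
    rw [hx.2.2] at h1
    have h2 : b ^ (2 * (2 * h + 1 - h)) ≤ b ^ (2 * h) :=
      pow_le_pow_of_le_one hb0.le hb1.le (by omega)
    nlinarith
  have hdev : ∀ h : ℕ, ∀ᵐ x ∂ν, |Φ x - m| ≤ 2 * B * b ^ (2 * h) := by
    intro h
    have hΦh : Measurable fun x => Φ (T^[h] x) := hΦ.comp (hT.measurable.iterate h)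
    have h1 : ∀ᵐ x ∂ν, |Φ (T^[h] x) - m| ≤ 2 * B * b ^ (2 * h) := by
      filter_upwards [hosc h] with x hx
      have h2 := norm_integral_le_of_norm_le_const (μ := ν)
          (f := fun x' => Φ (T^[h] x) - Φ (T^[h] x')) (C := 2 * B * b ^ (2 * h)) hx
      rw [integral_sub (integrable_const _) (integrable_of_bdd hΦh fun x => hA _),
        integral_comp_iterate hT hΦ h] at h2
      simpa using h2
    have hms : MeasurableSet {x | |Φ x - m| ≤ 2 * B * b ^ (2 * h)} :=
      measurableSet_le (hΦ.sub_const m).abs measurable_const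
    rw [← (hT.iterate h).map_eq]
    exact (ae_map_iff (hT.iterate h).measurable.aemeasurable hms).2 h1
  filter_upwards [ae_all_iff.2 hdev] with x hx
  have h1 : Filter.Tendsto (fun h : ℕ => 2 * B * b ^ (2 * h)) Filter.atTop (nhds (2 * B * 0)) := by
    refine Filter.Tendsto.const_mul _ ?_
    simp only [pow_mul]
    exact tendsto_pow_atTop_nhds_zero_of_lt_one (by positivity) (by nlinarith)
  rw [mul_zero] at h1
  have h2 := ge_of_tendsto' h1 hx
  exact sub_eq_zero.1 (abs_eq_zero.1 (le_antisymm h2 (abs_nonneg _)))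

omit hζ hval hqm in
lemma measureReal_exists_lt_eq_zero {Y : X → ℝ} (hY : ∀ᵐ x ∂ν, Y x = 0) (n : ℕ) {e : ℝ}
    (he : 0 < e) : ν.real {x | ∃ j, n ≤ j ∧ e * j < |birkhoffSum T Y j x|} = 0 := by
  have h1 : ∀ᵐ x ∂ν, ∀ i : ℕ, Y (T^[i] x) = 0 :=
    ae_all_iff.2 fun i => (hT.iterate i).quasiMeasurePreserving.ae hY
  rw [measureReal_eq_zero_iff]
  refine measure_mono_null ?_ h1
  rintro x ⟨j, _, hj⟩ hx
  rw [birkhoffSum, Finset.sum_eq_zero fun i _ => hx i, abs_zero] at hj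
  have : 0 ≤ e * j := by positivity
  linarith

end Rigidity

/-! ### The tower and its symbolic representation. -/

section SymbolicRepresentation

variable {d : ℕ} {M : Type*} [MetricSpace M] [ChartedSpace (EuclideanSpace ℝ (Fin d)) M]
  [IsManifold (𝓡 d) ∞ M] {Ks Ku : Type*} [TopologicalSpace Ks] [TopologicalSpace Ku]
  {ι : Type*} [Nonempty ι]

namespace Scheme

/-- The symbolic representation of a point of the tower: its level and its itinerary. -/
def sym (S : Scheme d M Ks Ku ι) (f : M → M) (y : S.Tower f) : ℕ × (ℕ → ι) :=
  (y.1.2, S.itin f y.1.1)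

variable {S : Scheme d M Ks Ku ι} {f : M → M}

lemma R_eq_time_sym (y : S.Tower f) : S.R y.1.1 = S.time ((S.sym f y).2 0) :=
  S.R_eq (mem_cell_itin y.2.1 0)

lemma sym_fst_lt (y : S.Tower f) : (S.sym f y).1 < S.time ((S.sym f y).2 0) := by
  rw [← R_eq_time_sym]; exact y.2.2

lemma sym_towerMap (y : S.Tower f) :
    S.sym f (S.towerMap f y) = symStep S.time (S.sym f y) := by
  have h := R_eq_time_sym y
  by_cases hy : y.1.2 + 1 < S.R y.1.1
  · rw [symStep_of_lt _ (by rw [← h]; exact hy), towerMap, dif_pos hy]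
    rfl
  · rw [symStep_of_le _ (by rw [← h]; exact not_lt.1 hy), towerMap, dif_neg hy]
    exact Prod.ext rfl (funext fun n => itin_ret _ n)

lemma proj_towerMap (y : S.Tower f) : S.proj f (S.towerMap f y) = f (S.proj f y) := by
  by_cases hy : y.1.2 + 1 < S.R y.1.1
  · rw [towerMap, dif_pos hy, proj, proj]
    exact Function.iterate_succ_apply' f _ _
  · have h : S.R y.1.1 = y.1.2 + 1 := by have := y.2.2; omega
    rw [towerMap, dif_neg hy, proj, proj]
    change f^[0] (f^[S.R y.1.1] y.1.1) = _
    rw [h]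
    exact Function.iterate_succ_apply' f _ _

lemma iterate_proj (n : ℕ) (y : S.Tower f) :
    S.proj f ((S.towerMap f)^[n] y) = f^[n] (S.proj f y) := by
  induction n with
  | zero => rfl
  | succ n ih =>
    rw [Function.iterate_succ_apply', proj_towerMap, ih, Function.iterate_succ_apply']

lemma sym_iterate (n : ℕ) (y : S.Tower f) :
    S.sym f ((S.towerMap f)^[n] y) = (symStep S.time)^[n] (S.sym f y) := by
  induction n with
  | zero => rfl
  | succ n ih =>
    rw [Function.iterate_succ_apply', sym_towerMap, ih, Function.iterate_succ_apply']

lemma iterate_towerMap_base (n : ℕ) (y : S.Tower f) :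
    ((S.towerMap f)^[n] y).1.1 = (S.ret f)^[returns S.time n (S.sym f y)] y.1.1 := by
  induction n with
  | zero => rfl
  | succ n ih =>
    rw [returns_succ, ← sym_iterate, Function.iterate_succ_apply']
    set z := (S.towerMap f)^[n] y with hz
    by_cases hy : z.1.2 + 1 < S.R z.1.1
    · have h : S.towerMap f z = ⟨(z.1.1, z.1.2 + 1), z.2.1, hy⟩ := by rw [towerMap, dif_pos hy]
      have h1 : (S.sym f (S.towerMap f z)).1 ≠ 0 := by
        rw [h]; exact Nat.succ_ne_zero _
      rw [if_neg h1, add_zero, ← ih, h]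
    · have h : S.towerMap f z = ⟨(S.ret f z.1.1, 0), S.ret_mem_core z.2.1,
          S.R_pos_of_core (S.ret_mem_core z.2.1)⟩ := by rw [towerMap, dif_neg hy]
      have h1 : (S.sym f (S.towerMap f z)).1 = 0 := by rw [h]; rfl
      rw [if_pos h1, Function.iterate_succ_apply', ← ih, h]

/-- Lipschitz functions of the symbols are Lipschitz on the tower. -/
lemma abs_sub_le_of_isSymLip [MeasurableSpace ι] {b A L : ℝ} (hb0 : 0 < b)
    {u : ℕ × (ℕ → ι) → ℝ} (hu : IsSymLip b A L u) (y z : S.Tower f) :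
    |u (S.sym f y) - u (S.sym f z)| ≤ (2 * A + L) * epow b (S.towerSep f y z) := by
  obtain ⟨_, hA, hL⟩ := hu
  have hA0 : 0 ≤ A := (abs_nonneg _).trans (hA (S.sym f y))
  have hL0 : 0 ≤ L := by
    have := (abs_nonneg _).trans (hL 0 (S.sym f y) (S.sym f y) (Agree.refl 0 _))
    simpa using this
  by_cases hl : y.1.2 = z.1.2
  · rw [towerSep, if_pos hl]
    by_cases hs : ∀ n, S.itin f y.1.1 n = S.itin f z.1.1 n
    · have h1 : S.sym f y = S.sym f z := Prod.ext hl (funext hs)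
      rw [sep_eq_top y.2.1 z.2.1 hs, epow, if_pos rfl, h1, sub_self, abs_zero, mul_zero]
    · push Not at hs
      classical
      have hn := Nat.find_spec hs
      have hm : ∀ m < Nat.find hs, S.itin f y.1.1 m = S.itin f z.1.1 m := fun m hm =>
        not_not.1 (Nat.find_min hs hm)
      rw [sep_eq y.2.1 z.2.1 hm hn, epow, if_neg (ENat.natCast_ne_top _), ENat.toNat_natCast]
      refine (hL (Nat.find hs) _ _ ⟨hl, hm⟩).trans ?_
      gcongr
      linarith
  · rw [towerSep, if_neg hl, epow, if_neg (by simp), ENat.toNat_zero, pow_zero, mul_one]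
    have h1 := hA (S.sym f y)
    have h2 := hA (S.sym f z)
    exact (abs_sub _ _).trans (by linarith)

lemma isLip_comp_sym [MeasurableSpace ι] [Nonempty (S.Tower f)] {b A L : ℝ} (hb0 : 0 < b)
    {u : ℕ × (ℕ → ι) → ℝ} (hu : IsSymLip b A L u) :
    S.IsLip f b (fun y => u (S.sym f y)) ∧ 0 ≤ A + L ∧ 0 ≤ S.lipNorm f b (fun y => u (S.sym f y)) ∧
      S.lipNorm f b (fun y => u (S.sym f y)) ≤ 3 * (A + L) := by
  obtain ⟨y₀⟩ : Nonempty (S.Tower f) := inferInstance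
  have hA0 : 0 ≤ A := (abs_nonneg _).trans (hu.2.1 (S.sym f y₀))
  have hL0 : 0 ≤ L := by
    have := (abs_nonneg _).trans (hu.2.2 0 (S.sym f y₀) (S.sym f y₀) (Agree.refl 0 _))
    simpa using this
  have hep : ∀ s, 0 ≤ epow b s := fun s => by
    rw [epow]; split_ifs <;> positivity
  refine ⟨⟨2 * A + L + 1, by positivity, fun y z => ?_⟩, by positivity, ?_, ?_⟩
  · refine (abs_sub_le_of_isSymLip hb0 hu y z).trans ?_
    exact mul_le_mul_of_nonneg_right (by linarith) (hep _)
  · exact add_nonneg (Real.iSup_nonneg fun p => div_nonneg (abs_nonneg _) (hep _))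
      (Real.iSup_nonneg fun p => abs_nonneg _)
  · have h1 : (⨆ p : S.Tower f × S.Tower f, |u (S.sym f p.1) - u (S.sym f p.2)| /
        epow b (S.towerSep f p.1 p.2)) ≤ 2 * A + L :=
      Real.iSup_le (fun p => div_le_of_le_mul₀ (hep _) (by positivity)
        (abs_sub_le_of_isSymLip hb0 hu p.1 p.2)) (by positivity)
    have h2 : supNorm (fun y => u (S.sym f y)) ≤ A := Real.iSup_le (fun y => hu.2.1 _) hA0
    rw [lipNorm]
    linarith

variable [CompactSpace Ks] [CompactSpace Ku] [MeasurableSpace M] [BorelSpace M] [Countable ι]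

omit [Nonempty ι] [CompactSpace Ks] [CompactSpace Ku] [BorelSpace M] [Countable ι] in
lemma measurable_proj (hf : Measurable f) : Measurable (S.proj f) :=
  (measurable_from_prod_countable_left (f := fun p : M × ℕ => f^[p.2] p.1)
    fun n => hf.iterate n).comp measurable_subtype_coe

variable [MeasurableSpace ι] [MeasurableSingletonClass ι]

lemma measurable_sym (hf : Measurable f) : Measurable (S.sym f) :=
  (measurable_snd.comp measurable_subtype_coe).prodMk
    ((S.measurable_itin hf).comp (measurable_fst.comp measurable_subtype_coe))

variable {ν : Measure (S.Tower f)} [IsProbabilityMeasure ν]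

omit [IsProbabilityMeasure ν] in
lemma measurePreserving_symStep_map (hf : Measurable f)
    (hT : MeasurePreserving (S.towerMap f) ν ν) :
    MeasurePreserving (symStep S.time) (ν.map (S.sym f)) (ν.map (S.sym f)) := by
  have hsm := S.measurable_sym hf
  refine ⟨measurable_symStep S.time, ?_⟩
  rw [Measure.map_map (measurable_symStep S.time) hsm]
  conv_rhs => rw [← hT.map_eq, Measure.map_map hsm hT.measurable]
  congr 1
  ext1 y
  exact (sym_towerMap y).symm

omit [IsProbabilityMeasure ν] in
lemma ae_sym_fst_lt (hf : Measurable f) :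
    ∀ᵐ z ∂(ν.map (S.sym f)), z.1 < S.time (z.2 0) := by
  refine (ae_map_iff (S.measurable_sym hf).aemeasurable ?_).2
    (Filter.Eventually.of_forall fun y => sym_fst_lt y)
  exact measurableSet_lt measurable_fst
    ((measurable_of_countable S.time).comp ((measurable_pi_apply 0).comp measurable_snd))

/-- Decay of correlations on the tower gives decay of correlations on the symbolic tower. -/
lemma decayCor_of_corr_le (hf : Measurable f) {b C : ℝ} (hb0 : 0 < b) (hC : 0 < C) {r : ℕ → ℝ}
    (hr : ∀ n, 0 ≤ r n) (h : ∀ ψ ξ : S.Tower f → ℝ, S.IsLip f b ψ → S.IsLip f b ξ → ∀ n : ℕ, 1 ≤ n →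
      corr ν (S.towerMap f) ψ ξ n ≤ C * S.lipNorm f b ψ * S.lipNorm f b ξ * r n) :
    DecayCor (ν.map (S.sym f)) S.time b (9 * C) r := by
  intro u g A L A' L' hu hg n hn
  have := nonempty_of_isProbabilityMeasure ν
  have hsm := (S.measurable_sym hf).aemeasurable (μ := ν)
  have hgn : Measurable fun z => g ((symStep S.time)^[n] z) :=
    hg.1.comp ((measurable_symStep S.time).iterate n)
  obtain ⟨h1, h2, h3, h4⟩ := isLip_comp_sym (S := S) (f := f) hb0 hu
  obtain ⟨h5, h6, h7, h8⟩ := isLip_comp_sym (S := S) (f := f) hb0 hg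
  rw [integral_map hsm (show Measurable fun z => u z * g ((symStep S.time)^[n] z) from
      hu.1.mul hgn).aestronglyMeasurable,
    integral_map hsm hu.1.aestronglyMeasurable, integral_map hsm hg.1.aestronglyMeasurable]
  have h9 := h _ _ h1 h5 n hn
  simp only [corr, sym_iterate] at h9
  refine h9.trans ?_
  calc C * S.lipNorm f b (fun y => u (S.sym f y)) * S.lipNorm f b (fun y => g (S.sym f y)) * r n ≤
      C * (3 * (A + L)) * (3 * (A' + L')) * r n := by
        gcongr
        exact hr n
    _ = _ := by ring

end Scheme

end SymbolicRepresentation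

lemma IsGibbsOn.mono {ι : Type*} [MeasurableSpace ι] {p : List ι → Prop} {μ : Measure (ℕ → ι)}
    {C β b : ℝ} (h : IsGibbsOn p μ C β) (hC : 0 ≤ C) (hβ : 0 ≤ β) (hb : β ≤ b) :
    IsGibbsOn p μ C b := by
  intro w hw s E E' hE hE' hEE'
  refine (h w hw s E E' hE hE' hEE').trans ?_
  gcongr

/-! ### Young structures satisfy the symbolic hypotheses. -/

namespace IsYoung

variable {d : ℕ} {M : Type*} [MetricSpace M] [ChartedSpace (EuclideanSpace ℝ (Fin d)) M]
  [IsManifold (𝓡 d) ∞ M] {Ks Ku : Type*} [TopologicalSpace Ks] [TopologicalSpace Ku]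
  {ι : Type*} [Nonempty ι] [MeasurableSpace M]
  [RiemannianBundle (fun x : M => TangentSpace (𝓡 d) x)]
  {S : Scheme d M Ks Ku ι} {f : M → M} {C β : ℝ} (hS : IsYoung S f C β)
include hS

open Scheme

/-- Hölder observables oscillate little over symbolic cylinders. -/
lemma symOsc {η : ℝ} (hη0 : 0 < η) (hη1 : η < 1) {φ : M → ℝ} {Q : ℝ} (hQ : 0 ≤ Q)
    (hφ : ∀ x y, |φ x - φ y| ≤ Q * dist x y ^ η) :
    SymOsc (S.towerMap f) (S.sym f) S.time (fun y => φ (S.proj f y))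
      ((C + C ^ 2) ^ η * ((β ^ (η / 2)) ^ 2)⁻¹ * Q) (β ^ (η / 2)) := by
  have hβ := hS.β_pos
  have hC := hS.C_pos
  set b := β ^ (η / 2) with hb
  have hb0 : 0 < b := by positivity
  have hb2 : ∀ n : ℕ, (β ^ n) ^ η = b ^ (2 * n) := fun n => by
    rw [hb, ← Real.rpow_natCast, ← Real.rpow_natCast, ← Real.rpow_mul hβ.le, ← Real.rpow_mul hβ.le]
    congr 1
    push_cast
    ring
  intro y y' h s hl hs hn
  obtain ⟨h1, h2⟩ := iterate_symStep_congr S.time hl hs hn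
  set n := returns S.time h (S.sym f y) with hn'
  have e1 : S.proj f ((S.towerMap f)^[h] y) =
      f^[((symStep S.time)^[h] (S.sym f y)).1] ((S.ret f)^[n] y.1.1) := by
    rw [proj, iterate_towerMap_base, ← sym_iterate]; rfl
  have e2 : S.proj f ((S.towerMap f)^[h] y') =
      f^[((symStep S.time)^[h] (S.sym f y)).1] ((S.ret f)^[n] y'.1.1) := by
    rw [proj, iterate_towerMap_base, h2, ← h1, ← sym_iterate]; rfl
  have hlev : ((symStep S.time)^[h] (S.sym f y)).1 < S.time (S.itin f y.1.1 n) := by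
    have h3 := sym_fst_lt ((S.towerMap f)^[h] y)
    rw [sym_iterate] at h3
    rw [iterate_symStep_snd, shift_iterate_apply, zero_add] at h3
    exact h3
  -- Of the s - n remaining common symbols one is lost between returns; after taking the power η
  -- this is the factor (b²)⁻¹.
  have hd := hS.dist_le y.2.1 y'.2.1 (n := n) (m := s - n - 1)
    (fun l hl => hs l (by omega)) hlev
  rw [← e1, ← e2] at hd
  have h4 : dist (S.proj f ((S.towerMap f)^[h] y)) (S.proj f ((S.towerMap f)^[h] y')) ^ η ≤
      (C + C ^ 2) ^ η * ((β ^ n) ^ η + (β ^ (s - n - 1)) ^ η) := by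
    refine (Real.rpow_le_rpow dist_nonneg hd hη0.le).trans ?_
    rw [← mul_add, Real.mul_rpow (by positivity) (by positivity)]
    gcongr
    exact Real.rpow_add_le_add_rpow (by positivity) (by positivity) hη0.le hη1.le
  refine (hφ _ _).trans ?_
  have h5 : (β ^ n) ^ η + (β ^ (s - n - 1)) ^ η ≤
      (b ^ 2)⁻¹ * (b ^ (2 * n) + b ^ (2 * (s - n))) := by
    have hb1 : b ≤ 1 := Real.rpow_le_one hβ.le hS.β_lt_one.le (by positivity)
    rw [hb2, hb2, mul_add, show b ^ (2 * (s - n)) = b ^ (2 * (s - n - 1)) * b ^ 2 by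
      rw [← pow_add]; congr 1; omega]
    have h6 : (b ^ 2)⁻¹ * (b ^ (2 * (s - n - 1)) * b ^ 2) = b ^ (2 * (s - n - 1)) := by
      field_simp
    rw [h6]
    have h7 : 1 ≤ (b ^ 2)⁻¹ := (one_le_inv₀ (by positivity)).2 (pow_le_one₀ hb0.le hb1)
    have h8 : 0 ≤ b ^ (2 * n) := by positivity
    nlinarith
  calc Q * dist (S.proj f ((S.towerMap f)^[h] y)) (S.proj f ((S.towerMap f)^[h] y')) ^ η ≤
      Q * ((C + C ^ 2) ^ η * ((b ^ 2)⁻¹ * (b ^ (2 * n) + b ^ (2 * (s - n))))) := by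
        gcongr
        exact h4.trans (by gcongr)
    _ = _ := by ring

variable [CompactSpace Ks] [CompactSpace Ku] [BorelSpace M] [Countable ι] [MeasurableSpace ι]
  [MeasurableSingletonClass ι] [IsContMDiffRiemannianBundle (𝓡 d) ∞ (EuclideanSpace ℝ (Fin d))
    (fun x : M => TangentSpace (𝓡 d) x)] [MeasurableSpace Ku]
  {ν : Measure (S.Tower f)} (hν : S.IsSRB f ν) (hf : Measurable f)
include hν hf

/-- The itineraries of an SRB measure are absolutely continuous with respect to those of the
Lebesgue measure on a disk. -/
lemma baseMeasure_absolutelyContinuous (k₀ : Ku) :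
    baseMeasure (ν.map (S.sym f)) ≪ S.itinMeasure f k₀ := by
  obtain ⟨_, _, κ, _, hκν, hκ⟩ := hν
  refine Measure.AbsolutelyContinuous.mk fun E hE h0 => ?_
  have hsm := S.measurable_sym hf
  have hmE : MeasurableSet {z : ℕ × (ℕ → ι) | z.1 = 0 ∧ z.2 ∈ E} :=
    (measurableSet_fst_eq 0).inter (measurable_snd hE)
  rw [baseMeasure_apply _ hE, Measure.map_apply hsm hmE, hκν,
    Measure.bind_apply (hsm hmE) κ.aemeasurable, lintegral_eq_zero_iff
      (κ.measurable_coe (hsm hmE))]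
  -- A null set of itineraries for one disk is null for all disks, hence for almost every
  -- conditional measure of ν.
  filter_upwards [hκ] with a ha
  have h1 := hS.itinMeasure_null hf k₀ a.1 hE h0
  rw [itinMeasure_apply hf a.1 hE] at h1
  have h2 := ha.2 h1
  have hm1 : Measurable fun y : S.Tower f => y.1.1 := measurable_fst.comp measurable_subtype_coe
  rw [Measure.map_apply hm1 ((S.measurableSet_core hf).inter (S.measurable_itin hf hE))] at h2
  refine measure_mono_null ?_ h2
  intro y hy
  exact ⟨y.2.1, hy.2⟩

/-- The measure induced by an SRB measure on the base of the symbolic tower has bounded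
distortion. -/
lemma isGibbs_baseMeasure {b : ℝ} (hb : β ≤ b) :
    IsGibbs (baseMeasure (ν.map (S.sym f))) (2 * (2 * C / (1 - β))) b := by
  have hsm := S.measurable_sym hf
  have hprob : IsProbabilityMeasure ν := hν.1
  have hprob' : IsProbabilityMeasure (ν.map (S.sym f)) :=
    Measure.isProbabilityMeasure_map hsm.aemeasurable
  have hβ1 : 0 < 1 - β := by linarith [hS.β_lt_one]
  have hC := hS.C_pos
  obtain ⟨y⟩ := nonempty_of_isProbabilityMeasure ν
  obtain ⟨k₀, _⟩ := S.exists_unstable y.2.1.1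
  exact (IsGibbsOn.of_absolutelyContinuous (hS.isGibbs_itinMeasure hf k₀)
    (hS.baseMeasure_absolutelyContinuous hν hf k₀)
    (measurePreserving_shift_baseMeasure (measurePreserving_symStep_map hf hν.2.1)
      (ae_sym_fst_lt hf))).mono (by positivity) hS.β_pos.le hb

end IsYoung

/-! ### Hölder functions and their norms. -/

section HolderFunctions

variable {M : Type*} [MetricSpace M] {η : ℝ} {φ : M → ℝ}

lemma IsHolder.continuous (h : IsHolder η φ) (hη : 0 < η) : Continuous φ := by
  obtain ⟨C, hC⟩ := h
  refine continuous_iff_continuousAt.2 fun x => ?_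
  rw [ContinuousAt, tendsto_iff_dist_tendsto_zero]
  have h1 : Continuous fun y => C * dist y x ^ η :=
    continuous_const.mul ((continuous_id.dist continuous_const).rpow_const fun _ => Or.inr hη.le)
  have h2 := h1.tendsto x
  rw [dist_self, Real.zero_rpow hη.ne', mul_zero] at h2
  exact squeeze_zero (fun _ => dist_nonneg) (fun y => by rw [Real.dist_eq]; exact hC y x) h2

lemma supNorm_nonneg {X : Type*} (φ : X → ℝ) : 0 ≤ supNorm φ :=
  Real.iSup_nonneg fun _ => abs_nonneg _

lemma IsHolder.abs_le_supNorm [CompactSpace M] (h : IsHolder η φ) (hη : 0 < η) (x : M) :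
    |φ x| ≤ supNorm φ :=
  le_ciSup (f := fun x => |φ x|) (isCompact_range (h.continuous hη).abs).bddAbove x

lemma IsHolder.exists_holderNorm_eq (h : IsHolder η φ) (hη : 0 < η) :
    ∃ Q, 0 ≤ Q ∧ holderNorm η φ = supNorm φ + Q ∧ ∀ x y, |φ x - φ y| ≤ Q * dist x y ^ η := by
  refine ⟨_, Real.iSup_nonneg fun p => by positivity, rfl, fun x y => ?_⟩
  obtain ⟨C, hC⟩ := h
  have hbdd : BddAbove (range fun p : M × M => |φ p.1 - φ p.2| / dist p.1 p.2 ^ η) := by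
    refine ⟨|C|, ?_⟩
    rintro _ ⟨p, rfl⟩
    refine div_le_of_le_mul₀ (by positivity) (abs_nonneg _) ((hC _ _).trans ?_)
    exact mul_le_mul_of_nonneg_right (le_abs_self C) (by positivity)
  rcases eq_or_ne x y with rfl | hxy
  · simp [Real.zero_rpow hη.ne']
  · have hd : 0 < dist x y ^ η := Real.rpow_pos_of_pos (dist_pos.2 hxy) η
    exact (div_le_iff₀ hd).1 (le_ciSup hbdd (x, y))

end HolderFunctions

/-! ### Deviations on the manifold as deviations on the tower. -/

section Deviations

variable {X : Type*} [MeasurableSpace X] {ν : Measure X} [IsProbabilityMeasure ν] {T : X → X}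

lemma birkhoffSum_affine {Φ : X → ℝ} (hΦ : Integrable Φ ν) (a c : ℝ) (j : ℕ) (x : X) :
    birkhoffSum T (fun x => a * (Φ x + c) - ∫ y, a * (Φ y + c) ∂ν) j x =
      a * birkhoffSum T (fun x => Φ x - ∫ y, Φ y ∂ν) j x := by
  have h1 : ∫ y, a * (Φ y + c) ∂ν = a * (∫ y, Φ y ∂ν + c) := by
    rw [integral_const_mul, integral_add hΦ (integrable_const c)]
    simp
  simp only [birkhoffSum, h1, Finset.mul_sum]
  exact Finset.sum_congr rfl fun i _ => by ring

/-- The affine change a (φ + c) makes the observable non-negative and normalises it; centred sums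
are only multiplied by a. Since j ≥ n ≥ 1, averages may be turned into sums. -/
lemma mld_map_eq {M : Type*} [MeasurableSpace M] {f : M → M} (hf : Measurable f) {p : X → M}
    (hp : Measurable p) (hpT : ∀ n x, p (T^[n] x) = f^[n] (p x)) {φ : M → ℝ} (hφ : Measurable φ)
    (hi : Integrable (fun x => φ (p x)) ν) {a : ℝ} (ha : 0 < a) (c : ℝ) {ε : ℝ} (hε : 0 < ε) {n : ℕ}
    (hn : 1 ≤ n) :
    mld (ν.map p) f φ ε n = ν.real {x | ∃ j, n ≤ j ∧ a * ε * j <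
      |birkhoffSum T (fun x => a * (φ (p x) + c) - ∫ y, a * (φ (p y) + c) ∂ν) j x|} := by
  rw [mld, integral_map hp.aemeasurable hφ.aestronglyMeasurable, measureReal_def, measureReal_def]
  congr 1
  have hm : Measurable fun x => ⨆ (j : ℕ) (_ : n ≤ j), ENNReal.ofReal
      |(∑ i ∈ Finset.range j, φ (f^[i] x)) / (j : ℝ) - ∫ y, φ (p y) ∂ν| := by
    refine Measurable.iSup fun j => Measurable.iSup fun _ => ?_
    refine Measurable.ennreal_ofReal (Measurable.abs ?_)
    refine Measurable.sub (Measurable.div_const ?_ _) measurable_const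
    exact Finset.measurable_sum _ fun i _ => hφ.comp (hf.iterate i)
  rw [Measure.map_apply hp (measurableSet_lt measurable_const hm)]
  congr 1
  ext x
  simp only [mem_preimage, mem_ofPred_eq, lt_iSup_iff, exists_prop]
  refine exists_congr fun j => and_congr_right fun hj => ?_
  have hj0 : (0 : ℝ) < j := by exact_mod_cast hn.trans hj
  rw [ENNReal.ofReal_lt_ofReal_iff_of_nonneg hε.le, birkhoffSum_affine hi, abs_mul, abs_of_pos ha,
    mul_assoc, mul_lt_mul_iff_right₀ ha, ← lt_div_iff₀ hj0]
  have h1 : birkhoffSum T (fun x => φ (p x) - ∫ y, φ (p y) ∂ν) j x =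
      j * ((∑ i ∈ Finset.range j, φ (f^[i] (p x))) / (j : ℝ) - ∫ y, φ (p y) ∂ν) := by
    rw [mul_sub, mul_div_cancel₀ _ hj0.ne']
    simp [birkhoffSum, hpT, Finset.sum_sub_distrib]
  rw [h1, abs_mul, abs_of_pos hj0, mul_div_cancel_left₀ _ hj0.ne']

lemma SymOsc.affine {ι : Type*} {q : X → ℕ × (ℕ → ι)} {τ : ι → ℕ} {Φ : X → ℝ} {B B' b : ℝ}
    (h : SymOsc T q τ Φ B b) {a : ℝ} (ha : 0 ≤ a) (hb : 0 ≤ b) (c : ℝ) (hB : a * B ≤ B') :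
    SymOsc T q τ (fun x => a * (Φ x + c)) B' b := by
  intro x x' k s h1 h2 h3
  have h4 := h x x' k s h1 h2 h3
  have h5 : a * (Φ (T^[k] x) + c) - a * (Φ (T^[k] x') + c) = a * (Φ (T^[k] x) - Φ (T^[k] x')) := by
    ring
  dsimp only
  rw [h5, abs_mul, abs_of_nonneg ha]
  refine (mul_le_mul_of_nonneg_left h4 ha).trans ?_
  rw [← mul_assoc]
  gcongr

end Deviations

/-! ### The two cases of the theorem. -/

namespace IsYoung

variable {d : ℕ} {M : Type*} [MetricSpace M] [CompactSpace M]
  [ChartedSpace (EuclideanSpace ℝ (Fin d)) M]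
  [IsManifold (𝓡 d) ∞ M] {Ks Ku : Type*} [TopologicalSpace Ks] [TopologicalSpace Ku]
  {ι : Type*} [Nonempty ι] [MeasurableSpace M]
  [RiemannianBundle (fun x : M => TangentSpace (𝓡 d) x)]
  {S : Scheme d M Ks Ku ι} {f : M → M} {C β : ℝ} (hS : IsYoung S f C β)
  [CompactSpace Ks] [CompactSpace Ku] [BorelSpace M] [Countable ι] [MeasurableSpace ι]
  [MeasurableSingletonClass ι] [IsContMDiffRiemannianBundle (𝓡 d) ∞ (EuclideanSpace ℝ (Fin d))
    (fun x : M => TangentSpace (𝓡 d) x)] [MeasurableSpace Ku]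
  {ν : Measure (S.Tower f)} (hν : S.IsSRB f ν) (hf : Measurable f)
  {η : ℝ} (hη₀ : 0 < η) (hη₁ : η < 1)

open Scheme

omit [Nonempty ι] [CompactSpace Ks] [CompactSpace Ku] [Countable ι] [MeasurableSpace ι]
  [MeasurableSingletonClass ι] [IsContMDiffRiemannianBundle (𝓡 d) ∞ (EuclideanSpace ℝ (Fin d))
    (fun x : M => TangentSpace (𝓡 d) x)] in
include hν hf hη₀ in
lemma integrable_comp_proj {φ : M → ℝ} (hφ : IsHolder η φ) :
    Integrable (fun y => φ (S.proj f y)) ν := by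
  have := hν.1
  refine Integrable.of_bound (((hφ.continuous hη₀).measurable.comp
    (measurable_proj hf)).aestronglyMeasurable) (supNorm φ) ?_
  exact Filter.Eventually.of_forall fun y => hφ.abs_le_supNorm hη₀ _

omit [CompactSpace Ks] [CompactSpace Ku] [Countable ι] [MeasurableSpace ι]
  [MeasurableSingletonClass ι] [IsContMDiffRiemannianBundle (𝓡 d) ∞ (EuclideanSpace ℝ (Fin d))
    (fun x : M => TangentSpace (𝓡 d) x)] in
include hν hf hη₀ in
lemma mld_eq_zero_of_ae_eq {φ : M → ℝ} (hφ : IsHolder η φ) {a : ℝ}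
    (ha : ∀ᵐ y ∂ν, φ (S.proj f y) = a) {ε : ℝ} (hε : 0 < ε) {n : ℕ} (hn : 1 ≤ n) :
    mld (ν.map (S.proj f)) f φ ε n = 0 := by
  have := hν.1
  rw [mld_map_eq (T := S.towerMap f) hf (measurable_proj hf) iterate_proj
    (hφ.continuous hη₀).measurable (integrable_comp_proj hν hf hη₀ hφ) one_pos 0 hε hn]
  refine measureReal_exists_lt_eq_zero hν.2.1 ?_ n (by positivity)
  have h1 : ∫ y, 1 * (φ (S.proj f y) + 0) ∂ν = a := by
    rw [integral_congr_ae (g := fun _ => a) (by filter_upwards [ha] with y hy; simp [hy])]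
    simp
  filter_upwards [ha] with y hy
  rw [h1, hy]
  ring

include hS hν hf hη₀ hη₁

theorem exists_mld_le_poly {α q : ℝ} (hα : 1 < α) (hq : max 1 α < q) {Cc : ℝ} (hCc : 0 < Cc)
    (hcor : ∀ ψ ξ : S.Tower f → ℝ,
      S.IsLip f (β ^ (η / 2)) ψ → S.IsLip f (β ^ (η / 2)) ξ → ∀ n : ℕ, 1 ≤ n →
        corr ν (S.towerMap f) ψ ξ n ≤
          Cc * S.lipNorm f (β ^ (η / 2)) ψ * S.lipNorm f (β ^ (η / 2)) ξ * (n : ℝ) ^ (-α)) :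
    ∃ K : ℝ, 0 < K ∧ ∀ φ : M → ℝ, IsHolder η φ → ∀ ε : ℝ, 0 < ε → ∀ n : ℕ, 1 ≤ n →
      mld (ν.map (S.proj f)) f φ ε n ≤
        K * holderNorm η φ * supNorm φ ^ (2 * q - 1) * ε ^ (-2 * q) * (n : ℝ) ^ (-α) := by
  have hprob := hν.1
  have hβ := hS.β_pos
  have hβ1 := hS.β_lt_one
  have hC := hS.C_pos
  have hβ1' : 0 < 1 - β := by linarith
  have hq1 : 1 < q := (le_max_left _ _).trans_lt hq
  have hqα : α < q := (le_max_right _ _).trans_lt hq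
  have hsm := S.measurable_sym hf
  have hprob' : IsProbabilityMeasure (ν.map (S.sym f)) :=
    Measure.isProbabilityMeasure_map hsm.aemeasurable
  have hb0 : 0 < β ^ (η / 2) := by positivity
  have hb1 : β ^ (η / 2) < 1 := Real.rpow_lt_one hβ.le hβ1 (by positivity)
  have hbβ : β ≤ β ^ (η / 2) := by
    conv_lhs => rw [← Real.rpow_one β]
    exact Real.rpow_le_rpow_of_exponent_ge hβ hβ1.le (by linarith)
  -- With p = 2 q, the condition q > max(1, α) gives both 2 α < p and 1 + α < p.
  obtain ⟨K, hK, hbound⟩ := exists_measureReal_exists_lt_le_of_decayCor_poly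
    (measurePreserving_symStep_map hf hν.2.1) (ae_sym_fst_lt hf)
    (hS.isGibbs_baseMeasure hν hf hbβ) S.time_pos hν.2.1 (hsm.measurePreserving ν) sym_towerMap
    (by positivity) hb0 hb1 (p := 2 * q) (by linarith) (by linarith) (by linarith) (by linarith)
    (by positivity) (decayCor_of_corr_le hf hb0 hCc (fun n => by positivity) hcor)
    (CB := (C + C ^ 2) ^ η * ((β ^ (η / 2)) ^ 2)⁻¹) (by positivity)
  refine ⟨K * 2 ^ (2 * q), by positivity, fun φ hφ ε hε n hn => ?_⟩
  obtain ⟨Q, hQ0, hQ, hφQ⟩ := hφ.exists_holderNorm_eq hη₀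
  have hφA := fun x => abs_le.1 (hφ.abs_le_supNorm hη₀ x)
  have hφm := (hφ.continuous hη₀).measurable.comp (measurable_proj (S := S) hf)
  have hH0 : 0 ≤ holderNorm η φ := by linarith [supNorm_nonneg φ]
  rcases (supNorm_nonneg φ).eq_or_lt with hA | hA
  · rw [mld_eq_zero_of_ae_eq (a := 0) hν hf hη₀ hφ (Filter.Eventually.of_forall fun y => ?_) hε hn]
    · have := supNorm_nonneg φ
      positivity
    · have := hφA (S.proj f y)
      linarith
  -- The function (φ + ‖φ‖) / 2 takes values in [0, ‖φ‖], the norm being that of the supremum;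
  -- halving ε costs 2^(2q).
  · rw [mld_map_eq (T := S.towerMap f) hf (measurable_proj hf) iterate_proj
      (hφ.continuous hη₀).measurable (integrable_comp_proj hν hf hη₀ hφ) (a := 1 / 2) (by norm_num)
      (supNorm φ) hε hn]
    refine (hbound (fun y => 1 / 2 * (φ (S.proj f y) + supNorm φ)) (supNorm φ) (holderNorm η φ)
      ((hφm.add_const _).const_mul _) (fun y => ?_) (fun y => ?_) hA (by linarith)
      ((hS.symOsc hη₀ hη₁ hQ0 hφQ).affine (by norm_num) hb0.le _ ?_) n (1 / 2 * ε) hn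
      (by positivity)).trans_eq ?_
    · linarith [(hφA (S.proj f y)).1]
    · linarith [(hφA (S.proj f y)).2]
    · rw [mul_left_comm]
      gcongr
      linarith
    · rw [Real.mul_rpow (by norm_num) hε.le, one_div, Real.inv_rpow (by norm_num),
        ← Real.rpow_neg (by norm_num), neg_neg, neg_mul]
      ring

/-- For θ ≤ 1 the probabilistic argument applies; its use of subadditivity of t^θ excludes θ > 1,
where rigidity makes the left side zero. -/
theorem exists_mld_le_exp {c θ : ℝ} (hc : 0 < c) (hθ : 0 < θ) {Cc : ℝ} (hCc : 0 < Cc)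
    (hcor : ∀ ψ ξ : S.Tower f → ℝ,
      S.IsLip f (β ^ (η / 2)) ψ → S.IsLip f (β ^ (η / 2)) ξ → ∀ n : ℕ, 1 ≤ n →
        corr ν (S.towerMap f) ψ ξ n ≤
          Cc * S.lipNorm f (β ^ (η / 2)) ψ * S.lipNorm f (β ^ (η / 2)) ξ *
            Real.exp (-c * (n : ℝ) ^ θ)) :
    ∃ c' K : ℝ, 0 < c' ∧ 0 < K ∧ ∀ φ : M → ℝ, IsHolder η φ → ∀ ε : ℝ, 0 < ε → ∀ n : ℕ, 1 ≤ n →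
      mld (ν.map (S.proj f)) f φ ε n ≤
        K * Real.exp (-(c' * holderNorm η φ ^ (-2 * (θ / (θ + 1)))) *
          (n : ℝ) ^ (θ / (θ + 1)) * ε ^ (2 * (θ / (θ + 1)))) := by
  have hprob := hν.1
  have hβ := hS.β_pos
  have hβ1 := hS.β_lt_one
  have hC := hS.C_pos
  have hβ1' : 0 < 1 - β := by linarith
  have hsm := S.measurable_sym hf
  have hprob' : IsProbabilityMeasure (ν.map (S.sym f)) :=
    Measure.isProbabilityMeasure_map hsm.aemeasurable
  have hb0 : 0 < β ^ (η / 2) := by positivity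
  have hb1 : β ^ (η / 2) < 1 := Real.rpow_lt_one hβ.le hβ1 (by positivity)
  have hbβ : β ≤ β ^ (η / 2) := by
    conv_lhs => rw [← Real.rpow_one β]
    exact Real.rpow_le_rpow_of_exponent_ge hβ hβ1.le (by linarith)
  have hdecay := decayCor_of_corr_le hf hb0 hCc (fun n => by positivity) hcor
  rcases le_or_gt θ 1 with hθ1 | hθ1
  · obtain ⟨K, c', hK, hc', hbound⟩ := exists_measureReal_exists_lt_le_of_decayCor_exp
      (measurePreserving_symStep_map hf hν.2.1) (ae_sym_fst_lt hf)
      (hS.isGibbs_baseMeasure hν hf hbβ) S.time_pos hν.2.1 (hsm.measurePreserving ν) sym_towerMap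
      (by positivity) hb0 hb1 hc hθ hθ1 (by positivity) hdecay
      (CB := (C + C ^ 2) ^ η * ((β ^ (η / 2)) ^ 2)⁻¹) (by positivity)
    refine ⟨c' * 2 ^ (-2 * (θ / (θ + 1))), K, by positivity, hK, fun φ hφ ε hε n hn => ?_⟩
    obtain ⟨Q, hQ0, hQ, hφQ⟩ := hφ.exists_holderNorm_eq hη₀
    have hφA := fun x => abs_le.1 (hφ.abs_le_supNorm hη₀ x)
    have hφm := (hφ.continuous hη₀).measurable.comp (measurable_proj (S := S) hf)
    have hA0 := supNorm_nonneg φ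
    have hH0 : 0 ≤ holderNorm η φ := by linarith
    rcases hH0.eq_or_lt with hH | hH
    · rw [mld_eq_zero_of_ae_eq (a := 0) hν hf hη₀ hφ (Filter.Eventually.of_forall fun y => ?_)
        hε hn]
      · positivity
      · have := hφA (S.proj f y)
        linarith
    -- Dividing by twice the Hölder norm makes the supremum at most 1 and the oscillation constant
    -- independent of φ; the deviation ε / (2 H) produces the power -2θ' of the norm.
    · have ha : 0 < (2 * holderNorm η φ)⁻¹ := by positivity
      rw [mld_map_eq (T := S.towerMap f) hf (measurable_proj hf) iterate_proj
        (hφ.continuous hη₀).measurable (integrable_comp_proj hν hf hη₀ hφ) ha (supNorm φ) hε hn]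
      refine (hbound (fun y => (2 * holderNorm η φ)⁻¹ * (φ (S.proj f y) + supNorm φ))
        ((hφm.add_const _).const_mul _) (fun y => ?_) (fun y => ?_)
        ((hS.symOsc hη₀ hη₁ hQ0 hφQ).affine ha.le hb0.le _ ?_) n _ hn
        (by positivity)).trans_eq ?_
      · exact mul_nonneg ha.le (by linarith [(hφA (S.proj f y)).1])
      · rw [inv_mul_le_iff₀ (by positivity)]
        linarith [(hφA (S.proj f y)).2]
      · rw [mul_left_comm]
        refine mul_le_of_le_one_right (by positivity) ?_
        rw [inv_mul_le_iff₀ (by positivity)]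
        linarith
      · rw [add_comm 1 θ]
        congr 2
        rw [Real.mul_rpow (by positivity) (by positivity), ← Real.rpow_natCast,
          ← Real.rpow_mul (by positivity), Real.mul_rpow ha.le hε.le, Real.inv_rpow (by positivity),
          ← Real.rpow_neg (by positivity), Real.mul_rpow (by norm_num) hH.le]
        push_cast
        rw [neg_mul 2]
        ring
  · refine ⟨1, 1, one_pos, one_pos, fun φ hφ ε hε n hn => ?_⟩
    obtain ⟨Q, hQ0, hQ, hφQ⟩ := hφ.exists_holderNorm_eq hη₀
    have hφm := (hφ.continuous hη₀).measurable.comp (measurable_proj (S := S) hf)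
    rw [mld_eq_zero_of_ae_eq hν hf hη₀ hφ (SymOsc.ae_eq_integral_of_decayCor
      (measurePreserving_symStep_map hf hν.2.1) (ae_sym_fst_lt hf) hν.2.1 (hsm.measurePreserving ν)
      hb0 hb1 hc hθ1 hdecay (hS.symOsc hη₀ hη₁ hQ0 hφQ) (by positivity) hφm
      (fun y => hφ.abs_le_supNorm hη₀ (S.proj f y))) hε hn]
    positivity

end IsYoung

end YoungTower

end

theorem theoremC {d : ℕ} {M : Type*} [MetricSpace M] [CompactSpace M]
    [ChartedSpace (EuclideanSpace ℝ (Fin d)) M] [IsManifold (𝓡 d) ∞ M]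
    [RiemannianBundle (fun x : M => TangentSpace (𝓡 d) x)]
    [IsContMDiffRiemannianBundle (𝓡 d) ∞ (EuclideanSpace ℝ (Fin d))
      (fun x : M => TangentSpace (𝓡 d) x)]
    [IsRiemannianManifold (𝓡 d) M]
    [MeasurableSpace M] [BorelSpace M]
    {f : M → M} (hf : Measurable f)
    {Ks Ku ι : Type*} [MetricSpace Ks] [CompactSpace Ks] [MetricSpace Ku] [CompactSpace Ku]
    [MeasurableSpace Ku] [BorelSpace Ku] [Countable ι]
    (S : YoungTower.Scheme d M Ks Ku ι) {C₀ β : ℝ} (hS : YoungTower.IsYoung S f C₀ β)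
    (ν : MeasureTheory.Measure (S.Tower f)) (hν : S.IsSRB f ν)
    (η : ℝ) (hη₀ : 0 < η) (hη₁ : η < 1) :
    -- polynomial case
    (∀ α : ℝ, 1 < α → ∀ q : ℝ, max 1 α < q → ∃ K : ℝ, 0 < K ∧
      ((∃ C : ℝ, 0 < C ∧ ∀ ψ ξ : S.Tower f → ℝ,
          S.IsLip f (β ^ (η / 2)) ψ → S.IsLip f (β ^ (η / 2)) ξ → ∀ n : ℕ, 1 ≤ n →
          YoungTower.corr ν (S.towerMap f) ψ ξ n ≤
            C * S.lipNorm f (β ^ (η / 2)) ψ * S.lipNorm f (β ^ (η / 2)) ξ * (n : ℝ) ^ (-α)) →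
        ∀ φ : M → ℝ, YoungTower.IsHolder η φ → ∀ ε : ℝ, 0 < ε → ∀ n : ℕ, 1 ≤ n →
          YoungTower.mld (ν.map (S.proj f)) f φ ε n ≤
            K * YoungTower.holderNorm η φ * YoungTower.supNorm φ ^ (2 * q - 1) *
              ε ^ (-2 * q) * (n : ℝ) ^ (-α))) ∧
    -- stretched exponential case
    (∀ τ θ : ℝ, 0 < τ → 0 < θ → ∃ c : ℝ, 0 < c ∧
      ∀ φ : M → ℝ, YoungTower.IsHolder η φ → ∃ K : ℝ, 0 < K ∧
      ((∃ C : ℝ, 0 < C ∧ ∀ ψ ξ : S.Tower f → ℝ,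
          S.IsLip f (β ^ (η / 2)) ψ → S.IsLip f (β ^ (η / 2)) ξ → ∀ n : ℕ, 1 ≤ n →
          YoungTower.corr ν (S.towerMap f) ψ ξ n ≤
            C * S.lipNorm f (β ^ (η / 2)) ψ * S.lipNorm f (β ^ (η / 2)) ξ *
              Real.exp (-τ * (n : ℝ) ^ θ)) →
        ∀ ε : ℝ, 0 < ε → ∀ n : ℕ, 1 ≤ n →
          YoungTower.mld (ν.map (S.proj f)) f φ ε n ≤
            K * Real.exp (-(c * YoungTower.holderNorm η φ ^ (-2 * (θ / (θ + 1)))) *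
              (n : ℝ) ^ (θ / (θ + 1)) * ε ^ (2 * (θ / (θ + 1)))))) := by
  obtain ⟨y⟩ : Nonempty (S.Tower f) := by
    have := hν.1
    exact MeasureTheory.nonempty_of_isProbabilityMeasure ν
  have : Nonempty ι := ⟨(y.2.1.2 0).choose⟩
  -- The countable alphabet carries the discrete σ-algebra; it is nonempty because the tower is.
  let : MeasurableSpace ι := ⊤
  have : MeasurableSingletonClass ι := ⟨fun _ => trivial⟩
  refine ⟨fun α hα q hq => ?_, fun τ θ hτ hθ => ?_⟩
  -- The constant must be given before the decay hypothesis, which only concerns the fixed data; so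
  -- one first decides whether it holds.
  · by_cases h : ∃ C : ℝ, 0 < C ∧ ∀ ψ ξ : S.Tower f → ℝ,
          S.IsLip f (β ^ (η / 2)) ψ → S.IsLip f (β ^ (η / 2)) ξ → ∀ n : ℕ, 1 ≤ n →
          YoungTower.corr ν (S.towerMap f) ψ ξ n ≤
            C * S.lipNorm f (β ^ (η / 2)) ψ * S.lipNorm f (β ^ (η / 2)) ξ * (n : ℝ) ^ (-α)
    · obtain ⟨C, hC, hcor⟩ := h
      obtain ⟨K, hK, hbound⟩ := hS.exists_mld_le_poly hν hf hη₀ hη₁ hα hq hC hcor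
      exact ⟨K, hK, fun _ => hbound⟩
    · exact ⟨1, one_pos, fun h' => absurd h' h⟩
  · by_cases h : ∃ C : ℝ, 0 < C ∧ ∀ ψ ξ : S.Tower f → ℝ,
          S.IsLip f (β ^ (η / 2)) ψ → S.IsLip f (β ^ (η / 2)) ξ → ∀ n : ℕ, 1 ≤ n →
          YoungTower.corr ν (S.towerMap f) ψ ξ n ≤
            C * S.lipNorm f (β ^ (η / 2)) ψ * S.lipNorm f (β ^ (η / 2)) ξ *
              Real.exp (-τ * (n : ℝ) ^ θ)
    · obtain ⟨C, hC, hcor⟩ := h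
      obtain ⟨c, K, hc, hK, hbound⟩ := hS.exists_mld_le_exp hν hf hη₀ hη₁ hτ hθ hC hcor
      exact ⟨c, hc, fun φ hφ => ⟨K, hK, fun _ => hbound φ hφ⟩⟩
    · exact ⟨1, one_pos, fun φ _ => ⟨1, one_pos, fun h' => absurd h' h⟩⟩
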